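/- **Setting.** Let $X$ be a smooth complex projective variety of dimension $d$ and $D=\sum_i D_i$ a divisor on $X$ with simple normal crossings. Let $P=\mathbb P(T_X(-\log D))$ be the bundle of lines in the logarithmic tangent bundle ($\mathbb P(\Omega_X(\log D))$ in Grothendieck's notation), let $L$ be the tautological bundle on $P$, i.e. the dual of the tautological line subbundle of $T_X(-\log D)$, and let $\eta$ be a positive definite smooth $(1,1)$-form on $P$, for instance the Chern form of a positively curved metric on an ample line bundle. Let $\mathbb D$ be the open unit disc. A non-constant holomorphic $f:\mathbb D\to X\setminus D$ has a logarithmic derivative $f':\mathbb D\to P$ (the class of the vector $f_*(\partial/\partial z)$ of $T_X(-\log D)$), and for $0<r<1$ it defines a current $$T_{f'}(r):A^{1,1}(P)\to\mathbb C,\qquad \omega\mapsto\int_0^r\frac{dt}{t}\int_{|z|<t}f'^*\omega .$$ For a sequence $f_n$ of discs and a fixed $r$, a *limit current* $T'(r)$ is a weak limit, along some subsequence, of the currents $T_{f_n'}(r)/T_{f_n'}(r)(\eta)$. Put $L\cdot T'(r):=T'(r)(c_1(\overline L))$, where $\overline L$ is $L$ with a smooth metric. A sequence of discs is said to converge if its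 graphs converge, locally in $\mathbb D\times X$ for the Hausdorff metric, to the graph of a holomorphic map to $X$ from a disc with bubbles (the disc with finite trees of rational curves attached at a closed discrete set of points). Say that $(f_n)$ *satisfies the tautological inequality* if, after passing to a subsequence, there is a set $E\subset(0,1)$ of finite hyperbolic measure, $\int_E\frac{dr}{1-r^2}<\infty$, such that for every $r\in(0,1)\setminus E$, every limit current $T'(r)$ of the subsequence, and every smooth metric on $L$, $$L\cdot T'(r)\le 0 .$$ **Statement.** Let $f_n:\mathbb D\to X\setminus D$ be holomorphic maps such that the points $f_n(0)$ stay out of a fixed neighbourhood of $D$ and such that no subsequence of $(f_n)$ converges. (a) If the length of the vector $f_{n*}(\partial/\partial z)$ at the origin, for a smooth metric on $T_X(-\log D)$ (or on $L$), is bounded below by a positive constant independent of $n$, then $(f_n)$ satisfies the tautological inequality. (b) In general, after passing to a subsequence, there are points $a_n\in\mathbb D$ converging to a point of $\mathbb D$ such that, with $\alpha_n(z)=(z+a_n)/(1+\bar a_n z)\in\operatorname{Aut}(\mathbb D)$, the points $f_n\circ\alpha_n(0)$ stay out of a neighbourhood of $D$, the discs $f_n\circ\alpha_n$ satisfy the hypothesis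 of (a), and $(f_n\circ\alpha_n)$ satisfies the tautological inequality. -/

import Mathlib

namespace LogDisc

open Set Filter Topology Complex
open scoped Manifold ContDiff ComplexConjugate

noncomputable section

section Levi
variable {V W : Type*} [NormedAddCommGroup V] [NormedSpace ℝ V] [NormedSpace ℂ V]
  [IsScalarTower ℝ ℂ V] [NormedAddCommGroup W] [NormedSpace ℝ W] [NormedSpace ℂ W]
  [IsScalarTower ℝ ℂ W]

/-- The second real derivative. -/
def hess (u : V → ℝ) (p : V) : V →L[ℝ] V →L[ℝ] ℝ := fderiv ℝ (fderiv ℝ u) p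

lemma hess_I_I (u : V → ℝ) (p v w : V) :
    hess u p (I • I • v) w = - hess u p v w := by
  rw [smul_smul, I_mul_I, neg_one_smul, map_neg]; rfl

lemma hess_I_I' (u : V → ℝ) (p v w : V) :
    hess u p v (I • I • w) = - hess u p v w := by
  rw [smul_smul, I_mul_I, neg_one_smul, map_neg]

lemma complex_smul_eq (c : ℂ) (v : V) : c • v = c.re • v + c.im • (I • v) := by
  conv_lhs => rw [← re_add_im c, add_smul, mul_smul]
  congr 1
  · exact (algebraMap_smul ℂ c.re v)
  · exact (algebraMap_smul ℂ c.im (I • v))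

/-- The Levi form `∂∂̄ u`, i.e. the sesquilinear form with coefficients `∂²u / ∂w_j ∂(conj w_k)`. -/
def levi (u : V → ℝ) (p : V) : V →ₗ[ℂ] V →ₗ⋆[ℂ] ℂ :=
  LinearMap.mk₂'ₛₗ (RingHom.id ℂ) (starRingEnd ℂ)
    (fun v w => (1 / 4 : ℂ) * (((hess u p v w + hess u p (I • v) (I • w) : ℝ) : ℂ)
      + I * ((hess u p v (I • w) - hess u p (I • v) w : ℝ) : ℂ)))
    (by intro a b c; simp only [smul_add, map_add, add_apply]; push_cast; ring)
    (by
      intro c a b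
      rw [complex_smul_eq c a, smul_add, smul_comm I c.re a, smul_comm I c.im (I • a)]
      simp only [map_add, map_smul, add_apply, smul_apply,
        hess_I_I, smul_eq_mul, RingHom.id_apply]
      apply Complex.ext <;> simp <;> ring)
    (by intro a b c; simp only [smul_add, map_add]; push_cast; ring)
    (by
      intro c a b
      rw [complex_smul_eq c b, smul_add, smul_comm I c.re b, smul_comm I c.im (I • b)]
      simp only [map_add, map_smul, hess_I_I', smul_eq_mul]
      apply Complex.ext <;> simp <;> ring)

lemma levi_apply (u : V → ℝ) (p v w : V) : levi u p v w =
    (1 / 4 : ℂ) * (((hess u p v w + hess u p (I • v) (I • w) : ℝ) : ℂ)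
      + I * ((hess u p v (I • w) - hess u p (I • v) w : ℝ) : ℂ)) := rfl

lemma levi_congr {u u' : V → ℝ} {p : V} (h : u =ᶠ[𝓝 p] u') : levi u p = levi u' p := by
  have : hess u p = hess u' p := h.fderiv.fderiv_eq
  ext v w
  simp only [levi_apply, this]

lemma levi_comp {u : W → ℝ} {τ : V → W} {p : V} (hu : ContDiffAt ℝ 2 u (τ p))
    (hτ : ContDiffAt ℂ 2 τ p) (v w : V) :
    levi (fun q => u (τ q)) p v w = levi u (τ p) (fderiv ℂ τ p v) (fderiv ℂ τ p w) := by
  have hc : ContinuousAt τ p := hτ.continuousAt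
  have h1 : ∀ᶠ q in 𝓝 p, DifferentiableAt ℂ τ q :=
    (hτ.eventually (by simp)).mono fun q hq => hq.differentiableAt (by simp)
  have h2 : ∀ᶠ q in 𝓝 p, DifferentiableAt ℝ u (τ q) :=
    hc.eventually ((hu.eventually (by simp)).mono fun q hq => hq.differentiableAt (by simp))
  have h3 : fderiv ℝ (fun q => u (τ q)) =ᶠ[𝓝 p]
      fun q => (fderiv ℝ u (τ q)).comp ((fderiv ℂ τ q).restrictScalars ℝ) := by
    filter_upwards [h1, h2] with q hq1 hq2
    exact (hq2.hasFDerivAt.comp q (hq1.hasFDerivAt.restrictScalars ℝ)).fderiv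
  have hdu : DifferentiableAt ℝ (fderiv ℝ u) (τ p) :=
    (hu.fderiv_right (m := 1) (by norm_num)).differentiableAt (by simp)
  have hdt : DifferentiableAt ℂ (fderiv ℂ τ) p :=
    (hτ.fderiv_right (m := 1) (by norm_num)).differentiableAt (by simp)
  have hτp := h1.self_of_nhds
  have hA : HasFDerivAt (fun q => fderiv ℝ u (τ q))
      ((fderiv ℝ (fderiv ℝ u) (τ p)).comp ((fderiv ℂ τ p).restrictScalars ℝ)) p :=
    hdu.hasFDerivAt.comp p (hτp.hasFDerivAt.restrictScalars ℝ)
  have key : ∀ a b : V, hess (fun q => u (τ q)) p a b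
      = hess u (τ p) (fderiv ℂ τ p a) (fderiv ℂ τ p b)
        + fderiv ℝ u (τ p) (fderiv ℂ (fderiv ℂ τ) p a b) := by
    intro a b
    have hb : HasFDerivAt (fun q => fderiv ℂ τ q b)
        (((ContinuousLinearMap.apply ℂ W b).comp
          (fderiv ℂ (fderiv ℂ τ) p)).restrictScalars ℝ) p :=
      (((ContinuousLinearMap.apply ℂ W b).hasFDerivAt.comp p hdt.hasFDerivAt)).restrictScalars ℝ
    have hfull := hA.clm_apply hb
    have hd2 : DifferentiableAt ℝ (fderiv ℝ (fun q => u (τ q))) p := by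
      have hcd : ContDiffAt ℝ 2 (fun q => u (τ q)) p :=
        hu.comp p (hτ.restrict_scalars ℝ)
      exact (hcd.fderiv_right (m := 1) (by norm_num)).differentiableAt (by simp)
    have e1 : hess (fun q => u (τ q)) p a b
        = fderiv ℝ (fun q => fderiv ℝ (fun q => u (τ q)) q b) p a := by
      have := (hd2.hasFDerivAt.clm_apply (hasFDerivAt_const b p)).fderiv
      rw [this]
      simp [hess]
    have e2 : (fun q => fderiv ℝ (fun q => u (τ q)) q b) =ᶠ[𝓝 p]
        fun q => fderiv ℝ u (τ q) (fderiv ℂ τ q b) := by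
      filter_upwards [h3] with q hq
      rw [hq]; rfl
    rw [e1, e2.fderiv_eq, hfull.fderiv]
    simp [hess, add_comm]
  simp only [levi_apply, key, map_smul, smul_apply]
  have hI : ∀ x : W, I • I • x = -x := fun x => by rw [smul_smul, I_mul_I, neg_one_smul]
  simp only [hI, map_neg]
  push_cast
  ring

end Levi

section LeviMore
variable {V : Type*} [NormedAddCommGroup V] [NormedSpace ℝ V] [NormedSpace ℂ V]
  [IsScalarTower ℝ ℂ V]

lemma levi_add {u u' : V → ℝ} {p : V} (hu : ContDiffAt ℝ 2 u p) (hu' : ContDiffAt ℝ 2 u' p) :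
    levi (fun q => u q + u' q) p = levi u p + levi u' p := by
  have h : fderiv ℝ (fun q => u q + u' q) =ᶠ[𝓝 p] fun q => fderiv ℝ u q + fderiv ℝ u' q := by
    filter_upwards [hu.eventually (by simp), hu'.eventually (by simp)] with q h1 h2
    exact fderiv_fun_add (h1.differentiableAt (by simp)) (h2.differentiableAt (by simp))
  have hh : hess (fun q => u q + u' q) p = hess u p + hess u' p := by
    unfold hess
    rw [h.fderiv_eq]
    exact fderiv_fun_add ((hu.fderiv_right (m := 1) (by norm_num)).differentiableAt (by simp))
      ((hu'.fderiv_right (m := 1) (by norm_num)).differentiableAt (by simp))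
  ext v w
  simp only [levi_apply, hh, add_apply, LinearMap.add_apply]
  push_cast
  ring

lemma levi_clm (l : V →L[ℝ] ℝ) (p : V) : levi (fun q => l q) p = 0 := by
  have hh : hess (fun q => l q) p = 0 := by
    unfold hess
    have : fderiv ℝ (fun q => l q) = fun _ => l := by
      funext q; exact l.fderiv
    rw [this]; simp
  ext v w
  simp [levi_apply, hh]

lemma levi_const (c : ℝ) (p : V) : levi (fun _ : V => c) p = 0 := by
  have hh : hess (fun _ : V => c) p = 0 := by
    unfold hess
    have : fderiv ℝ (fun _ : V => c) = fun _ => 0 := by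
      funext q; simp
    rw [this]; simp
  ext v w
  simp [levi_apply, hh]

lemma levi_contDiffOn {u : V → ℝ} {s : Set V} (hs : IsOpen s) (hu : ContDiffOn ℝ ∞ u s) (v w : V) :
    ContDiffOn ℝ ∞ (fun p => levi u p v w) s := by
  have h2 : ContDiffOn ℝ ∞ (hess u) s :=
    (hu.fderiv_of_isOpen hs (m := ∞) (by simp)).fderiv_of_isOpen hs (m := ∞) (by simp)
  have h3 : ∀ a b : V, ContDiffOn ℝ ∞ (fun p => ((hess u p a b : ℝ) : ℂ)) s := fun a b =>
    Complex.ofRealCLM.contDiff.comp_contDiffOn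
      ((h2.clm_apply contDiffOn_const).clm_apply contDiffOn_const)
  simp only [levi_apply]
  push_cast
  exact contDiffOn_const.mul (((h3 _ _).add (h3 _ _)).add
    (contDiffOn_const.mul ((h3 _ _).sub (h3 _ _))))

end LeviMore

section Euler
variable {d : ℕ}

/-- Pairs of vectors of `ℂ^d`. -/
abbrev Cpair (d : ℕ) := (Fin d → ℂ) × (Fin d → ℂ)

lemma levi_scale {u : Cpair d → ℝ} {p : Cpair d} {c : ℂ}
    (hu : ContDiffAt ℝ 2 u (p.1, c • p.2)) (C : ℝ)
    (h : ∀ᶠ q in 𝓝 p, u (q.1, c • q.2) = u q + C) (hp : ContDiffAt ℝ 2 u p) (v w : Cpair d) :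
    levi u (p.1, c • p.2) (v.1, c • v.2) (w.1, c • w.2) = levi u p v w := by
  let τ : Cpair d →L[ℂ] Cpair d :=
    (ContinuousLinearMap.fst ℂ _ _).prod (c • ContinuousLinearMap.snd ℂ _ _)
  have h1 := levi_comp (u := u) (τ := τ) (p := p) hu τ.contDiff.contDiffAt v w
  rw [τ.fderiv] at h1
  have h2 : levi (fun q => u (τ q)) p = levi u p := by
    have : (fun q => u (τ q)) =ᶠ[𝓝 p] fun q => u q + C := h
    rw [levi_congr this, levi_add hp contDiffAt_const, levi_const, add_zero]
  rw [h2] at h1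
  exact h1.symm

lemma levi_euler {u : Cpair d → ℝ} {p : Cpair d} (hu : ContDiffAt ℝ 2 u p)
    (k : ℝ)
    (h : ∀ᶠ q in 𝓝 p, ∀ s : ℂ, u (q.1, Complex.exp s • q.2) = u q + k * s.re) (w : Cpair d) :
    levi u p (0, p.2) w = 0 ∧ levi u p w (0, p.2) = 0 := by
  let Φ : Cpair d × ℂ → Cpair d := fun q => (q.1.1, Complex.exp q.2 • q.1.2)
  have hΦ0 : Φ (p, 0) = p := by simp [Φ]
  have hΦ : ContDiffAt ℂ 2 Φ (p, 0) := by
    apply ContDiff.contDiffAt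
    fun_prop
  have hd : HasFDerivAt Φ ((((ContinuousLinearMap.fst ℂ _ _).comp
      (ContinuousLinearMap.fst ℂ (Cpair d) ℂ))).prod
      ((ContinuousLinearMap.snd ℂ _ _).comp (ContinuousLinearMap.fst ℂ (Cpair d) ℂ)
        + (ContinuousLinearMap.snd ℂ (Cpair d) ℂ).smulRight p.2)) (p, 0) := by
    apply HasFDerivAt.prodMk
    · exact (((ContinuousLinearMap.fst ℂ _ _).comp
        (ContinuousLinearMap.fst ℂ (Cpair d) ℂ))).hasFDerivAt
    · have he : HasFDerivAt (fun q : Cpair d × ℂ => Complex.exp q.2)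
          (ContinuousLinearMap.snd ℂ (Cpair d) ℂ) (p, 0) := by
        have := (ContinuousLinearMap.snd ℂ (Cpair d) ℂ).hasFDerivAt (x := ((p, 0) : Cpair d × ℂ))
        simpa using this.cexp
      have hq : HasFDerivAt (fun q : Cpair d × ℂ => q.1.2)
          ((ContinuousLinearMap.snd ℂ _ _).comp (ContinuousLinearMap.fst ℂ (Cpair d) ℂ)) (p, 0) :=
        ((ContinuousLinearMap.snd ℂ _ _).comp
          (ContinuousLinearMap.fst ℂ (Cpair d) ℂ)).hasFDerivAt
      simpa using he.smul hq
  have key : ∀ a b : Cpair d × ℂ, levi u p (fderiv ℂ Φ (p, 0) a) (fderiv ℂ Φ (p, 0) b)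
      = levi u p a.1 b.1 := by
    intro a b
    have h1 := levi_comp (u := u) (τ := Φ) (p := (p, 0)) (by rw [hΦ0]; exact hu) hΦ a b
    rw [hΦ0] at h1
    rw [← h1]
    have e : (fun q => u (Φ q)) =ᶠ[𝓝 (p, (0 : ℂ))] fun q => u q.1 +
        (k • Complex.reCLM.comp (ContinuousLinearMap.snd ℝ (Cpair d) ℂ)) q := by
      have : ∀ᶠ q in 𝓝 (p, (0 : ℂ)), ∀ s : ℂ, 
          u (q.1.1, Complex.exp s • q.1.2) = u q.1 + k * s.re :=
        (continuous_fst.tendsto (p, (0 : ℂ))).eventually h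
      filter_upwards [this] with q hq
      exact hq q.2
    have hc1 : ContDiffAt ℝ 2 (fun q : Cpair d × ℂ => u q.1) (p, 0) :=
      ContDiffAt.comp (p, (0 : ℂ)) (g := u) (f := Prod.fst) hu contDiffAt_fst
    rw [levi_congr e, levi_add hc1 (ContinuousLinearMap.contDiff _).contDiffAt, levi_clm, add_zero]
    have h3 := levi_comp (u := u) (τ := (ContinuousLinearMap.fst ℂ (Cpair d) ℂ)) (p := (p, 0)) hu
      (ContinuousLinearMap.contDiff _).contDiffAt a b
    rw [ContinuousLinearMap.fderiv] at h3
    exact h3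
  rw [hd.fderiv] at key
  have k1 := key (0, 1) (w, 0)
  have k2 := key (w, 0) (0, 1)
  simp at k1 k2
  exact ⟨k1, k2⟩

end Euler

section Geometry
variable {X : Type*} [TopologicalSpace X] {ι : Type*}

/-- A logarithmic chart for the family of hypersurfaces `D`: a holomorphic chart of `X` in which each
`D i` is either absent or cut out by one of the coordinates. `label k = some i` says that the
`k`-th coordinate is an equation of `D i`; distinct coordinates carry distinct labels. -/
structure LogChart (d : ℕ) [ChartedSpace (Fin d → ℂ) X] (D : ι → Set X) where
  chart : OpenPartialHomeomorph X (Fin d → ℂ)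
  mem_atlas : chart ∈ IsManifold.maximalAtlas 𝓘(ℂ, Fin d → ℂ) ω X
  label : Fin d → Option ι
  label_inj : ∀ k l i, label k = some i → label l = some i → k = l
  mem_iff : ∀ x ∈ chart.source, ∀ i, x ∈ D i ↔ ∃ k, label k = some i ∧ chart x k = 0

/-- `⋃ i, D i` is a divisor with simple normal crossings whose smooth components are the `D i`:
every point lies in the domain of a logarithmic chart. -/
def IsSNC (d : ℕ) [ChartedSpace (Fin d → ℂ) X] (D : ι → Set X) : Prop :=
  ∀ x : X, ∃ φ : LogChart d D, x ∈ φ.chart.source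

namespace LogChart
variable {d : ℕ} [ChartedSpace (Fin d → ℂ) X] {D : ι → Set X}

/-- Over a logarithmic chart with coordinates `x`, the bundle `T_X(-log D)` has the frame
`e k = x k • ∂/∂x k` for labelled `k`, and `e k = ∂/∂x k` otherwise. This is the factor. -/
def weight (φ : LogChart d D) (x : Fin d → ℂ) (k : Fin d) : ℂ :=
  if (φ.label k).isSome then x k else 1

/-- The complement of the zero section of `T_X(-log D)` over the domain of a logarithmic chart, in
the coordinates `(x, a)` standing for the vector `∑ k, a k • e k` at the point `x`. The bundle
`P = P(T_X(-log D))` of lines of `T_X(-log D)` is its quotient by `(x, a) ↦ (x, c • a)`. -/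
def dom (φ : LogChart d D) : Set (Cpair d) := {p | p.1 ∈ φ.chart.target ∧ p.2 ≠ 0}

/-- The part of `φ.dom` that lies over the domain of `ψ` and over the complement of `D`. -/
def overlap (φ ψ : LogChart d D) : Set (Cpair d) :=
  {p | p ∈ φ.dom ∧ φ.chart.symm p.1 ∈ ψ.chart.source ∧ φ.chart.symm p.1 ∉ ⋃ i, D i}

/-- The change of coordinates of `T_X(-log D)` from the chart `φ` to the chart `ψ`, at points over the
complement of `D`, where `T_X(-log D)` is the tangent bundle. -/
def transition (φ ψ : LogChart d D) (p : Cpair d) : Cpair d :=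
  (ψ.chart (φ.chart.symm p.1), fun k =>
    fderiv ℂ (fun x => ψ.chart (φ.chart.symm x)) p.1 (fun j => φ.weight p.1 j * p.2 j) k
      / ψ.weight (ψ.chart (φ.chart.symm p.1)) k)

/-- The logarithmic derivative of a disc `f` avoiding `D`: the vector `f_* (∂/∂z)` of `T_X(-log D)`
at `f z`, in the coordinates of `φ`. -/
def lift (φ : LogChart d D) (f : ℂ → X) (z : ℂ) : Cpair d :=
  (φ.chart (f z), fun k =>
    deriv (fun w => φ.chart (f w)) z k / φ.weight (φ.chart (f z)) k)

lemma isOpen_dom (φ : LogChart d D) : IsOpen φ.dom :=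
  (φ.chart.open_target.preimage continuous_fst).inter
    (isOpen_ne.preimage continuous_snd)

lemma weight_ne_zero (φ : LogChart d D) {x : X} (hx : x ∈ φ.chart.source) (hD : x ∉ ⋃ i, D i)
    (k : Fin d) : φ.weight (φ.chart x) k ≠ 0 := by
  unfold weight
  split_ifs with h
  · obtain ⟨i, hi⟩ := Option.isSome_iff_exists.1 h
    intro h0
    exact hD (mem_iUnion.2 ⟨i, (φ.mem_iff x hx i).2 ⟨k, hi, h0⟩⟩)
  · exact one_ne_zero

lemma contDiff_weight (φ : LogChart d D) (k : Fin d) : ContDiff ℂ ω fun x => φ.weight x k := by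
  unfold weight
  split_ifs
  · exact contDiff_apply ℂ ℂ k
  · exact contDiff_const

lemma isOpen_overlap (φ ψ : LogChart d D) : IsOpen (φ.overlap ψ) := by
  rw [isOpen_iff_mem_nhds]
  rintro p ⟨hp, hs, hD⟩
  have hc : ContinuousAt (fun q : Cpair d => φ.chart.symm q.1) p :=
    (φ.chart.continuousAt_symm hp.1).comp continuousAt_fst
  have hc2 : ContinuousAt (fun q : Cpair d => ψ.chart (φ.chart.symm q.1)) p :=
    ContinuousAt.comp (g := ψ.chart) (f := fun q : Cpair d => φ.chart.symm q.1)
      (ψ.chart.continuousAt hs) hc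
  have h1 : ∀ k, ∀ᶠ q in 𝓝 p, ψ.weight (ψ.chart (φ.chart.symm q.1)) k ≠ 0 := fun k =>
    (((ψ.contDiff_weight k).continuous.continuousAt).comp hc2).eventually_ne
      (ψ.weight_ne_zero hs hD k)
  filter_upwards [eventually_all.2 h1, φ.isOpen_dom.mem_nhds hp,
    hc.eventually (ψ.chart.open_source.mem_nhds hs)] with q hq hqd hqs
  refine ⟨hqd, hqs, fun hqD => ?_⟩
  obtain ⟨i, hi⟩ := mem_iUnion.1 hqD
  obtain ⟨k, hk, h0⟩ := (ψ.mem_iff _ hqs i).1 hi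
  apply hq k
  simp [weight, hk, h0]

lemma contDiffAt_change (φ ψ : LogChart d D) {x : Fin d → ℂ} (hx : x ∈ φ.chart.target)
    (hs : φ.chart.symm x ∈ ψ.chart.source) :
    ContDiffAt ℂ ω (fun x => ψ.chart (φ.chart.symm x)) x := by
  rw [← contMDiffAt_iff_contDiffAt]
  exact (contMDiffAt_of_mem_maximalAtlas ψ.mem_atlas hs).comp x
    (contMDiffAt_symm_of_mem_maximalAtlas φ.mem_atlas hx)

lemma contDiffAt_transition (φ ψ : LogChart d D) {p : Cpair d} (hp : p ∈ φ.overlap ψ) :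
    ContDiffAt ℂ 2 (φ.transition ψ) p := by
  obtain ⟨hp, hs, hD⟩ := hp
  have h1 := φ.contDiffAt_change ψ hp.1 hs
  have h2 : ContDiffAt ℂ ω (fun q : Cpair d => ψ.chart (φ.chart.symm q.1)) p :=
    ContDiffAt.comp p (f := Prod.fst) (g := fun x => ψ.chart (φ.chart.symm x)) h1 contDiffAt_fst
  have h3 : ContDiffAt ℂ ω
      (fun q : Cpair d => fderiv ℂ (fun x => ψ.chart (φ.chart.symm x)) q.1) p :=
    ContDiffAt.comp p (f := Prod.fst) (g := fderiv ℂ (fun x => ψ.chart (φ.chart.symm x)))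
      (h1.fderiv_right (m := ω) (by simp)) contDiffAt_fst
  have h4 : ContDiffAt ℂ ω (fun q : Cpair d => (fun j => φ.weight q.1 j * q.2 j)) p := by
    rw [contDiffAt_pi]
    intro j
    exact ((φ.contDiff_weight j).contDiffAt.comp p contDiffAt_fst).mul
      ((contDiff_apply ℂ ℂ j).contDiffAt.comp p contDiffAt_snd)
  have h5 := h3.clm_apply h4
  have h6 : ContDiffAt ℂ ω (φ.transition ψ) p := by
    refine h2.prodMk ?_
    rw [contDiffAt_pi]
    intro k
    refine ((contDiff_apply ℂ ℂ k).contDiffAt.comp p h5).div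
      ((ψ.contDiff_weight k).contDiffAt.comp p h2) (ψ.weight_ne_zero hs hD k)
  exact h6.of_le (by simp)

lemma transition_mem_dom (φ ψ : LogChart d D) {p : Cpair d} (hp : p ∈ φ.overlap ψ) :
    φ.transition ψ p ∈ ψ.dom := by
  obtain ⟨hp, hs, hD⟩ := hp
  refine ⟨ψ.chart.map_source hs, fun h0 => hp.2 ?_⟩
  have hw : ∀ k, ψ.weight (ψ.chart (φ.chart.symm p.1)) k ≠ 0 := ψ.weight_ne_zero hs hD
  have hz : fderiv ℂ (fun x => ψ.chart (φ.chart.symm x)) p.1 (fun j => φ.weight p.1 j * p.2 j)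
      = 0 := by
    funext k
    have := congrFun h0 k
    simpa [transition, hw k] using this
  have hsφ : φ.chart.symm p.1 ∈ φ.chart.source := φ.chart.map_target hp.1
  have h1 := (φ.contDiffAt_change ψ hp.1 hs).differentiableAt (by simp)
  have h2 := (ψ.contDiffAt_change φ (x := ψ.chart (φ.chart.symm p.1)) (ψ.chart.map_source hs)
    (by rw [ψ.chart.left_inv hs]; exact hsφ)).differentiableAt (by simp)
  have h3 := h2.hasFDerivAt.comp p.1 h1.hasFDerivAt
  have h4 : ((fun x => φ.chart (ψ.chart.symm x)) ∘ fun x => ψ.chart (φ.chart.symm x))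
      =ᶠ[𝓝 p.1] id := by
    filter_upwards [φ.chart.open_target.mem_nhds hp.1,
      (φ.chart.continuousAt_symm hp.1).eventually (ψ.chart.open_source.mem_nhds hs)] with x hx hx2
    simp only [Function.comp, id]
    rw [ψ.chart.left_inv hx2, φ.chart.right_inv hx]
  have h5 := h3.unique ((hasFDerivAt_id p.1).congr_of_eventuallyEq h4)
  have h6 := DFunLike.congr_fun h5 (fun j => φ.weight p.1 j * p.2 j)
  rw [ContinuousLinearMap.comp_apply, hz, map_zero] at h6
  funext j
  have h7 : φ.weight p.1 j * p.2 j = 0 := (congrFun h6 j).symm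
  have h8 : φ.weight p.1 j ≠ 0 := by
    have := φ.weight_ne_zero hsφ hD j
    rwa [φ.chart.right_inv hp.1] at this
  exact (mul_eq_zero.1 h7).resolve_left h8

end LogChart

/-- The space `A^{1,1}(P)` of smooth complex `(1,1)`-forms on `P = P(T_X(-log D))`.
A `(1,1)`-form `i ∑ h_{jk} dw_j ∧ d(conj w_k)` is recorded as the sesquilinear form `h` on tangent
vectors. A form on `P` is described by its pullback to the complement of the zero section of
`T_X(-log D)`, that is, in each logarithmic chart, by a smooth form on `φ.dom` which vanishes on the
Euler field `(0, a)`, is invariant under `(x, a) ↦ (x, c • a)`, and is compatible with changes of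
charts. It suffices to impose the compatibility over the complement of `D`, which is dense.
(Values outside `φ.dom` are meaningless.) -/
def logForms (d : ℕ) [ChartedSpace (Fin d → ℂ) X] (D : ι → Set X) :
    Submodule ℂ (LogChart d D → Cpair d → (Cpair d →ₗ[ℂ] Cpair d →ₗ⋆[ℂ] ℂ)) where
  carrier := {h |
    (∀ φ v w, ContDiffOn ℝ ∞ (fun p => h φ p v w) φ.dom) ∧
    (∀ φ, ∀ p ∈ φ.dom, ∀ w, h φ p (0, p.2) w = 0 ∧ h φ p w (0, p.2) = 0) ∧
    (∀ φ, ∀ p ∈ φ.dom, ∀ c : ℂ, c ≠ 0 → ∀ v w,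
      h φ (p.1, c • p.2) (v.1, c • v.2) (w.1, c • w.2) = h φ p v w) ∧
    (∀ φ ψ : LogChart d D, ∀ p ∈ φ.overlap ψ, ∀ v w,
      h ψ (φ.transition ψ p) (fderiv ℂ (φ.transition ψ) p v) (fderiv ℂ (φ.transition ψ) p w)
        = h φ p v w)}
  zero_mem' := by
    refine ⟨fun φ v w => ?_, ?_, ?_, ?_⟩
    · exact contDiffOn_const
    all_goals simp
  add_mem' := by
    rintro a b ⟨a1, a2, a3, a4⟩ ⟨b1, b2, b3, b4⟩
    refine ⟨fun φ v w => (a1 φ v w).add (b1 φ v w), fun φ p hp w => ?_, fun φ p hp c hc v w => ?_,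
      fun φ ψ p hp v w => ?_⟩
    · simp [a2 φ p hp w, b2 φ p hp w]
    · simp [a3 φ p hp c hc v w, b3 φ p hp c hc v w]
    · simp [a4 φ ψ p hp v w, b4 φ ψ p hp v w]
  smul_mem' := by
    rintro s a ⟨a1, a2, a3, a4⟩
    refine ⟨fun φ v w => contDiffOn_const.mul (a1 φ v w), fun φ p hp w => ?_,
      fun φ p hp c hc v w => ?_, fun φ ψ p hp v w => ?_⟩
    · simp [a2 φ p hp w]
    · simp [a3 φ p hp c hc v w]
    · simp [a4 φ ψ p hp v w]

/-- A smooth metric on `L`. Here `L` is the dual of the tautological line subbundle of `T_X(-log D)` on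
`P`, so that a metric on `L` is a smooth length function on the nonzero vectors of `T_X(-log D)`
with `norm (c • a) = ‖c‖ * norm a`. Every Hermitian metric of `T_X(-log D)` gives one. -/
structure LogMetric (d : ℕ) [ChartedSpace (Fin d → ℂ) X] (D : ι → Set X) where
  norm : LogChart d D → Cpair d → ℝ
  pos : ∀ φ, ∀ p ∈ φ.dom, 0 < norm φ p
  smooth : ∀ φ, ContDiffOn ℝ ∞ (norm φ) φ.dom
  norm_smul : ∀ φ, ∀ x ∈ φ.chart.target, ∀ (c : ℂ) (a : Fin d → ℂ),
    norm φ (x, c • a) = ‖c‖ * norm φ (x, a)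
  compat : ∀ φ ψ : LogChart d D, ∀ p ∈ φ.overlap ψ, norm ψ (φ.transition ψ p) = norm φ p

namespace LogMetric
variable {d : ℕ} [ChartedSpace (Fin d → ℂ) X] {D : ι → Set X}

lemma contDiffOn_log (ρ : LogMetric d D) (φ : LogChart d D) :
    ContDiffOn ℝ ∞ (fun q => Real.log (ρ.norm φ q ^ 2)) φ.dom :=
  ((ρ.smooth φ).pow 2).log fun p hp => pow_ne_zero 2 (ρ.pos φ p hp).ne'

lemma contDiffAt_log (ρ : LogMetric d D) (φ : LogChart d D) {p : Cpair d} (hp : p ∈ φ.dom) :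
    ContDiffAt ℝ 2 (fun q => Real.log (ρ.norm φ q ^ 2)) p :=
  ((ρ.contDiffOn_log φ).contDiffAt (φ.isOpen_dom.mem_nhds hp)).of_le (by
    exact WithTop.coe_le_coe.2 le_top)

lemma log_smul (ρ : LogMetric d D) (φ : LogChart d D) {p : Cpair d} (hp : p ∈ φ.dom) {c : ℂ}
    (hc : c ≠ 0) : Real.log (ρ.norm φ (p.1, c • p.2) ^ 2)
      = Real.log (ρ.norm φ p ^ 2) + Real.log (‖c‖ ^ 2) := by
  rw [ρ.norm_smul φ p.1 hp.1, mul_pow, Real.log_mul (by simpa using hc)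
    (pow_ne_zero 2 (ρ.pos φ p hp).ne'), add_comm]

/-- The Chern form `c_1(L) = (i / 2π) ∂∂̄ log norm²` of the metrised bundle `L`. -/
def chern (ρ : LogMetric d D) : logForms d D :=
  ⟨fun φ p => (1 / (2 * Real.pi) : ℂ) • levi (fun q => Real.log (ρ.norm φ q ^ 2)) p, by
    refine ⟨fun φ v w => ?_, fun φ p hp w => ?_, fun φ p hp c hc v w => ?_,
      fun φ ψ p hp v w => ?_⟩
    · exact contDiffOn_const.mul (levi_contDiffOn φ.isOpen_dom (ρ.contDiffOn_log φ) v w)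
    · have he := levi_euler (ρ.contDiffAt_log φ hp) 2 (by
        filter_upwards [φ.isOpen_dom.mem_nhds hp] with q hq
        intro s
        rw [ρ.log_smul φ hq (Complex.exp_ne_zero s), Complex.norm_exp, Real.log_pow,
          Real.log_pow, Real.log_exp]
        norm_num) w
      simp only [LinearMap.smul_apply, he.1, he.2, smul_zero, and_self]
    · have hp' : (p.1, c • p.2) ∈ φ.dom := ⟨hp.1, smul_ne_zero hc hp.2⟩
      simp only [LinearMap.smul_apply]
      rw [levi_scale (ρ.contDiffAt_log φ hp') (Real.log (‖c‖ ^ 2)) _ (ρ.contDiffAt_log φ hp)]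
      filter_upwards [φ.isOpen_dom.mem_nhds hp] with q hq
      exact ρ.log_smul φ hq hc
    · simp only [LinearMap.smul_apply]
      rw [← levi_comp (ρ.contDiffAt_log ψ (φ.transition_mem_dom ψ hp))
        (φ.contDiffAt_transition ψ hp)]
      congr 3
      apply levi_congr
      filter_upwards [(φ.isOpen_overlap ψ).mem_nhds hp] with q hq
      rw [ρ.compat φ ψ q hq]⟩

end LogMetric
end Geometry

section Statement
variable (d : ℕ) {X : Type*} [TopologicalSpace X] [ChartedSpace (Fin d → ℂ) X] {ι : Type*}

/-- `X` is projective: there is an injective holomorphic immersion of `X` into some projective space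
(an embedding if `X` is compact). Holomorphic maps to projective space are given locally by
homogeneous coordinates `F`; the map is an immersion iff `dF(v) ∈ ℂ F` only for `v = 0`. -/
def IsProjective (X : Type*) [TopologicalSpace X] [ChartedSpace (Fin d → ℂ) X] : Prop :=
  ∃ (N : ℕ) (j : X → Projectivization ℂ (Fin (N + 1) → ℂ)), Function.Injective j ∧
    ∀ x : X, ∃ (U : Set X) (F : X → Fin (N + 1) → ℂ), IsOpen U ∧ x ∈ U ∧
      MDifferentiableOn 𝓘(ℂ, Fin d → ℂ) 𝓘(ℂ, Fin (N + 1) → ℂ) F U ∧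
      (∀ y ∈ U, ∃ h : F y ≠ 0, j y = Projectivization.mk ℂ (F y) h) ∧
      ∀ (v : TangentSpace 𝓘(ℂ, Fin d → ℂ) x) (c : ℂ),
        mfderiv 𝓘(ℂ, Fin d → ℂ) 𝓘(ℂ, Fin (N + 1) → ℂ) F x v = c • F x → v = 0

/-- A holomorphic map from the open unit disc to `X` (values off the disc are meaningless). -/
def IsHolomorphicDisc (f : ℂ → X) : Prop :=
  MDifferentiableOn 𝓘(ℂ) 𝓘(ℂ, Fin d → ℂ) f (Metric.ball 0 1)

/-- A holomorphic map from the Riemann sphere to `X`, tested in the coordinates `w` and `1 / w`. -/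
def IsHolomorphicSphere (g : OnePoint ℂ → X) : Prop :=
  MDifferentiable 𝓘(ℂ) 𝓘(ℂ, Fin d → ℂ) (fun w : ℂ => g (w : OnePoint ℂ)) ∧
  MDifferentiable 𝓘(ℂ) 𝓘(ℂ, Fin d → ℂ)
    (fun w : ℂ => g (if w = 0 then OnePoint.infty else ((w⁻¹ : ℂ) : OnePoint ℂ)))

/-- A holomorphic map to `X` from a finite tree of Riemann spheres meeting at nodes. The component
`i.succ` is glued, by its point `inner i.succ`, to the point `outer i` of the earlier component
`parent i`; the root is the component `0`, and `inner 0` is its point reserved for the disc. All the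
special points on one component are distinct. -/
structure RationalTree (X : Type*) [TopologicalSpace X] [ChartedSpace (Fin d → ℂ) X] where
  size : ℕ
  parent : Fin size → Fin (size + 1)
  parent_lt : ∀ i, parent i < i.succ
  inner : Fin (size + 1) → OnePoint ℂ
  outer : Fin size → OnePoint ℂ
  inner_ne_outer : ∀ i, inner (parent i) ≠ outer i
  outer_ne_outer : ∀ i j, i ≠ j → parent i = parent j → outer i ≠ outer j
  map : Fin (size + 1) → OnePoint ℂ → X
  holomorphic : ∀ i, IsHolomorphicSphere d (map i)
  glue : ∀ i, map (parent i) (outer i) = map i.succ (inner i.succ)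

/-- A holomorphic map to `X` from a disc with bubbles: the unit disc, with a tree of Riemann spheres
attached at each point of a closed discrete set of nodes. -/
structure BubbleDisc (X : Type*) [TopologicalSpace X] [ChartedSpace (Fin d → ℂ) X] where
  disc : ℂ → X
  holomorphic : IsHolomorphicDisc d disc
  nodes : Set ℂ
  nodes_subset : nodes ⊆ Metric.ball (0 : ℂ) 1
  locally_finite : ∀ z ∈ Metric.ball (0 : ℂ) 1, ∃ U ∈ 𝓝 z, (U ∩ nodes).Finite
  tree : ℂ → RationalTree d X
  attach : ∀ z ∈ nodes, (tree z).map 0 ((tree z).inner 0) = disc z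

variable {d}

/-- The graph of a map from a disc with bubbles, a closed subset of (unit disc) `× X`. -/
def BubbleDisc.graph (F : BubbleDisc d X) : Set (ℂ × X) :=
  {p | p.1 ∈ Metric.ball (0 : ℂ) 1 ∧
    (p.2 = F.disc p.1 ∨ p.1 ∈ F.nodes ∧ ∃ i w, p.2 = (F.tree p.1).map i w)}

/-- The graph of a disc without bubbles. -/
def discGraph {X : Type*} (f : ℂ → X) : Set (ℂ × X) :=
  {p | p.1 ∈ Metric.ball (0 : ℂ) 1 ∧ p.2 = f p.1}

/-- Convergence of discs to a disc with bubbles: local Hausdorff convergence of the graphs, as closed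
subsets of the locally compact space (unit disc) `× X`. -/
def ConvergesTo (f : ℕ → ℂ → X) (F : BubbleDisc d X) : Prop :=
  (∀ W : Set (ℂ × X), IsOpen W → (W ∩ F.graph).Nonempty →
    ∀ᶠ n in atTop, (W ∩ discGraph (f n)).Nonempty) ∧
  (∀ K : Set (ℂ × X), IsCompact K → K ⊆ Metric.ball (0 : ℂ) 1 ×ˢ univ → K ∩ F.graph = ∅ →
    ∀ᶠ n in atTop, K ∩ discGraph (f n) = ∅)

variable (d) in
/-- No subsequence of `f` converges to a disc with bubbles in `X`. -/
def NoConvergentSubsequence (f : ℕ → ℂ → X) : Prop :=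
  ∀ s : ℕ → ℕ, StrictMono s → ∀ F : BubbleDisc d X, ¬ ConvergesTo (fun n => f (s n)) F

/-- The points `x n` stay out of a neighbourhood of `D`. -/
def AwayFrom (D : ι → Set X) (x : ℕ → X) : Prop :=
  ∃ U : Set X, IsOpen U ∧ (⋃ i, D i) ⊆ U ∧ ∀ n, x n ∉ U

variable {D : ι → Set X}

open Classical in
/-- The density, with respect to Lebesgue measure, of the pullback of the form `h` on `P` by the
logarithmic derivative `f' : (unit disc) → P` of a disc `f` avoiding `D`. It is computed in any
logarithmic chart, using the lift `f_* (∂/∂z)` of `f'` to `T_X(-log D)`, off the discrete set where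
that lift vanishes. The factor `2` is due to `i dz ∧ d(conj z) = 2 dx dy`. -/
def pullbackDensity (h : logForms d D) (f : ℂ → X) (z : ℂ) : ℂ :=
  if hz : ∃ φ : LogChart d D, f z ∈ φ.chart.source then
    if (hz.choose.lift f z).2 = 0 then 0
    else 2 * h.1 hz.choose (hz.choose.lift f z) (deriv (hz.choose.lift f) z)
      (deriv (hz.choose.lift f) z)
  else 0

/-- The current `T_{f'}(r)` on `P` of the logarithmic derivative `f'` of `f`:
`h ↦ ∫_0^r (dt / t) ∫_{|z| < t} (f')^* h`. -/
def discCurrent (f : ℂ → X) (r : ℝ) (h : logForms d D) : ℂ :=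
  ∫ t in (0 : ℝ)..r, (t : ℂ)⁻¹ * ∫ z in Metric.ball (0 : ℂ) t, pullbackDensity h f z

/-- `h` is a positive definite real `(1,1)`-form on `P` (for example the Chern form of an ample line
bundle on `P` with a metric of positive curvature): it is positive semidefinite on the complement of
the zero section, and only the Euler direction, which is contracted in `P`, is isotropic. -/
def IsPositiveForm (h : logForms d D) : Prop :=
  ∀ φ : LogChart d D, ∀ p ∈ φ.dom, ∀ v,
    0 ≤ (h.1 φ p v v).re ∧ (h.1 φ p v v).im = 0 ∧ (h.1 φ p v v = 0 → ∃ c : ℂ, v = (0, c • p.2))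

/-- `T` is the weak limit of the currents of the logarithmic derivatives of the discs `f n` at radius
`r`, each normalised by its degree with respect to `η`. -/
def IsLimitCurrent (η : logForms d D) (f : ℕ → ℂ → X) (r : ℝ) (T : logForms d D →ₗ[ℂ] ℂ) : Prop :=
  ∀ h : logForms d D,
    Tendsto (fun n => discCurrent (f n) r h / discCurrent (f n) r η) atTop (𝓝 (T h))

/-- `E` is a set of radii of finite hyperbolic measure `dr / (1 - r²)`. -/
def FiniteHyperbolicMeasure (E : Set ℝ) : Prop :=
  MeasurableSet E ∧ E ⊆ Ioo 0 1 ∧ ∫⁻ r in E, ENNReal.ofReal (1 / (1 - r ^ 2)) < ⊤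

/-- After passing to a subsequence, and for all radii `r` outside a set of finite hyperbolic measure,
`L · T'(r) ≤ 0` for every limit current `T'(r)`, where `L · T'(r)` is the value of `T'(r)` on the
Chern form of any smooth metric on `L`. -/
def TautologicalInequality (η : logForms d D) (f : ℕ → ℂ → X) : Prop :=
  ∃ s : ℕ → ℕ, StrictMono s ∧ ∃ E : Set ℝ, FiniteHyperbolicMeasure E ∧
    ∀ r ∈ Ioo (0 : ℝ) 1 \ E, ∀ s' : ℕ → ℕ, StrictMono s' → ∀ T : logForms d D →ₗ[ℂ] ℂ,
      IsLimitCurrent η (fun n => f (s (s' n))) r T →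
        ∀ ρ : LogMetric d D, (T ρ.chern).im = 0 ∧ (T ρ.chern).re ≤ 0

variable (d) in
/-- The vectors `(f n)_* (∂/∂z)` of `T_X(-log D)` at the origin have length bounded below by a positive
constant, for some smooth metric. -/
def NondegenerateAtOrigin (D : ι → Set X) (f : ℕ → ℂ → X) : Prop :=
  ∃ (ρ : LogMetric d D) (c : ℝ), 0 < c ∧ ∀ n, ∀ φ : LogChart d D,
    f n 0 ∈ φ.chart.source → c ≤ ρ.norm φ (φ.lift (f n) 0)

/-- The automorphism `z ↦ (z + a) / (1 + conj a * z)` of the unit disc, which takes `0` to `a`. -/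
def discAut (a z : ℂ) : ℂ := (z + a) / (1 + conj a * z)

end Statement

end

end LogDisc

open LogDisc
open scoped Manifold ContDiff Topology

/-!
Both parts rest on two facts about a sequence of discs: bounded degrees give a convergent subsequence,
and the degree of `L` is at most of the order of the square root of the degree of `η`. Degrees are
measured by `nev e r = ∫_0^r (dt / t) ∫_{|z| < t} e`, where `e` is the density of the pullback of `η`
by the logarithmic derivative (`IsEnergy`).

**Compactness.** As `η` is positive and `X` is compact, `e` dominates the pullback of the Fubini–Study
form (`IsEmbedded.exists_dominates`). On a smaller disc take homogeneous coordinates of which one is a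
Blaschke product (`IsEmbedded.exists_global_lift`). By Green's formula (`green`) and the
sub-mean-value property they are bounded, and bounded below at the origin, in terms of the energy
(`IsEmbedded.exists_bounded_lift`), so that they converge along a subsequence (`montel`), and the maps
converge off the zeros of the limit. At a zero of order `m` one rescales so that the limit becomes a
nonconstant vector of polynomials, that is a holomorphic sphere, whose zeros have order less than `m`;
by induction the graphs accumulate there on a tree of spheres (`IsEmbedded.bubble`). Hence bounded
energy gives convergence to a disc with bubbles (`IsEmbedded.exists_convergesTo_of_bounded`).

**The lemma on the logarithmic derivative.** By Green's formula the degree of `L` is at most the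
circle mean of the logarithm of the length of the logarithmic derivative, minus its value at the
origin, up to a factor; zeros of the logarithmic derivative only lower it (`exists_chern_le`). The
square of the length is bounded by `e` and the terms `|∇ log (sigma i ∘ f)|²`, where `sigma i` is
comparable to the squared distance to the component `D i` (`ChartCover.exists_metric_bound`). With
`l = const - log (sigma i ∘ f) ≥ 1`, the Laplacian of `l` is bounded by `e`, and `|∇ l|² / l²` has
growth at most `nev e`, since it is `lap l / l - lap (log l)` (`ChartCover.exists_growth`). Concavity
of the logarithm and Borel's lemma (`borel`) bound the circle means by `log (nev e r)`, hence by its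
square root, for `r` outside a set of small hyperbolic measure (`ChartCover.exists_chern_le_sqrt`).

If no subsequence converges, the degrees are unbounded at some radius, and along a subsequence with
degrees at least `2 ^ k` the quotients of the degrees of `L` and `η` have nonpositive limits
(`tautologicalInequality_of_nondegenerateAtOrigin`).

**Moving the origin.** If the speeds of the discs tended to zero as long as they stay near a limit of
the points `f n 0`, a subsequence would converge to a constant disc. So there are points of a smaller
disc where the speeds are bounded below (`exists_points_of_noConvergentSubsequence`). Moving the
origin there keeps the hypotheses, as convergence is invariant under convergent sequences of
automorphisms of the disc (`ConvergesTo.of_comp_discAut`).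
-/

namespace LogDisc

open Set Filter Topology Complex Metric MeasureTheory
open scoped Manifold ContDiff ComplexConjugate

noncomputable section

/-! ### Green's formula on discs -/

section

open intervalIntegral

open scoped Real

lemma hasDerivAt_integral_of_continuousOn {G G' : ℝ → ℝ → ℝ} {U : Set ℝ} (hU : IsOpen U) {t₀ : ℝ}
    (ht : t₀ ∈ U) (a b : ℝ)
    (hd : ∀ t ∈ U, ∀ θ, HasDerivAt (fun t => G t θ) (G' t θ) t)
    (hG : ContinuousOn (Function.uncurry G) (U ×ˢ univ))
    (hG' : ContinuousOn (Function.uncurry G') (U ×ˢ univ)) :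
    HasDerivAt (fun t => ∫ θ in a..b, G t θ) (∫ θ in a..b, G' t₀ θ) t₀ := by
  obtain ⟨ε, hε, hεU⟩ := Metric.nhds_basis_closedBall.mem_iff.1 (hU.mem_nhds ht)
  have hc : ∀ t ∈ U, Continuous (G t) := fun t ht => by
    have : ContinuousOn (fun θ => Function.uncurry G (t, θ)) univ :=
      hG.comp (by fun_prop) (fun θ _ => ⟨ht, mem_univ _⟩)
    exact continuousOn_univ.1 this
  have hc' : ∀ t ∈ U, Continuous (G' t) := fun t ht => by
    have : ContinuousOn (fun θ => Function.uncurry G' (t, θ)) univ :=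
      hG'.comp (by fun_prop) (fun θ _ => ⟨ht, mem_univ _⟩)
    exact continuousOn_univ.1 this
  obtain ⟨C, hC⟩ := ((isCompact_closedBall t₀ ε).prod (isCompact_uIcc (a := a) (b := b))
    ).exists_bound_of_continuousOn (hG'.mono (prod_mono hεU (subset_univ _)))
  refine (intervalIntegral.hasDerivAt_integral_of_dominated_loc_of_deriv_le (F := G) (F' := G')
    (bound := fun _ => C) (closedBall_mem_nhds t₀ hε) ?_ ?_ ?_ ?_ ?_ ?_).2
  · filter_upwards [hU.mem_nhds ht] with t ht
    exact (hc t ht).aestronglyMeasurable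
  · exact (hc t₀ ht).intervalIntegrable _ _
  · exact (hc' t₀ ht).aestronglyMeasurable
  · refine Eventually.of_forall fun θ hθ t ht => hC (t, θ) ⟨ht, uIoc_subset_uIcc hθ⟩
  · exact intervalIntegrable_const
  · exact Eventually.of_forall fun θ _ t ht => hd t (hεU ht) θ

/-- The Laplacian on `ℂ`, as the trace of the second derivative. -/
def lap (w : ℂ → ℝ) (z : ℂ) : ℝ := hess w z 1 1 + hess w z I I

/-- The Nevanlinna-type double integral `∫_0^r (dt / t) ∫_{|z| < t} g`. -/
def nev (g : ℂ → ℝ) (r : ℝ) : ℝ := ∫ t in (0 : ℝ)..r, t⁻¹ * ∫ z in ball (0 : ℂ) t, g z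

/-- Integral over the circle of radius `s` with respect to the angle. -/
def circInt (g : ℂ → ℝ) (s : ℝ) : ℝ := ∫ θ in (0 : ℝ)..2 * π, g (circleMap 0 s θ)

lemma circInt_eq (g : ℂ → ℝ) (s : ℝ) : circInt g s = 2 * π * Real.circleAverage g 0 s := by
  rw [Real.circleAverage_def, circInt, smul_eq_mul, mul_inv_cancel_left₀]
  positivity

lemma continuousOn_circle {g : ℂ → ℝ} {ρ : ℝ} (hg : ContinuousOn g (ball 0 ρ)) :
    ContinuousOn (fun p : ℝ × ℝ => g (circleMap 0 p.1 p.2)) (Ioo (-ρ) ρ ×ˢ univ) := by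
  refine hg.comp (by unfold circleMap; fun_prop) ?_
  rintro ⟨s, θ⟩ ⟨hs, -⟩
  simpa [abs_lt] using hs

lemma continuousOn_circInt {g : ℂ → ℝ} {ρ : ℝ} (hg : ContinuousOn g (ball 0 ρ)) :
    ContinuousOn (circInt g) (Ioo (-ρ) ρ) := by
  have h1 := continuousOn_circle hg
  refine continuousOn_of_forall_continuousAt fun s hs => ?_
  obtain ⟨ε, hε, hεU⟩ := Metric.nhds_basis_closedBall.mem_iff.1 (isOpen_Ioo.mem_nhds hs)
  obtain ⟨C, hC⟩ := ((isCompact_closedBall s ε).prod (isCompact_uIcc (a := 0) (b := 2 * π))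
    ).exists_bound_of_continuousOn (h1.mono (prod_mono hεU (subset_univ _)))
  refine intervalIntegral.continuousAt_of_dominated_interval (bound := fun _ => C) ?_ ?_ ?_ ?_
  · filter_upwards [isOpen_Ioo.mem_nhds hs] with t ht
    have : Continuous fun θ => g (circleMap 0 t θ) := continuousOn_univ.1
      (h1.comp (f := fun θ : ℝ => (t, θ)) (by fun_prop) (fun θ _ => ⟨ht, mem_univ _⟩))
    exact this.aestronglyMeasurable
  · filter_upwards [closedBall_mem_nhds s hε] with t ht
    exact Eventually.of_forall fun θ hθ => hC (t, θ) ⟨ht, uIoc_subset_uIcc hθ⟩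
  · exact intervalIntegrable_const
  · refine Eventually.of_forall fun θ _ => ?_
    exact ((h1.continuousAt ((isOpen_Ioo.prod isOpen_univ).mem_nhds
      (show (s, θ) ∈ _ from ⟨hs, mem_univ _⟩))).comp
      (f := fun t : ℝ => (t, θ)) (by fun_prop))

/-- Polar coordinates on discs. -/
lemma integral_ball_eq {g : ℂ → ℝ} {ρ t : ℝ} (hg : ContinuousOn g (ball 0 ρ)) (ht : 0 ≤ t)
    (htρ : t < ρ) : ∫ z in ball (0 : ℂ) t, g z = ∫ s in (0 : ℝ)..t, s * circInt g s := by
  rw [← MeasureTheory.integral_indicator measurableSet_ball, ← Complex.integral_comp_polarCoord_symm]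
  have h1 := continuousOn_circle hg
  have e1 : ∀ p ∈ polarCoord.target, p.1 • (ball (0 : ℂ) t).indicator g (Complex.polarCoord.symm p)
      = (Ioo 0 t ×ˢ Ioo (-π) π).indicator (fun p : ℝ × ℝ => p.1 * g (circleMap 0 p.1 p.2)) p := by
    rintro ⟨s, θ⟩ hp
    obtain ⟨hs, hθ⟩ : 0 < s ∧ θ ∈ Ioo (-π) π := by simpa [polarCoord] using hp
    have e : Complex.polarCoord.symm (s, θ) = circleMap 0 s θ := by
      rw [Complex.polarCoord_symm_apply, circleMap, Complex.exp_mul_I]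
      simp
    rw [e]
    by_cases hst : s < t
    · rw [indicator_of_mem, indicator_of_mem]
      · rfl
      · exact ⟨⟨hs, hst⟩, hθ⟩
      · simpa [abs_of_pos hs] using hst
    · rw [indicator_of_notMem, indicator_of_notMem]
      · simp
      · exact fun h => hst h.1.2
      · simpa [abs_of_pos hs] using hst
  rw [setIntegral_congr_fun (by
    rw [polarCoord_target]; exact measurableSet_Ioi.prod measurableSet_Ioo) e1]
  rw [setIntegral_indicator (measurableSet_Ioo.prod measurableSet_Ioo)]
  have e2 : polarCoord.target ∩ Ioo 0 t ×ˢ Ioo (-π) π = Ioo 0 t ×ˢ Ioo (-π) π := by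
    apply inter_eq_right.2
    rw [polarCoord_target]
    exact prod_mono (fun x hx => hx.1) le_rfl
  rw [e2]
  have hint : IntegrableOn (fun p : ℝ × ℝ => p.1 * g (circleMap 0 p.1 p.2))
      (Ioo 0 t ×ˢ Ioo (-π) π) := by
    have : ContinuousOn (fun p : ℝ × ℝ => p.1 * g (circleMap 0 p.1 p.2))
        (Icc 0 t ×ˢ Icc (-π) π) := continuousOn_fst.mul (h1.mono (by
      rintro ⟨s, θ⟩ ⟨hs, -⟩
      exact ⟨⟨by linarith [hs.1], by linarith [hs.2]⟩, mem_univ _⟩))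
    exact (this.integrableOn_compact (isCompact_Icc.prod isCompact_Icc)).mono_set
      (prod_mono Ioo_subset_Icc_self Ioo_subset_Icc_self)
  rw [Measure.volume_eq_prod] at hint ⊢
  rw [setIntegral_prod _ hint, intervalIntegral.integral_of_le ht, integral_Ioc_eq_integral_Ioo]
  refine setIntegral_congr_fun measurableSet_Ioo fun s hs => ?_
  simp only
  rw [MeasureTheory.integral_const_mul, ← integral_Ioc_eq_integral_Ioo,
    ← intervalIntegral.integral_of_le (by linarith [Real.pi_pos]), circInt]
  congr 1
  have hper : Function.Periodic (fun θ => g (circleMap 0 s θ)) (2 * π) := fun θ => by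
    simp only [periodic_circleMap 0 s θ]
  have := hper.intervalIntegral_add_eq (-π) 0
  rw [zero_add, show -π + 2 * π = π by ring] at this
  exact this

section nev
variable {g g' : ℂ → ℝ} {ρ : ℝ}

lemma hasDerivAt_area (hg : ContinuousOn g (ball 0 ρ)) {t : ℝ} (ht : t ∈ Ioo 0 ρ) :
    HasDerivAt (fun t => ∫ z in ball (0 : ℂ) t, g z) (t * circInt g t) t := by
  have hc : ContinuousOn (fun s => s * circInt g s) (Ioo (-ρ) ρ) :=
    continuousOn_id.mul (continuousOn_circInt hg)
  have ht' : t ∈ Ioo (-ρ) ρ := ⟨by linarith [ht.1, ht.2], ht.2⟩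
  have h1 : HasDerivAt (fun t => ∫ s in (0 : ℝ)..t, s * circInt g s) (t * circInt g t) t := by
    refine intervalIntegral.integral_hasDerivAt_right ?_ ?_ ?_
    · refine (hc.mono ?_).intervalIntegrable
      rw [uIcc_of_le ht.1.le]
      exact fun x hx => ⟨by linarith [hx.1, ht.1, ht.2], hx.2.trans_lt ht.2⟩
    · exact hc.stronglyMeasurableAtFilter isOpen_Ioo t ht'
    · exact hc.continuousAt (isOpen_Ioo.mem_nhds ht')
  refine h1.congr_of_eventuallyEq ?_
  filter_upwards [isOpen_Ioo.mem_nhds ht] with s hs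
  exact integral_ball_eq hg hs.1.le hs.2

lemma continuousOn_inv_area (hg : ContinuousOn g (ball 0 ρ)) :
    ContinuousOn (fun t => t⁻¹ * ∫ z in ball (0 : ℂ) t, g z) (Ico 0 ρ) := by
  intro t ht
  rcases eq_or_lt_of_le ht.1 with h0 | h0
  · subst h0
    have hρ : 0 < ρ := ht.2
    obtain ⟨C, hC⟩ := (isCompact_Icc (a := 0) (b := ρ / 2)).exists_bound_of_continuousOn
      ((continuousOn_circInt hg).mono (fun x hx => ⟨by linarith [hx.1], by linarith [hx.2]⟩))
    have hb : ∀ᶠ t in 𝓝[Ico 0 ρ] (0 : ℝ), ‖t⁻¹ * ∫ z in ball (0 : ℂ) t, g z‖ ≤ C * t := by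
      have : Iio (ρ / 2) ∈ 𝓝[Ico 0 ρ] (0 : ℝ) :=
        mem_nhdsWithin_of_mem_nhds (Iio_mem_nhds (by linarith))
      filter_upwards [this, self_mem_nhdsWithin] with t ht1 ht2
      have ht1 : t < ρ / 2 := ht1
      rcases eq_or_lt_of_le ht2.1 with h | h
      · subst h; simp
      rw [integral_ball_eq hg ht2.1 ht2.2, norm_mul]
      have h3 : ‖∫ s in (0 : ℝ)..t, s * circInt g s‖ ≤ t * C * |t - 0| := by
        apply intervalIntegral.norm_integral_le_of_norm_le_const
        intro s hs
        rw [uIoc_of_le h.le] at hs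
        rw [norm_mul, Real.norm_of_nonneg hs.1.le]
        exact mul_le_mul hs.2 (hC s ⟨hs.1.le, by linarith [hs.2]⟩) (norm_nonneg _) h.le
      rw [sub_zero, abs_of_pos h] at h3
      rw [norm_inv, Real.norm_of_nonneg h.le]
      calc t⁻¹ * _ ≤ t⁻¹ * (t * C * t) := by gcongr
        _ = C * t := by field_simp
    have h0 : (fun t => t⁻¹ * ∫ z in ball (0 : ℂ) t, g z) 0 = 0 := by simp
    show Tendsto _ _ (𝓝 ((fun t => t⁻¹ * ∫ z in ball (0 : ℂ) t, g z) 0))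
    rw [h0]
    refine squeeze_zero_norm' hb ?_
    have : Tendsto (fun t : ℝ => C * t) (𝓝[Ico 0 ρ] 0) (𝓝 (C * 0)) :=
      (tendsto_id.const_mul C).mono_left nhdsWithin_le_nhds
    simpa using this
  · exact ((continuousAt_id.inv₀ h0.ne').mul
      (hasDerivAt_area hg ⟨h0, ht.2⟩).continuousAt).continuousWithinAt

lemma intervalIntegrable_inv_area (hg : ContinuousOn g (ball 0 ρ)) {r : ℝ} (h0 : 0 ≤ r)
    (hr : r < ρ) :
    IntervalIntegrable (fun t => t⁻¹ * ∫ z in ball (0 : ℂ) t, g z) volume 0 r := by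
  refine ((continuousOn_inv_area hg).mono ?_).intervalIntegrable
  rw [uIcc_of_le h0]
  exact fun x hx => ⟨hx.1, hx.2.trans_lt hr⟩

lemma integrableOn_ball (hg : ContinuousOn g (ball 0 ρ)) {t : ℝ} (ht : t < ρ) :
    IntegrableOn g (ball 0 t) :=
  ((hg.mono (closedBall_subset_ball ht)).integrableOn_compact (isCompact_closedBall 0 t)).mono_set
    ball_subset_closedBall

lemma nev_mono (hg : ContinuousOn g (ball 0 ρ)) (hg' : ContinuousOn g' (ball 0 ρ))
    (h : ∀ z ∈ ball 0 ρ, g z ≤ g' z) {r : ℝ} (h0 : 0 ≤ r) (hr : r < ρ) : nev g r ≤ nev g' r := by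
  refine intervalIntegral.integral_mono_on h0 (intervalIntegrable_inv_area hg h0 hr)
    (intervalIntegrable_inv_area hg' h0 hr) fun t ht => ?_
  refine mul_le_mul_of_nonneg_left ?_ (inv_nonneg.2 ht.1)
  have htρ := ht.2.trans_lt hr
  exact setIntegral_mono_on (integrableOn_ball hg htρ) (integrableOn_ball hg' htρ)
    measurableSet_ball fun z hz => h z (ball_subset_ball htρ.le hz)

lemma nev_add (hg : ContinuousOn g (ball 0 ρ)) (hg' : ContinuousOn g' (ball 0 ρ))
    {r : ℝ} (h0 : 0 ≤ r) (hr : r < ρ) : nev (fun z => g z + g' z) r = nev g r + nev g' r := by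
  rw [nev, nev, nev, ← intervalIntegral.integral_add (intervalIntegrable_inv_area hg h0 hr)
    (intervalIntegrable_inv_area hg' h0 hr)]
  refine intervalIntegral.integral_congr fun t ht => ?_
  rw [uIcc_of_le h0] at ht
  have htρ := ht.2.trans_lt hr
  rw [MeasureTheory.integral_add (integrableOn_ball hg htρ) (integrableOn_ball hg' htρ), mul_add]

lemma nev_const_mul (c r : ℝ) : nev (fun z => c * g z) r = c * nev g r := by
  rw [nev, nev, ← intervalIntegral.integral_const_mul]
  refine intervalIntegral.integral_congr fun t _ => ?_
  have : ∫ z in ball (0 : ℂ) t, c * g z = c * ∫ z in ball (0 : ℂ) t, g z :=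
    MeasureTheory.integral_const_mul c g
  simp only [this]
  ring

lemma nev_nonneg (h : ∀ z ∈ ball 0 ρ, 0 ≤ g z) {r : ℝ} (h0 : 0 ≤ r) (hr : r < ρ) :
    0 ≤ nev g r := by
  refine intervalIntegral.integral_nonneg h0 fun t ht => mul_nonneg (inv_nonneg.2 ht.1) ?_
  exact setIntegral_nonneg measurableSet_ball fun z hz =>
    h z (ball_subset_ball (ht.2.trans hr.le) hz)

lemma hasDerivAt_nev (hg : ContinuousOn g (ball 0 ρ)) {t : ℝ} (ht : t ∈ Ioo 0 ρ) :
    HasDerivAt (nev g) (t⁻¹ * ∫ z in ball (0 : ℂ) t, g z) t := by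
  have hc := (continuousOn_inv_area hg).mono (Ioo_subset_Ico_self (a := 0) (b := ρ))
  refine intervalIntegral.integral_hasDerivAt_right
    (intervalIntegrable_inv_area hg ht.1.le ht.2) ?_ ?_
  · exact hc.stronglyMeasurableAtFilter isOpen_Ioo t ht
  · exact hc.continuousAt (isOpen_Ioo.mem_nhds ht)

lemma nev_le_nev (h : ∀ z ∈ ball 0 ρ, 0 ≤ g z) (hg : ContinuousOn g (ball 0 ρ)) {r r' : ℝ}
    (h0 : 0 ≤ r) (hrr : r ≤ r') (hr : r' < ρ) : nev g r ≤ nev g r' := by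
  have e := intervalIntegral.integral_interval_sub_left
    (intervalIntegrable_inv_area hg (h0.trans hrr) hr)
    (intervalIntegrable_inv_area hg h0 (hrr.trans_lt hr))
  have h2 : 0 ≤ ∫ t in r..r', t⁻¹ * ∫ z in ball (0 : ℂ) t, g z := by
    refine intervalIntegral.integral_nonneg hrr fun t ht =>
      mul_nonneg (inv_nonneg.2 (h0.trans ht.1)) ?_
    exact setIntegral_nonneg measurableSet_ball fun z hz =>
      h z (ball_subset_ball (ht.2.trans hr.le) hz)
  unfold nev
  linarith

end nev

lemma hess_rot {w : ℂ → ℝ} {z : ℂ} (c s : ℝ) (h : c ^ 2 + s ^ 2 = 1) :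
    hess w z (c + s * I) (c + s * I) + hess w z (I * (c + s * I)) (I * (c + s * I)) = lap w z := by
  have e1 : (c + s * I : ℂ) = c • (1 : ℂ) + s • I := by simp
  have e2 : I * (c + s * I : ℂ) = c • I + (-s) • (1 : ℂ) := by
    simp only [real_smul, mul_one, ofReal_neg]
    linear_combination (s : ℂ) * I_mul_I
  rw [e2, e1]
  simp only [map_add, map_smul, add_apply, smul_apply, smul_eq_mul, lap]
  linear_combination (hess w z 1 1 + hess w z I I) * h

/-- Green's formula: the mean over a circle minus the value at the centre. -/
theorem green {w : ℂ → ℝ} {ρ r : ℝ} (hw : ContDiffOn ℝ 2 w (ball 0 ρ)) (h0 : 0 < r) (hr : r < ρ) :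
    nev (lap w) r = circInt w r - 2 * π * w 0 := by
  have hI : ∀ t θ, t ∈ Ioo (-ρ) ρ → circleMap 0 t θ ∈ ball (0 : ℂ) ρ := fun t θ ht => by
    simpa [abs_lt] using ht
  have hat : ∀ z ∈ ball (0 : ℂ) ρ, ContDiffAt ℝ 2 w z := fun z hz =>
    hw.contDiffAt (isOpen_ball.mem_nhds hz)
  have hd1 : ∀ z ∈ ball (0 : ℂ) ρ, HasFDerivAt w (fderiv ℝ w z) z := fun z hz =>
    ((hat z hz).differentiableAt (by simp)).hasFDerivAt
  have hd2 : ∀ z ∈ ball (0 : ℂ) ρ, HasFDerivAt (fderiv ℝ w) (hess w z) z := fun z hz =>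
    (((hat z hz).fderiv_right (m := 1) (by norm_num)).differentiableAt (by simp)).hasFDerivAt
  have hc1 : ContinuousOn (fderiv ℝ w) (ball 0 ρ) := fun z hz =>
    (hd2 z hz).continuousAt.continuousWithinAt
  have hc2 : ContinuousOn (hess w) (ball 0 ρ) := fun z hz =>
    ((((hat z hz).fderiv_right (m := 1) (by norm_num)).fderiv_right (m := 0)
      (by norm_num)).continuousAt).continuousWithinAt
  have hcm : ContinuousOn (fun p : ℝ × ℝ => circleMap 0 p.1 p.2) (Ioo (-ρ) ρ ×ˢ univ) := by
    unfold circleMap; fun_prop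
  have hmaps : MapsTo (fun p : ℝ × ℝ => circleMap 0 p.1 p.2) (Ioo (-ρ) ρ ×ˢ univ) (ball 0 ρ) :=
    fun p hp => hI _ _ hp.1
  let e : ℝ → ℂ := fun θ => Complex.exp (θ * I)
  have he : Continuous e := by fun_prop
  have hmap : ∀ t θ, HasDerivAt (fun t : ℝ => circleMap 0 t θ) (e θ) t := fun t θ => by
    have := ((hasDerivAt_id t).ofReal_comp).mul_const (e θ)
    simpa [circleMap, e] using this
  have hmapθ : ∀ t θ, HasDerivAt (fun θ : ℝ => circleMap 0 t θ) ((t : ℝ) • (I * e θ)) θ :=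
    fun t θ => by
      convert hasDerivAt_circleMap 0 t θ using 1
      simp [circleMap, e]; ring
  have hmape : ∀ θ, HasDerivAt e (I * e θ) θ := fun θ => by
    have h := hasDerivAt_circleMap 0 1 θ
    have h1 : circleMap 0 1 = e := by funext x; simp [circleMap, e]
    rw [h1] at h
    convert h using 1
    ring
  have cF : ContinuousOn (fun p : ℝ × ℝ => fderiv ℝ w (circleMap 0 p.1 p.2) (e p.2))
      (Ioo (-ρ) ρ ×ˢ univ) :=
    (hc1.comp hcm hmaps).clm_apply (he.comp continuous_snd).continuousOn
  have cH : ContinuousOn (fun p : ℝ × ℝ => hess w (circleMap 0 p.1 p.2) (e p.2) (e p.2))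
      (Ioo (-ρ) ρ ×ˢ univ) :=
    ((hc2.comp hcm hmaps).clm_apply (he.comp continuous_snd).continuousOn).clm_apply
      (he.comp continuous_snd).continuousOn
  have hopen : IsOpen (Ioo (-ρ) ρ) := isOpen_Ioo
  -- first derivative of the mean
  have D1 : ∀ t ∈ Ioo (-ρ) ρ, HasDerivAt (circInt w)
      (∫ θ in (0 : ℝ)..2 * π, fderiv ℝ w (circleMap 0 t θ) (e θ)) t := fun t ht => by
    refine hasDerivAt_integral_of_continuousOn (G := fun t θ => w (circleMap 0 t θ))
      (G' := fun t θ => fderiv ℝ w (circleMap 0 t θ) (e θ)) hopen ht 0 (2 * π) ?_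
      (continuousOn_circle hw.continuousOn) cF
    intro t ht θ
    exact (hd1 _ (hI t θ ht)).comp_hasDerivAt t (hmap t θ)
  -- second derivative
  have D2 : ∀ t ∈ Ioo (-ρ) ρ, HasDerivAt
      (fun t => ∫ θ in (0 : ℝ)..2 * π, t * fderiv ℝ w (circleMap 0 t θ) (e θ))
      (∫ θ in (0 : ℝ)..2 * π, (1 * fderiv ℝ w (circleMap 0 t θ) (e θ)
        + t * hess w (circleMap 0 t θ) (e θ) (e θ))) t := fun t ht => by
    refine hasDerivAt_integral_of_continuousOn
      (G := fun t θ => t * fderiv ℝ w (circleMap 0 t θ) (e θ))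
      (G' := fun t θ => 1 * fderiv ℝ w (circleMap 0 t θ) (e θ)
        + t * hess w (circleMap 0 t θ) (e θ) (e θ)) hopen ht 0 (2 * π) ?_
      (continuousOn_fst.mul cF) ((continuousOn_const.mul cF).add (continuousOn_fst.mul cH))
    intro t ht θ
    refine (hasDerivAt_id t).mul ?_
    have h1 := (hd2 _ (hI t θ ht)).comp_hasDerivAt t (hmap t θ)
    have h2 := h1.clm_apply (hasDerivAt_const t (e θ))
    simpa using h2
  -- the integrand is the angular derivative of a periodic function
  have hper : ∀ t ∈ Ioo (-ρ) ρ, ∫ θ in (0 : ℝ)..2 * π,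
      (t * hess w (circleMap 0 t θ) (I * e θ) (I * e θ)
        - fderiv ℝ w (circleMap 0 t θ) (e θ)) = 0 := fun t ht => by
    have hd : ∀ θ, HasDerivAt (fun θ => fderiv ℝ w (circleMap 0 t θ) (I * e θ))
        (t * hess w (circleMap 0 t θ) (I * e θ) (I * e θ)
          - fderiv ℝ w (circleMap 0 t θ) (e θ)) θ := fun θ => by
      have h1 := (hd2 _ (hI t θ ht)).comp_hasDerivAt θ (hmapθ t θ)
      have h2 := h1.clm_apply ((hmape θ).const_mul I)
      refine h2.congr_deriv ?_
      have : I * (I * e θ) = - e θ := by rw [← mul_assoc, I_mul_I, neg_one_mul]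
      rw [this, map_neg, map_smul]
      simp [sub_eq_add_neg]
    have hcont : ∀ {F : ℝ × ℝ → ℝ}, ContinuousOn F (Ioo (-ρ) ρ ×ˢ univ) →
        Continuous fun θ => F (t, θ) := fun hF =>
      continuousOn_univ.1 (hF.comp (f := fun θ : ℝ => (t, θ)) (by fun_prop)
        (fun θ _ => ⟨ht, mem_univ _⟩))
    have cH' : ContinuousOn (fun p : ℝ × ℝ => hess w (circleMap 0 p.1 p.2) (I * e p.2) (I * e p.2))
        (Ioo (-ρ) ρ ×ˢ univ) :=
      ((hc2.comp hcm hmaps).clm_apply (by fun_prop)).clm_apply (by fun_prop)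
    rw [intervalIntegral.integral_eq_sub_of_hasDerivAt (fun θ _ => hd θ)]
    · have : e (2 * π) = e 0 := by simp [e, Complex.exp_two_pi_mul_I]
      simp only [circleMap, ofReal_mul, ofReal_ofNat]
      simp only [e] at this
      rw [Complex.exp_two_pi_mul_I]
      simp [e, Complex.exp_two_pi_mul_I]
    · refine Continuous.intervalIntegrable ?_ _ _
      exact ((hcont cH').const_mul t).sub (hcont cF)
  -- the trace of the second derivative is invariant under rotations, so the radial and angular
  -- second derivatives add up to `lap w`
  have D2' : ∀ t ∈ Ioo (-ρ) ρ, HasDerivAt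
      (fun t => ∫ θ in (0 : ℝ)..2 * π, t * fderiv ℝ w (circleMap 0 t θ) (e θ))
      (t * circInt (lap w) t) t := fun t ht => by
    convert D2 t ht using 1
    have hcont : ∀ {F : ℝ × ℝ → ℝ}, ContinuousOn F (Ioo (-ρ) ρ ×ˢ univ) →
        Continuous fun θ => F (t, θ) := fun hF =>
      continuousOn_univ.1 (hF.comp (f := fun θ : ℝ => (t, θ)) (by fun_prop)
        (fun θ _ => ⟨ht, mem_univ _⟩))
    have cH' : ContinuousOn (fun p : ℝ × ℝ => hess w (circleMap 0 p.1 p.2) (I * e p.2) (I * e p.2))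
        (Ioo (-ρ) ρ ×ˢ univ) :=
      ((hc2.comp hcm hmaps).clm_apply (by fun_prop)).clm_apply (by fun_prop)
    refine Eq.trans ?_ ((congrArg ((∫ θ in (0 : ℝ)..2 * π,
      (1 * fderiv ℝ w (circleMap 0 t θ) (e θ)
        + t * hess w (circleMap 0 t θ) (e θ) (e θ))) + ·) (hper t ht)).trans (add_zero _))
    rw [← intervalIntegral.integral_add]
    · rw [circInt, ← intervalIntegral.integral_const_mul]
      refine intervalIntegral.integral_congr fun θ _ => ?_
      have := hess_rot (w := w) (z := circleMap 0 t θ) (Real.cos θ) (Real.sin θ)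
        (Real.cos_sq_add_sin_sq θ)
      rw [ofReal_cos, ofReal_sin, ← Complex.exp_mul_I] at this
      simp only [e]
      rw [← this]
      ring
    · exact ((continuous_const.mul (hcont cF)).add
        (continuous_const.mul (hcont cH))).intervalIntegrable _ _
    · exact ((continuous_const.mul (hcont cH')).sub (hcont cF)).intervalIntegrable _ _
  have clap : ContinuousOn (lap w) (ball 0 ρ) :=
    ((hc2.clm_apply continuousOn_const).clm_apply continuousOn_const).add
      ((hc2.clm_apply continuousOn_const).clm_apply continuousOn_const)
  -- hence the area integral of `lap w` is `t` times the derivative of the mean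
  have hN : ∀ t, 0 ≤ t → t < ρ → ∫ z in ball (0 : ℂ) t, lap w z
      = t * ∫ θ in (0 : ℝ)..2 * π, fderiv ℝ w (circleMap 0 t θ) (e θ) := fun t ht htρ => by
    rw [integral_ball_eq clap ht htρ]
    have hsub : uIcc 0 t ⊆ Ioo (-ρ) ρ := by
      rw [uIcc_of_le ht]
      exact fun x hx => ⟨by linarith [hx.1], hx.2.trans_lt htρ⟩
    rw [intervalIntegral.integral_eq_sub_of_hasDerivAt (fun s hs => D2' s (hsub hs))]
    · simp [intervalIntegral.integral_const_mul]
    · exact ((continuousOn_id.mul (continuousOn_circInt clap)).mono hsub).intervalIntegrable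
  have hsub : uIcc 0 r ⊆ Ioo (-ρ) ρ := by
    rw [uIcc_of_le h0.le]
    exact fun x hx => ⟨by linarith [hx.1], hx.2.trans_lt hr⟩
  have hcD : ContinuousOn (fun t => ∫ θ in (0 : ℝ)..2 * π, fderiv ℝ w (circleMap 0 t θ) (e θ))
      (Ioo 0 ρ) := by
    have := (continuousOn_inv_area clap).mono (Ioo_subset_Ico_self (a := 0) (b := ρ))
    refine this.congr fun t ht => ?_
    simp only
    rw [hN t ht.1.le ht.2, inv_mul_cancel_left₀ ht.1.ne']
  have hcR : ContinuousOn (circInt w) (Icc 0 r) := fun t ht =>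
    (D1 t (hsub (by rwa [uIcc_of_le h0.le]))).continuousAt.continuousWithinAt
  have hfin : ∫ t in (0 : ℝ)..r, t⁻¹ * ∫ z in ball (0 : ℂ) t, lap w z = circInt w r - circInt w 0 := by
    refine intervalIntegral.integral_eq_sub_of_hasDerivAt_of_le h0.le hcR (fun t ht => ?_)
      (intervalIntegrable_inv_area clap h0.le hr)
    rw [hN t ht.1.le (ht.2.trans hr), inv_mul_cancel_left₀ ht.1.ne']
    exact D1 t ⟨by linarith [ht.1], ht.2.trans hr⟩
  rw [nev, hfin, circInt_eq w 0]
  simp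

end

/-! ### Borel's growth lemma -/

section

open intervalIntegral

/-- Where `Y ^ 2 < Y' * (1 - r ^ 2)`, the density `1 / (1 - r ^ 2)` is below `Y' / Y ^ 2`, the
derivative of `-1 / Y`, whose integral is at most `1 / K`. -/
lemma borel_aux {Y Y' : ℝ → ℝ} {r₀ K : ℝ} (hr₀ : r₀ ∈ Ioo (0 : ℝ) 1) (hK : 0 < K)
    (hY : ∀ r ∈ Ioo (0 : ℝ) 1, HasDerivAt Y (Y' r) r) (hc : ContinuousOn Y' (Ioo 0 1))
    (hn : ∀ r ∈ Ioo (0 : ℝ) 1, 0 ≤ Y' r) (hYK : K ≤ Y r₀) :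
    IsOpen {r ∈ Ioo r₀ 1 | Y r ^ 2 < Y' r * (1 - r ^ 2)} ∧
    ∫⁻ r in {r ∈ Ioo r₀ 1 | Y r ^ 2 < Y' r * (1 - r ^ 2)}, ENNReal.ofReal (1 / (1 - r ^ 2))
      ≤ ENNReal.ofReal (1 / K) := by
  have hsub : Ioo r₀ 1 ⊆ Ioo (0 : ℝ) 1 := Ioo_subset_Ioo_left hr₀.1.le
  have hYc : ContinuousOn Y (Ioo 0 1) := fun r hr => (hY r hr).continuousAt.continuousWithinAt
  have hmono : MonotoneOn Y (Ioo 0 1) := monotoneOn_of_deriv_nonneg (convex_Ioo 0 1) hYc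
    (fun r hr => by
      rw [interior_Ioo] at hr
      exact (hY r hr).differentiableAt.differentiableWithinAt)
    (fun r hr => by
      rw [interior_Ioo] at hr
      rw [(hY r hr).deriv]; exact hn r hr)
  have hYK' : ∀ r ∈ Ico r₀ 1, K ≤ Y r := fun r hr =>
    hYK.trans (hmono hr₀ ⟨hr₀.1.trans_le hr.1, hr.2⟩ hr.1)
  have hopen : IsOpen {r ∈ Ioo r₀ 1 | Y r ^ 2 < Y' r * (1 - r ^ 2)} := by
    have h1 : ContinuousOn (fun r => Y' r * (1 - r ^ 2) - Y r ^ 2) (Ioo r₀ 1) :=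
      ((hc.mono hsub).mul (by fun_prop)).sub ((hYc.mono hsub).pow 2)
    have := h1.isOpen_inter_preimage isOpen_Ioo (isOpen_Ioi (a := (0 : ℝ)))
    convert this using 1
    ext r
    simp [sub_pos]
  refine ⟨hopen, ?_⟩
  let G : ℝ → ℝ := fun r => Y' r / Y r ^ 2
  have hGc : ContinuousOn G (Ico r₀ 1) := by
    refine ContinuousOn.div (hc.mono ?_) ((hYc.mono ?_).pow 2) fun r hr =>
      pow_ne_zero 2 (hK.trans_le (hYK' r hr)).ne'
    all_goals exact fun r hr => ⟨hr₀.1.trans_le hr.1, hr.2⟩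
  have hG0 : ∀ r ∈ Ico r₀ 1, 0 ≤ G r := fun r hr =>
    div_nonneg (hn r ⟨hr₀.1.trans_le hr.1, hr.2⟩) (sq_nonneg _)
  have step : ∀ r₁ ∈ Ico r₀ 1, ∫⁻ r in Ioc r₀ r₁, ENNReal.ofReal (G r)
      ≤ ENNReal.ofReal (1 / K) := by
    intro r₁ hr₁
    have hI : Icc r₀ r₁ ⊆ Ico r₀ 1 := fun r hr => ⟨hr.1, hr.2.trans_lt hr₁.2⟩
    have hint : IntegrableOn G (Icc r₀ r₁) := (hGc.mono hI).integrableOn_compact isCompact_Icc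
    rw [← ofReal_integral_eq_lintegral_ofReal (hint.mono_set Ioc_subset_Icc_self)
      ((ae_restrict_iff' measurableSet_Ioc).2 (Eventually.of_forall fun r hr =>
        hG0 r (hI (Ioc_subset_Icc_self hr))))]
    refine ENNReal.ofReal_le_ofReal ?_
    rw [← intervalIntegral.integral_of_le hr₁.1]
    have hderiv : ∀ r ∈ uIcc r₀ r₁, HasDerivAt (fun r => - (Y r)⁻¹) (G r) r := fun r hr => by
      rw [uIcc_of_le hr₁.1] at hr
      have hr' := hI hr
      have := ((hY r ⟨hr₀.1.trans_le hr'.1, hr'.2⟩).inv (hK.trans_le (hYK' r hr')).ne').neg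
      refine this.congr_deriv ?_
      simp only [G]; ring
    rw [intervalIntegral.integral_eq_sub_of_hasDerivAt hderiv (by
      apply ContinuousOn.intervalIntegrable
      rw [uIcc_of_le hr₁.1]
      exact hGc.mono hI)]
    have h1 : 0 ≤ (Y r₁)⁻¹ := inv_nonneg.2 (hK.le.trans (hYK' r₁ hr₁))
    have h2 : (Y r₀)⁻¹ ≤ 1 / K := by
      rw [one_div]
      exact inv_anti₀ hK hYK
    linarith
  -- exhaust the interval by compact subintervals
  let u : ℕ → ℝ := fun n => 1 - (1 - r₀) / (n + 1)
  have hu : ∀ n, u n ∈ Ico r₀ 1 := fun n => by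
    have h1 : 0 < 1 - r₀ := by linarith [hr₀.2]
    have h2 : (1 - r₀) / (n + 1) ≤ 1 - r₀ := div_le_self h1.le (by simp)
    have h3 : 0 < (1 - r₀) / (n + 1) := by positivity
    constructor <;> simp only [u] <;> linarith
  have hutend : Tendsto u atTop (𝓝 1) := by
    have := (tendsto_one_div_add_atTop_nhds_zero_nat (𝕜 := ℝ)).const_mul (1 - r₀)
    have := this.const_sub 1
    simpa [u, div_eq_mul_inv] using this
  have hU : Ioo r₀ 1 ⊆ ⋃ n, Ioc r₀ (u n) := fun r hr => by
    obtain ⟨n, hn⟩ := (hutend.eventually (lt_mem_nhds hr.2)).exists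
    exact mem_iUnion.2 ⟨n, hr.1, hn.le⟩
  calc ∫⁻ r in {r ∈ Ioo r₀ 1 | Y r ^ 2 < Y' r * (1 - r ^ 2)}, ENNReal.ofReal (1 / (1 - r ^ 2))
      ≤ ∫⁻ r in {r ∈ Ioo r₀ 1 | Y r ^ 2 < Y' r * (1 - r ^ 2)}, ENNReal.ofReal (G r) := by
        refine setLIntegral_mono' hopen.measurableSet fun r hr => ENNReal.ofReal_le_ofReal ?_
        obtain ⟨hr1, hr2⟩ := hr
        have hYr := hK.trans_le (hYK' r ⟨hr1.1.le, hr1.2⟩)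
        have h1 : 0 < 1 - r ^ 2 := by nlinarith [hr1.1, hr1.2, hr₀.1]
        rw [div_le_div_iff₀ h1 (by positivity)]
        linarith
    _ ≤ ∫⁻ r in ⋃ n, Ioc r₀ (u n), ENNReal.ofReal (G r) :=
        lintegral_mono_set ((sep_subset _ _).trans hU)
    _ = ⨆ n, ∫⁻ r in Ioc r₀ (u n), ENNReal.ofReal (G r) := by
        refine setLIntegral_iUnion_of_directed _ (Monotone.directed_le ?_)
        intro m n hmn
        refine Ioc_subset_Ioc_right ?_
        simp only [u]
        have : (1 - r₀) / ((n : ℝ) + 1) ≤ (1 - r₀) / ((m : ℝ) + 1) :=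
          div_le_div_of_nonneg_left (by linarith [hr₀.2]) (by positivity)
            (by exact_mod_cast Nat.succ_le_succ hmn)
        linarith
    _ ≤ _ := iSup_le fun n => step _ (hu n)

/-- Borel's lemma, applied to both derivatives of `nev g`: outside a set of radii of small hyperbolic
measure the circular means of `g` are controlled by `nev g`. -/
theorem borel {g : ℂ → ℝ} (hg : ContinuousOn g (ball 0 1)) (hpos : ∀ z ∈ ball 0 1, 0 ≤ g z)
    {r₀ K : ℝ} (hr₀ : r₀ ∈ Ioo (0 : ℝ) 1) (hK : 0 < K) (hgK : K ≤ nev g r₀) :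
    ∃ E ⊆ Ioo r₀ 1, MeasurableSet E ∧
      ∫⁻ r in E, ENNReal.ofReal (1 / (1 - r ^ 2)) ≤ ENNReal.ofReal (2 / K) ∧
      ∀ r ∈ Ioo r₀ 1 \ E,
        circInt g r * (r * (1 - r ^ 2)) ≤ (nev g r ^ 2 / (1 - r ^ 2) + nev g r) ^ 2 := by
  let A : ℝ → ℝ := fun t => ∫ z in ball (0 : ℂ) t, g z
  have hA0 : ∀ t < 1, 0 ≤ A t := fun t ht =>
    setIntegral_nonneg measurableSet_ball fun z hz => hpos z (ball_subset_ball ht.le hz)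
  have hAd : ∀ t ∈ Ioo (0 : ℝ) 1, HasDerivAt A (t * circInt g t) t := fun t ht =>
    hasDerivAt_area hg ht
  have hcirc : ContinuousOn (circInt g) (Ioo 0 1) :=
    (continuousOn_circInt hg).mono (Ioo_subset_Ioo_left (by norm_num))
  have hcirc0 : ∀ t ∈ Ioo (0 : ℝ) 1, 0 ≤ circInt g t := fun t ht =>
    intervalIntegral.integral_nonneg (by positivity) fun θ _ => hpos _ (by
      simpa [abs_of_pos ht.1] using ht.2)
  have hAc : ContinuousOn A (Ioo 0 1) := fun t ht => (hAd t ht).continuousAt.continuousWithinAt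
  -- first for `nev g`, then for the area integral, made positive by adding `K`
  obtain ⟨o1, m1⟩ := borel_aux (Y := nev g) (Y' := fun t => t⁻¹ * A t) hr₀ hK
    (fun r hr => hasDerivAt_nev hg hr)
    ((continuousOn_inv₀.mono (fun t ht => ht.1.ne')).mul hAc)
    (fun r hr => mul_nonneg (inv_nonneg.2 hr.1.le) (hA0 r hr.2)) hgK
  obtain ⟨o2, m2⟩ := borel_aux (Y := fun t => A t + K) (Y' := fun t => t * circInt g t) hr₀ hK
    (fun r hr => (hAd r hr).add_const K) (continuousOn_id.mul hcirc)
    (fun r hr => mul_nonneg hr.1.le (hcirc0 r hr)) (by linarith [hA0 r₀ hr₀.2])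
  refine ⟨_ ∪ _, union_subset (sep_subset _ _) (sep_subset _ _),
    o1.measurableSet.union o2.measurableSet, ?_, ?_⟩
  · refine (lintegral_union_le _ _ _).trans ((add_le_add m1 m2).trans ?_)
    rw [← ENNReal.ofReal_add (by positivity) (by positivity)]
    refine ENNReal.ofReal_le_ofReal ?_
    rw [← add_div]; norm_num
  · rintro r ⟨hr, hE⟩
    have hr1 : 0 < r := hr₀.1.trans hr.1
    have hd : 0 < 1 - r ^ 2 := by nlinarith [hr.2]
    have h1 : r⁻¹ * A r * (1 - r ^ 2) ≤ nev g r ^ 2 := not_lt.1 fun h => hE (Or.inl ⟨hr, h⟩)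
    have h2 : r * circInt g r * (1 - r ^ 2) ≤ (A r + K) ^ 2 :=
      not_lt.1 fun h => hE (Or.inr ⟨hr, h⟩)
    have hKn : K ≤ nev g r := hgK.trans (nev_le_nev hpos hg hr₀.1.le hr.1.le hr.2)
    have hAr := hA0 r hr.2
    have h3 : A r ≤ nev g r ^ 2 / (1 - r ^ 2) := by
      rw [le_div_iff₀ hd]
      refine le_trans ?_ h1
      have : A r ≤ r⁻¹ * A r := le_mul_of_one_le_left hAr ((one_le_inv₀ hr1).2 hr.2.le)
      gcongr
    calc circInt g r * (r * (1 - r ^ 2)) = r * circInt g r * (1 - r ^ 2) := by ring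
      _ ≤ (A r + K) ^ 2 := h2
      _ ≤ _ := by gcongr

end

/-! ### Sequences of holomorphic functions -/

section

section Taylor
variable {E : Type*} [NormedAddCommGroup E] [NormedSpace ℂ E]

/-- The Taylor coefficients at the origin. -/
def tc (G : ℂ → E) (k : ℕ) : E := (k.factorial : ℂ)⁻¹ • iteratedDeriv k G 0

variable [CompleteSpace E]

lemma norm_tc_le {G : ℂ → E} {δ r M : ℝ} (hr : 0 < r) (hrδ : r < δ)
    (hG : DifferentiableOn ℂ G (ball 0 δ)) (hM : ∀ z ∈ ball (0 : ℂ) δ, ‖G z‖ ≤ M) (k : ℕ) :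
    ‖tc G k‖ ≤ M / r ^ k := by
  have h1 : DiffContOnCl ℂ G (ball 0 r) := hG.diffContOnCl_ball (closedBall_subset_ball hrδ)
  have h2 := norm_iteratedDeriv_le_of_forall_mem_sphere_norm_le k hr h1 (C := M) fun z hz =>
    hM z (closedBall_subset_ball hrδ (sphere_subset_closedBall hz))
  rw [tc, norm_smul, norm_inv, Complex.norm_natCast]
  have hk : (0 : ℝ) < k.factorial := by exact_mod_cast k.factorial_pos
  rw [inv_mul_le_iff₀ hk]
  calc _ ≤ _ := h2
    _ = _ := by ring

lemma hasSum_tc {G : ℂ → E} {δ : ℝ} (hG : DifferentiableOn ℂ G (ball 0 δ)) {z : ℂ}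
    (hz : z ∈ ball (0 : ℂ) δ) : HasSum (fun k => z ^ k • tc G k) (G z) := by
  have := hasSum_taylorSeries_on_ball hG hz
  convert this using 2 with k
  rw [tc, sub_zero, smul_comm]

lemma taylor_remainder {G : ℂ → E} {δ r M : ℝ} (hr : 0 < r) (hrδ : r < δ)
    (hG : DifferentiableOn ℂ G (ball 0 δ)) (hM : ∀ z ∈ ball (0 : ℂ) δ, ‖G z‖ ≤ M) (m : ℕ)
    {z : ℂ} (hz : ‖z‖ ≤ r / 2) :
    ‖G z - ∑ k ∈ Finset.range m, z ^ k • tc G k‖ ≤ 2 * M * (‖z‖ / r) ^ m := by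
  have hM0 : 0 ≤ M := (norm_nonneg _).trans (hM 0 (by simpa using hr.trans hrδ))
  have hs := hasSum_tc hG (z := z) (by simp; linarith)
  have h1 := (hasSum_nat_add_iff' m).2 hs
  have hq : ‖z‖ / r ≤ 1 / 2 := by rw [div_le_iff₀ hr]; linarith
  have hq0 : 0 ≤ ‖z‖ / r := by positivity
  have hgeo : HasSum (fun i : ℕ => M * (‖z‖ / r) ^ m * (1 / 2) ^ i) (M * (‖z‖ / r) ^ m * 2) :=
    hasSum_geometric_two.mul_left _
  have h2 := h1.norm_le_of_bounded hgeo fun i => by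
    rw [norm_smul, norm_pow]
    calc ‖z‖ ^ (i + m) * ‖tc G (i + m)‖ ≤ ‖z‖ ^ (i + m) * (M / r ^ (i + m)) := by
          gcongr; exact norm_tc_le hr hrδ hG hM _
      _ = M * (‖z‖ / r) ^ m * (‖z‖ / r) ^ i := by
          rw [div_pow, div_pow, pow_add, pow_add]; field_simp
      _ ≤ _ := by gcongr
  linarith

end Taylor

section Sequences
variable {E : Type*} [NormedAddCommGroup E] [NormedSpace ℂ E]

/-- Montel's theorem. -/
theorem montel [FiniteDimensional ℂ E] {H : ℕ → ℂ → E} {R : ℝ} (hR : 0 < R)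
    (hd : ∀ n, DifferentiableOn ℂ (H n) (ball 0 R))
    (hb : ∀ r, 0 < r → r < R → ∃ M, ∀ n, ∀ z ∈ ball (0 : ℂ) r, ‖H n z‖ ≤ M) :
    ∃ (s : ℕ → ℕ) (F : ℂ → E), StrictMono s ∧
      TendstoLocallyUniformlyOn (fun n => H (s n)) F atTop (ball 0 R) := by
  have : CompleteSpace E := FiniteDimensional.complete ℂ E
  have : ProperSpace E := FiniteDimensional.proper ℂ E
  have hcoef : ∀ r, 0 < r → r < R → ∃ M, ∀ n k, ‖tc (H n) k‖ ≤ M / r ^ k := fun r h0 hr => by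
    obtain ⟨M, hM⟩ := hb ((r + R) / 2) (by linarith) (by linarith)
    exact ⟨M, fun n k => norm_tc_le h0 (by linarith)
      ((hd n).mono (ball_subset_ball (by linarith))) (hM n) k⟩
  obtain ⟨M₀, hM₀⟩ := hcoef (R / 2) (by linarith) (by linarith)
  -- the sequences of Taylor coefficients lie in a compact product of balls
  have hcomp : IsCompact (univ.pi fun k : ℕ => closedBall (0 : E) (M₀ / (R / 2) ^ k)) :=
    isCompact_univ_pi fun k => isCompact_closedBall _ _
  obtain ⟨a, -, s, hs, ha⟩ := hcomp.isSeqCompact (x := fun n k => tc (H n) k)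
    (fun n k _ => by simpa using hM₀ n k)
  have ha : ∀ k, Tendsto (fun n => tc (H (s n)) k) atTop (𝓝 (a k)) := fun k =>
    (tendsto_pi_nhds.1 ha) k
  have hak : ∀ r, 0 < r → r < R → ∃ M, (∀ n k, ‖tc (H n) k‖ ≤ M / r ^ k) ∧
      ∀ k, ‖a k‖ ≤ M / r ^ k := fun r h0 hr => by
    obtain ⟨M, hM⟩ := hcoef r h0 hr
    exact ⟨M, hM, fun k => le_of_tendsto (ha k).norm (Eventually.of_forall fun n => hM _ k)⟩
  refine ⟨s, fun z => ∑' k, z ^ k • a k, hs, ?_⟩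
  have hunif : ∀ r, 0 < r → r < R → TendstoUniformlyOn (fun n => H (s n))
      (fun z => ∑' k, z ^ k • a k) atTop (ball 0 r) := fun r h0 hr => by
    obtain ⟨M, hM, hMa⟩ := hak ((r + R) / 2) (by linarith) (by linarith)
    set q := r / ((r + R) / 2)
    have hq0 : 0 ≤ q := by positivity
    have hq1 : q < 1 := by rw [div_lt_one (by linarith)]; linarith
    have hpow : ∀ k : ℕ, r ^ k * (M / ((r + R) / 2) ^ k) = M * q ^ k := fun k => by
      simp only [q, div_pow]
      ring
    have hbound : ∀ n k, ‖r ^ k * ‖tc (H (s n)) k - a k‖‖ ≤ 2 * M * q ^ k := fun n k => by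
      rw [norm_mul, norm_norm, Real.norm_of_nonneg (by positivity)]
      calc _ ≤ r ^ k * (M / ((r + R) / 2) ^ k + M / ((r + R) / 2) ^ k) := by
            gcongr
            exact (norm_sub_le _ _).trans (add_le_add (hM _ k) (hMa k))
        _ = 2 * M * q ^ k := by rw [mul_add, hpow]; ring
    have hsumm : Summable fun k => 2 * M * q ^ k := (summable_geometric_of_lt_one hq0 hq1).mul_left _
    have htan : Tendsto (fun n => ∑' k, r ^ k * ‖tc (H (s n)) k - a k‖) atTop
        (𝓝 (∑' _ : ℕ, (0 : ℝ))) := by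
      refine tendsto_tsum_of_dominated_convergence hsumm (fun k => ?_)
        (Eventually.of_forall fun n k => hbound n k)
      have := ((ha k).sub_const (a k)).norm.const_mul (r ^ k)
      simpa using this
    rw [tsum_zero] at htan
    rw [Metric.tendstoUniformlyOn_iff]
    intro ε hε
    filter_upwards [htan.eventually (gt_mem_nhds hε)] with n hn z hz
    have hz' : ‖z‖ < r := by simpa using hz
    have hsa : Summable fun k => z ^ k • a k := by
      refine Summable.of_norm_bounded ((summable_geometric_of_lt_one hq0 hq1).mul_left M)
        fun k => ?_
      rw [norm_smul, norm_pow, ← hpow]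
      gcongr
      exact hMa k
    have h1 := hsa.hasSum.sub (hasSum_tc (hd (s n)) (ball_subset_ball hr.le hz))
    rw [dist_eq_norm]
    refine lt_of_le_of_lt ?_ hn
    refine h1.norm_le_of_bounded (Summable.of_norm_bounded hsumm (hbound n)).hasSum fun k => ?_
    rw [← smul_sub, norm_smul, norm_pow, norm_sub_rev]
    gcongr
  intro u hu x hx
  have hx' : ‖x‖ < R := by simpa using hx
  refine ⟨ball 0 ((‖x‖ + R) / 2), mem_nhdsWithin_of_mem_nhds (isOpen_ball.mem_nhds ?_), ?_⟩
  · simp; linarith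
  · exact hunif _ (by linarith [norm_nonneg x]) (by linarith) u hu

lemma differentiableOn_iteratedDeriv [CompleteSpace E] {f : ℂ → E} {U : Set ℂ} (hU : IsOpen U)
    (hf : DifferentiableOn ℂ f U) (k : ℕ) : DifferentiableOn ℂ (iteratedDeriv k f) U := by
  induction k with
  | zero => simpa using hf
  | succ k ih =>
    rw [iteratedDeriv_succ]
    exact ih.deriv hU

lemma tendsto_iteratedDeriv [CompleteSpace E] {H : ℕ → ℂ → E} {F : ℂ → E} {U : Set ℂ}
    (hU : IsOpen U) (hd : ∀ᶠ n in atTop, DifferentiableOn ℂ (H n) U)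
    (h : TendstoLocallyUniformlyOn H F atTop U) (k : ℕ) :
    TendstoLocallyUniformlyOn (fun n => iteratedDeriv k (H n)) (iteratedDeriv k F) atTop U := by
  induction k with
  | zero => simpa using h
  | succ k ih =>
    simp_rw [iteratedDeriv_succ]
    exact ih.deriv (hd.mono fun n hn => differentiableOn_iteratedDeriv hU hn k) hU

lemma tendsto_of_locallyUniformlyOn {E' : Type*} [NormedAddCommGroup E'] {H : ℕ → ℂ → E'}
    {F : ℂ → E'} {U : Set ℂ}
    (hU : IsOpen U) (h : TendstoLocallyUniformlyOn H F atTop U) (hF : ContinuousOn F U) {z : ℂ}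
    (hz : z ∈ U) : Tendsto (fun p : ℕ × ℂ => H p.1 p.2) (atTop ×ˢ 𝓝 z) (𝓝 (F z)) := by
  have h1 := tendstoLocallyUniformlyOn_iff_forall_tendsto.1 h z hz
  rw [hU.nhdsWithin_eq hz] at h1
  have h2 : Tendsto (fun p : ℕ × ℂ => F p.2) (atTop ×ˢ 𝓝 z) (𝓝 (F z)) :=
    (hF.continuousAt (hU.mem_nhds hz)).tendsto.comp tendsto_snd
  rw [Metric.tendsto_nhds] at h2 ⊢
  intro ε hε
  have h3 := h1 (Metric.dist_mem_uniformity (half_pos hε))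
  filter_upwards [h2 (ε / 2) (by linarith), h3] with p hp hp'
  have hp' : dist (F p.2) (H p.1 p.2) < ε / 2 := hp'
  calc dist (H p.1 p.2) (F z) ≤ dist (H p.1 p.2) (F p.2) + dist (F p.2) (F z) := dist_triangle _ _ _
    _ < ε := by rw [dist_comm] at hp'; linarith

/-- Hurwitz's theorem: zeros of a non-trivial limit are limits of zeros. -/
theorem hurwitz {h : ℕ → ℂ → ℂ} {g : ℂ → ℂ} {δ : ℝ} (hδ : 0 < δ)
    (hd : ∀ᶠ n in atTop, DifferentiableOn ℂ (h n) (ball 0 δ))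
    (hlim : TendstoLocallyUniformlyOn h g atTop (ball 0 δ)) (h0 : g 0 = 0)
    (hg : ∃ᶠ z in 𝓝 0, g z ≠ 0) {ε : ℝ} (hε : 0 < ε) :
    ∀ᶠ n in atTop, ∃ z, ‖z‖ < ε ∧ h n z = 0 := by
  have hgd : DifferentiableOn ℂ g (ball 0 δ) := hlim.differentiableOn hd isOpen_ball
  have hga : AnalyticAt ℂ g 0 := hgd.analyticAt (isOpen_ball.mem_nhds (by simpa))
  have hne : ∀ᶠ z in 𝓝[≠] (0 : ℂ), g z ≠ 0 :=
    hga.eventually_eq_zero_or_eventually_ne_zero.resolve_left fun h =>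
      hg (h.mono fun z hz => not_not.2 hz)
  obtain ⟨η, hη, hηne⟩ := Metric.mem_nhdsWithin_iff.1 hne
  set r := min (min (ε / 2) (δ / 2)) (η / 2) with hr
  have hr0 : 0 < r := by positivity
  have hrε : r < ε := lt_of_le_of_lt ((min_le_left _ _).trans (min_le_left _ _)) (by linarith)
  have hrδ : r < δ := lt_of_le_of_lt ((min_le_left _ _).trans (min_le_right _ _)) (by linarith)
  have hrη : r < η := lt_of_le_of_lt (min_le_right _ _) (by linarith)
  have hcb : closedBall (0 : ℂ) r ⊆ ball 0 δ := closedBall_subset_ball hrδ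
  obtain ⟨z₁, hz₁, hmin⟩ := (isCompact_sphere (0 : ℂ) r).exists_isMinOn
    (NormedSpace.sphere_nonempty.2 hr0.le)
    ((hgd.continuousOn.mono (sphere_subset_closedBall.trans hcb)).norm)
  have hm : 0 < ‖g z₁‖ := by
    refine norm_pos_iff.2 (hηne ⟨?_, ?_⟩)
    · simp only [mem_sphere, dist_zero_right] at hz₁
      simpa [hz₁] using hrη
    · rintro rfl
      simp at hz₁
      exact hr0.ne hz₁
  have hu := (tendstoLocallyUniformlyOn_iff_tendstoUniformlyOn_of_compact
    (isCompact_closedBall (0 : ℂ) r)).1 (hlim.mono hcb)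
  rw [Metric.tendstoUniformlyOn_iff] at hu
  filter_upwards [hu (‖g z₁‖ / 2) (by linarith), hd] with n hn hdn
  -- without zeros, the maximum principle bounds `(h n)⁻¹` at the origin, where `h n` is small
  by_contra hcon
  push Not at hcon
  have hnz : ∀ z ∈ closedBall (0 : ℂ) r, h n z ≠ 0 := fun z hz =>
    hcon z (lt_of_le_of_lt (by simpa using hz) hrε)
  have hdi : DiffContOnCl ℂ (fun z => (h n z)⁻¹) (ball 0 r) := by
    refine DiffContOnCl.inv (hdn.diffContOnCl_ball hcb) fun z hz => hnz z ?_
    rwa [closure_ball _ hr0.ne'] at hz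
  have := norm_le_of_forall_mem_frontier_norm_le isBounded_ball hdi (C := 2 / ‖g z₁‖)
    (fun z hz => by
      rw [frontier_ball _ hr0.ne'] at hz
      have h1 : ‖g z₁‖ ≤ ‖g z‖ := hmin hz
      have h2 := hn z (sphere_subset_closedBall hz)
      rw [dist_eq_norm] at h2
      have h3 := norm_sub_norm_le (g z) (h n z)
      rw [norm_inv, inv_le_comm₀ (norm_pos_iff.2 (hnz z (sphere_subset_closedBall hz)))
        (by positivity), inv_div]
      linarith) (subset_closure (mem_ball_self hr0))
  have h2 := hn 0 (by simpa using hr0.le)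
  rw [h0, dist_zero_left] at h2
  have h3 : 0 < ‖h n 0‖ := norm_pos_iff.2 (hnz 0 (by simpa using hr0.le))
  rw [norm_inv, inv_le_comm₀ h3 (by positivity), inv_div] at this
  linarith

end Sequences

/-! ### Finite Blaschke products -/

/-- The Blaschke factor of the disc of radius `R`, with its zero at `a`. -/
def blaschkeFactor (R : ℝ) (a z : ℂ) : ℂ := R * (z - a) / (R ^ 2 - conj a * z)

lemma blaschke_den_ne_zero {R : ℝ} {a z : ℂ} (hR : 0 < R) (ha : ‖a‖ < R) (hz : ‖z‖ ≤ R) :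
    (R ^ 2 - conj a * z : ℂ) ≠ 0 := by
  intro h
  have h1 : (R ^ 2 : ℂ) = conj a * z := sub_eq_zero.1 h
  have h2 : R ^ 2 = ‖a‖ * ‖z‖ := by
    have := congrArg norm h1
    simpa [abs_of_pos hR] using this
  nlinarith [norm_nonneg a, norm_nonneg z]

lemma blaschke_identity (R : ℝ) (a z : ℂ) :
    ‖(R ^ 2 - conj a * z : ℂ)‖ ^ 2 - ‖(R * (z - a) : ℂ)‖ ^ 2
      = (R ^ 2 - ‖a‖ ^ 2) * (R ^ 2 - ‖z‖ ^ 2) := by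
  simp only [← Complex.normSq_eq_norm_sq, Complex.normSq_apply]
  simp [pow_two]
  ring

lemma norm_blaschkeFactor_le {R : ℝ} {a z : ℂ} (hR : 0 < R) (ha : ‖a‖ < R) (hz : ‖z‖ ≤ R) :
    ‖blaschkeFactor R a z‖ ≤ 1 := by
  rw [blaschkeFactor, norm_div, div_le_one (norm_pos_iff.2 (blaschke_den_ne_zero hR ha hz))]
  have h := blaschke_identity R a z
  have h1 : 0 ≤ (R ^ 2 - ‖a‖ ^ 2) * (R ^ 2 - ‖z‖ ^ 2) :=
    mul_nonneg (by nlinarith [norm_nonneg a]) (by nlinarith [norm_nonneg z])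
  exact (pow_le_pow_iff_left₀ (norm_nonneg _) (norm_nonneg _) two_ne_zero).1 (by linarith)

lemma norm_blaschkeFactor_eq {R : ℝ} {a z : ℂ} (hR : 0 < R) (ha : ‖a‖ < R) (hz : ‖z‖ = R) :
    ‖blaschkeFactor R a z‖ = 1 := by
  have hne := norm_pos_iff.2 (blaschke_den_ne_zero hR ha hz.le)
  rw [blaschkeFactor, norm_div, div_eq_one_iff_eq hne.ne']
  have h := blaschke_identity R a z
  rw [hz, sub_self, mul_zero] at h
  exact (pow_left_inj₀ (norm_nonneg _) (norm_nonneg _) two_ne_zero).1 (by linarith)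

lemma analyticAt_blaschkeFactor {R : ℝ} {a z : ℂ} (hR : 0 < R) (ha : ‖a‖ < R) (hz : ‖z‖ ≤ R) :
    AnalyticAt ℂ (blaschkeFactor R a) z := by
  unfold blaschkeFactor
  exact AnalyticAt.div (by fun_prop) (by fun_prop) (blaschke_den_ne_zero hR ha hz)

lemma blaschkeFactor_eq_zero_iff {R : ℝ} {a z : ℂ} (hR : 0 < R) (ha : ‖a‖ < R) (hz : ‖z‖ ≤ R) :
    blaschkeFactor R a z = 0 ↔ z = a := by
  have hR' : (R : ℂ) ≠ 0 := by exact_mod_cast hR.ne'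
  simp [blaschkeFactor, blaschke_den_ne_zero hR ha hz, hR', sub_eq_zero]

lemma analyticOrderAt_blaschkeFactor {R : ℝ} {a z : ℂ} (hR : 0 < R) (ha : ‖a‖ < R) (hz : ‖z‖ ≤ R) :
    analyticOrderAt (blaschkeFactor R a) z = if z = a then 1 else 0 := by
  split_ifs with h
  · subst h
    rw [← Nat.cast_one, (analyticAt_blaschkeFactor hR ha hz).analyticOrderAt_eq_natCast]
    have hR' : (R : ℂ) ≠ 0 := by exact_mod_cast hR.ne'
    refine ⟨fun w => R / (R ^ 2 - conj z * w), ?_, ?_, Eventually.of_forall fun w => ?_⟩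
    · exact AnalyticAt.div (by fun_prop) (by fun_prop) (blaschke_den_ne_zero hR ha hz)
    · exact div_ne_zero hR' (blaschke_den_ne_zero hR ha hz)
    · simp only [blaschkeFactor, smul_eq_mul, pow_one]
      ring
  · rw [(analyticAt_blaschkeFactor hR ha hz).analyticOrderAt_eq_zero]
    exact fun h0 => h ((blaschkeFactor_eq_zero_iff hR ha hz).1 h0)

/-- A finite Blaschke product with prescribed vanishing orders in the open disc of radius `R`. -/
theorem exists_blaschke {R : ℝ} (hR : 0 < R) (k : ℂ → ℕ)
    (hk : ∀ z ∈ closedBall (0 : ℂ) R, ∀ᶠ z' in 𝓝[≠] z, k z' = 0) :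
    ∃ B : ℂ → ℂ, (∀ z ∈ closedBall (0 : ℂ) R, AnalyticAt ℂ B z) ∧
      (∀ z ∈ closedBall (0 : ℂ) R, ‖B z‖ ≤ 1) ∧ (∀ z ∈ sphere (0 : ℂ) R, ‖B z‖ = 1) ∧
      ∀ z ∈ ball (0 : ℂ) R, analyticOrderAt B z = k z := by
  have hfin : {z ∈ ball (0 : ℂ) R | k z ≠ 0}.Finite := by
    by_contra hinf
    obtain ⟨z, hz, hacc⟩ := Set.Infinite.exists_accPt_of_subset_isCompact hinf
      (isCompact_closedBall (0 : ℂ) R) fun z hz => ball_subset_closedBall hz.1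
    exact (accPt_iff_frequently_nhdsNE.1 hacc) ((hk z hz).mono fun w hw h => h.2 hw)
  have key : ∀ S : Finset ℂ, (∀ a ∈ S, ‖a‖ < R) → ∃ B : ℂ → ℂ,
      (∀ z ∈ closedBall (0 : ℂ) R, AnalyticAt ℂ B z) ∧
      (∀ z ∈ closedBall (0 : ℂ) R, ‖B z‖ ≤ 1) ∧ (∀ z ∈ sphere (0 : ℂ) R, ‖B z‖ = 1) ∧
      ∀ z ∈ ball (0 : ℂ) R, analyticOrderAt B z = if z ∈ S then (k z : ℕ∞) else 0 := by
    intro S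
    induction S using Finset.induction_on with
    | empty =>
      refine fun _ => ⟨fun _ => 1, fun z _ => analyticAt_const, by simp, by simp, fun z _ => ?_⟩
      rw [analyticAt_const.analyticOrderAt_eq_zero.2 one_ne_zero]
      simp
    | insert a S haS ih =>
      intro hS
      obtain ⟨B, h1, h2, h3, h4⟩ := ih fun b hb => hS b (Finset.mem_insert_of_mem hb)
      have ha := hS a (Finset.mem_insert_self a S)
      have hc : ∀ z : ℂ, z ∈ closedBall (0 : ℂ) R ↔ ‖z‖ ≤ R := fun z => by simp
      have hfa : ∀ z ∈ closedBall (0 : ℂ) R, AnalyticAt ℂ (blaschkeFactor R a ^ k a) z :=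
        fun z hz => (analyticAt_blaschkeFactor hR ha ((hc z).1 hz)).pow _
      refine ⟨blaschkeFactor R a ^ k a * B, fun z hz => (hfa z hz).mul (h1 z hz),
        fun z hz => ?_, fun z hz => ?_, fun z hz => ?_⟩
      · rw [Pi.mul_apply, norm_mul, Pi.pow_apply, norm_pow]
        exact mul_le_one₀ (pow_le_one₀ (norm_nonneg _)
          (norm_blaschkeFactor_le hR ha ((hc z).1 hz))) (norm_nonneg _) (h2 z hz)
      · rw [Pi.mul_apply, norm_mul, Pi.pow_apply, norm_pow, h3 z hz,
          norm_blaschkeFactor_eq hR ha (by simpa using hz)]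
        simp
      · have hz' := ball_subset_closedBall hz
        rw [analyticOrderAt_mul (hfa z hz') (h1 z hz'), h4 z hz,
          analyticOrderAt_pow (analyticAt_blaschkeFactor hR ha ((hc z).1 hz')),
          analyticOrderAt_blaschkeFactor hR ha ((hc z).1 hz')]
        by_cases hza : z = a
        · subst hza
          simp [haS]
        · simp [hza]
  obtain ⟨B, h1, h2, h3, h4⟩ := key hfin.toFinset fun a ha => by
    simpa using (hfin.mem_toFinset.1 ha).1
  refine ⟨B, h1, h2, h3, fun z hz => ?_⟩
  rw [h4 z hz]
  split_ifs with h
  · rfl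
  · have : k z = 0 := by
      by_contra h0
      exact h (hfin.mem_toFinset.2 ⟨hz, h0⟩)
    simp [this]

lemma eventually_norm_ge_of_norm_eq_one {B : ℂ → ℂ} {R : ℝ} (hR : 0 < R)
    (hB : ∀ z ∈ sphere (0 : ℂ) R, ContinuousAt B z) (h1 : ∀ z ∈ sphere (0 : ℂ) R, ‖B z‖ = 1)
    {c : ℝ} (hc : c < 1) : ∃ s₀ < R, ∀ s ∈ Ioo s₀ R, ∀ z ∈ sphere (0 : ℂ) s, c < ‖B z‖ := by
  have hU : ∀ z ∈ sphere (0 : ℂ) R, z ∈ interior {z | c < ‖B z‖} := fun z hz =>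
    mem_interior_iff_mem_nhds.2 ((hB z hz).norm.eventually (lt_mem_nhds (hc.trans_eq (h1 z hz).symm)))
  obtain ⟨δ, hδ, hsub⟩ := (isCompact_sphere (0 : ℂ) R).exists_thickening_subset_open
    isOpen_interior hU
  refine ⟨max (R - δ) 0, max_lt (by linarith) hR, fun s hs z hz => ?_⟩
  have hs0 : 0 < s := (le_max_right _ _).trans_lt hs.1
  have hs1 : R - δ < s := (le_max_left _ _).trans_lt hs.1
  have hzs : ‖z‖ = s := by simpa using hz
  have hmem : z ∈ interior {z | c < ‖B z‖} := hsub (mem_thickening_iff.2 ⟨((R / s : ℝ) : ℂ) * z, by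
    simp [hzs, abs_of_pos hR, abs_of_pos hs0]
    field_simp, by
    rw [dist_eq_norm, show z - ((R / s : ℝ) : ℂ) * z = ((1 - R / s : ℝ) : ℂ) * z by
      push_cast; ring, norm_mul, hzs, norm_real, Real.norm_eq_abs]
    have : 1 - R / s = - ((R - s) / s) := by field_simp; ring
    rw [this, abs_neg, abs_of_nonneg (div_nonneg (by linarith [hs.2]) hs0.le),
      div_mul_cancel₀ _ hs0.ne']
    linarith⟩)
  exact (interior_subset hmem : z ∈ {z | c < ‖B z‖})

end

/-! ### Holomorphic maps to a projective manifold -/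

section

open Asymptotics

lemma differentiableAt_of_immersion {V E : Type*} [NormedAddCommGroup V] [NormedSpace ℂ V]
    [FiniteDimensional ℂ V] [NormedAddCommGroup E] [NormedSpace ℂ E] [FiniteDimensional ℂ E]
    {Φ : V → E} {x : ℂ → V} {P : ℂ → E} {z₀ : ℂ} {A : V →L[ℂ] E} (hA : HasFDerivAt Φ A (x z₀))
    (hinj : ∀ v, A v = 0 → v = 0) (hx : ContinuousAt x z₀) (hP : DifferentiableAt ℂ P z₀)
    (h : ∀ᶠ z in 𝓝 z₀, Φ (x z) = P z) : DifferentiableAt ℂ x z₀ := by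
  obtain ⟨B, hB⟩ := LinearMap.exists_leftInverse_of_injective (A : V →ₗ[ℂ] E)
    (LinearMap.ker_eq_bot'.2 hinj)
  let B' : E →L[ℂ] V := LinearMap.toContinuousLinearMap B
  have hB' : ∀ v, B' (A v) = v := fun v => LinearMap.congr_fun hB v
  have h1 : HasFDerivAt (fun y => y - B' (Φ y)) (0 : V →L[ℂ] V) (x z₀) := by
    refine ((hasFDerivAt_id (x z₀)).sub (B'.hasFDerivAt.comp (x z₀) hA)).congr_fderiv ?_
    ext v
    simp [hB']
  have h2 := h1.isLittleO.comp_tendsto hx.tendsto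
  have h3 : (fun z => B' (P z) - B' (P z₀)) =O[𝓝 z₀] fun z => z - z₀ :=
    (B'.differentiableAt.comp z₀ hP).isBigO_sub
  have h4 : (fun z => x z - x z₀ - (B' (P z) - B' (P z₀))) =o[𝓝 z₀] fun z => x z - x z₀ := by
    refine h2.congr' ?_ EventuallyEq.rfl
    filter_upwards [h] with z hz
    simp only [Function.comp, zero_apply, sub_zero, hz, h.self_of_nhds]
    abel
  have h5 : (fun z => x z - x z₀) =O[𝓝 z₀] fun z => z - z₀ := by
    refine h4.right_isBigO_sub.trans (h3.congr_left fun z => ?_)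
    abel
  have h6 : HasFDerivAt (fun z => B' (P z)) (fderiv ℂ (fun z => B' (P z)) z₀) z₀ :=
    (B'.differentiableAt.comp z₀ hP).hasFDerivAt
  refine HasFDerivAt.differentiableAt (f' := fderiv ℂ (fun z => B' (P z)) z₀)
    (.of_isLittleO ?_)
  refine ((h4.trans_isBigO h5).add h6.isLittleO).congr_left fun z => ?_
  abel

variable {d : ℕ} {X : Type*} [TopologicalSpace X] [ChartedSpace (Fin d → ℂ) X] {N : ℕ}

/-- `v` is a vector of homogeneous coordinates of the point `j x`. -/
def Lift (j : X → Projectivization ℂ (Fin (N + 1) → ℂ)) (x : X) (v : Fin (N + 1) → ℂ) : Prop :=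
  ∃ h : v ≠ 0, j x = Projectivization.mk ℂ v h

variable (d) in
/-- `j` is an injective holomorphic immersion into projective space. -/
def IsEmbedded (j : X → Projectivization ℂ (Fin (N + 1) → ℂ)) : Prop :=
  Function.Injective j ∧
    ∀ x : X, ∃ (U : Set X) (F : X → Fin (N + 1) → ℂ), IsOpen U ∧ x ∈ U ∧
      MDifferentiableOn 𝓘(ℂ, Fin d → ℂ) 𝓘(ℂ, Fin (N + 1) → ℂ) F U ∧
      (∀ y ∈ U, Lift j y (F y)) ∧
      ∀ (v : TangentSpace 𝓘(ℂ, Fin d → ℂ) x) (c : ℂ),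
        mfderiv 𝓘(ℂ, Fin d → ℂ) 𝓘(ℂ, Fin (N + 1) → ℂ) F x v = c • F x → v = 0

section Lifts
variable {X : Type*} {N : ℕ} {j : X → Projectivization ℂ (Fin (N + 1) → ℂ)}

lemma Lift.smul {x : X} {v : Fin (N + 1) → ℂ} (h : Lift j x v) {c : ℂ} (hc : c ≠ 0) :
    Lift j x (c • v) := by
  obtain ⟨hv, h⟩ := h
  refine ⟨smul_ne_zero hc hv, h.trans ?_⟩
  rw [Projectivization.mk_eq_mk_iff']
  exact ⟨c⁻¹, inv_smul_smul₀ hc v⟩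

lemma Lift.of_smul {x : X} {v : Fin (N + 1) → ℂ} {c : ℂ} (h : Lift j x (c • v)) : Lift j x v := by
  have hc : c ≠ 0 := fun h0 => h.1 (by rw [h0, zero_smul])
  have := h.smul (inv_ne_zero hc)
  rwa [inv_smul_smul₀ hc] at this

lemma Lift.exists_smul {x : X} {v w : Fin (N + 1) → ℂ} (h : Lift j x v) (h' : Lift j x w) :
    ∃ c : ℂ, c ≠ 0 ∧ w = c • v := by
  obtain ⟨hv, h⟩ := h
  obtain ⟨hw, h'⟩ := h'
  obtain ⟨c, hc⟩ := (Projectivization.mk_eq_mk_iff' ℂ w v hw hv).1 (h'.symm.trans h)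
  refine ⟨c, fun h0 => hw ?_, hc.symm⟩
  rw [← hc, h0, zero_smul]

lemma Lift.unique {x y : X} {v : Fin (N + 1) → ℂ} (hj : Function.Injective j) (h : Lift j x v)
    (h' : Lift j y v) : x = y := hj (h.2.trans h'.2.symm)

end Lifts

variable {j : X → Projectivization ℂ (Fin (N + 1) → ℂ)}

/-- The cone over the image of a compact `X` is closed, and the projection to `X` is continuous. -/
lemma IsEmbedded.tendsto [CompactSpace X] (hj : IsEmbedded d j) {κ : Type*} {l : Filter κ} [l.NeBot]
    {x : κ → X} {V : κ → Fin (N + 1) → ℂ} {v : Fin (N + 1) → ℂ} (hV : Tendsto V l (𝓝 v))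
    (hv : v ≠ 0) (h : ∀ᶠ i in l, Lift j (x i) (V i)) : ∃ y, Lift j y v ∧ Tendsto x l (𝓝 y) := by
  have key : ∀ y, MapClusterPt y l x → Lift j y v := by
    intro y hy
    obtain ⟨u, hu, hux⟩ := mapClusterPt_iff_ultrafilter.1 hy
    obtain ⟨U, F, hU, hyU, hF, hFl, -⟩ := hj.2 y
    have hFc : Tendsto (fun i => F (x i)) u (𝓝 (F y)) :=
      (hF.continuousOn.continuousAt (hU.mem_nhds hyU)).tendsto.comp hux
    have hVu := hV.mono_left hu
    have hyl := hFl y hyU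
    obtain ⟨a, ha⟩ : ∃ a, v a ≠ 0 := Function.ne_iff.1 hv
    have hcol : ∀ b, v a * F y b = v b * F y a := fun b => by
      have h1 : Tendsto (fun i => V i a * F (x i) b) u (𝓝 (v a * F y b)) :=
        ((tendsto_pi_nhds.1 hVu) a).mul ((tendsto_pi_nhds.1 hFc) b)
      have h2 : Tendsto (fun i => V i b * F (x i) a) u (𝓝 (v b * F y a)) :=
        ((tendsto_pi_nhds.1 hVu) b).mul ((tendsto_pi_nhds.1 hFc) a)
      refine tendsto_nhds_unique (h1.congr' ?_) h2
      filter_upwards [hu h, hux.eventually (hU.mem_nhds hyU)] with i hi hiU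
      obtain ⟨c, -, hc⟩ := hi.exists_smul (hFl _ hiU)
      rw [hc]
      simp only [Pi.smul_apply, smul_eq_mul]
      ring
    have e : F y = (F y a / v a) • v := by
      ext b
      simp only [Pi.smul_apply, smul_eq_mul]
      rw [div_mul_eq_mul_div, eq_div_iff ha]
      linear_combination hcol b
    rw [e] at hyl
    exact hyl.of_smul
  obtain ⟨y, hy⟩ := exists_clusterPt_of_compactSpace (map x l)
  refine ⟨y, key y hy, le_nhds_of_unique_clusterPt fun y' hy' => ?_⟩
  exact (key y' hy').unique hj.1 (key y hy)

/-- A map to `X` with holomorphic homogeneous coordinates is holomorphic. -/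
lemma IsEmbedded.mdifferentiableOn [CompactSpace X] [IsManifold 𝓘(ℂ, Fin d → ℂ) ω X]
    (hj : IsEmbedded d j) {U : Set ℂ} (hU : IsOpen U) {g : ℂ → X} {G : ℂ → Fin (N + 1) → ℂ}
    (hG : DifferentiableOn ℂ G U) (hg : ∀ z ∈ U, Lift j (g z) (G z)) :
    MDifferentiableOn 𝓘(ℂ) 𝓘(ℂ, Fin d → ℂ) g U := by
  intro z₀ hz₀
  refine MDifferentiableAt.mdifferentiableWithinAt ?_
  have hGd : DifferentiableAt ℂ G z₀ := hG.differentiableAt (hU.mem_nhds hz₀)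
  have hgc : ContinuousAt g z₀ := by
    obtain ⟨y, hy, hty⟩ := hj.tendsto (l := 𝓝 z₀) hGd.continuousAt (hg z₀ hz₀).1
      ((hU.eventually_mem hz₀).mono fun z hz => hg z hz)
    rwa [hy.unique hj.1 (hg z₀ hz₀)] at hty
  rw [mdifferentiableAt_iff_target]
  refine ⟨hgc, mdifferentiableAt_iff_differentiableAt.2 ?_⟩
  obtain ⟨U', F, hU', hxU, hF, hFl, himm⟩ := hj.2 (g z₀)
  have hFx : MDifferentiableAt 𝓘(ℂ, Fin d → ℂ) 𝓘(ℂ, Fin (N + 1) → ℂ) F (g z₀) :=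
    (hF _ hxU).mdifferentiableAt (hU'.mem_nhds hxU)
  set e := extChartAt 𝓘(ℂ, Fin d → ℂ) (g z₀) with he
  let A : (Fin d → ℂ) →L[ℂ] (Fin (N + 1) → ℂ) :=
    mfderiv 𝓘(ℂ, Fin d → ℂ) 𝓘(ℂ, Fin (N + 1) → ℂ) F (g z₀)
  have hA : HasFDerivAt (F ∘ e.symm) A (e (g z₀)) := by
    have := hFx.hasMFDerivAt.2
    rw [modelWithCornersSelf_coe, range_id] at this
    exact (hasFDerivWithinAt_univ (f := F ∘ e.symm) (f' := A)).1 this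
  obtain ⟨a, ha⟩ : ∃ a, F (g z₀) a ≠ 0 := Function.ne_iff.1 (hFl _ hxU).1
  have hcan : (F ∘ e.symm) (e (g z₀)) = F (g z₀) := by
    simp [he]
  have hAa : HasFDerivAt (fun y => (F ∘ e.symm) y a)
      ((ContinuousLinearMap.proj (R := ℂ) (φ := fun _ : Fin (N + 1) => ℂ) a).comp
        A) (e (g z₀)) :=
    hasFDerivAt_pi'.1 hA a
  have hinv := (hasDerivAt_inv (by rw [hcan]; exact ha)).comp_hasFDerivAt (e (g z₀)) hAa
  have hΦ := hinv.smul hA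
  obtain ⟨c₀, hc₀, hc₀'⟩ := (hFl _ hxU).exists_smul (hg z₀ hz₀)
  have hGa : G z₀ a ≠ 0 := by
    rw [hc₀']
    exact mul_ne_zero hc₀ ha
  have hGa' : DifferentiableAt ℂ (fun z => G z a) z₀ := differentiableAt_pi.1 hGd a
  -- with the coordinate `a` normalised to `1` the embedding is still an immersion
  refine differentiableAt_of_immersion (x := e ∘ g)
    (P := fun z => (G z a)⁻¹ • G z) hΦ ?_ ?_ ((hGa'.inv hGa).smul hGd) ?_
  · intro v hv
    have hv' : (F (g z₀) a)⁻¹ • A v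
        + (- (F (g z₀) a ^ 2)⁻¹ * A v a) • F (g z₀)
          = 0 := by
      have hcan' : F (e.symm (e (g z₀))) = F (g z₀) := hcan
      simpa [hcan'] using hv
    refine himm v (F (g z₀) a * ((F (g z₀) a ^ 2)⁻¹
      * A v a)) ?_
    have h2 := congrArg (fun u => F (g z₀) a • u) hv'
    simp only [smul_add, smul_inv_smul₀ ha, smul_zero, smul_smul] at h2
    have h3 := eq_neg_of_add_eq_zero_left h2
    refine h3.trans ?_
    rw [← neg_smul]
    congr 1
    ring
  · exact (continuousAt_extChartAt (I := 𝓘(ℂ, Fin d → ℂ)) (g z₀)).comp hgc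
  · have hsrc : e.source ∈ 𝓝 (g z₀) := extChartAt_source_mem_nhds (I := 𝓘(ℂ, Fin d → ℂ)) (g z₀)
    filter_upwards [hgc.eventually (hU'.mem_nhds hxU), hgc.eventually hsrc,
      hU.mem_nhds hz₀] with z h1 h2 h3
    have e1 : (F ∘ e.symm) ((e ∘ g) z) = F (g z) := by
      simp only [Function.comp]
      rw [e.left_inv h2]
    change ((F ∘ e.symm) ((e ∘ g) z) a)⁻¹ • (F ∘ e.symm) ((e ∘ g) z) = (G z a)⁻¹ • G z
    rw [e1]
    obtain ⟨c, hc, hc'⟩ := (hFl _ h1).exists_smul (hg z h3)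
    rw [hc', Pi.smul_apply, smul_eq_mul, smul_smul, mul_inv, mul_comm c⁻¹, mul_assoc,
      inv_mul_cancel₀ hc, mul_one]

/-- Extension of a holomorphic map to projective space over the common zeros of its homogeneous
coordinates. -/
lemma IsEmbedded.exists_extension [CompactSpace X] [T2Space X] [Nonempty X]
    [IsManifold 𝓘(ℂ, Fin d → ℂ) ω X]
    (hj : IsEmbedded d j) {U : Set ℂ} (hU : IsOpen U) {Q : ℂ → Fin (N + 1) → ℂ}
    (hQ : DifferentiableOn ℂ Q U) (hfin : ∀ z ∈ U, analyticOrderAt Q z ≠ ⊤)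
    (hQX : ∀ z ∈ U, Q z ≠ 0 → ∃ x, Lift j x (Q z)) :
    ∃ β : ℂ → X, MDifferentiableOn 𝓘(ℂ) 𝓘(ℂ, Fin d → ℂ) β U ∧
      ∀ z ∈ U, ∀ G : ℂ → Fin (N + 1) → ℂ, ContinuousAt G z → G z ≠ 0 →
        (∀ᶠ w in 𝓝[≠] z, ∃ c : ℂ, Q w = c • G w) → Lift j (β z) (G z) := by
  have hfac : ∀ z ∈ U, ∃ G : ℂ → Fin (N + 1) → ℂ, ∃ k : ℕ, AnalyticAt ℂ G z ∧ G z ≠ 0 ∧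
      ∀ᶠ w in 𝓝 z, Q w = (w - z) ^ k • G w := fun z hz => by
    obtain ⟨G, h1, h2, h3⟩ := (AnalyticAt.analyticOrderAt_ne_top
      (hQ.analyticAt (hU.mem_nhds hz))).1 (hfin z hz)
    exact ⟨G, _, h1, h2, h3⟩
  choose! G k hGa hG0 hGQ using hfac
  have hne : ∀ z ∈ U, ∀ᶠ w in 𝓝[≠] z, Q w ≠ 0 ∧ w ∈ U ∧ Q w = (w - z) ^ k z • G z w := by
    intro z hz
    filter_upwards [nhdsWithin_le_nhds (hU.mem_nhds hz), nhdsWithin_le_nhds (hGQ z hz),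
      nhdsWithin_le_nhds ((hGa z hz).continuousAt.eventually_ne (hG0 z hz)),
      self_mem_nhdsWithin] with w h1 h2 h3 h4
    refine ⟨?_, h1, h2⟩
    rw [h2]
    exact smul_ne_zero (pow_ne_zero _ (sub_ne_zero.2 h4)) h3
  have hβ : ∀ z, ∃ y : X, z ∈ U → Lift j y (G z z) := by
    intro z
    by_cases hz : z ∈ U
    · choose! x hx using hQX
      obtain ⟨y, hy, -⟩ := hj.tendsto (l := 𝓝[≠] z) (x := x) (V := G z) (v := G z z)
        ((hGa z hz).continuousAt.tendsto.mono_left nhdsWithin_le_nhds) (hG0 z hz) (by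
          filter_upwards [hne z hz] with w hw
          have := hx w hw.2.1 hw.1
          rw [hw.2.2] at this
          exact this.of_smul)
      exact ⟨y, fun _ => hy⟩
    · exact ⟨Classical.arbitrary X, fun h => absurd h hz⟩
  choose β hβ using hβ
  have hβQ : ∀ z ∈ U, Q z ≠ 0 → Lift j (β z) (Q z) := by
    intro z hz h0
    have h1 := (hGQ z hz).self_of_nhds
    rw [sub_self] at h1
    rw [h1] at h0 ⊢
    exact (hβ z hz).smul (left_ne_zero_of_smul h0)
  have hloc : ∀ z ∈ U, ∀ᶠ w in 𝓝 z, Lift j (β w) (G z w) := by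
    intro z hz
    rw [← nhdsNE_sup_pure, eventually_sup]
    refine ⟨?_, by simpa using hβ z hz⟩
    filter_upwards [hne z hz] with w hw
    have := hβQ w hw.2.1 hw.1
    rw [hw.2.2] at this
    exact this.of_smul
  have hmd : ∀ z ∈ U, MDifferentiableAt 𝓘(ℂ) 𝓘(ℂ, Fin d → ℂ) β z := by
    intro z hz
    obtain ⟨W, hW, hWo, hzW⟩ := _root_.eventually_nhds_iff.1
      ((hloc z hz).and ((hGa z hz).eventually_analyticAt))
    exact (hj.mdifferentiableOn hWo (fun w hw => (hW w hw).2.differentiableAt.differentiableWithinAt)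
      fun w hw => (hW w hw).1).mdifferentiableAt (hWo.mem_nhds hzW)
  refine ⟨β, fun z hz => (hmd z hz).mdifferentiableWithinAt, fun z hz G' hG'c hG'0 hG' => ?_⟩
  obtain ⟨y, hy, hty⟩ := hj.tendsto (l := 𝓝[≠] z) (x := β)
    (hG'c.tendsto.mono_left nhdsWithin_le_nhds) hG'0 (by
      filter_upwards [hne z hz, hG'] with w hw hw'
      obtain ⟨c, hc⟩ := hw'
      have := hβQ w hw.2.1 hw.1
      rw [hc] at this
      exact this.of_smul)
  have := tendsto_nhds_unique hty
    ((hmd z hz).continuousAt.tendsto.mono_left nhdsWithin_le_nhds)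
  exact this ▸ hy

end

/-! ### Polynomial homogeneous coordinates and trees of spheres -/

section

section Poly
variable {N : ℕ}

/-- The vector-valued polynomial with coefficients `q 0, …, q m`. -/
def vpoly (q : ℕ → Fin (N + 1) → ℂ) (m : ℕ) (w : ℂ) : Fin (N + 1) → ℂ :=
  ∑ k ∈ Finset.range (m + 1), w ^ k • q k

lemma differentiable_vpoly (q : ℕ → Fin (N + 1) → ℂ) (m : ℕ) : Differentiable ℂ (vpoly q m) := by
  unfold vpoly
  fun_prop

lemma exists_polynomial (q : ℕ → Fin (N + 1) → ℂ) (m : ℕ) (a : Fin (N + 1)) :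
    ∃ P : Polynomial ℂ, (∀ w, P.eval w = vpoly q m w a) ∧ (∀ k ≤ m, P.coeff k = q k a) ∧
      P.natDegree ≤ m := by
  refine ⟨∑ k ∈ Finset.range (m + 1), Polynomial.monomial k (q k a), fun w => ?_, fun k hk => ?_,
    ?_⟩
  · simp [vpoly, Polynomial.eval_finsetSum, mul_comm]
  · simp [Polynomial.finsetSum_coeff, Polynomial.coeff_monomial, Nat.lt_succ_of_le hk]
  · refine Polynomial.natDegree_sum_le_of_forall_le _ _ fun k hk => ?_
    exact (Polynomial.natDegree_monomial_le _).trans (by simpa [Nat.lt_succ_iff] using hk)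

lemma finite_vpoly_eq_zero {q : ℕ → Fin (N + 1) → ℂ} {m k : ℕ} (hk : k ≤ m) (hq : q k ≠ 0) :
    {w | vpoly q m w = 0}.Finite := by
  obtain ⟨a, ha⟩ := Function.ne_iff.1 hq
  obtain ⟨P, hP, hPc, -⟩ := exists_polynomial q m a
  have hP0 : P ≠ 0 := fun h => ha (by rw [← hPc k hk, h]; simp)
  refine (P.roots.toFinset.finite_toSet).subset fun w hw => ?_
  have hw : vpoly q m w = 0 := hw
  simp [hP0, Polynomial.IsRoot, hP, hw]

lemma analyticOrderAt_vpoly_ne_top {q : ℕ → Fin (N + 1) → ℂ} {m k : ℕ} (hk : k ≤ m) (hq : q k ≠ 0)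
    (z : ℂ) : analyticOrderAt (vpoly q m) z ≠ ⊤ := fun h =>
  infinite_of_mem_nhds z (analyticOrderAt_eq_top.1 h) (finite_vpoly_eq_zero hk hq)

lemma vpoly_inv (q : ℕ → Fin (N + 1) → ℂ) (m : ℕ) {w : ℂ} (hw : w ≠ 0) :
    vpoly (fun k => q (m - k)) m w = w ^ m • vpoly q m w⁻¹ := by
  unfold vpoly
  rw [Finset.smul_sum, ← Finset.sum_range_reflect]
  refine Finset.sum_congr rfl fun k hk => ?_
  have hk : k ≤ m := by simpa [Nat.lt_succ_iff] using hk
  rw [show m + 1 - 1 - k = m - k by omega]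
  change w ^ (m - k) • q (m - (m - k)) = _
  rw [show m - (m - k) = k by omega, smul_smul]
  congr 1
  rw [inv_pow, eq_mul_inv_iff_mul_eq₀ (pow_ne_zero _ hw), ← pow_add, Nat.sub_add_cancel hk]

/-- If the coordinate `a` of the vector polynomial has degree `m` and no term of degree `m - 1`, then
a zero of order at least `m` can only be at the origin, where it kills all lower coefficients. -/
lemma analyticOrderAt_vpoly_lt {q : ℕ → Fin (N + 1) → ℂ} {m : ℕ} {a : Fin (N + 1)} (hm : 1 ≤ m)
    (hqm : q m a ≠ 0) (hq : q (m - 1) a = 0) (hne : ∃ k < m, q k ≠ 0) (z : ℂ) :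
    analyticOrderAt (vpoly q m) z < m := by
  by_contra! hlt
  have hlt' : ∀ b, ∃ P : Polynomial ℂ, (∀ k ≤ m, P.coeff k = q k b) ∧ P.natDegree ≤ m ∧
      ∀ i < m, (Polynomial.derivative^[i] P).eval z = 0 := by
    intro b
    obtain ⟨P, hP, hPc, hPd⟩ := exists_polynomial q m b
    refine ⟨P, hPc, hPd, fun i hi => ?_⟩
    have h1 : (m : ℕ∞) ≤ analyticOrderAt (fun w => P.eval w) z := by
      obtain ⟨G, hG, hG'⟩ := (natCast_le_analyticOrderAt
        ((differentiable_vpoly q m).analyticAt z)).1 hlt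
      refine (natCast_le_analyticOrderAt (P.differentiable.analyticAt z)).2
        ⟨fun w => G w b, ?_, ?_⟩
      · exact (ContinuousLinearMap.proj (R := ℂ) (φ := fun _ : Fin (N + 1) => ℂ)
          b).analyticAt _ |>.comp hG
      · filter_upwards [hG'] with w hw
        rw [hP, hw]; rfl
    have h2 := (natCast_le_analyticOrderAt_iff_iteratedDeriv_eq_zero
      (P.differentiable.analyticAt z)).1 h1 i hi
    have h3 : ∀ i, iteratedDeriv i (fun w => P.eval w)
        = fun w => (Polynomial.derivative^[i] P).eval w := by
      intro i
      induction i with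
      | zero => simp
      | succ i ih =>
        rw [iteratedDeriv_succ, ih, Function.iterate_succ_apply']
        funext w
        exact Polynomial.deriv _
    rwa [h3] at h2
  -- the derivative of order `m - 1` of the coordinate `a` is a nonzero multiple of the variable
  have hz : z = 0 := by
    obtain ⟨P, hPc, hPd, hP⟩ := hlt' a
    have h1 := hP (m - 1) (by omega)
    have hdeg : (Polynomial.derivative^[m - 1] P).natDegree < 2 := by
      have := Polynomial.natDegree_iterate_derivative P (m - 1)
      omega
    rw [Polynomial.eval_eq_sum_range' hdeg] at h1
    simp only [Finset.sum_range_succ, Finset.sum_range_zero, Polynomial.coeff_iterate_derivative,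
      zero_add, pow_zero, mul_one, pow_one, nsmul_eq_mul] at h1
    rw [hPc _ (by omega), hPc _ (by omega), hq, mul_zero, zero_add,
      show 1 + (m - 1) = m by omega] at h1
    refine (mul_eq_zero.1 h1).resolve_left (mul_ne_zero ?_ hqm)
    rw [Nat.cast_ne_zero, ← Nat.pos_iff_ne_zero]
    exact Nat.descFactorial_pos.2 (by omega)
  obtain ⟨k, hk, hqk⟩ := hne
  refine hqk (funext fun b => ?_)
  obtain ⟨P, hPc, -, hP⟩ := hlt' b
  have h1 := hP k hk
  rw [hz, ← Polynomial.coeff_zero_eq_eval_zero, Polynomial.coeff_iterate_derivative, zero_add,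
    hPc k hk.le, Nat.descFactorial_self, nsmul_eq_mul] at h1
  exact (mul_eq_zero.1 h1).resolve_left (by exact_mod_cast k.factorial_ne_zero)

end Poly

variable {d : ℕ} {X : Type*} [TopologicalSpace X] [ChartedSpace (Fin d → ℂ) X] {N : ℕ}
  {j : X → Projectivization ℂ (Fin (N + 1) → ℂ)}

/-- Polynomial homogeneous coordinates define a holomorphic sphere. -/
lemma IsEmbedded.exists_sphere [CompactSpace X] [T2Space X] [Nonempty X]
    [IsManifold 𝓘(ℂ, Fin d → ℂ) ω X] (hj : IsEmbedded d j) {q : ℕ → Fin (N + 1) → ℂ} {m : ℕ}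
    (hqm : q m ≠ 0) (hQX : ∀ w, vpoly q m w ≠ 0 → ∃ x, Lift j x (vpoly q m w)) :
    ∃ β : OnePoint ℂ → X, IsHolomorphicSphere d β ∧ Lift j (β OnePoint.infty) (q m) ∧
      ∀ (w : ℂ) (G : ℂ → Fin (N + 1) → ℂ), ContinuousAt G w → G w ≠ 0 →
        (∀ᶠ u in 𝓝[≠] w, ∃ c : ℂ, vpoly q m u = c • G u) → Lift j (β (w : OnePoint ℂ)) (G w) := by
  obtain ⟨β₁, hβ₁, h₁⟩ := hj.exists_extension isOpen_univ (differentiable_vpoly q m).differentiableOn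
    (fun z _ => analyticOrderAt_vpoly_ne_top le_rfl hqm z) fun w _ => hQX w
  have hq0 : (fun k => q (m - k)) 0 ≠ 0 := hqm
  -- the coordinates at infinity: the polynomial with reversed coefficients
  set q' := fun k => q (m - k) with hq'
  have hQ0 : vpoly q' m 0 = q m := by
    simp [vpoly, Finset.sum_range_succ', q']
  have hQX' : ∀ w, w ≠ 0 → vpoly q' m w ≠ 0 → ∃ x, Lift j x (vpoly q' m w) := by
    intro w hw h
    rw [vpoly_inv q m hw] at h ⊢
    obtain ⟨x, hx⟩ := hQX w⁻¹ (right_ne_zero_of_smul h)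
    exact ⟨x, hx.smul (left_ne_zero_of_smul h)⟩
  have hc' := (differentiable_vpoly q' m).continuous
  have hev : ∀ w₀, ∀ᶠ w in 𝓝[≠] w₀, w ≠ 0 ∧ vpoly q' m w ≠ 0 := by
    intro w₀
    have hf : ({0} ∪ {w | vpoly q' m w = 0}).Finite :=
      (finite_singleton 0).union (finite_vpoly_eq_zero (Nat.zero_le m) hq0)
    filter_upwards [mem_nhdsWithin_of_mem_nhds ((hf.subset (sdiff_subset
      (t := {w₀}))).isClosed.isOpen_compl.mem_nhds fun h => h.2 rfl),
      self_mem_nhdsWithin] with w hw hw'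
    constructor
    · exact fun h => hw ⟨Or.inl h, hw'⟩
    · exact fun h => hw ⟨Or.inr h, hw'⟩
  have hQX0 : ∀ w, vpoly q' m w ≠ 0 → ∃ x, Lift j x (vpoly q' m w) := by
    intro w h
    by_cases hw : w = 0
    · subst hw
      choose! x hx using hQX'
      obtain ⟨y, hy, -⟩ := hj.tendsto (l := 𝓝[≠] (0 : ℂ)) (x := x)
        (hc'.continuousAt.tendsto.mono_left nhdsWithin_le_nhds) h (by
          filter_upwards [hev 0] with w hw using hx w hw.1 hw.2)
      exact ⟨y, hy⟩
    · exact hQX' w hw h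
  obtain ⟨β₂, hβ₂, h₂⟩ := hj.exists_extension isOpen_univ
    (differentiable_vpoly q' m).differentiableOn
    (fun z _ => analyticOrderAt_vpoly_ne_top (Nat.zero_le m) hq0 z) fun w _ => hQX0 w
  rw [mdifferentiableOn_univ] at hβ₁ hβ₂
  have hglue : ∀ w ≠ 0, β₂ w = β₁ w⁻¹ := by
    intro w hw
    have t1 : Tendsto (fun u : ℂ => β₁ u⁻¹) (𝓝[≠] w) (𝓝 (β₁ w⁻¹)) :=
      (((hβ₁ w⁻¹).continuousAt.tendsto).comp (continuousAt_inv₀ hw).tendsto).mono_left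
        nhdsWithin_le_nhds
    have t2 : Tendsto β₂ (𝓝[≠] w) (𝓝 (β₂ w)) :=
      (hβ₂ w).continuousAt.tendsto.mono_left nhdsWithin_le_nhds
    refine tendsto_nhds_unique t2 (t1.congr' ?_)
    filter_upwards [hev w] with u hu
    have e1 : Lift j (β₂ u) (vpoly q' m u) := h₂ u (mem_univ _) _ hc'.continuousAt hu.2
      (Eventually.of_forall fun _ => ⟨1, (one_smul _ _).symm⟩)
    rw [vpoly_inv q m hu.1] at e1
    have hne := right_ne_zero_of_smul e1.1
    have e2 : Lift j (β₁ u⁻¹) (vpoly q m u⁻¹) := h₁ u⁻¹ (mem_univ _) _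
      (differentiable_vpoly q m).continuous.continuousAt hne
      (Eventually.of_forall fun _ => ⟨1, (one_smul _ _).symm⟩)
    exact e2.unique hj.1 e1.of_smul
  refine ⟨fun p => p.elim (β₂ 0) β₁, ⟨hβ₁, ?_⟩, ?_, fun w G => h₁ w (mem_univ _) G⟩
  · convert hβ₂ using 1
    funext w
    by_cases hw : w = 0
    · simp [hw]
    · simp [hw, hglue w hw]
  · have := h₂ 0 (mem_univ _) _ hc'.continuousAt (by rwa [hQ0])
      (Eventually.of_forall fun _ => ⟨1, (one_smul _ _).symm⟩)
    rwa [hQ0] at this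

/-- The tree with a single component. -/
def RationalTree.single (β : OnePoint ℂ → X) (hβ : IsHolomorphicSphere d β) (p : OnePoint ℂ) :
    RationalTree d X where
  size := 0
  parent := Fin.elim0
  parent_lt := fun i => i.elim0
  inner := fun _ => p
  outer := Fin.elim0
  inner_ne_outer := fun i => i.elim0
  outer_ne_outer := fun i => i.elim0
  map := fun _ => β
  holomorphic := fun _ => hβ
  glue := fun i => i.elim0

/-- The image of a tree of spheres. -/
def RationalTree.image (T : RationalTree d X) : Set X := {x | ∃ i w, x = T.map i w}

/-- The tree obtained by attaching `T'` to the root of `T` at the point `p`. -/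
def RationalTree.graft (T T' : RationalTree d X) (p : OnePoint ℂ) (hp : T.inner 0 ≠ p)
    (hp' : ∀ i, T.parent i = 0 → T.outer i ≠ p) (hg : T.map 0 p = T'.map 0 (T'.inner 0)) :
    RationalTree d X where
  size := T.size + 1 + T'.size
  parent := Fin.addCases
    (fun i => Fin.castAdd (T'.size + 1) (Fin.lastCases (motive := fun _ => Fin (T.size + 1))
      0 T.parent i))
    (fun i => Fin.natAdd (T.size + 1) (T'.parent i))
  inner := Fin.addCases (m := T.size + 1) (n := T'.size + 1) (motive := fun _ => OnePoint ℂ)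
    T.inner T'.inner
  outer := Fin.addCases (Fin.lastCases (motive := fun _ => OnePoint ℂ) p T.outer) T'.outer
  map := Fin.addCases (m := T.size + 1) (n := T'.size + 1) (motive := fun _ => OnePoint ℂ → X)
    T.map T'.map
  holomorphic := Fin.addCases (m := T.size + 1) (n := T'.size + 1)
    (fun i => by simpa using T.holomorphic i) (fun i => by simpa using T'.holomorphic i)
  parent_lt := by
    refine Fin.addCases (fun i => ?_) fun i => ?_
    · refine Fin.lastCases ?_ (fun i => ?_) i
      · simp [Fin.lt_def]
      · have := T.parent_lt i
        simpa [Fin.lt_def] using this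
    · have := T'.parent_lt i
      simp [Fin.lt_def] at this ⊢
      omega
  inner_ne_outer := by
    refine Fin.addCases (fun i => ?_) fun i => ?_
    · refine Fin.lastCases ?_ (fun i => ?_) i
      · simpa using hp
      · simpa using T.inner_ne_outer i
    · simpa using T'.inner_ne_outer i
  outer_ne_outer := by
    refine Fin.addCases (fun i => ?_) fun i => ?_
    · refine Fin.addCases (fun k => ?_) fun k => ?_
      · refine Fin.lastCases ?_ (fun i => ?_) i
        · refine Fin.lastCases ?_ (fun k => ?_) k
          · simp
          · intro _ h
            have h : Fin.castAdd (T'.size + 1) 0 = Fin.castAdd (T'.size + 1) (T.parent k) := by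
              simpa only [Fin.addCases_left, Fin.lastCases_last, Fin.lastCases_castSucc] using h
            simpa using (hp' k (Fin.castAdd_injective _ _ h).symm).symm
        · refine Fin.lastCases ?_ (fun k => ?_) k
          · intro _ h
            have h : Fin.castAdd (T'.size + 1) (T.parent i) = Fin.castAdd (T'.size + 1) 0 := by
              simpa only [Fin.addCases_left, Fin.lastCases_last, Fin.lastCases_castSucc] using h
            simpa using hp' i (Fin.castAdd_injective _ _ h)
          · intro h h'
            simpa using T.outer_ne_outer i k (fun e => h (by rw [e]))
              (by simpa [Fin.ext_iff] using h')
      · intro _ h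
        simp [Fin.ext_iff] at h
        omega
    · refine Fin.addCases (fun k => ?_) fun k => ?_
      · intro _ h
        simp [Fin.ext_iff] at h
        omega
      · intro h h'
        simpa using T'.outer_ne_outer i k (fun e => h (by rw [e]))
          (by simpa [Fin.ext_iff] using h')
  glue := by
    refine Fin.addCases (fun i => ?_) fun i => ?_
    · refine Fin.lastCases ?_ (fun i => ?_) i
      · have e : (Fin.castAdd T'.size (Fin.last T.size)).succ
            = Fin.natAdd (T.size + 1) (0 : Fin (T'.size + 1)) := by ext; simp
        rw [e]
        simpa using hg
      · have e : (Fin.castAdd T'.size i.castSucc).succ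
            = Fin.castAdd (T'.size + 1) i.succ := by ext; simp
        rw [e]
        simpa using T.glue i
    · have e : (Fin.natAdd (T.size + 1) i).succ
            = Fin.natAdd (T.size + 1) i.succ := by ext; simp; omega
      rw [e]
      simpa using T'.glue i

lemma RationalTree.exists_graft (T T' : RationalTree d X) (p : OnePoint ℂ) (hp : T.inner 0 ≠ p)
    (hp' : ∀ i, T.parent i = 0 → T.outer i ≠ p) (hg : T.map 0 p = T'.map 0 (T'.inner 0)) :
    ∃ S : RationalTree d X, S.map 0 = T.map 0 ∧ S.inner 0 = T.inner 0 ∧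
      (∀ i, S.parent i = 0 → S.outer i = p ∨ ∃ k, T.parent k = 0 ∧ S.outer i = T.outer k) ∧
      S.image = T.image ∪ T'.image := by
  refine ⟨T.graft T' p hp hp' hg, ?_, ?_, ?_, ?_⟩
  · exact Fin.addCases_left (m := T.size + 1) (n := T'.size + 1)
      (motive := fun _ => OnePoint ℂ → X) (left := T.map) (right := T'.map) (0 : Fin (T.size + 1))
  · exact Fin.addCases_left (m := T.size + 1) (n := T'.size + 1)
      (motive := fun _ => OnePoint ℂ) (left := T.inner) (right := T'.inner)
      (0 : Fin (T.size + 1))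
  · refine Fin.addCases (m := T.size + 1) (n := T'.size) (fun i => ?_) fun i => ?_
    · refine Fin.lastCases ?_ (fun i => ?_) i
      · intro _
        left
        simp [graft]
      · intro h
        right
        simp only [graft, Fin.addCases_left, Fin.lastCases_castSucc] at h
        have h' := congrArg Fin.val h
        exact ⟨i, Fin.ext h', by simp [graft]⟩
    · intro h
      simp only [graft, Fin.addCases_right] at h
      have := congrArg Fin.val h
      simp at this
  · ext x
    constructor
    · rintro ⟨i, w, rfl⟩
      revert i
      refine Fin.addCases (m := T.size + 1) (n := T'.size + 1) (fun i => ?_) fun i => ?_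
      · exact Or.inl ⟨i, w, by simp [graft]⟩
      · exact Or.inr ⟨i, w, by simp [graft]⟩
    · rintro (⟨i, w, rfl⟩ | ⟨i, w, rfl⟩)
      · exact ⟨Fin.castAdd (T'.size + 1) i, w, by simp [graft]⟩
      · exact ⟨Fin.natAdd (T.size + 1) i, w, by simp [graft]⟩

end

/-! ### Rescaling at a common zero of the homogeneous coordinates -/

section

section Rescaling
variable {N : ℕ}

lemma tendsto_tc {H : ℕ → ℂ → Fin (N + 1) → ℂ} {F : ℂ → Fin (N + 1) → ℂ} {δ : ℝ} (hδ : 0 < δ)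
    (hd : ∀ n, DifferentiableOn ℂ (H n) (ball 0 δ))
    (hl : TendstoLocallyUniformlyOn H F atTop (ball 0 δ)) {s : ℕ → ℕ} (hs : Tendsto s atTop atTop)
    {b : ℕ → ℂ} (hb : Tendsto b atTop (𝓝 0)) (k : ℕ) :
    Tendsto (fun n => tc (fun ζ => H (s n) (b n + ζ)) k) atTop (𝓝 (tc F k)) := by
  have hFd : DifferentiableOn ℂ F (ball 0 δ) :=
    hl.differentiableOn (Eventually.of_forall hd) isOpen_ball
  have h1 := tendsto_of_locallyUniformlyOn isOpen_ball
    (tendsto_iteratedDeriv isOpen_ball (Eventually.of_forall hd) hl k)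
    (differentiableOn_iteratedDeriv isOpen_ball hFd k).continuousOn (mem_ball_self hδ)
  have h2 := h1.comp (hs.prodMk hb)
  simp only [tc, iteratedDeriv_comp_const_add, add_zero]
  exact h2.const_smul _

/-- Let `H n → F` near the origin, where `F` has a zero of order `m ≥ 1` but the `H n` have no zeros.
Centre at a zero `b n` of the `(m - 1)`-st derivative of a coordinate in which `F` has order `m`, and
choose the radius `r n` so that the Taylor coefficients `A n k` of order `k < m`, rescaled to the
radius `r n`, are bounded and do not all tend to zero. -/
lemma exists_rescaling {H : ℕ → ℂ → Fin (N + 1) → ℂ} {F : ℂ → Fin (N + 1) → ℂ} {δ : ℝ} {m : ℕ}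
    (hm : 1 ≤ m) (hδ : 0 < δ) (hd : ∀ n, DifferentiableOn ℂ (H n) (ball 0 δ))
    (hl : TendstoLocallyUniformlyOn H F atTop (ball 0 δ)) (h0 : ∀ n, ∀ z ∈ ball (0 : ℂ) δ, H n z ≠ 0)
    (hF : ∀ k < m, tc F k = 0) (hFm : tc F m ≠ 0) :
    ∃ (s : ℕ → ℕ) (b : ℕ → ℂ) (r : ℕ → ℝ) (A : ℕ → ℕ → Fin (N + 1) → ℂ)
      (q : ℕ → Fin (N + 1) → ℂ) (a : Fin (N + 1)) (ρ C : ℝ), StrictMono s ∧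
      Tendsto b atTop (𝓝 0) ∧ Tendsto r atTop (𝓝 0) ∧ (∀ n, 0 < r n) ∧ 0 < ρ ∧ 0 ≤ C ∧
      q m = tc F m ∧ q m a ≠ 0 ∧ q (m - 1) a = 0 ∧ (∃ k < m, q k ≠ 0) ∧
      (∀ n ζ, ‖ζ‖ ≤ ρ → b n + ζ ∈ ball (0 : ℂ) δ ∧
        ‖H (s n) (b n + ζ) - ∑ k ∈ Finset.range (m + 1), ζ ^ k • A n k‖ ≤ C * ‖ζ‖ ^ (m + 1)) ∧
      ∀ k ≤ m, Tendsto (fun n => ((r n : ℂ) ^ (m - k))⁻¹ • A n k) atTop (𝓝 (q k)) := by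
  have hFd : DifferentiableOn ℂ F (ball 0 δ) :=
    hl.differentiableOn (Eventually.of_forall hd) isOpen_ball
  obtain ⟨a, ha⟩ := Function.ne_iff.1 hFm
  let π : (Fin (N + 1) → ℂ) →L[ℂ] ℂ := ContinuousLinearMap.proj (R := ℂ) (φ := fun _ => ℂ) a
  -- zeros of the derivative of order `m - 1` of the coordinate `a`
  have hz : ∀ ε > 0, ∀ᶠ n in atTop, ∃ z, ‖z‖ < ε ∧ iteratedDeriv (m - 1) (H n) z a = 0 := by
    intro ε hε
    have hdi : ∀ n, DifferentiableOn ℂ (iteratedDeriv (m - 1) (H n)) (ball 0 δ) := fun n =>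
      differentiableOn_iteratedDeriv isOpen_ball (hd n) _
    have hFi := differentiableOn_iteratedDeriv isOpen_ball hFd (m - 1)
    have hl' := tendsto_iteratedDeriv isOpen_ball (Eventually.of_forall hd) hl (m - 1)
    refine hurwitz (g := fun z => iteratedDeriv (m - 1) F z a) hδ
      (Eventually.of_forall fun n => π.differentiable.comp_differentiableOn (hdi n)) ?_ ?_ ?_ hε
    · exact π.uniformContinuous.comp_tendstoLocallyUniformlyOn hl'
    · have := hF (m - 1) (by omega)
      rw [tc, smul_eq_zero] at this
      rw [this.resolve_left (inv_ne_zero (by exact_mod_cast (m - 1).factorial_ne_zero))]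
      rfl
    · have h1 : HasDerivAt (fun z => iteratedDeriv (m - 1) F z a) (iteratedDeriv m F 0 a) 0 := by
        have h2 := (hFi.differentiableAt (isOpen_ball.mem_nhds (mem_ball_self hδ))).hasDerivAt
        rw [← iteratedDeriv_succ, Nat.sub_add_cancel hm] at h2
        exact hasDerivAt_pi.1 h2 a
      have h3 : iteratedDeriv m F 0 a ≠ 0 := fun h => ha (by simp [tc, h])
      exact (h1.eventually_ne h3).frequently.filter_mono nhdsWithin_le_nhds
  obtain ⟨M, hM⟩ : ∃ M, ∀ᶠ n in atTop, ∀ z ∈ closedBall (0 : ℂ) (3 * δ / 4), ‖H n z‖ ≤ M := by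
    have hK : closedBall (0 : ℂ) (3 * δ / 4) ⊆ ball 0 δ := closedBall_subset_ball (by linarith)
    obtain ⟨M, hM⟩ := (isCompact_closedBall (0 : ℂ) (3 * δ / 4)).exists_bound_of_continuousOn
      (hFd.continuousOn.mono hK)
    have hu := (tendstoLocallyUniformlyOn_iff_forall_isCompact isOpen_ball).1 hl _ hK
      (isCompact_closedBall _ _)
    refine ⟨M + 1, ?_⟩
    filter_upwards [Metric.tendstoUniformlyOn_iff.1 hu 1 one_pos] with n hn z hz
    have h1 := hn z hz
    rw [dist_comm, dist_eq_norm] at h1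
    have := norm_le_norm_add_norm_sub' (H n z) (F z)
    linarith [hM z hz]
  obtain ⟨s, hs, hsb⟩ := extraction_forall_of_eventually (P := fun i n =>
    (∃ z, ‖z‖ < min (δ / 4) (1 / ((i : ℝ) + 1)) ∧ iteratedDeriv (m - 1) (H n) z a = 0) ∧
      ∀ z ∈ closedBall (0 : ℂ) (3 * δ / 4), ‖H n z‖ ≤ M) fun i =>
      (hz _ (lt_min (by linarith) (by positivity))).and hM
  choose b hb using fun i => (hsb i).1
  have hM' := fun i => (hsb i).2
  have hb0 : Tendsto b atTop (𝓝 0) := by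
    rw [tendsto_zero_iff_norm_tendsto_zero]
    exact squeeze_zero (fun _ => norm_nonneg _) (fun i => ((hb i).1.trans_le (min_le_right _ _)).le)
      tendsto_one_div_add_atTop_nhds_zero_nat
  have hbδ : ∀ i, ‖b i‖ < δ / 4 := fun i => (hb i).1.trans_le (min_le_left _ _)
  -- the Taylor coefficients at `b n`
  let A : ℕ → ℕ → Fin (N + 1) → ℂ := fun n k => tc (fun ζ => H (s n) (b n + ζ)) k
  have hA : ∀ k, Tendsto (fun n => A n k) atTop (𝓝 (tc F k)) := fun k =>
    tendsto_tc hδ hd hl hs.tendsto_atTop hb0 k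
  have hA0 : ∀ n, A n 0 ≠ 0 := fun n => by
    simpa [A, tc] using h0 (s n) (b n) (by simpa using (hbδ n).trans (by linarith))
  have hAa : ∀ n, A n (m - 1) a = 0 := fun n => by
    simp only [A, tc, iteratedDeriv_comp_const_add, add_zero, Pi.smul_apply, (hb n).2, smul_zero]
  -- the sum of the natural scales of the lower coefficients, positive as `H n` has no zeros
  let r : ℕ → ℝ := fun n => ∑ k ∈ Finset.range m, ‖A n k‖ ^ ((m - k : ℝ)⁻¹)
  have hexp : ∀ k ∈ Finset.range m, 0 < (m - k : ℝ)⁻¹ := fun k hk => by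
    have : (k : ℝ) < m := by exact_mod_cast Finset.mem_range.1 hk
    exact inv_pos.2 (by linarith)
  have hr0 : ∀ n, 0 < r n := fun n => by
    refine Finset.sum_pos' (fun k _ => by positivity) ⟨0, Finset.mem_range.2 hm, ?_⟩
    exact Real.rpow_pos_of_pos (norm_pos_iff.2 (hA0 n)) _
  have hr : Tendsto r atTop (𝓝 0) := by
    have : Tendsto r atTop (𝓝 (∑ k ∈ Finset.range m, (0 : ℝ) ^ ((m - k : ℝ)⁻¹))) := by
      refine tendsto_finsetSum _ fun k hk => ?_
      have h1 := (hA k).norm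
      rw [hF k (Finset.mem_range.1 hk), norm_zero] at h1
      exact h1.rpow_const (Or.inr (hexp k hk).le)
    rwa [Finset.sum_eq_zero fun k hk => Real.zero_rpow (hexp k hk).ne'] at this
  have hrdef : ∀ n, r n = ∑ k ∈ Finset.range m, ‖A n k‖ ^ ((m - k : ℝ)⁻¹) := fun n => rfl
  have hrem : ∀ n ζ, ‖ζ‖ ≤ δ / 8 → b n + ζ ∈ ball (0 : ℂ) δ ∧
      ‖H (s n) (b n + ζ) - ∑ k ∈ Finset.range (m + 1), ζ ^ k • A n k‖
        ≤ 2 * M * ((δ / 4) ^ (m + 1))⁻¹ * ‖ζ‖ ^ (m + 1) := by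
    intro n ζ hζ
    have hbn := hbδ n
    refine ⟨?_, ?_⟩
    · rw [mem_ball_zero_iff]
      have := norm_add_le (b n) ζ
      exact this.trans_lt (by linarith)
    · have hsub : ∀ z ∈ ball (0 : ℂ) (δ / 2), b n + z ∈ closedBall (0 : ℂ) (3 * δ / 4) := by
        intro z hz
        rw [mem_ball_zero_iff] at hz
        rw [mem_closedBall_zero_iff]
        have := norm_add_le (b n) z
        linarith
      have h1 := taylor_remainder (G := fun ζ => H (s n) (b n + ζ)) (δ := δ / 2)
        (r := δ / 4) (M := M) (by linarith) (by linarith) (by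
          refine (hd _).comp (by fun_prop) fun z hz => ?_
          exact closedBall_subset_ball (by linarith) (hsub z hz))
        (fun z hz => hM' _ _ (hsub z hz)) (m + 1) (z := ζ) (by linarith)
      refine h1.trans (le_of_eq ?_)
      rw [div_pow]
      ring
  clear_value r A
  -- the rescaled coefficients have weighted norms adding up to `1`, hence a nonzero limit
  let B : ℕ → Fin m → Fin (N + 1) → ℂ := fun n k => ((r n : ℂ) ^ (m - k : ℕ))⁻¹ • A n k
  have hrn : ∀ n (j : ℕ), ‖((r n : ℂ) ^ j)⁻¹‖ = (r n ^ j)⁻¹ := fun n j => by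
    rw [norm_inv, norm_pow, Complex.norm_of_nonneg (hr0 n).le]
  have hpow : ∀ n (k : Fin m), ‖B n k‖ ^ ((m - k : ℝ)⁻¹) = ‖A n k‖ ^ ((m - k : ℝ)⁻¹) / r n := by
    intro n k
    have hk := hexp k (Finset.mem_range.2 k.2)
    have e : (m - k : ℝ) = ((m - k : ℕ) : ℝ) := by rw [Nat.cast_sub k.2.le]
    rw [norm_smul, hrn, Real.mul_rpow (inv_nonneg.2 (pow_nonneg (hr0 n).le _)) (norm_nonneg _),
      Real.inv_rpow (pow_nonneg (hr0 n).le _), ← Real.rpow_natCast, ← e, ← Real.rpow_mul (hr0 n).le,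
      mul_inv_cancel₀ (inv_pos.1 hk).ne', Real.rpow_one]
    ring
  have hsum : ∀ n, ∑ k : Fin m, ‖B n k‖ ^ ((m - k : ℝ)⁻¹) = 1 := fun n => by
    simp_rw [hpow, ← Finset.sum_div]
    rw [Fin.sum_univ_eq_sum_range (fun k => ‖A n k‖ ^ ((m - k : ℝ)⁻¹)) m, ← hrdef]
    exact div_self (hr0 n).ne'
  have hB1 : ∀ n, B n ∈ closedBall (0 : Fin m → Fin (N + 1) → ℂ) 1 := fun n => by
    rw [mem_closedBall_zero_iff, pi_norm_le_iff_of_nonneg zero_le_one]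
    intro k
    by_contra! hlt
    have h1 := Real.one_lt_rpow hlt (hexp k (Finset.mem_range.2 k.2))
    have h2 := Finset.single_le_sum (f := fun k : Fin m => ‖B n k‖ ^ ((m - k : ℝ)⁻¹))
      (fun k _ => by positivity) (Finset.mem_univ k)
    rw [hsum] at h2
    exact absurd (h1.trans_le h2) (lt_irrefl _)
  obtain ⟨q', -, t, ht, hq'⟩ := (isCompact_closedBall (0 : Fin m → Fin (N + 1) → ℂ) 1).isSeqCompact
    hB1
  have hq'k : ∀ k, Tendsto (fun n => B (t n) k) atTop (𝓝 (q' k)) := fun k => tendsto_pi_nhds.1 hq' k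
  have hq'sum : ∑ k : Fin m, ‖q' k‖ ^ ((m - k : ℝ)⁻¹) = 1 := by
    refine tendsto_nhds_unique (f := fun n => ∑ k : Fin m, ‖B (t n) k‖ ^ ((m - k : ℝ)⁻¹))
      (l := atTop) (tendsto_finsetSum _ fun k _ => ?_) (by simp only [hsum]; exact tendsto_const_nhds)
    exact ((hq'k k).norm).rpow_const (Or.inr (hexp k (Finset.mem_range.2 k.2)).le)
  let q : ℕ → Fin (N + 1) → ℂ := fun k => if h : k < m then q' ⟨k, h⟩ else tc F m
  have hM0 : 0 ≤ M := (norm_nonneg _).trans (hM' 0 0 (by simp; linarith))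
  refine ⟨s ∘ t, b ∘ t, r ∘ t, fun n => A (t n), q, a, δ / 8, 2 * M * ((δ / 4) ^ (m + 1))⁻¹,
    hs.comp ht, hb0.comp ht.tendsto_atTop, hr.comp ht.tendsto_atTop, fun n => hr0 _, by linarith,
    by positivity, by simp [q], by simpa [q] using ha, ?_, ?_, ?_, ?_⟩
  · have h1 : (m - 1 : ℕ) < m := by omega
    simp only [q, h1, dif_pos]
    refine tendsto_nhds_unique (tendsto_pi_nhds.1 (hq'k ⟨m - 1, h1⟩) a) ?_
    simp only [B, Pi.smul_apply, hAa, smul_zero]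
    exact tendsto_const_nhds
  · by_contra! hall
    have h1 : ∀ k : Fin m, q' k = 0 := fun k => by
      have := hall k k.2
      simpa [q] using this
    rw [Finset.sum_eq_zero fun k _ => by
      rw [h1, norm_zero, Real.zero_rpow (hexp k (Finset.mem_range.2 k.2)).ne']] at hq'sum
    exact zero_ne_one hq'sum
  · exact fun n => hrem (t n)
  · intro k hk
    rcases hk.lt_or_eq with h | rfl
    · simp only [q, h, dif_pos]
      exact hq'k ⟨k, h⟩
    · simp only [Nat.sub_self, pow_zero, inv_one, one_smul, q, lt_irrefl, dif_neg, not_false_eq_true]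
      exact (hA k).comp ht.tendsto_atTop

end Rescaling

end

section

section RescaledLimits
variable {N : ℕ} {H : ℕ → ℂ → Fin (N + 1) → ℂ} {b : ℕ → ℂ} {r : ℕ → ℝ}
  {A : ℕ → ℕ → Fin (N + 1) → ℂ} {q : ℕ → Fin (N + 1) → ℂ} {ρ C : ℝ} {m : ℕ}

/-- Rescaled by `r n` at `b n`, the coordinates converge to the polynomial with coefficients `q k`,
uniformly on compact sets. -/
lemma rescaled_uniform (hr : Tendsto r atTop (𝓝 0)) (hr0 : ∀ n, 0 < r n) (hρ : 0 < ρ) (hC : 0 ≤ C)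
    (hrem : ∀ n ζ, ‖ζ‖ ≤ ρ → ‖H n (b n + ζ) - ∑ k ∈ Finset.range (m + 1), ζ ^ k • A n k‖
      ≤ C * ‖ζ‖ ^ (m + 1))
    (hA : ∀ k ≤ m, Tendsto (fun n => ((r n : ℂ) ^ (m - k))⁻¹ • A n k) atTop (𝓝 (q k)))
    (R : ℝ) :
    TendstoUniformlyOn (fun n w => ((r n : ℂ) ^ m)⁻¹ • H n (b n + r n * w)) (vpoly q m) atTop
      (closedBall 0 R) := by
  have hlim : Tendsto (fun n => (∑ k ∈ Finset.range (m + 1),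
      R ^ k * ‖((r n : ℂ) ^ (m - k))⁻¹ • A n k - q k‖) + C * R ^ (m + 1) * r n) atTop (𝓝 0) := by
    have h1 : Tendsto (fun n => ∑ k ∈ Finset.range (m + 1),
        R ^ k * ‖((r n : ℂ) ^ (m - k))⁻¹ • A n k - q k‖) atTop
        (𝓝 (∑ k ∈ Finset.range (m + 1), R ^ k * 0)) := by
      refine tendsto_finsetSum _ fun k hk => Tendsto.const_mul _ ?_
      exact tendsto_iff_norm_sub_tendsto_zero.1
        (hA k (by simpa [Nat.lt_succ_iff] using hk))
    simpa using h1.add (hr.const_mul (C * R ^ (m + 1)))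
  rw [Metric.tendstoUniformlyOn_iff]
  intro ε hε
  have hev : ∀ᶠ n in atTop, r n * R < ρ := by
    have : Tendsto (fun n => r n * R) atTop (𝓝 0) := by simpa using hr.mul_const R
    exact this.eventually_lt_const hρ
  filter_upwards [hlim.eventually_lt_const hε, hev] with n hn hnρ w hw
  rw [mem_closedBall_zero_iff] at hw
  have hrn := hr0 n
  have hrc : (r n : ℂ) ≠ 0 := by exact_mod_cast hrn.ne'
  have hζ : ‖(r n : ℂ) * w‖ = r n * ‖w‖ := by rw [norm_mul, Complex.norm_of_nonneg hrn.le]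
  have h1 := hrem n (r n * w) (by rw [hζ]; nlinarith)
  rw [dist_comm, dist_eq_norm]
  refine lt_of_le_of_lt ?_ hn
  have e : ((r n : ℂ) ^ m)⁻¹ • H n (b n + r n * w) - vpoly q m w
      = (∑ k ∈ Finset.range (m + 1), w ^ k • (((r n : ℂ) ^ (m - k))⁻¹ • A n k - q k))
        + ((r n : ℂ) ^ m)⁻¹ • (H n (b n + r n * w)
          - ∑ k ∈ Finset.range (m + 1), ((r n : ℂ) * w) ^ k • A n k) := by
    have : ((r n : ℂ) ^ m)⁻¹ • ∑ k ∈ Finset.range (m + 1), ((r n : ℂ) * w) ^ k • A n k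
        = ∑ k ∈ Finset.range (m + 1), w ^ k • ((r n : ℂ) ^ (m - k))⁻¹ • A n k := by
      rw [Finset.smul_sum]
      refine Finset.sum_congr rfl fun k hk => ?_
      have hk : k ≤ m := by simpa [Nat.lt_succ_iff] using hk
      rw [smul_smul, smul_smul]
      congr 1
      rw [mul_pow, pow_sub₀ _ hrc hk, mul_inv, inv_inv]
      ring
    rw [smul_sub, this]
    simp only [smul_sub, Finset.sum_sub_distrib]
    rw [vpoly]
    abel
  rw [e]
  refine (norm_add_le _ _).trans (add_le_add ?_ ?_)
  · refine (norm_sum_le _ _).trans (Finset.sum_le_sum fun k _ => ?_)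
    rw [norm_smul, norm_pow]
    gcongr
  · rw [norm_smul, norm_inv, norm_pow, Complex.norm_of_nonneg hrn.le, inv_mul_le_iff₀ (by positivity)]
    refine h1.trans ?_
    rw [hζ, mul_pow]
    have : ‖w‖ ^ (m + 1) ≤ R ^ (m + 1) := by gcongr
    calc C * (r n ^ (m + 1) * ‖w‖ ^ (m + 1)) ≤ C * (r n ^ (m + 1) * R ^ (m + 1)) := by gcongr
      _ = _ := by ring

/-- On the necks, where `|z - b n|` is much larger than `r n`, the leading term dominates. -/
lemma rescaled_neck (hr0 : ∀ n, 0 < r n) (hρ : 0 < ρ) (hb : Tendsto b atTop (𝓝 0))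
    (hrem : ∀ n ζ, ‖ζ‖ ≤ ρ → ‖H n (b n + ζ) - ∑ k ∈ Finset.range (m + 1), ζ ^ k • A n k‖
      ≤ C * ‖ζ‖ ^ (m + 1))
    (hA : ∀ k ≤ m, Tendsto (fun n => ((r n : ℂ) ^ (m - k))⁻¹ • A n k) atTop (𝓝 (q k)))
    {l : Filter (ℕ × ℂ)} (hl : l ≤ atTop ×ˢ 𝓝 0)
    (hW : Tendsto (fun p : ℕ × ℂ => (p.2 - b p.1) / r p.1) l (Bornology.cobounded ℂ)) :
    Tendsto (fun p : ℕ × ℂ => ((p.2 - b p.1) ^ m)⁻¹ • H p.1 p.2) l (𝓝 (q m)) := by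
  have hn : Tendsto Prod.fst l (atTop : Filter ℕ) := tendsto_fst.mono_left hl
  have hζ : Tendsto (fun p : ℕ × ℂ => p.2 - b p.1) l (𝓝 0) := by
    simpa using (tendsto_snd.mono_left hl).sub (hb.comp hn)
  have hW' : Tendsto (fun p : ℕ × ℂ => r p.1 / (p.2 - b p.1)) l (𝓝 0) := by
    simpa [Function.comp_def] using tendsto_inv₀_cobounded.comp hW
  have hne : ∀ᶠ p in l, p.2 - b p.1 ≠ 0 := by
    filter_upwards [hW.eventually (Bornology.eventually_ne_cobounded 0)] with p hp h
    exact hp (by rw [h, zero_div])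
  have h1 : Tendsto (fun p : ℕ × ℂ => ∑ k ∈ Finset.range (m + 1),
      (r p.1 / (p.2 - b p.1)) ^ (m - k) • ((r p.1 : ℂ) ^ (m - k))⁻¹ • A p.1 k) l
      (𝓝 (∑ k ∈ Finset.range (m + 1), (0 : ℂ) ^ (m - k) • q k)) := by
    refine tendsto_finsetSum _ fun k hk => (hW'.pow _).smul ?_
    exact (hA k (by simpa [Nat.lt_succ_iff] using hk)).comp hn
  have e : ∑ k ∈ Finset.range (m + 1), (0 : ℂ) ^ (m - k) • q k = q m := by
    rw [Finset.sum_range_succ, Finset.sum_eq_zero fun k hk => ?_]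
    · simp
    · have hk := Finset.mem_range.1 hk
      rw [zero_pow (by omega), zero_smul]
  rw [e] at h1
  have h2 : Tendsto (fun p : ℕ × ℂ => C * ‖p.2 - b p.1‖) l (𝓝 0) := by
    simpa using (hζ.norm).const_mul C
  refine tendsto_of_tendsto_of_dist h1 (squeeze_zero' (Eventually.of_forall fun _ => dist_nonneg)
    ?_ h2)
  have hev : ∀ᶠ p in l, ‖p.2 - b p.1‖ ≤ ρ := by
    have := hζ.norm
    rw [norm_zero] at this
    exact this.eventually_le_const hρ
  filter_upwards [hne, hev] with p hp hpρ
  have h3 := hrem p.1 (p.2 - b p.1) hpρ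
  rw [add_sub_cancel] at h3
  have hrc : (r p.1 : ℂ) ≠ 0 := by exact_mod_cast (hr0 p.1).ne'
  have e2 : ∑ k ∈ Finset.range (m + 1),
      (r p.1 / (p.2 - b p.1)) ^ (m - k) • ((r p.1 : ℂ) ^ (m - k))⁻¹ • A p.1 k
      = ((p.2 - b p.1) ^ m)⁻¹ • ∑ k ∈ Finset.range (m + 1), (p.2 - b p.1) ^ k • A p.1 k := by
    rw [Finset.smul_sum]
    refine Finset.sum_congr rfl fun k hk => ?_
    have hk : k ≤ m := by simpa [Nat.lt_succ_iff] using hk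
    rw [smul_smul, smul_smul]
    congr 1
    rw [div_pow, div_mul_eq_mul_div, mul_inv_cancel₀ (pow_ne_zero _ hrc), pow_sub₀ _ hp hk, one_div,
      mul_inv, inv_inv]
  rw [e2, dist_comm, dist_eq_norm, ← smul_sub, norm_smul, norm_inv, norm_pow,
    inv_mul_le_iff₀ (by have := norm_pos_iff.2 hp; positivity)]
  refine h3.trans (le_of_eq ?_)
  ring

end RescaledLimits

section Cluster
variable {X : Type*} [TopologicalSpace X]

/-- The points at which the graphs of a sequence of maps accumulate over `z`. -/
def Clu (f : ℕ → ℂ → X) (z : ℂ) : Set X :=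
  {x | MapClusterPt x (atTop ×ˢ 𝓝 z) fun p : ℕ × ℂ => f p.1 p.2}

/-- The points over `z` which are limits of points of the graphs of a sequence of maps. -/
def Lo (f : ℕ → ℂ → X) (z : ℂ) : Set X :=
  {x | ∀ V ∈ 𝓝 z, ∀ W ∈ 𝓝 x, ∀ᶠ n in atTop, ∃ u ∈ V, f n u ∈ W}

lemma mem_Clu_iff {f : ℕ → ℂ → X} {z : ℂ} {x : X} : x ∈ Clu f z ↔
    ∃ u : Ultrafilter (ℕ × ℂ), ↑u ≤ (atTop : Filter ℕ) ×ˢ 𝓝 z ∧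
      Tendsto (fun p : ℕ × ℂ => f p.1 p.2) u (𝓝 x) := mapClusterPt_iff_ultrafilter

lemma Clu_comp_subset (f : ℕ → ℂ → X) {s : ℕ → ℕ} (hs : StrictMono s) (z : ℂ) :
    Clu (fun n => f (s n)) z ⊆ Clu f z := by
  intro x hx
  have h : Tendsto (fun p : ℕ × ℂ => (s p.1, p.2)) (atTop ×ˢ 𝓝 z) (atTop ×ˢ 𝓝 z) :=
    hs.tendsto_atTop.prodMap tendsto_id
  exact MapClusterPt.of_comp h hx

lemma Lo_subset_comp (f : ℕ → ℂ → X) {s : ℕ → ℕ} (hs : StrictMono s) (z : ℂ) :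
    Lo f z ⊆ Lo (fun n => f (s n)) z := fun _ hx V hV W hW =>
  hs.tendsto_atTop.eventually (hx V hV W hW)

lemma Lo_reparam_subset (f : ℕ → ℂ → X) {ψ : ℕ → ℂ → ℂ} {z w : ℂ}
    (hψ : Tendsto (fun p : ℕ × ℂ => ψ p.1 p.2) (atTop ×ˢ 𝓝 w) (𝓝 z)) :
    Lo (fun n u => f n (ψ n u)) w ⊆ Lo f z := by
  intro x hx V hV W hW
  obtain ⟨A, hA, B, hB, hAB⟩ := Filter.mem_prod_iff.1 (hψ hV)
  filter_upwards [hx B hB W hW, hA] with n hn hnA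
  obtain ⟨u, hu, hfu⟩ := hn
  exact ⟨ψ n u, hAB (mk_mem_prod hnA hu), hfu⟩

lemma isClosed_Lo (f : ℕ → ℂ → X) (z : ℂ) : IsClosed (Lo f z) := by
  refine isClosed_of_closure_subset fun x hx V hV W hW => ?_
  obtain ⟨W', hW'W, hW', hxW'⟩ := mem_nhds_iff.1 hW
  obtain ⟨y, hyW, hy⟩ := mem_closure_iff.1 hx W' hW' hxW'
  filter_upwards [hy V hV W' (hW'.mem_nhds hyW)] with n hn
  obtain ⟨u, hu, hfu⟩ := hn
  exact ⟨u, hu, hW'W hfu⟩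

lemma mem_Lo_of_tendsto {f : ℕ → ℂ → X} {z : ℂ} {x : X} {u : ℕ → ℂ} (hu : Tendsto u atTop (𝓝 z))
    (h : Tendsto (fun n => f n (u n)) atTop (𝓝 x)) : x ∈ Lo f z := fun V hV W hW => by
  filter_upwards [hu hV, h hW] with n h1 h2 using ⟨u n, h1, h2⟩

end Cluster

end

/-! ### Bubbling -/

section

variable {d : ℕ} {X : Type*} [TopologicalSpace X] [ChartedSpace (Fin d → ℂ) X] {N : ℕ}
  {j : X → Projectivization ℂ (Fin (N + 1) → ℂ)}

lemma exists_leading {E : Type*} [NormedAddCommGroup E] [NormedSpace ℂ E] [CompleteSpace E]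
    {F : ℂ → E} (hF : AnalyticAt ℂ F 0) {m : ℕ}
    (h : ∀ k < m, tc F k = 0) :
    ∃ G : ℂ → E, ContinuousAt G 0 ∧ G 0 = tc F m ∧ ∀ᶠ z in 𝓝 0, F z = z ^ m • G z := by
  obtain ⟨K, hK, hFK⟩ := hF.exists_eventuallyEq_sum_add_pow_mul (m + 1)
  refine ⟨fun z => tc F m + z • K z, by
    have := hK.continuousAt
    fun_prop, by simp, ?_⟩
  filter_upwards [hFK] with z hz
  have e : ∀ k, (z ^ k / (k.factorial : ℂ)) • iteratedDeriv k F 0 = z ^ k • tc F k := fun k => by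
    rw [tc, smul_smul, div_eq_mul_inv]
  simp only [e] at hz
  rw [hz, Finset.sum_range_succ, Finset.sum_eq_zero fun k hk => by
    rw [h k (Finset.mem_range.1 hk), smul_zero]]
  rw [zero_add, smul_add, smul_smul, ← pow_succ]

/-- Attaching trees at finitely many points of a sphere, passing to a subsequence each time. -/
lemma exists_tree_of_children {f g : ℕ → ℂ → X} {β : OnePoint ℂ → X} (hβ : IsHolomorphicSphere d β)
    (S : Finset ℂ)
    (hch : ∀ w ∈ S, ∀ s : ℕ → ℕ, StrictMono s → ∃ (s' : ℕ → ℕ) (T' : RationalTree d X),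
      StrictMono s' ∧ T'.map 0 (T'.inner 0) = β (w : OnePoint ℂ) ∧
      T'.image ⊆ Lo (fun n => f (s (s' n))) 0 ∧
      Clu (fun n u => g (s (s' n)) (w + u)) 0 ⊆ T'.image) :
    ∃ (s : ℕ → ℕ) (T : RationalTree d X), StrictMono s ∧ T.map 0 = β ∧
      T.inner 0 = OnePoint.infty ∧
      (∀ i, T.parent i = 0 → ∃ w ∈ S, T.outer i = (w : OnePoint ℂ)) ∧ range β ⊆ T.image ∧
      T.image ⊆ range β ∪ Lo (fun n => f (s n)) 0 ∧
      ∀ w ∈ S, Clu (fun n u => g (s n) (w + u)) 0 ⊆ T.image := by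
  induction S using Finset.induction_on with
  | empty =>
    refine ⟨id, RationalTree.single β hβ OnePoint.infty, strictMono_id, rfl, rfl,
      fun i => i.elim0, ?_, ?_, by simp⟩
    · rintro _ ⟨w, rfl⟩
      exact ⟨0, w, rfl⟩
    · rintro _ ⟨i, w, rfl⟩
      exact Or.inl ⟨w, rfl⟩
  | insert w₀ S hw₀ ih =>
    obtain ⟨s, T, hs, hT0, hTi, hTo, hTβ, hTL, hTC⟩ :=
      ih fun w hw => hch w (Finset.mem_insert_of_mem hw)
    obtain ⟨s', T', hs', hT'0, hT'L, hT'C⟩ := hch w₀ (Finset.mem_insert_self _ _) s hs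
    obtain ⟨U, hU0, hUi, hUo, hU⟩ := T.exists_graft T' (w₀ : OnePoint ℂ)
      (by rw [hTi]; exact OnePoint.infty_ne_coe w₀)
      (fun i hi => by
        obtain ⟨w, hw, hw'⟩ := hTo i hi
        rw [hw']
        intro h
        exact hw₀ (OnePoint.coe_injective h ▸ hw))
      (by rw [hT0, hT'0])
    refine ⟨fun n => s (s' n), U, hs.comp hs', hU0.trans hT0, hUi.trans hTi, fun i hi => ?_,
      ?_, ?_, ?_⟩
    · rcases hUo i hi with h | ⟨k, hk, h⟩
      · exact ⟨w₀, Finset.mem_insert_self _ _, h⟩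
      · obtain ⟨w, hw, hw'⟩ := hTo k hk
        exact ⟨w, Finset.mem_insert_of_mem hw, h.trans hw'⟩
    · rw [hU]
      exact hTβ.trans subset_union_left
    · rw [hU]
      refine union_subset (hTL.trans (union_subset_union_right _ ?_))
        (hT'L.trans subset_union_right)
      exact Lo_subset_comp (fun n => f (s n)) hs' 0
    · intro w hw
      rw [hU]
      rcases Finset.mem_insert.1 hw with rfl | hw
      · exact hT'C.trans subset_union_right
      · exact ((Clu_comp_subset (fun n u => g (s n) (w + u)) hs' 0).trans (hTC w hw)).trans
          subset_union_left

lemma isHolomorphicSphere_const (x : X) : IsHolomorphicSphere d (fun _ => x) :=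
  ⟨mdifferentiable_const, mdifferentiable_const⟩

/-- A sequence of maps whose homogeneous coordinates converge to a map with a zero of order `m` at the
origin has a subsequence whose graphs accumulate over the origin precisely on a tree of spheres. -/
theorem IsEmbedded.bubble [CompactSpace X] [T2Space X] [IsManifold 𝓘(ℂ, Fin d → ℂ) ω X]
    (hj : IsEmbedded d j) (m : ℕ) : ∀ (f : ℕ → ℂ → X) (H : ℕ → ℂ → Fin (N + 1) → ℂ)
      (F : ℂ → Fin (N + 1) → ℂ) (δ : ℝ), 0 < δ → (∀ n, DifferentiableOn ℂ (H n) (ball 0 δ)) →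
      TendstoLocallyUniformlyOn H F atTop (ball 0 δ) →
      (∀ n, ∀ z ∈ ball (0 : ℂ) δ, Lift j (f n z) (H n z)) →
      (∀ k < m, tc F k = 0) → tc F m ≠ 0 →
      ∃ (s : ℕ → ℕ) (T : RationalTree d X), StrictMono s ∧
        Lift j (T.map 0 (T.inner 0)) (tc F m) ∧ T.image ⊆ Lo (fun n => f (s n)) 0 ∧
        Clu (fun n => f (s n)) 0 ⊆ T.image := by
  induction m using Nat.strong_induction_on with
  | _ m ih =>
  intro f H F δ hδ hd hl hL hF hFm
  have hFd : DifferentiableOn ℂ F (ball 0 δ) :=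
    hl.differentiableOn (Eventually.of_forall hd) isOpen_ball
  have : Nonempty X := ⟨f 0 0⟩
  have hball : ∀ᶠ p : ℕ × ℂ in atTop ×ˢ 𝓝 0, p.2 ∈ ball (0 : ℂ) δ :=
    tendsto_snd.eventually (ball_mem_nhds 0 hδ)
  -- without a zero the maps converge near the origin
  rcases Nat.eq_zero_or_pos m with rfl | hm
  · have hF0 : tc F 0 = F 0 := by simp [tc]
    rw [hF0] at hFm ⊢
    have hlim := tendsto_of_locallyUniformlyOn isOpen_ball hl hFd.continuousOn (mem_ball_self hδ)
    obtain ⟨y, hy, hty⟩ := hj.tendsto (x := fun p : ℕ × ℂ => f p.1 p.2) hlim hFm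
      (hball.mono fun p hp => hL _ _ hp)
    refine ⟨id, .single (fun _ => y) (isHolomorphicSphere_const y) OnePoint.infty, strictMono_id,
      hy, ?_, ?_⟩
    · rintro _ ⟨i, w, rfl⟩
      exact mem_Lo_of_tendsto (u := fun _ => 0) tendsto_const_nhds
        (hty.comp (tendsto_id.prodMk tendsto_const_nhds))
    · intro x hx
      obtain ⟨u, hu, hux⟩ := mem_Clu_iff.1 hx
      exact ⟨0, OnePoint.infty, tendsto_nhds_unique hux (hty.mono_left hu)⟩
  obtain ⟨s₀, b, r, A, q, a, ρ, C, hs₀, hb, hr, hr0, hρ, hC, hqm, hqa, hqa', hqne, hrem, hA⟩ :=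
    exists_rescaling hm hδ hd hl (fun n z hz => (hL n z hz).1) hF hFm
  have hqm0 : q m ≠ 0 := hqm ▸ hFm
  have hunif := fun R : ℝ => rescaled_uniform (H := fun n => H (s₀ n)) hr hr0 hρ hC
    (fun n ζ hζ => (hrem n ζ hζ).2) hA R
  set g : ℕ → ℂ → X := fun n w => f (s₀ n) (b n + r n * w) with hg
  have hgL : ∀ R : ℝ, ∀ᶠ n in atTop, ∀ w : ℂ, ‖w‖ ≤ R → b n + r n * w ∈ ball (0 : ℂ) δ := by
    intro R
    have h1 : Tendsto (fun n => r n * R) atTop (𝓝 0) := by simpa using hr.mul_const R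
    filter_upwards [h1.eventually_lt_const hρ] with n hn w hw
    refine (hrem n _ ?_).1
    rw [norm_mul, Complex.norm_of_nonneg (hr0 n).le]
    exact (mul_le_mul_of_nonneg_left hw (hr0 n).le).trans hn.le
  have hQc := (differentiable_vpoly q m).continuous
  have hQlim : ∀ w, Tendsto (fun p : ℕ × ℂ => ((r p.1 : ℂ) ^ m)⁻¹ • H (s₀ p.1) (b p.1 + r p.1 * p.2))
      (atTop ×ˢ 𝓝 w) (𝓝 (vpoly q m w)) := fun w => by
    have h1 := (hunif (‖w‖ + 1)).tendstoLocallyUniformlyOn.mono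
      ball_subset_closedBall
    exact tendsto_of_locallyUniformlyOn isOpen_ball h1 hQc.continuousOn (by simp)
  have hgw : ∀ w, ∀ᶠ p : ℕ × ℂ in atTop ×ˢ 𝓝 w, Lift j (g p.1 p.2)
      (((r p.1 : ℂ) ^ m)⁻¹ • H (s₀ p.1) (b p.1 + r p.1 * p.2)) := fun w => by
    filter_upwards [tendsto_fst.eventually (hgL (‖w‖ + 1)),
      tendsto_snd.eventually (ball_mem_nhds w one_pos)] with p h1 h2
    refine (hL _ _ (h1 p.2 ?_)).smul (inv_ne_zero (pow_ne_zero _ (by exact_mod_cast (hr0 p.1).ne')))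
    have h2 : dist p.2 w < 1 := h2
    rw [dist_eq_norm] at h2
    have := norm_le_norm_add_norm_sub' p.2 w
    linarith
  -- off the zeros of the limit polynomial the rescaled maps converge
  have hgconv : ∀ w, vpoly q m w ≠ 0 → ∃ y, Lift j y (vpoly q m w) ∧
      Tendsto (fun p : ℕ × ℂ => g p.1 p.2) (atTop ×ˢ 𝓝 w) (𝓝 y) := fun w hw =>
    hj.tendsto (hQlim w) hw (hgw w)
  obtain ⟨β, hβ, hβi, hβw⟩ := hj.exists_sphere hqm0 fun w hw => by
    obtain ⟨y, hy, -⟩ := hgconv w hw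
    exact ⟨y, hy⟩
  have hβQ : ∀ w, vpoly q m w ≠ 0 →
      Tendsto (fun p : ℕ × ℂ => g p.1 p.2) (atTop ×ˢ 𝓝 w) (𝓝 (β (w : OnePoint ℂ))) := by
    intro w hw
    obtain ⟨y, hy, hty⟩ := hgconv w hw
    have := hβw w _ hQc.continuousAt hw
      (Eventually.of_forall fun _ => ⟨1, (one_smul _ _).symm⟩)
    rwa [hy.unique hj.1 this] at hty
  have hψ : ∀ w, Tendsto (fun p : ℕ × ℂ => b p.1 + r p.1 * p.2) (atTop ×ˢ 𝓝 w) (𝓝 0) := by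
    intro w
    have h1 : Tendsto (fun p : ℕ × ℂ => (r p.1 : ℂ)) (atTop ×ˢ 𝓝 w) (𝓝 0) := by
      have := (Complex.continuous_ofReal.tendsto 0).comp hr
      rw [Complex.ofReal_zero] at this
      exact this.comp tendsto_fst
    simpa using (hb.comp tendsto_fst).add (h1.mul tendsto_snd)
  have hfin := finite_vpoly_eq_zero (q := q) le_rfl hqm0
  -- the image of the root component consists of limit points
  have hβL : range β ⊆ Lo (fun n => f (s₀ n)) 0 := by
    have h1 : ∀ w, vpoly q m w ≠ 0 → β (w : OnePoint ℂ) ∈ Lo (fun n => f (s₀ n)) 0 := fun w hw =>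
      mem_Lo_of_tendsto (u := fun n => b n + r n * w)
        ((hψ w).comp (tendsto_id.prodMk tendsto_const_nhds))
        ((hβQ w hw).comp (tendsto_id.prodMk tendsto_const_nhds))
    have hcl := isClosed_Lo (fun n => f (s₀ n)) 0
    rintro _ ⟨p, rfl⟩
    induction p using OnePoint.rec with
    | infty =>
      have hc := (hβ.2 0).continuousAt.tendsto.mono_left (nhdsWithin_le_nhds (s := {0}ᶜ))
      rw [if_pos rfl] at hc
      refine hcl.mem_of_tendsto hc ?_
      have hev : ∀ᶠ w in 𝓝[≠] (0 : ℂ), w⁻¹ ∉ {w | vpoly q m w = 0} :=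
        tendsto_inv₀_nhdsNE_zero.eventually (Bornology.isBounded_def.1 hfin.isBounded)
      filter_upwards [hev, self_mem_nhdsWithin] with w hw hw0
      have hw0 : w ≠ 0 := hw0
      rw [if_neg hw0]
      exact h1 _ hw
    | coe w₀ =>
      refine hcl.mem_of_tendsto ((hβ.1 w₀).continuousAt.tendsto.mono_left
        (nhdsWithin_le_nhds (s := {w₀}ᶜ))) ?_
      filter_upwards [mem_nhdsWithin_of_mem_nhds ((hfin.subset (sdiff_subset
        (t := {w₀}))).isClosed.isOpen_compl.mem_nhds fun h => h.2 rfl),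
        self_mem_nhdsWithin] with w hw hw'
      exact h1 w fun h => hw ⟨h, hw'⟩
  -- the zeros of the limit polynomial have order less than `m`, so the induction hypothesis applies
  obtain ⟨s, T, hs, hT0, hTi, -, hTβ, hTL, hTC⟩ := exists_tree_of_children (d := d)
    (f := fun n => f (s₀ n)) (g := g) hβ hfin.toFinset (by
    intro w₀ hw₀ s hs
    have hw₀ : vpoly q m w₀ = 0 := by simpa using hw₀
    set F' : ℂ → Fin (N + 1) → ℂ := fun u => vpoly q m (w₀ + u) with hF'
    have hF'a : AnalyticAt ℂ F' 0 :=
      ((differentiable_vpoly q m).comp (by fun_prop : Differentiable ℂ fun u : ℂ => w₀ + u)).analyticAt 0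
    set m' := analyticOrderNatAt (vpoly q m) w₀ with hm'
    have hm'e : analyticOrderAt (vpoly q m) w₀ = m' :=
      (Nat.cast_analyticOrderNatAt (analyticOrderAt_vpoly_ne_top le_rfl hqm0 w₀)).symm
    have hm'm : m' < m := by
      have := analyticOrderAt_vpoly_lt hm hqa hqa' hqne w₀
      rw [hm'e] at this
      exact_mod_cast this
    have htc : ∀ k, tc F' k = (k.factorial : ℂ)⁻¹ • iteratedDeriv k (vpoly q m) w₀ := fun k => by
      simp only [tc, hF', iteratedDeriv_comp_const_add, add_zero]
    have hord := ((analyticOrderAt_eq_nat_iff_iteratedDeriv_eq_zero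
      ((differentiable_vpoly q m).analyticAt w₀)).1 hm'e)
    have hF'k : ∀ k < m', tc F' k = 0 := fun k hk => by rw [htc, hord.1 k hk, smul_zero]
    have hF'm : tc F' m' ≠ 0 := by
      rw [htc]
      exact smul_ne_zero (inv_ne_zero (by exact_mod_cast m'.factorial_ne_zero)) hord.2
    obtain ⟨n₀, hn₀⟩ := eventually_atTop.1 (hgL (‖w₀‖ + 1))
    have hsn : ∀ n, n₀ ≤ s (n + n₀) := fun n => (Nat.le_add_left _ _).trans hs.le_apply
    have hmem : ∀ n, ∀ u ∈ ball (0 : ℂ) 1,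
        b (s (n + n₀)) + r (s (n + n₀)) * (w₀ + u) ∈ ball (0 : ℂ) δ := fun n u hu => by
      refine hn₀ _ (hsn n) _ ((norm_add_le _ _).trans ?_)
      rw [mem_ball_zero_iff] at hu
      linarith
    have hts : StrictMono fun n => s (n + n₀) := fun a b hab => hs (by simpa using hab)
    obtain ⟨t, T', ht, hT'0, hT'L, hT'C⟩ := ih m' hm'm (fun n u => g (s (n + n₀)) (w₀ + u))
      (fun n u => ((r (s (n + n₀)) : ℂ) ^ m)⁻¹ • H (s₀ (s (n + n₀)))
        (b (s (n + n₀)) + r (s (n + n₀)) * (w₀ + u))) F' 1 one_pos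
      (fun n => ((hd (s₀ (s (n + n₀)))).comp (f := fun u : ℂ => b (s (n + n₀))
        + r (s (n + n₀)) * (w₀ + u)) (by fun_prop) (hmem n)).const_smul
          ((r (s (n + n₀)) : ℂ) ^ m)⁻¹)
      (by
        have h1 := (hunif (‖w₀‖ + 1)).comp (fun u => w₀ + u)
        have h2 := (h1.mono (s' := ball 0 1) fun u hu => by
          rw [mem_ball_zero_iff] at hu
          rw [mem_preimage, mem_closedBall_zero_iff]
          exact (norm_add_le _ _).trans (by linarith)).tendstoLocallyUniformlyOn
        exact fun v hv x hx => by
          obtain ⟨t, ht, h⟩ := h2 v hv x hx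
          exact ⟨t, ht, hts.tendsto_atTop.eventually h⟩)
      (fun n u hu => (hL _ _ (hmem n u hu)).smul
        (inv_ne_zero (pow_ne_zero _ (by exact_mod_cast (hr0 _).ne'))))
      hF'k hF'm
    have ht' : StrictMono fun n => t n + n₀ := fun a b hab => by simpa using ht hab
    refine ⟨fun n => t n + n₀, T', ht', ?_, ?_, hT'C⟩
    · obtain ⟨G, hGc, hG0, hG⟩ := exists_leading hF'a hF'k
      have e0 : w₀ - w₀ = 0 := sub_self w₀
      have h1 := hβw w₀ (fun u => G (u - w₀))
        (ContinuousAt.comp (g := G) (by rwa [e0]) (by fun_prop)) (by rwa [e0, hG0]) (by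
          have : Tendsto (fun u => u - w₀) (𝓝[≠] w₀) (𝓝 0) := by
            rw [← e0]
            exact ((continuous_id.sub continuous_const).tendsto w₀).mono_left nhdsWithin_le_nhds
          filter_upwards [this.eventually hG] with u hu
          refine ⟨(u - w₀) ^ m', ?_⟩
          rw [← hu, hF']
          simp)
      simp only [e0, hG0] at h1
      exact hT'0.unique hj.1 h1
    · refine hT'L.trans ?_
      refine Lo_reparam_subset (fun n => f (s₀ (s (t n + n₀))))
        (ψ := fun n u => b (s (t n + n₀)) + r (s (t n + n₀)) * (w₀ + u)) ?_
      have h1 : Tendsto (fun p : ℕ × ℂ => (s (t p.1 + n₀), w₀ + p.2)) (atTop ×ˢ 𝓝 0)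
          (atTop ×ˢ 𝓝 w₀) := by
        refine ((hs.comp ht').tendsto_atTop.comp tendsto_fst).prodMk ?_
        have : Tendsto (fun u : ℂ => w₀ + u) (𝓝 0) (𝓝 w₀) := by
          simpa using (tendsto_const_nhds (x := w₀)).add (tendsto_id (x := 𝓝 (0 : ℂ)))
        exact this.comp tendsto_snd
      exact (hψ w₀).comp h1)
  refine ⟨fun n => s₀ (s n), T, hs₀.comp hs, ?_, ?_, ?_⟩
  · rw [hT0, hTi, ← hqm]
    exact hβi
  · refine hTL.trans (union_subset (hβL.trans ?_) le_rfl)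
    exact Lo_subset_comp (fun n => f (s₀ n)) hs 0
  · intro x hx
    obtain ⟨u, hu, hux⟩ := mem_Clu_iff.1 hx
    have hs1 : Tendsto (fun p : ℕ × ℂ => s p.1) (u : Filter (ℕ × ℂ)) atTop :=
      hs.tendsto_atTop.comp (tendsto_fst.mono_left hu)
    set W : ℕ × ℂ → ℂ := fun p => (p.2 - b (s p.1)) / r (s p.1) with hW
    have hWz : ∀ p : ℕ × ℂ, b (s p.1) + r (s p.1) * W p = p.2 := fun p => by
      have : (r (s p.1) : ℂ) ≠ 0 := by exact_mod_cast (hr0 _).ne'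
      rw [hW, mul_div_cancel₀ _ this, add_sub_cancel]
    have hfg : ∀ p : ℕ × ℂ, f (s₀ (s p.1)) p.2 = g (s p.1) (W p) := fun p => by
      simp only [hg, hWz]
    -- an accumulation point lies on the root or on a child, according to the limit of the rescaled
    -- variable; at infinity, on the neck, the maps tend to the value of the root at infinity
    obtain ⟨ω', hω'⟩ : ∃ p : OnePoint ℂ, Tendsto (fun p => (W p : OnePoint ℂ)) u (𝓝 p) := by
      obtain ⟨p, -, hp⟩ := isCompact_univ.ultrafilter_le_nhds
        (u.map fun p => (W p : OnePoint ℂ)) (by simp)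
      exact ⟨p, hp⟩
    induction ω' using OnePoint.rec with
    | infty =>
      have hWi : Tendsto W u (Bornology.cobounded ℂ) := by
        rw [Metric.cobounded_eq_cocompact, ← coclosedCompact_eq_cocompact,
          ← OnePoint.comap_coe_nhds_infty, tendsto_comap_iff]
        exact hω'
      set l : Filter (ℕ × ℂ) := map (fun p : ℕ × ℂ => (s p.1, p.2)) u with hldef
      have hlu : l ≤ atTop ×ˢ 𝓝 0 := hs1.prodMk (tendsto_snd.mono_left hu)
      have hl1 : Tendsto (fun p : ℕ × ℂ => (p.2 - b p.1) / r p.1) l (Bornology.cobounded ℂ) := by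
        rw [hldef, tendsto_map'_iff]
        exact hWi
      have hneck := rescaled_neck (H := fun n => H (s₀ n)) hr0 hρ hb
        (fun n ζ hζ => (hrem n ζ hζ).2) hA hlu hl1
      obtain ⟨y, hy, hty⟩ := hj.tendsto (x := fun p : ℕ × ℂ => f (s₀ p.1) p.2) hneck hqm0 (by
        filter_upwards [hl1.eventually (Bornology.eventually_ne_cobounded 0),
          (tendsto_snd.mono_left hlu).eventually (ball_mem_nhds 0 hδ)] with p hp hp2
        refine (hL _ _ hp2).smul (inv_ne_zero (pow_ne_zero _ fun h => hp ?_))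
        rw [h, zero_div])
      refine hTβ ⟨OnePoint.infty, ?_⟩
      rw [hβi.unique hj.1 hy]
      exact tendsto_nhds_unique (hty.comp tendsto_map) hux
    | coe w =>
      have hWw : Tendsto W u (𝓝 w) := OnePoint.isOpenEmbedding_coe.isInducing.tendsto_nhds_iff.2 hω'
      by_cases hw : vpoly q m w = 0
      · refine hTC w (by simpa using hw) ?_
        have h1 : Tendsto (fun p : ℕ × ℂ => (p.1, W p - w)) u (atTop ×ˢ 𝓝 0) := by
          refine (tendsto_fst.mono_left hu).prodMk ?_
          simpa using hWw.sub_const w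
        refine MapClusterPt.of_comp h1 ?_
        refine Tendsto.mapClusterPt ?_
        refine hux.congr fun p => ?_
        simp [hfg]
      · refine hTβ ⟨(w : OnePoint ℂ), ?_⟩
        have h1 := (hβQ w hw).comp (hs1.prodMk hWw)
        refine tendsto_nhds_unique h1 (hux.congr fun p => ?_)
        simp [hfg]

end

/-! ### Convergence to a disc with bubbles -/

section

lemma Lo_subset_Clu {X : Type*} [TopologicalSpace X] (f : ℕ → ℂ → X) (z : ℂ) : Lo f z ⊆ Clu f z := by
  intro x hx
  refine mapClusterPt_iff_frequently.2 fun W hW => ?_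
  rw [Filter.frequently_iff]
  intro S hS
  obtain ⟨A, hA, B, hB, hAB⟩ := Filter.mem_prod_iff.1 hS
  obtain ⟨n, ⟨u, hu, hfu⟩, hn⟩ := ((hx B hB W hW).and hA).exists
  exact ⟨(n, u), hAB ⟨hn, hu⟩, hfu⟩

/-- Along a subsequence, every accumulation point of the graphs is a limit point. -/
lemma exists_subseq_Clu_subset_Lo {X : Type*} [TopologicalSpace X] [SecondCountableTopology X]
    (f : ℕ → ℂ → X) :
    ∃ s : ℕ → ℕ, StrictMono s ∧ ∀ z, Clu (fun n => f (s n)) z ⊆ Lo (fun n => f (s n)) z := by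
  classical
  have hb := TopologicalSpace.isBasis_countableBasis (ℂ × X)
  have hcount := TopologicalSpace.countable_countableBasis (ℂ × X)
  have hne : (TopologicalSpace.countableBasis (ℂ × X)).Nonempty ∨ IsEmpty (ℂ × X) := by
    by_cases h : Nonempty (ℂ × X)
    · left
      obtain ⟨x⟩ := h
      obtain ⟨v, hv, -⟩ := hb.exists_subset_of_mem_open (mem_univ x) isOpen_univ
      exact ⟨v, hv⟩
    · exact Or.inr (not_nonempty_iff.1 h)
  rcases hne with hne | hne
  swap
  · exact ⟨id, strictMono_id, fun z x => (hne.false (z, x)).elim⟩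
  obtain ⟨B, hB⟩ := hcount.exists_eq_range hne
  -- for every basic open set, along the subsequence the graphs meet it always or never, eventually
  obtain ⟨a, s, hs, ha⟩ := SeqCompactSpace.tendsto_subseq
    fun (n : ℕ) (i : ℕ) => decide (∃ u, (u, f n u) ∈ B i)
  refine ⟨s, hs, fun z x hx V hV W hW => ?_⟩
  obtain ⟨v, hv, hzx, hvVW⟩ := hb.mem_nhds_iff.1 (prod_mem_nhds hV hW)
  rw [hB] at hv
  obtain ⟨i, rfl⟩ := hv
  have hopen : IsOpen (B i) := hb.isOpen (hB ▸ mem_range_self i)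
  have hfr : ∃ᶠ n in atTop, ∃ u, (u, f (s n) u) ∈ B i := by
    obtain ⟨u, hu, hux⟩ := mem_Clu_iff.1 hx
    have h1 : Tendsto (fun p : ℕ × ℂ => (p.2, f (s p.1) p.2)) u (𝓝 (z, x)) :=
      Tendsto.prodMk_nhds (tendsto_snd.mono_left hu) hux
    have h2 := h1.eventually (hopen.mem_nhds hzx)
    have h3 : Tendsto Prod.fst (u : Filter (ℕ × ℂ)) atTop := tendsto_fst.mono_left hu
    exact h3.frequently (h2.mono fun p hp => ⟨p.2, hp⟩).frequently
  have hai := tendsto_pi_nhds.1 ha i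
  have hev : ∀ᶠ n in atTop, decide (∃ u, (u, f (s n) u) ∈ B i) = a i := by
    rw [nhds_discrete, tendsto_pure] at hai
    exact hai
  obtain ⟨n₁, h1, h2⟩ := (hfr.and_eventually hev).exists
  rw [decide_eq_true h1] at h2
  filter_upwards [hev] with n hn
  rw [← h2, decide_eq_true_iff] at hn
  obtain ⟨u, hu⟩ := hn
  exact ⟨u, hvVW hu⟩

variable {d : ℕ} {X : Type*} [TopologicalSpace X] [ChartedSpace (Fin d → ℂ) X] {N : ℕ}
  {j : X → Projectivization ℂ (Fin (N + 1) → ℂ)}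

/-- Homogeneous coordinates of a subsequence of `f` converge on the disc of radius `R`. -/
def HasConvergentLifts (j : X → Projectivization ℂ (Fin (N + 1) → ℂ)) (f : ℕ → ℂ → X) (R : ℝ) :
    Prop :=
  ∃ (s : ℕ → ℕ) (H : ℕ → ℂ → Fin (N + 1) → ℂ) (F : ℂ → Fin (N + 1) → ℂ), StrictMono s ∧
    (∀ n, DifferentiableOn ℂ (H n) (ball 0 R)) ∧ TendstoLocallyUniformlyOn H F atTop (ball 0 R) ∧
    (∀ n, ∀ z ∈ ball (0 : ℂ) R, Lift j (f (s n) z) (H n z)) ∧ F 0 ≠ 0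

/-- The structure of the accumulation set of the graphs over a disc on which the homogeneous
coordinates converge. -/
lemma IsEmbedded.local_structure [CompactSpace X] [T2Space X] [IsManifold 𝓘(ℂ, Fin d → ℂ) ω X]
    (hj : IsEmbedded d j) {f : ℕ → ℂ → X} (hf : ∀ z, Clu f z ⊆ Lo f z) {R : ℝ} (hR : 0 < R)
    (h : HasConvergentLifts j f R) :
    ∃ β : ℂ → X, MDifferentiableOn 𝓘(ℂ) 𝓘(ℂ, Fin d → ℂ) β (ball 0 R) ∧
      (∀ z ∈ ball (0 : ℂ) R, ∀ᶠ w in 𝓝[≠] z, Clu f w = {β w}) ∧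
      ∀ z ∈ ball (0 : ℂ) R, ∃ T : RationalTree d X, T.image = Clu f z ∧
        T.map 0 (T.inner 0) = β z := by
  obtain ⟨s, H, F, hs, hd, hl, hL, hF0⟩ := h
  have : Nonempty X := ⟨f 0 0⟩
  have hFd : DifferentiableOn ℂ F (ball 0 R) :=
    hl.differentiableOn (Eventually.of_forall hd) isOpen_ball
  have hFa : AnalyticOnNhd ℂ F (ball 0 R) := hFd.analyticOnNhd isOpen_ball
  have hfin : ∀ z ∈ ball (0 : ℂ) R, analyticOrderAt F z ≠ ⊤ := fun z hz =>
    hFa.analyticOrderAt_ne_top_of_isPreconnected (convex_ball 0 R).isPreconnected (mem_ball_self hR)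
      hz (by
        rw [(hFa 0 (mem_ball_self hR)).analyticOrderAt_eq_zero.2 hF0]
        exact ENat.zero_ne_top)
  have hconv : ∀ z ∈ ball (0 : ℂ) R, F z ≠ 0 → ∃ y, Lift j y (F z) ∧
      Tendsto (fun p : ℕ × ℂ => f (s p.1) p.2) (atTop ×ˢ 𝓝 z) (𝓝 y) := fun z hz hFz =>
    hj.tendsto (tendsto_of_locallyUniformlyOn isOpen_ball hl hFd.continuousOn hz) hFz
      ((tendsto_snd.eventually (isOpen_ball.mem_nhds hz)).mono fun p hp => hL _ _ hp)
  obtain ⟨β, hβ, hβG⟩ := hj.exists_extension isOpen_ball hFd hfin fun z hz hFz => by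
    obtain ⟨y, hy, -⟩ := hconv z hz hFz
    exact ⟨y, hy⟩
  -- passing to a subsequence does not change the accumulation sets
  have hsub : ∀ t : ℕ → ℕ, StrictMono t → ∀ z, Clu (fun n => f (t n)) z = Clu f z := fun t ht z =>
    (Clu_comp_subset f ht z).antisymm
      (((hf z).trans (Lo_subset_comp f ht z)).trans (Lo_subset_Clu _ z))
  have hne : ∀ z ∈ ball (0 : ℂ) R, F z ≠ 0 → Clu f z = {β z} := by
    intro z hz hFz
    obtain ⟨y, hy, hty⟩ := hconv z hz hFz
    have e : y = β z := hy.unique hj.1 (hβG z hz F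
      (hFd.continuousOn.continuousAt (isOpen_ball.mem_nhds hz)) hFz
      (Eventually.of_forall fun _ => ⟨1, (one_smul _ _).symm⟩))
    rw [← hsub s hs, ← e]
    refine Subset.antisymm (fun x hx => ?_) (singleton_subset_iff.2 hty.mapClusterPt)
    obtain ⟨u, hu, hux⟩ := mem_Clu_iff.1 hx
    exact tendsto_nhds_unique hux (hty.mono_left hu)
  refine ⟨β, hβ, fun z hz => ?_, fun z₀ hz₀ => ?_⟩
  · have h1 := ((hFa z hz).eventually_eq_zero_or_eventually_ne_zero).resolve_left fun h =>
      hfin z hz (analyticOrderAt_eq_top.2 h)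
    filter_upwards [h1, mem_nhdsWithin_of_mem_nhds (isOpen_ball.mem_nhds hz)] with w hw hwR
    exact hne w hwR hw
  · set m := analyticOrderNatAt F z₀ with hm
    have hme : analyticOrderAt F z₀ = m := (Nat.cast_analyticOrderNatAt (hfin z₀ hz₀)).symm
    set F' : ℂ → Fin (N + 1) → ℂ := fun u => F (z₀ + u) with hF'
    have hz₀R : ‖z₀‖ < R := by simpa using hz₀
    have hmaps : MapsTo (fun u => z₀ + u) (ball (0 : ℂ) (R - ‖z₀‖)) (ball 0 R) := fun u hu => by
      rw [mem_ball_zero_iff] at hu ⊢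
      exact (norm_add_le _ _).trans_lt (by linarith)
    have hF'a : AnalyticAt ℂ F' 0 := by
      have h1 : DifferentiableOn ℂ F' (ball 0 (R - ‖z₀‖)) := hFd.comp (by fun_prop) hmaps
      exact h1.analyticAt (isOpen_ball.mem_nhds (mem_ball_self (by linarith)))
    have htc : ∀ k, tc F' k = (k.factorial : ℂ)⁻¹ • iteratedDeriv k F z₀ := fun k => by
      simp only [tc, hF', iteratedDeriv_comp_const_add, add_zero]
    have hord := (analyticOrderAt_eq_nat_iff_iteratedDeriv_eq_zero (hFa z₀ hz₀)).1 hme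
    have hF'k : ∀ k < m, tc F' k = 0 := fun k hk => by rw [htc, hord.1 k hk, smul_zero]
    have hF'm : tc F' m ≠ 0 := by
      rw [htc]
      exact smul_ne_zero (inv_ne_zero (by exact_mod_cast m.factorial_ne_zero)) hord.2
    obtain ⟨t, T, ht, hT0, hTL, hTC⟩ := hj.bubble m (fun n u => f (s n) (z₀ + u))
      (fun n u => H n (z₀ + u)) F' (R - ‖z₀‖) (by linarith)
      (fun n => (hd n).comp (by fun_prop) hmaps) (by
        exact hl.comp (fun u => z₀ + u) hmaps (by fun_prop))
      (fun n u hu => hL n _ (hmaps hu)) hF'k hF'm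
    have hst := hs.comp ht
    have htr : ∀ w : ℂ, Tendsto (fun u => w + u) (𝓝 (z₀ - w)) (𝓝 z₀) := fun w => by
      have := (tendsto_const_nhds (x := w)).add (tendsto_id (x := 𝓝 (z₀ - w)))
      simpa using this
    refine ⟨T, ?_, ?_⟩
    · rw [← hsub _ hst z₀]
      refine Subset.antisymm ?_ ?_
      · refine (hTL.trans (Lo_reparam_subset (fun n => f (s (t n))) (ψ := fun _ u => z₀ + u)
          (z := z₀) ?_)).trans (Lo_subset_Clu _ _)
        have := htr z₀
        rw [sub_self] at this
        exact this.comp tendsto_snd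
      · refine Subset.trans (fun x hx => ?_) hTC
        obtain ⟨u, hu, hux⟩ := mem_Clu_iff.1 hx
        have h1 : Tendsto (fun p : ℕ × ℂ => (p.1, p.2 - z₀)) u (atTop ×ˢ 𝓝 0) := by
          refine (tendsto_fst.mono_left hu).prodMk ?_
          simpa using (tendsto_snd.mono_left hu).sub_const z₀
        refine MapClusterPt.of_comp h1 (Tendsto.mapClusterPt (hux.congr fun p => ?_))
        simp
    · obtain ⟨G, hGc, hG0, hG⟩ := exists_leading hF'a hF'k
      have e0 : z₀ - z₀ = 0 := sub_self z₀
      have h1 := hβG z₀ hz₀ (fun u => G (u - z₀))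
        (ContinuousAt.comp (g := G) (by rwa [e0]) (by fun_prop)) (by rwa [e0, hG0]) (by
          have : Tendsto (fun u => u - z₀) (𝓝[≠] z₀) (𝓝 0) := by
            rw [← e0]
            exact ((continuous_id.sub continuous_const).tendsto z₀).mono_left nhdsWithin_le_nhds
          filter_upwards [this.eventually hG] with u hu
          refine ⟨(u - z₀) ^ m, ?_⟩
          rw [← hu, hF']
          simp)
      simp only [e0, hG0] at h1
      exact hT0.unique hj.1 h1

/-- If homogeneous coordinates converge along subsequences on every smaller disc, some subsequence
converges to a disc with bubbles. -/
theorem IsEmbedded.exists_convergesTo [CompactSpace X] [T2Space X]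
    [IsManifold 𝓘(ℂ, Fin d → ℂ) ω X] (hj : IsEmbedded d j) {f : ℕ → ℂ → X}
    (h : ∀ R ∈ Ioo (0 : ℝ) 1, ∀ s : ℕ → ℕ, StrictMono s →
      HasConvergentLifts j (fun n => f (s n)) R) :
    ∃ (s : ℕ → ℕ) (B : BubbleDisc d X), StrictMono s ∧ ConvergesTo (fun n => f (s n)) B := by
  have : SecondCountableTopology X :=
    ChartedSpace.secondCountable_of_sigmaCompact (Fin d → ℂ) X
  obtain ⟨s, hs, hCL⟩ := exists_subseq_Clu_subset_Lo f
  set g : ℕ → ℂ → X := fun n => f (s n) with hg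
  have : Nonempty (ℂ → X) := ⟨f 0⟩
  choose! β hβ hβΓ hβT using fun (R : ℝ) (hR : R ∈ Ioo (0 : ℝ) 1) =>
    hj.local_structure hCL hR.1 (h R hR s hs)
  -- limits on different discs agree off a discrete set, hence everywhere
  have hagree : ∀ R ∈ Ioo (0 : ℝ) 1, ∀ R' ∈ Ioo (0 : ℝ) 1, ∀ z ∈ ball (0 : ℂ) R,
      z ∈ ball (0 : ℂ) R' → β R z = β R' z := by
    intro R hR R' hR' z hz hz'
    have t1 : Tendsto (β R) (𝓝[≠] z) (𝓝 (β R z)) :=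
      ((hβ R hR).continuousOn.continuousAt (isOpen_ball.mem_nhds hz)).tendsto.mono_left
        nhdsWithin_le_nhds
    have t2 : Tendsto (β R') (𝓝[≠] z) (𝓝 (β R' z)) :=
      ((hβ R' hR').continuousOn.continuousAt (isOpen_ball.mem_nhds hz')).tendsto.mono_left
        nhdsWithin_le_nhds
    refine tendsto_nhds_unique t1 (t2.congr' ?_)
    filter_upwards [hβΓ R hR z hz, hβΓ R' hR' z hz'] with w h1 h2
    exact (singleton_eq_singleton_iff.1 (h1.symm.trans h2)).symm
  let ρ : ℂ → ℝ := fun z => (1 + ‖z‖) / 2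
  have hρ : ∀ z ∈ ball (0 : ℂ) 1, ρ z ∈ Ioo (0 : ℝ) 1 ∧ z ∈ ball (0 : ℂ) (ρ z) := fun z hz => by
    rw [mem_ball_zero_iff] at hz
    have := norm_nonneg z
    refine ⟨⟨?_, ?_⟩, ?_⟩
    · simp only [ρ]; linarith
    · simp only [ρ]; linarith
    · rw [mem_ball_zero_iff]; simp only [ρ]; linarith
  let D : ℂ → X := fun z => β (ρ z) z
  have hD : ∀ R ∈ Ioo (0 : ℝ) 1, ∀ z ∈ ball (0 : ℂ) R, D z = β R z := fun R hR z hz =>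
    hagree _ (hρ z (ball_subset_ball hR.2.le hz)).1 _ hR _ (hρ z (ball_subset_ball hR.2.le hz)).2 hz
  have htree : ∀ z, ∃ T : RationalTree d X, z ∈ ball (0 : ℂ) 1 →
      T.image = Clu g z ∧ T.map 0 (T.inner 0) = D z := by
    intro z
    by_cases hz : z ∈ ball (0 : ℂ) 1
    · obtain ⟨T, hT⟩ := hβT (ρ z) (hρ z hz).1 z (hρ z hz).2
      exact ⟨T, fun _ => hT⟩
    · exact ⟨.single (fun _ => f 0 0) (isHolomorphicSphere_const _) OnePoint.infty,
        fun h => absurd h hz⟩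
  choose T hT using htree
  have hDΓ : ∀ z ∈ ball (0 : ℂ) 1, D z ∈ Clu g z := fun z hz => by
    rw [← (hT z hz).1, ← (hT z hz).2]
    exact ⟨0, _, rfl⟩
  -- the nodes are the points over which the graphs accumulate at more than one point
  let B : BubbleDisc d X :=
    { disc := D
      holomorphic := fun z hz => by
        have h1 := ((hβ _ (hρ z hz).1).mdifferentiableAt
          (isOpen_ball.mem_nhds (hρ z hz).2))
        refine (h1.congr_of_eventuallyEq ?_).mdifferentiableWithinAt
        filter_upwards [isOpen_ball.mem_nhds (hρ z hz).2] with w hw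
        exact hD _ (hρ z hz).1 w hw
      nodes := {z | z ∈ ball (0 : ℂ) 1 ∧ Clu g z ≠ {D z}}
      nodes_subset := fun z hz => hz.1
      locally_finite := fun z hz => by
        have h1 := hβΓ _ (hρ z hz).1 z (hρ z hz).2
        rw [eventually_nhdsWithin_iff] at h1
        refine ⟨_, inter_mem h1 (isOpen_ball.mem_nhds (hρ z hz).2),
          (finite_singleton z).subset ?_⟩
        rintro w ⟨⟨hw1, hw2⟩, hw3⟩
        by_contra hne
        refine hw3.2 ?_
        rw [hw1 hne, hD _ (hρ z hz).1 w hw2]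
      tree := T
      attach := fun z hz => (hT z hz.1).2 }
  have hgraph : B.graph = {p | p.1 ∈ ball (0 : ℂ) 1 ∧ p.2 ∈ Clu g p.1} := by
    ext ⟨z, x⟩
    constructor
    · rintro ⟨hz, h | ⟨-, h⟩⟩
      · exact ⟨hz, by rw [h]; exact hDΓ z hz⟩
      · exact ⟨hz, by rw [← (hT z hz).1]; exact h⟩
    · rintro ⟨hz, hx⟩
      refine ⟨hz, ?_⟩
      by_cases hn : Clu g z = {D z}
      · left
        simp only at hx
        rw [hn] at hx
        exact hx
      · right
        simp only at hx
        rw [← (hT z hz).1] at hx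
        exact ⟨⟨hz, hn⟩, hx⟩
  refine ⟨s, B, hs, ?_, ?_⟩
  · rintro W hW ⟨⟨z, x⟩, hzW, hzx⟩
    rw [hgraph] at hzx
    obtain ⟨V, hV, V', hV', hVV'⟩ := mem_nhds_prod_iff.1 (hW.mem_nhds hzW)
    filter_upwards [hCL z hzx.2 (V ∩ ball 0 1) (inter_mem hV (isOpen_ball.mem_nhds hzx.1)) V' hV']
      with n hn
    obtain ⟨u, hu, hfu⟩ := hn
    exact ⟨(u, g n u), hVV' ⟨hu.1, hfu⟩, hu.2, rfl⟩
  · intro K hK hKD hKg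
    by_contra hcon
    have hne : (atTop ⊓ 𝓟 {n | (K ∩ discGraph (g n)).Nonempty}).NeBot := by
      refine frequently_mem_iff_neBot.1 (Filter.Frequently.mono (not_eventually.1 hcon) fun n hn => ?_)
      exact nonempty_iff_ne_empty.2 hn
    have : Nonempty (ℂ × X) := ⟨(0, f 0 0)⟩
    choose! p hp using fun n (hn : (K ∩ discGraph (g n)).Nonempty) => hn
    set u := Ultrafilter.of (atTop ⊓ 𝓟 {n | (K ∩ discGraph (g n)).Nonempty})
    have hu := Ultrafilter.of_le (atTop ⊓ 𝓟 {n | (K ∩ discGraph (g n)).Nonempty})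
    have hpu : ∀ᶠ n in (u : Filter ℕ), p n ∈ K ∩ discGraph (g n) := by
      have h1 : ∀ᶠ n in (u : Filter ℕ), (K ∩ discGraph (g n)).Nonempty :=
        hu (mem_inf_of_right (mem_principal_self _))
      exact h1.mono hp
    obtain ⟨⟨z, x⟩, hzx, hlim⟩ := hK.ultrafilter_le_nhds (u.map p)
      (le_principal_iff.2 (hpu.mono fun n hn => hn.1))
    have hlim : Tendsto p u (𝓝 (z, x)) := hlim
    have hzg : (z, x) ∈ B.graph := by
      rw [hgraph]
      refine ⟨(hKD hzx).1, ?_⟩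
      have h1 : Tendsto (fun n => (n, (p n).1)) (u : Filter ℕ) (atTop ×ˢ 𝓝 z) :=
        Tendsto.prodMk (hu.trans inf_le_left) ((continuous_fst.tendsto _).comp hlim)
      refine MapClusterPt.of_comp h1 (Tendsto.mapClusterPt ?_)
      refine ((continuous_snd.tendsto _).comp hlim).congr' ?_
      filter_upwards [hpu] with n hn
      exact hn.2.2
    exact (eq_empty_iff_forall_notMem.1 hKg) _ ⟨hzx, hzg⟩

end

/-! ### Sub-mean-value inequalities -/

section

open scoped Real

lemma log_norm_le_circleAverage {B : ℂ → ℂ} {c : ℂ} {s : ℝ} (hs : 0 < s)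
    (hB : AnalyticOnNhd ℂ B (closedBall c s)) (h0 : B c ≠ 0) :
    Real.log ‖B c‖ ≤ Real.circleAverage (fun z => Real.log ‖B z‖) c s := by
  have hB' : AnalyticOnNhd ℂ B (closedBall c |s|) := by rwa [abs_of_pos hs]
  rw [hB'.circleAverage_log_norm hs.ne' h0, le_add_iff_nonneg_left]
  refine finsum_nonneg fun u => ?_
  by_cases hu : u ∈ closedBall c |s|
  · refine mul_nonneg (by exact_mod_cast MeromorphicOn.AnalyticOnNhd.divisor_nonneg hB' u) ?_
    rcases eq_or_ne c u with rfl | hcu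
    · simp
    · have hn : 0 < ‖c - u‖ := norm_pos_iff.2 (sub_ne_zero.2 hcu)
      refine Real.log_nonneg ?_
      rw [← div_eq_mul_inv, one_le_div hn, ← dist_eq_norm, dist_comm]
      rwa [abs_of_pos hs, mem_closedBall] at hu
  · rw [Function.locallyFinsuppWithin.apply_eq_zero_of_notMem _ hu]
    simp

lemma circleIntegrable_of_continuousOn {g : ℂ → ℝ} {ρ s : ℝ} (hg : ContinuousOn g (ball 0 ρ))
    (hs : 0 < s) (hsρ : s < ρ) : CircleIntegrable g 0 s :=
  (hg.mono (sphere_subset_closedBall.trans (closedBall_subset_ball hsρ))).circleIntegrable hs.le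

/-- Integration over a circle of an inequality which holds off the zeros of a holomorphic function
`B` and contains a multiple of `log ‖B‖`. -/
lemma circInt_le_sub_log {w g : ℂ → ℝ} {B : ℂ → ℂ} {ρ s c : ℝ} (hs : 0 < s) (hsρ : s < ρ)
    (hc : 0 ≤ c) (hw : ContinuousOn w (ball 0 ρ)) (hg : ContinuousOn g (ball 0 ρ))
    (hB : AnalyticOnNhd ℂ B (closedBall 0 s)) (h0 : B 0 ≠ 0)
    (hle : ∀ z ∈ sphere (0 : ℂ) s, B z ≠ 0 → w z ≤ g z - c * Real.log ‖B z‖) :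
    circInt w s ≤ circInt g s - 2 * π * (c * Real.log ‖B 0‖) := by
  have hwI := circleIntegrable_of_continuousOn hw hs hsρ
  have hgI := circleIntegrable_of_continuousOn hg hs hsρ
  have hBI : CircleIntegrable (fun z => Real.log ‖B z‖) 0 s :=
    MeromorphicOn.circleIntegrable_log_norm fun z hz =>
      (hB z (by rw [abs_of_pos hs] at hz; exact sphere_subset_closedBall hz)).meromorphicAt
  have hcB : CircleIntegrable (fun z => c * Real.log ‖B z‖) 0 s := by
    simpa [smul_eq_mul] using hBI.const_fun_smul (a := c)
  have hdI : CircleIntegrable (fun z => g z - c * Real.log ‖B z‖) 0 s := hgI.sub hcB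
  have hcod : (fun z => g z - c * Real.log ‖B z‖)
      =ᶠ[codiscreteWithin (sphere (0 : ℂ) |s|)]
        fun z => max (w z) (g z - c * Real.log ‖B z‖) := by
    have h1 := hB.preimage_zero_mem_codiscreteWithin h0 (by simpa using hs.le)
      ((convex_closedBall (0 : ℂ) s).isConnected ⟨0, by simpa using hs.le⟩)
    rw [abs_of_pos hs]
    filter_upwards [Filter.codiscreteWithin_mono sphere_subset_closedBall h1,
      Filter.self_mem_codiscreteWithin (sphere (0 : ℂ) s)] with z hz hzs
    exact (max_eq_right (hle z hzs hz)).symm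
  have hmI := hdI.congr_codiscreteWithin hcod
  have h1 : Real.circleAverage w 0 s ≤ Real.circleAverage (fun z => g z - c * Real.log ‖B z‖) 0 s := by
    rw [Real.circleAverage_congr_codiscreteWithin hcod hs.ne']
    exact Real.circleAverage_mono hwI hmI fun z _ => le_max_left _ _
  rw [Real.circleAverage_fun_sub hgI hcB] at h1
  have h2 : Real.circleAverage (fun z => c * Real.log ‖B z‖) 0 s
      = c * Real.circleAverage (fun z => Real.log ‖B z‖) 0 s := by
    simpa [smul_eq_mul] using Real.circleAverage_fun_smul (a := c) (c := (0 : ℂ)) (R := s)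
      (f := fun z => Real.log ‖B z‖)
  have h3 := mul_le_mul_of_nonneg_left (log_norm_le_circleAverage hs hB h0) hc
  rw [circInt_eq, circInt_eq, ← mul_sub]
  exact mul_le_mul_of_nonneg_left (by linarith) (by positivity)

/-- A holomorphic function is bounded on a smaller disc by the circle means of a majorant of
`log ‖h‖`. -/
lemma norm_le_of_circInt_le {v : ℂ → ℝ} {h : ℂ → ℂ} {R R' M : ℝ} (hR : 0 < R) (hRR' : R < R')
    (hv : ContinuousOn v (ball 0 R')) (hv0 : ∀ z ∈ ball (0 : ℂ) R', 0 ≤ v z)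
    (hh : DifferentiableOn ℂ h (ball 0 R')) (hle : ∀ z ∈ ball (0 : ℂ) R', Real.log ‖h z‖ ≤ v z)
    (hM : ∀ s ∈ Ioo 0 R', circInt v s ≤ M) {z : ℂ} (hz : z ∈ ball (0 : ℂ) R) :
    ‖h z‖ ≤ Real.exp (M * ((R + R') / 2) ^ 2 / (2 * π * ((R' - R) / 2) ^ 2)) := by
  set δ := (R' - R) / 2 with hδdef
  set ρ := (R + R') / 2 with hρdef
  have hδ : 0 < δ := by rw [hδdef]; linarith
  have hρ : 0 < ρ := by rw [hρdef]; linarith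
  have hzR : ‖z‖ < R := by simpa using hz
  by_cases h0 : h z = 0
  · rw [h0, norm_zero]
    exact (Real.exp_pos _).le
  have hmaps : ∀ {ε : ℝ}, ε ≤ 2 * δ → MapsTo (fun w => z + w) (ball (0 : ℂ) ε) (ball 0 R') := by
    intro ε hε w hw
    rw [mem_ball_zero_iff] at hw ⊢
    exact (norm_add_le _ _).trans_lt (by rw [hδdef] at hε; linarith)
  have hvz : ContinuousOn (fun w => v (z + w)) (ball 0 (2 * δ)) :=
    hv.comp (by fun_prop) (hmaps le_rfl)
  have hs : ∀ s ∈ Ioc 0 δ, 2 * π * Real.log ‖h z‖ ≤ circInt (fun w => v (z + w)) s := by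
    intro s hs
    have hsub : ∀ w ∈ closedBall (0 : ℂ) s, w ∈ ball (0 : ℂ) (2 * δ) := fun w hw => by
      rw [mem_closedBall_zero_iff] at hw
      rw [mem_ball_zero_iff]
      linarith [hs.2]
    have hd : DifferentiableOn ℂ (fun w => h (z + w)) (ball 0 (2 * δ)) :=
      hh.comp (by fun_prop) (hmaps le_rfl)
    have han : AnalyticOnNhd ℂ (fun w => h (z + w)) (closedBall 0 s) := fun w hw =>
      hd.analyticAt (isOpen_ball.mem_nhds (hsub w hw))
    have h1 := log_norm_le_circleAverage hs.1 han (by simpa using h0)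
    have h2 : Real.circleAverage (fun w => Real.log ‖h (z + w)‖) 0 s
        ≤ Real.circleAverage (fun w => v (z + w)) 0 s := by
      refine Real.circleAverage_mono (MeromorphicOn.circleIntegrable_log_norm fun w hw =>
        (han w (by rw [abs_of_pos hs.1] at hw; exact sphere_subset_closedBall hw)).meromorphicAt)
        (circleIntegrable_of_continuousOn hvz hs.1 (by linarith [hs.2])) fun w hw => ?_
      rw [abs_of_pos hs.1] at hw
      exact hle _ (hmaps le_rfl (hsub w (sphere_subset_closedBall hw)))
    rw [circInt_eq]
    simp only [add_zero] at h1
    exact mul_le_mul_of_nonneg_left (h1.trans h2) (by positivity)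
  have e1 := integral_ball_eq hvz hδ.le (by linarith)
  have e2 := integral_ball_eq hv hρ.le (show ρ < R' by rw [hρdef]; linarith)
  have hcont1 : ContinuousOn (fun s => s * circInt (fun w => v (z + w)) s) (uIcc 0 δ) :=
    continuousOn_id.mul ((continuousOn_circInt hvz).mono fun s hs => by
      rw [uIcc_of_le hδ.le] at hs
      exact ⟨by linarith [hs.1], by linarith [hs.2]⟩)
  have hcont2 : ContinuousOn (fun s => s * circInt v s) (uIcc 0 ρ) :=
    continuousOn_id.mul ((continuousOn_circInt hv).mono fun s hs => by
      rw [uIcc_of_le hρ.le] at hs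
      exact ⟨by linarith [hs.1], by rw [hρdef] at hs; linarith [hs.2]⟩)
  -- integrate over the radii, and enlarge the disc about `z` to a disc about the origin
  have i1 : 2 * π * Real.log ‖h z‖ * (δ ^ 2 / 2) ≤ ∫ w in ball (0 : ℂ) δ, v (z + w) := by
    rw [e1]
    have e3 : ∫ s in (0 : ℝ)..δ, s * (2 * π * Real.log ‖h z‖)
        = 2 * π * Real.log ‖h z‖ * (δ ^ 2 / 2) := by
      rw [intervalIntegral.integral_mul_const, integral_id]
      ring
    rw [← e3]
    refine intervalIntegral.integral_mono_on hδ.le (Continuous.intervalIntegrable (by fun_prop) _ _)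
      hcont1.intervalIntegrable fun s hs' => ?_
    rcases hs'.1.eq_or_lt with rfl | h0
    · simp
    · exact mul_le_mul_of_nonneg_left (hs s ⟨h0, hs'.2⟩) h0.le
  have i2 : ∫ w in ball (0 : ℂ) δ, v (z + w) ≤ ∫ w in ball (0 : ℂ) ρ, v w := by
    have e4 : ∫ w in ball (0 : ℂ) δ, v (z + w) = ∫ w in ball z δ, v w := by
      have := (measurePreserving_add_left (volume : Measure ℂ) z).setIntegral_preimage_emb
        (measurableEmbedding_addLeft z) v (ball z δ)
      rw [← this]
      congr 2
      ext w
      simp [dist_eq_norm]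
    rw [e4]
    refine setIntegral_mono_set (integrableOn_ball hv (by rw [hρdef]; linarith)) ?_ ?_
    · refine (ae_restrict_iff' measurableSet_ball).2 (Eventually.of_forall fun w hw => ?_)
      exact hv0 w (ball_subset_ball (by rw [hρdef]; linarith) hw)
    · refine LE.le.eventuallyLE fun w hw => ?_
      rw [mem_ball, dist_eq_norm] at hw
      rw [mem_ball_zero_iff]
      have := norm_le_norm_add_norm_sub' w z
      rw [hδdef] at hw
      rw [hρdef]
      linarith
  have i3 : ∫ w in ball (0 : ℂ) ρ, v w ≤ M * (ρ ^ 2 / 2) := by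
    rw [e2]
    have e3 : ∫ s in (0 : ℝ)..ρ, s * M = M * (ρ ^ 2 / 2) := by
      rw [intervalIntegral.integral_mul_const, integral_id]
      ring
    rw [← e3]
    refine intervalIntegral.integral_mono_on hρ.le hcont2.intervalIntegrable
      (Continuous.intervalIntegrable (by fun_prop) _ _) fun s hs' => ?_
    rcases hs'.1.eq_or_lt with rfl | h0
    · simp
    · exact mul_le_mul_of_nonneg_left (hM s ⟨h0, hs'.2.trans_lt (by rw [hρdef]; linarith)⟩) h0.le
  rw [← Real.log_le_iff_le_exp (norm_pos_iff.2 h0), le_div_iff₀ (by positivity)]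
  linarith

/-- Gluing of local extensions of a function defined off a discrete set. -/
lemma exists_punctured_extension {E : Type*} [TopologicalSpace E] [T2Space E] [Nonempty E]
    (p : ℂ → E) :
    ∃ H : ℂ → E, ∀ z₀ : ℂ, ∀ G : ℂ → E, (∀ᶠ z in 𝓝 z₀, ContinuousAt G z) →
      (∀ᶠ z in 𝓝[≠] z₀, p z = G z) → ∀ᶠ z in 𝓝 z₀, H z = G z := by
  refine ⟨fun z => limUnder (𝓝[≠] z) p, fun z₀ G hG hp => ?_⟩
  have h1 : ∀ᶠ z in 𝓝 z₀, ∀ᶠ w in 𝓝[≠] z, p w = G w := by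
    rw [← nhdsNE_sup_pure, eventually_sup]
    refine ⟨?_, by simpa using hp⟩
    rw [eventually_nhdsWithin_iff] at hp
    filter_upwards [mem_nhdsWithin_of_mem_nhds (eventually_eventually_nhds.2 hp),
      self_mem_nhdsWithin] with z hz hz0
    have hz0 : z ≠ z₀ := hz0
    refine Filter.Eventually.filter_mono nhdsWithin_le_nhds ?_
    filter_upwards [hz, isOpen_ne.mem_nhds hz0] with w h1 h2 using h1 h2
  filter_upwards [hG, h1] with z hz hz1
  have : Tendsto p (𝓝[≠] z) (𝓝 (G z)) :=
    (hz.tendsto.mono_left nhdsWithin_le_nhds).congr' (hz1.mono fun w hw => hw.symm)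
  exact this.limUnder_eq

end

/-! ### Normalised homogeneous coordinates of a disc -/

section

open scoped Real

section Sq
variable {N : ℕ}

/-- The Hermitian square norm. -/
def sq (v : Fin (N + 1) → ℂ) : ℝ := ∑ a, ‖v a‖ ^ 2

lemma sq_le (v : Fin (N + 1) → ℂ) (a : Fin (N + 1)) : ‖v a‖ ^ 2 ≤ sq v :=
  Finset.single_le_sum (f := fun a => ‖v a‖ ^ 2) (fun _ _ => by positivity) (Finset.mem_univ a)

lemma sq_pos {v : Fin (N + 1) → ℂ} (hv : v ≠ 0) : 0 < sq v := by
  obtain ⟨a, ha⟩ := Function.ne_iff.1 hv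
  have : 0 < ‖v a‖ := norm_pos_iff.2 ha
  exact (by positivity : 0 < ‖v a‖ ^ 2).trans_le (sq_le v a)

lemma sq_smul (c : ℂ) (v : Fin (N + 1) → ℂ) : sq (c • v) = ‖c‖ ^ 2 * sq v := by
  simp [sq, Finset.mul_sum, mul_pow]

lemma continuous_sq : Continuous (sq : (Fin (N + 1) → ℂ) → ℝ) := by
  unfold sq
  fun_prop

lemma contDiff_sq : ContDiff ℝ ∞ (sq : (Fin (N + 1) → ℂ) → ℝ) := by
  unfold sq
  exact ContDiff.sum fun a _ => (contDiff_apply ℝ ℂ a).norm_sq ℝ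

lemma contDiffOn_log_sq {H : ℂ → Fin (N + 1) → ℂ} {U : Set ℂ} (hU : IsOpen U)
    (hH : DifferentiableOn ℂ H U) (h0 : ∀ z ∈ U, H z ≠ 0) :
    ContDiffOn ℝ 2 (fun z => Real.log (sq (H z))) U := by
  have h1 : ContDiffOn ℂ 2 H U := hH.contDiffOn hU
  exact ((contDiff_sq.of_le (WithTop.coe_le_coe.2 le_top)).comp_contDiffOn
    (h1.restrict_scalars ℝ)).log fun z hz => (sq_pos (h0 z hz)).ne'

end Sq

lemma continuousOn_lap {w : ℂ → ℝ} {U : Set ℂ} (hU : IsOpen U) (hw : ContDiffOn ℝ 2 w U) :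
    ContinuousOn (lap w) U := by
  have h1 : ContDiffOn ℝ 0 (hess w) U :=
    (hw.fderiv_of_isOpen hU (m := 1) (by norm_num)).fderiv_of_isOpen hU (m := 0) (by norm_num)
  have h2 := h1.continuousOn
  unfold lap
  exact ((h2.clm_apply continuousOn_const).clm_apply continuousOn_const).add
    ((h2.clm_apply continuousOn_const).clm_apply continuousOn_const)

/-- The identity principle for a property which, near each point, holds identically or fails off the
point. -/
lemma eventually_nhdsNE_not_of_dichotomy {Z : ℂ → Prop}
    (hdich : ∀ z ∈ ball (0 : ℂ) 1, (∀ᶠ w in 𝓝 z, Z w) ∨ ∀ᶠ w in 𝓝[≠] z, ¬Z w) (h0 : ¬Z 0) :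
    ∀ z ∈ ball (0 : ℂ) 1, ∀ᶠ w in 𝓝[≠] z, ¬Z w := by
  let S : Set ℂ := {z | ∀ᶠ w in 𝓝 z, Z w}
  let S' : Set ℂ := {z | ∀ᶠ w in 𝓝[≠] z, ¬Z w}
  have hSo : IsOpen S := isOpen_iff_eventually.2 fun z hz => eventually_eventually_nhds.2 hz
  have hS'o : IsOpen S' := by
    rw [isOpen_iff_mem_nhds]
    intro z hz
    have h1 : ∀ᶠ w in 𝓝 z, w ∈ S' := by
      rw [← nhdsNE_sup_pure, eventually_sup]
      refine ⟨?_, by simpa using hz⟩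
      have hz' := eventually_nhdsWithin_iff.1 hz
      filter_upwards [mem_nhdsWithin_of_mem_nhds (eventually_eventually_nhds.2 hz'),
        self_mem_nhdsWithin] with w hw hw0
      have hw0 : w ≠ z := hw0
      refine Filter.Eventually.filter_mono nhdsWithin_le_nhds ?_
      filter_upwards [hw, isOpen_ne.mem_nhds hw0] with y h1 h2 using h1 h2
    exact h1
  refine fun z hz => (convex_ball (0 : ℂ) 1).isPreconnected.subset_left_of_subset_union hS'o hSo ?_
    (fun z hz => (hdich z hz).symm) ⟨0, by simp, ?_⟩ hz
  · rw [Set.disjoint_left]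
    intro z h1 h2
    have h1 : ∀ᶠ w in 𝓝[≠] z, ¬Z w := h1
    have h2 : ∀ᶠ w in 𝓝 z, Z w := h2
    obtain ⟨w, hw1, hw2⟩ := (h1.and (h2.filter_mono nhdsWithin_le_nhds)).exists
    exact hw1 hw2
  · exact (hdich 0 (by simp)).resolve_left fun h => h0 h.self_of_nhds

variable {d : ℕ} {X : Type*} [TopologicalSpace X] [ChartedSpace (Fin d → ℂ) X] {N : ℕ}
  {j : X → Projectivization ℂ (Fin (N + 1) → ℂ)}

lemma IsEmbedded.exists_local_lift (hj : IsEmbedded d j) {f : ℂ → X} (hf : IsHolomorphicDisc d f)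
    {z : ℂ} (hz : z ∈ ball (0 : ℂ) 1) :
    ∃ G : ℂ → Fin (N + 1) → ℂ, AnalyticAt ℂ G z ∧ ∀ᶠ w in 𝓝 z, Lift j (f w) (G w) := by
  obtain ⟨U, F, hU, hzU, hF, hFl, -⟩ := hj.2 (f z)
  have hfc : ContinuousOn f (ball 0 1) := hf.continuousOn
  have ho : IsOpen (ball (0 : ℂ) 1 ∩ f ⁻¹' U) := hfc.isOpen_inter_preimage isOpen_ball hU
  have hd : DifferentiableOn ℂ (F ∘ f) (ball (0 : ℂ) 1 ∩ f ⁻¹' U) := by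
    rw [← mdifferentiableOn_iff_differentiableOn]
    exact hF.comp (hf.mono inter_subset_left) inter_subset_right
  refine ⟨F ∘ f, hd.analyticAt (ho.mem_nhds ⟨hz, hzU⟩), ?_⟩
  filter_upwards [ho.mem_nhds ⟨hz, hzU⟩] with w hw using hFl _ hw.2

/-- Homogeneous coordinates on the disc of radius `R`, normalised so that the coordinate `a` is a
Blaschke product. -/
lemma IsEmbedded.exists_global_lift (hj : IsEmbedded d j) {f : ℂ → X} (hf : IsHolomorphicDisc d f)
    {R : ℝ} (hR : 0 < R) (hR1 : R < 1) {a : Fin (N + 1)} {v : Fin (N + 1) → ℂ} (hv : Lift j (f 0) v)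
    (hva : v a ≠ 0) :
    ∃ (B : ℂ → ℂ) (H : ℂ → Fin (N + 1) → ℂ), AnalyticOnNhd ℂ B (closedBall 0 R) ∧
      (∀ z ∈ closedBall (0 : ℂ) R, ‖B z‖ ≤ 1) ∧ (∀ z ∈ sphere (0 : ℂ) R, ‖B z‖ = 1) ∧ B 0 ≠ 0 ∧
      DifferentiableOn ℂ H (ball 0 R) ∧ (∀ z ∈ ball (0 : ℂ) R, Lift j (f z) (H z)) ∧
      ∀ z ∈ ball (0 : ℂ) R, H z a = B z := by
  choose! G hGa hG using fun z (hz : z ∈ ball (0 : ℂ) 1) => hj.exists_local_lift hf hz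
  have hπ : ∀ {K : ℂ → Fin (N + 1) → ℂ} {z}, AnalyticAt ℂ K z → AnalyticAt ℂ (fun w => K w a) z :=
    fun {K z} hK => ((ContinuousLinearMap.proj (R := ℂ) (φ := fun _ : Fin (N + 1) => ℂ)
      a).analyticAt _).comp hK
  -- the coordinate `a` does not vanish identically near any point
  have hne : ∀ z ∈ ball (0 : ℂ) 1, ∀ᶠ w in 𝓝[≠] z, G z w a ≠ 0 := by
    have h := eventually_nhdsNE_not_of_dichotomy (Z := fun w => ∃ v, Lift j (f w) v ∧ v a = 0)
      (fun z hz => ?_) (fun ⟨w, h1, h2⟩ => ?_)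
    · intro z hz
      filter_upwards [h z hz, mem_nhdsWithin_of_mem_nhds (hG z hz)] with w h1 h2 h3
      exact h1 ⟨_, h2, h3⟩
    · rcases (hπ (hGa z hz)).eventually_eq_zero_or_eventually_ne_zero with h | h
      · left
        filter_upwards [h, hG z hz] with w h1 h2 using ⟨_, h2, h1⟩
      · right
        filter_upwards [h, mem_nhdsWithin_of_mem_nhds (hG z hz)] with w h1 h2 ⟨v, h3, h4⟩
        obtain ⟨c, hc, hc'⟩ := h3.exists_smul h2
        rw [hc'] at h1
        simp [h4] at h1
    · obtain ⟨c, hc, hc'⟩ := h1.exists_smul hv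
      rw [hc'] at hva
      simp [h2] at hva
  have hcl : closedBall (0 : ℂ) R ⊆ ball 0 1 := closedBall_subset_ball hR1
  let k : ℂ → ℕ := fun z => analyticOrderNatAt (fun w => G z w a) z
  have hk : ∀ z ∈ ball (0 : ℂ) 1, analyticOrderAt (fun w => G z w a) z = k z := fun z hz => by
    refine (Nat.cast_analyticOrderNatAt fun h => ?_).symm
    obtain ⟨w, h1, h2⟩ := ((hne z hz).and
      ((analyticOrderAt_eq_top.1 h).filter_mono nhdsWithin_le_nhds)).exists
    exact h1 h2
  have hk0 : ∀ z ∈ ball (0 : ℂ) 1, (∃ v, Lift j (f z) v ∧ v a ≠ 0) → k z = 0 := by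
    rintro z hz ⟨v, hv, hva⟩
    obtain ⟨c, hc, hc'⟩ := (hG z hz).self_of_nhds.exists_smul hv
    have : analyticOrderAt (fun w => G z w a) z = 0 := by
      rw [(hπ (hGa z hz)).analyticOrderAt_eq_zero]
      intro h
      rw [hc'] at hva
      simp [h] at hva
    rw [hk z hz] at this
    exact_mod_cast this
  obtain ⟨B, hBa, hB1, hBs, hBk⟩ := exists_blaschke hR k fun z hz => by
    have hz1 := hcl hz
    filter_upwards [hne z hz1, mem_nhdsWithin_of_mem_nhds (hG z hz1),
      mem_nhdsWithin_of_mem_nhds (isOpen_ball.mem_nhds hz1)] with w h1 h2 h3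
    exact hk0 w h3 ⟨_, h2, h1⟩
  -- off the zeros the coordinates are `B • G / G a`
  obtain ⟨H, hH⟩ := exists_punctured_extension fun z => (B z / G z z a) • G z z
  have hloc : ∀ z ∈ ball (0 : ℂ) R, ∃ K : ℂ → Fin (N + 1) → ℂ, AnalyticAt ℂ K z ∧
      (∀ᶠ w in 𝓝 z, H w = K w) ∧ (∀ᶠ w in 𝓝 z, Lift j (f w) (K w)) ∧
      ∀ᶠ w in 𝓝 z, K w a = B w := by
    intro z hz
    have hz1 := hcl (ball_subset_closedBall hz)
    obtain ⟨g, hga, hg0, hg⟩ := ((hπ (hGa z hz1)).analyticOrderAt_eq_natCast).1 (hk z hz1)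
    obtain ⟨b, hba, hb0, hb⟩ :=
      ((hBa z (ball_subset_closedBall hz)).analyticOrderAt_eq_natCast).1 (hBk z hz)
    have hKa : AnalyticAt ℂ (fun w => (b w / g w) • G z w) z :=
      (hba.div hga hg0).smul (hGa z hz1)
    refine ⟨fun w => (b w / g w) • G z w, hKa, ?_, ?_, ?_⟩
    · refine hH z _ (hKa.eventually_analyticAt.mono fun w hw => hw.continuousAt) ?_
      have hGw : ∀ᶠ w in 𝓝 z, w ∈ ball (0 : ℂ) 1 := isOpen_ball.mem_nhds hz1
      filter_upwards [hne z hz1, mem_nhdsWithin_of_mem_nhds (hG z hz1),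
        mem_nhdsWithin_of_mem_nhds hg, mem_nhdsWithin_of_mem_nhds hb,
        mem_nhdsWithin_of_mem_nhds hGw, self_mem_nhdsWithin] with w h1 h2 h3 h4 h5 h6
      obtain ⟨c, hc, hc'⟩ := h2.exists_smul (hG w h5).self_of_nhds
      have h6 : w - z ≠ 0 := sub_ne_zero.2 h6
      have h7 := pow_ne_zero (k z) h6
      have hgw : g w ≠ 0 := fun h => h1 (by rw [h3, h, smul_zero])
      rw [hc', smul_smul, Pi.smul_apply, h3, h4]
      simp only [smul_eq_mul]
      congr 1
      field_simp
    · filter_upwards [hG z hz1, hga.continuousAt.eventually_ne hg0,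
        hba.continuousAt.eventually_ne hb0] with w h1 h2 h3
      exact h1.smul (div_ne_zero h3 h2)
    · filter_upwards [hg, hb, hga.continuousAt.eventually_ne hg0] with w h1 h2 h3
      simp only [Pi.smul_apply, smul_eq_mul]
      rw [h1, h2]
      simp only [smul_eq_mul]
      field_simp
  refine ⟨B, H, hBa, hB1, hBs, ?_, fun z hz => ?_, fun z hz => ?_, fun z hz => ?_⟩
  · have h1 := hBk 0 (mem_ball_self hR)
    rw [hk0 0 (by simp) ⟨v, hv, hva⟩, Nat.cast_zero] at h1
    exact ((hBa 0 (mem_closedBall_self hR.le)).analyticOrderAt_eq_zero).1 h1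
  · obtain ⟨K, hK, hHK, -, -⟩ := hloc z hz
    exact (hK.differentiableAt.congr_of_eventuallyEq hHK).differentiableWithinAt
  · obtain ⟨K, -, hHK, hL, -⟩ := hloc z hz
    rw [hHK.self_of_nhds]
    exact hL.self_of_nhds
  · obtain ⟨K, -, hHK, -, hKa⟩ := hloc z hz
    rw [hHK.self_of_nhds]
    exact hKa.self_of_nhds

end

/-! ### Compactness of discs of bounded energy -/

section

open scoped Real

variable {d : ℕ} {X : Type*} [TopologicalSpace X] [ChartedSpace (Fin d → ℂ) X] {N : ℕ}
  {j : X → Projectivization ℂ (Fin (N + 1) → ℂ)}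

/-- `e` dominates, up to the factor `C`, the pullback of the Fubini–Study form by `f`. -/
def DominatesFubiniStudy (j : X → Projectivization ℂ (Fin (N + 1) → ℂ)) (f : ℂ → X) (e : ℂ → ℝ)
    (C : ℝ) : Prop :=
  ∀ z ∈ ball (0 : ℂ) 1, ∀ G : ℂ → Fin (N + 1) → ℂ, AnalyticAt ℂ G z →
    (∀ᶠ w in 𝓝 z, Lift j (f w) (G w)) → lap (fun w => Real.log (sq (G w))) z ≤ C * e z

/-- Homogeneous coordinates of a disc of bounded energy, bounded on smaller discs and bounded below at
the origin by constants which depend only on the energy and on the position of `f 0`. -/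
lemma IsEmbedded.exists_bounded_lift (hj : IsEmbedded d j) {C M K R' : ℝ} (hC : 0 ≤ C)
    (hR' : 0 < R') (hR'1 : R' < 1) (hK : 0 < K) :
    ∃ (c : ℝ) (Mb : ℝ → ℝ), 0 < c ∧ ∀ (f : ℂ → X) (e : ℂ → ℝ) (a : Fin (N + 1))
      (v : Fin (N + 1) → ℂ), IsHolomorphicDisc d f → ContinuousOn e (ball 0 1) →
      (∀ z ∈ ball (0 : ℂ) 1, 0 ≤ e z) → DominatesFubiniStudy j f e C → nev e R' ≤ M →
      Lift j (f 0) v → v a ≠ 0 → sq v ≤ K * ‖v a‖ ^ 2 →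
      ∃ H : ℂ → Fin (N + 1) → ℂ, DifferentiableOn ℂ H (ball 0 R') ∧
        (∀ z ∈ ball (0 : ℂ) R', Lift j (f z) (H z)) ∧ c ≤ sq (H 0) ∧
        ∀ r, 0 < r → r < R' → ∀ z ∈ ball (0 : ℂ) r, ‖H z‖ ≤ Mb r := by
  set M₁ := C * M with hM₁
  set m₀ := -(2 * Real.log 2) - M₁ / (2 * π) with hm₀
  set M₂ := M₁ / 2 + π * Real.log K + π * (Real.log K - m₀) with hM₂
  refine ⟨Real.exp m₀, fun r => Real.exp (M₂ * ((r + R') / 2) ^ 2 / (2 * π * ((R' - r) / 2) ^ 2)),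
    Real.exp_pos _, fun f e a v hf he he0 hFS hM hv hva hKv => ?_⟩
  obtain ⟨B, H, hBa, hB1, hBs, hB0, hHd, hHL, hHa⟩ := hj.exists_global_lift hf hR' hR'1 hv hva
  have hH0 : ∀ z ∈ ball (0 : ℂ) R', H z ≠ 0 := fun z hz => (hHL z hz).1
  set W : ℂ → ℝ := fun z => Real.log (sq (H z)) with hW
  have hWc : ContDiffOn ℝ 2 W (ball 0 R') := contDiffOn_log_sq isOpen_ball hHd hH0
  have hsub : ball (0 : ℂ) R' ⊆ ball 0 1 := ball_subset_ball hR'1.le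
  -- Green's formula bounds the circle means of `W`
  have hgreen : ∀ r ∈ Ioo 0 R', circInt W r ≤ M₁ + 2 * π * W 0 := by
    intro r hr
    have h1 := green hWc hr.1 hr.2
    have h2 : nev (lap W) r ≤ nev (fun z => C * e z) r := by
      refine nev_mono (continuousOn_lap isOpen_ball hWc)
        (continuousOn_const.mul (he.mono hsub)) (fun z hz => ?_) hr.1.le hr.2
      exact hFS z (hsub hz) H (hHd.analyticAt (isOpen_ball.mem_nhds hz))
        ((isOpen_ball.eventually_mem hz).mono fun w hw => hHL w hw)
    rw [nev_const_mul] at h2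
    have h3 := nev_le_nev he0 he hr.1.le hr.2.le hR'1
    have h4 : C * nev e r ≤ M₁ := mul_le_mul_of_nonneg_left (h3.trans hM) hC
    linarith
  have hWB : ∀ z ∈ ball (0 : ℂ) R', B z ≠ 0 → 2 * Real.log ‖B z‖ ≤ W z := by
    intro z hz hBz
    have h1 := sq_le (H z) a
    rw [hHa z hz] at h1
    have h2 : 0 < ‖B z‖ := norm_pos_iff.2 hBz
    have h3 := Real.log_le_log (by positivity) h1
    rwa [Real.log_pow, Nat.cast_ofNat] at h3
  have h0R : (0 : ℂ) ∈ ball (0 : ℂ) R' := mem_ball_self hR'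
  -- the value at the origin
  have hW0 : W 0 ≤ Real.log K + 2 * Real.log ‖B 0‖ := by
    obtain ⟨c, hc, hc'⟩ := hv.exists_smul (hHL 0 h0R)
    have h1 : B 0 = c * v a := by rw [← hHa 0 h0R, hc']; rfl
    have h2 : sq (H 0) ≤ K * ‖B 0‖ ^ 2 := by
      rw [hc', sq_smul, h1, norm_mul, mul_pow]
      calc ‖c‖ ^ 2 * sq v ≤ ‖c‖ ^ 2 * (K * ‖v a‖ ^ 2) := by gcongr
        _ = _ := by ring
    have h3 : 0 < ‖B 0‖ := norm_pos_iff.2 hB0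
    have h4 := Real.log_le_log (sq_pos (hH0 0 h0R)) h2
    rwa [Real.log_mul hK.ne' (by positivity), Real.log_pow, Nat.cast_ofNat] at h4
  have hB0' : Real.log ‖B 0‖ ≤ 0 :=
    Real.log_nonpos (norm_nonneg _) (hB1 0 (mem_closedBall_self hR'.le))
  have hW0' : m₀ ≤ W 0 := by
    obtain ⟨s₀, hs₀, hs₀'⟩ := eventually_norm_ge_of_norm_eq_one hR'
      (fun z hz => (hBa z (sphere_subset_closedBall hz)).continuousAt) hBs
      (c := 1 / 2) (by norm_num)
    obtain ⟨r, hr1, hr2⟩ := exists_between (max_lt hs₀ hR')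
    have hr0 : 0 < r := (le_max_right _ _).trans_lt hr1
    have hrs : r ∈ Ioo s₀ R' := ⟨(le_max_left _ _).trans_lt hr1, hr2⟩
    have h1 : 2 * π * (-(2 * Real.log 2)) ≤ circInt W r := by
      have h2 : Real.circleAverage (fun _ => -(2 * Real.log 2)) 0 r ≤ Real.circleAverage W 0 r := by
        refine Real.circleAverage_mono (circleIntegrable_of_continuousOn continuousOn_const hr0 hr2)
          (circleIntegrable_of_continuousOn hWc.continuousOn hr0 hr2) fun z hz => ?_
        rw [abs_of_pos hr0] at hz
        have h3 := hs₀' r hrs z hz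
        have hzR : z ∈ ball (0 : ℂ) R' := closedBall_subset_ball hr2 (sphere_subset_closedBall hz)
        have h4 := hWB z hzR (norm_pos_iff.1 (by linarith))
        have h5 := Real.log_le_log (by norm_num) h3.le
        rw [one_div, Real.log_inv] at h5
        linarith
      rw [Real.circleAverage_const] at h2
      rw [circInt_eq]
      exact mul_le_mul_of_nonneg_left h2 (by positivity)
    have h6 := hgreen r ⟨hr0, hr2⟩
    rw [hm₀, sub_le_iff_le_add, ← sub_le_iff_le_add', le_div_iff₀ (by positivity)]
    linarith
  set V : ℂ → ℝ := fun z => max (W z / 2) 0 with hV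
  have hW2c : ContinuousOn (fun z => W z / 2) (ball 0 R') := hWc.continuousOn.div_const 2
  have hVc : ContinuousOn V (ball 0 R') := hW2c.sup continuousOn_const
  have hVint : ∀ s ∈ Ioo 0 R', circInt V s ≤ M₂ := by
    intro s hs
    have h1 := circInt_le_sub_log hs.1 hs.2 zero_le_one hVc hW2c
      (fun z hz => hBa z (closedBall_subset_closedBall hs.2.le hz)) hB0 fun z hz hBz => by
        have hzR : z ∈ ball (0 : ℂ) R' := closedBall_subset_ball hs.2 (sphere_subset_closedBall hz)
        have h2 := hWB z hzR hBz
        have h3 := Real.log_nonpos (norm_nonneg _) (hB1 z (ball_subset_closedBall hzR))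
        refine max_le ?_ ?_ <;> linarith
    have h2 : circInt (fun z => W z / 2) s = circInt W s / 2 := intervalIntegral.integral_div _ _
    have h3 := hgreen s hs
    rw [h2, one_mul] at h1
    have h4 : π * W 0 ≤ π * Real.log K := mul_le_mul_of_nonneg_left (by linarith) Real.pi_pos.le
    have h5 : π * (-(2 * Real.log ‖B 0‖)) ≤ π * (Real.log K - m₀) :=
      mul_le_mul_of_nonneg_left (by linarith) Real.pi_pos.le
    rw [hM₂]
    linarith
  refine ⟨H, hHd, hHL, ?_, fun r hr0 hr z hz => ?_⟩
  · rw [← Real.le_log_iff_exp_le (sq_pos (hH0 0 h0R))]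
    exact hW0'
  · rw [pi_norm_le_iff_of_nonneg (Real.exp_pos _).le]
    intro b
    refine norm_le_of_circInt_le hr0 hr hVc (fun z _ => le_max_right _ _)
      (differentiableOn_pi.1 hHd b) (fun w hw => ?_) hVint hz
    by_cases hb : H w b = 0
    · rw [hb, norm_zero, Real.log_zero]
      exact le_max_right _ _
    · refine le_max_of_le_left ?_
      have h1 : 0 < ‖H w b‖ := norm_pos_iff.2 hb
      have h3 := Real.log_le_log (by positivity) (sq_le (H w) b)
      rw [Real.log_pow, Nat.cast_ofNat] at h3
      change _ ≤ Real.log (sq (H w)) / 2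
      linarith

/-- A sequence of discs of bounded energy on every smaller disc has a subsequence which converges to
a disc with bubbles. -/
theorem IsEmbedded.exists_convergesTo_of_bounded [CompactSpace X] [T2Space X]
    [IsManifold 𝓘(ℂ, Fin d → ℂ) ω X] (hj : IsEmbedded d j) {f : ℕ → ℂ → X}
    (hf : ∀ n, IsHolomorphicDisc d (f n)) {e : ℕ → ℂ → ℝ} {C : ℝ} (hC : 0 ≤ C)
    (he : ∀ n, ContinuousOn (e n) (ball 0 1)) (he0 : ∀ n, ∀ z ∈ ball (0 : ℂ) 1, 0 ≤ e n z)
    (hFS : ∀ n, DominatesFubiniStudy j (f n) (e n) C)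
    (hb : ∀ R ∈ Ioo (0 : ℝ) 1, ∃ M, ∀ n, nev (e n) R ≤ M) :
    ∃ (s : ℕ → ℕ) (B : BubbleDisc d X), StrictMono s ∧ ConvergesTo (fun n => f (s n)) B := by
  have : SecondCountableTopology X := ChartedSpace.secondCountable_of_sigmaCompact (Fin d → ℂ) X
  refine hj.exists_convergesTo fun R hR s hs => ?_
  obtain ⟨R', hRR', hR'1⟩ := exists_between hR.2
  have hR' : 0 < R' := hR.1.trans hRR'
  obtain ⟨M, hM⟩ := hb R' ⟨hR', hR'1⟩
  obtain ⟨x, -, t, ht, hx⟩ := isCompact_univ.isSeqCompact (x := fun n => f (s n) 0)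
    fun n => mem_univ _
  obtain ⟨U, F, hU, hxU, hF, hFl, -⟩ := hj.2 x
  obtain ⟨a, ha⟩ := Function.ne_iff.1 (hFl x hxU).1
  have hFx : ContinuousAt F x := hF.continuousOn.continuousAt (hU.mem_nhds hxU)
  have hFa : ContinuousAt (fun y => F y a) x := continuousAt_pi.1 hFx a
  have ha' : F x a ≠ 0 := ha
  set K := sq (F x) / ‖F x a‖ ^ 2 + 1 with hK
  have hKpos : 0 < K := by
    have := sq_pos (hFl x hxU).1
    positivity
  have hev : ∀ᶠ y in 𝓝 x, y ∈ U ∧ F y a ≠ 0 ∧ sq (F y) ≤ K * ‖F y a‖ ^ 2 := by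
    have h1 : ContinuousAt (fun y => sq (F y) / ‖F y a‖ ^ 2) x :=
      (continuous_sq.continuousAt.comp hFx).div (hFa.norm.pow 2) (by simpa using ha')
    filter_upwards [hU.mem_nhds hxU, hFa.eventually_ne ha',
      h1.eventually (Iio_mem_nhds (lt_add_one _))] with y h2 h3 h4
    refine ⟨h2, h3, ?_⟩
    have : 0 < ‖F y a‖ := norm_pos_iff.2 h3
    exact ((div_lt_iff₀ (by positivity)).1 h4).le
  obtain ⟨n₀, hn₀⟩ := eventually_atTop.1 (hx.eventually hev)
  set σ : ℕ → ℕ := fun n => t (n + n₀) with hσ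
  have hσm : StrictMono σ := fun a b hab => ht (by simpa using hab)
  have hσ' := fun n => hn₀ (n + n₀) (Nat.le_add_left _ _)
  obtain ⟨c, Mb, hc, hbl⟩ := hj.exists_bounded_lift (M := M) hC hR' hR'1 hKpos
  choose H hHd hHL hHc hHb using fun n => hbl (f (s (σ n))) (e (s (σ n))) a (F (f (s (σ n)) 0))
    (hf _) (he _) (he0 _) (hFS _) (hM _) (hFl _ (hσ' n).1) (hσ' n).2.1 (hσ' n).2.2
  obtain ⟨τ, G, hτ, hG⟩ := montel hR' hHd fun r h0 hr => ⟨Mb r, fun n => hHb n r h0 hr⟩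
  have hsub : ball (0 : ℂ) R ⊆ ball 0 R' := ball_subset_ball hRR'.le
  refine ⟨fun n => σ (τ n), fun n => H (τ n), G, hσm.comp hτ, fun n => (hHd _).mono hsub,
    hG.mono hsub, fun n z hz => hHL _ z (hsub hz), fun h0 => ?_⟩
  have h1 := (hG.tendsto_at (mem_ball_self hR'))
  have h2 := (continuous_sq.tendsto (G 0)).comp h1
  have h3 : c ≤ sq (G 0) := ge_of_tendsto' h2 fun n => hHc (τ n)
  rw [h0] at h3
  simp [sq] at h3
  linarith

end

/-! ### The Laplacian along holomorphic curves -/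

section

lemma lap_congr {w w' : ℂ → ℝ} {z : ℂ} (h : w =ᶠ[𝓝 z] w') : lap w z = lap w' z := by
  unfold lap hess
  rw [h.fderiv.fderiv_eq]

lemma lap_eq_levi (w : ℂ → ℝ) (z : ℂ) : lap w z = 4 * (levi w z 1 1).re := by
  rw [levi_apply]
  simp [lap]

section Curve
variable {V : Type*} [NormedAddCommGroup V] [NormedSpace ℝ V] [NormedSpace ℂ V]
  [IsScalarTower ℝ ℂ V]

lemma levi_self_im {u : V → ℝ} {p : V} (hu : ContDiffAt ℝ 2 u p) (v : V) :
    (levi u p v v).im = 0 := by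
  have hs : IsSymmSndFDerivAt ℝ u p := hu.isSymmSndFDerivAt (by simp)
  have : hess u p v (I • v) = hess u p (I • v) v := hs v (I • v)
  rw [levi_apply]
  simp [this]

/-- The Laplacian of a function along a holomorphic curve is given by the Levi form. -/
lemma lap_comp [CompleteSpace V] {u : V → ℝ} {γ : ℂ → V} {z : ℂ} (hu : ContDiffAt ℝ 2 u (γ z))
    (hγ : AnalyticAt ℂ γ z) :
    lap (fun w => u (γ w)) z = 4 * (levi u (γ z) (deriv γ z) (deriv γ z)).re := by
  rw [lap_eq_levi, levi_comp hu hγ.contDiffAt]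
  rfl

end Curve

lemma lap_add {w w' : ℂ → ℝ} {z : ℂ} (hw : ContDiffAt ℝ 2 w z) (hw' : ContDiffAt ℝ 2 w' z) :
    lap (fun y => w y + w' y) z = lap w z + lap w' z := by
  simp only [lap_eq_levi, levi_add hw hw', LinearMap.add_apply, add_re]
  ring

lemma lap_const_mul (c : ℝ) {w : ℂ → ℝ} {z : ℂ} (hw : ContDiffAt ℝ 2 w z) :
    lap (fun y => c * w y) z = c * lap w z := by
  have h1 : fderiv ℝ (fun y => c * w y) =ᶠ[𝓝 z] fun y => c • fderiv ℝ w y := by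
    filter_upwards [hw.eventually (by simp)] with y hy
    exact fderiv_const_mul (hy.differentiableAt (by simp)) c
  have h2 : hess (fun y => c * w y) z = c • hess w z := by
    unfold hess
    rw [h1.fderiv_eq]
    exact fderiv_fun_const_smul ((hw.fderiv_right (m := 1) (by norm_num)).differentiableAt
      (by simp)) c
  simp only [lap, h2, smul_apply, smul_eq_mul]
  ring

lemma lap_const (c : ℝ) (z : ℂ) : lap (fun _ => c) z = 0 := by
  simp [lap_eq_levi, levi_const]

lemma contDiffAt_log_norm_sq {c : ℂ → ℂ} {z : ℂ} (hc : AnalyticAt ℂ c z) (h0 : c z ≠ 0) :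
    ContDiffAt ℝ 2 (fun w => Real.log (‖c w‖ ^ 2)) z :=
  ((hc.contDiffAt.restrict_scalars ℝ).norm_sq ℝ).log (by simpa using h0)

lemma lap_log_norm_sq {c : ℂ → ℂ} {z : ℂ} (hc : AnalyticAt ℂ c z) (h0 : c z ≠ 0) :
    lap (fun w => Real.log (‖c w‖ ^ 2)) z = 0 := by
  have h := hc.harmonicAt_log_norm h0
  have h2 : (fun w => Real.log (‖c w‖ ^ 2)) = fun w => 2 * Real.log ‖c w‖ := by
    funext w
    rw [Real.log_pow, Nat.cast_ofNat]
  rw [h2, lap_const_mul 2 h.1]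
  have h3 := h.2.self_of_nhds
  rw [InnerProductSpace.laplacian_eq_iteratedFDeriv_complexPlane] at h3
  simp only [iteratedFDeriv_two_apply, Matrix.cons_val_zero, Matrix.cons_val_one] at h3
  have h4 : lap (fun w => Real.log ‖c w‖) z = 0 := h3
  rw [h4, mul_zero]

/-- The square norm of the gradient. -/
def gradSq (w : ℂ → ℝ) (z : ℂ) : ℝ := fderiv ℝ w z 1 ^ 2 + fderiv ℝ w z I ^ 2

lemma gradSq_nonneg (w : ℂ → ℝ) (z : ℂ) : 0 ≤ gradSq w z := by unfold gradSq; positivity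

lemma lap_log {w : ℂ → ℝ} {z : ℂ} (hw : ContDiffAt ℝ 2 w z) (h0 : 0 < w z) :
    lap (fun y => Real.log (w y)) z = lap w z / w z - gradSq w z / w z ^ 2 := by
  have hd : DifferentiableAt ℝ w z := hw.differentiableAt (by simp)
  have hdd : DifferentiableAt ℝ (fderiv ℝ w) z :=
    (hw.fderiv_right (m := 1) (by norm_num)).differentiableAt (by simp)
  have h1 : fderiv ℝ (fun y => Real.log (w y)) =ᶠ[𝓝 z] fun y => (w y)⁻¹ • fderiv ℝ w y := by
    filter_upwards [hw.eventually (by simp), hw.continuousAt.eventually (lt_mem_nhds h0)]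
      with y hy hy0
    exact ((hy.differentiableAt (by simp)).hasFDerivAt.log hy0.ne').fderiv
  have h2 : HasFDerivAt (fun y => (w y)⁻¹ • fderiv ℝ w y)
      ((w z)⁻¹ • fderiv ℝ (fderiv ℝ w) z
        + (-(w z ^ 2)⁻¹ • fderiv ℝ w z).smulRight (fderiv ℝ w z)) z := by
    have hi : HasFDerivAt (fun y => (w y)⁻¹) (-(w z ^ 2)⁻¹ • fderiv ℝ w z) z :=
      (hasDerivAt_inv h0.ne').comp_hasFDerivAt z hd.hasFDerivAt
    exact hi.smul hdd.hasFDerivAt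
  unfold lap hess gradSq
  rw [h1.fderiv_eq, h2.fderiv]
  simp only [add_apply, smul_apply, ContinuousLinearMap.smulRight_apply, smul_eq_mul]
  field_simp
  ring

lemma hess_norm_sq (p v w : ℂ) : hess (fun y : ℂ => ‖y‖ ^ 2) p v w = 2 * inner ℝ v w := by
  have h1 : fderiv ℝ (fun y : ℂ => ‖y‖ ^ 2) = fun y => ((2 : ℝ) • innerSL ℝ) y := by
    funext y
    rw [((hasStrictFDerivAt_norm_sq y).hasFDerivAt).fderiv]
    ext
    simp [mul_add]
  unfold hess
  rw [h1, ContinuousLinearMap.fderiv]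
  simp [innerSL_apply_apply ℝ v w]

lemma lap_norm_sq {g : ℂ → ℂ} {z : ℂ} (hg : AnalyticAt ℂ g z) :
    lap (fun w => ‖g w‖ ^ 2) z = 4 * ‖deriv g z‖ ^ 2 := by
  rw [lap_comp (u := fun y : ℂ => ‖y‖ ^ 2) (contDiff_norm_sq ℝ).contDiffAt hg, levi_apply]
  simp only [hess_norm_sq, real_inner_self_eq_norm_sq]
  simp only [smul_eq_mul, norm_mul, norm_I, one_mul, mul_re, add_re, ofReal_re, I_re, I_im,
    ofReal_im]
  norm_num
  ring

lemma lap_sq {N : ℕ} {G : ℂ → Fin (N + 1) → ℂ} {z : ℂ} (hG : AnalyticAt ℂ G z) :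
    lap (fun w => sq (G w)) z = 4 * sq (deriv G z) := by
  have hGa : ∀ a, AnalyticAt ℂ (fun w => G w a) z := fun a =>
    ((ContinuousLinearMap.proj (R := ℂ) (φ := fun _ : Fin (N + 1) => ℂ) a).analyticAt _).comp hG
  have hc : ∀ a, ContDiffAt ℝ 2 (fun w => ‖G w a‖ ^ 2) z := fun a =>
    ((hGa a).contDiffAt.restrict_scalars ℝ).norm_sq ℝ
  have key : ∀ s : Finset (Fin (N + 1)), lap (fun w => ∑ a ∈ s, ‖G w a‖ ^ 2) z
      = ∑ a ∈ s, 4 * ‖deriv G z a‖ ^ 2 := by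
    intro s
    induction s using Finset.induction_on with
    | empty => simpa using lap_const 0 z
    | insert a s ha ih =>
      simp only [Finset.sum_insert ha]
      rw [lap_add (hc a) (ContDiffAt.sum fun a _ => hc a), ih, lap_norm_sq (hGa a),
        deriv_pi fun a => (hGa a).differentiableAt]
  unfold sq
  rw [key, Finset.mul_sum]

lemma lap_log_sq_le {N : ℕ} {G : ℂ → Fin (N + 1) → ℂ} {z : ℂ} (hG : AnalyticAt ℂ G z)
    (h0 : G z ≠ 0) :
    lap (fun w => Real.log (sq (G w))) z ≤ 4 * sq (deriv G z) / sq (G z) := by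
  have hc : ContDiffAt ℝ 2 (fun w => sq (G w)) z :=
    (contDiff_sq.of_le (WithTop.coe_le_coe.2 le_top)).contDiffAt.comp z
      (hG.contDiffAt.restrict_scalars ℝ)
  rw [lap_log hc (sq_pos h0), lap_sq hG]
  have : 0 ≤ gradSq (fun w => sq (G w)) z / sq (G z) ^ 2 :=
    div_nonneg (gradSq_nonneg _ _) (sq_nonneg _)
  linarith

section Del
variable {V W : Type*} [NormedAddCommGroup V] [NormedSpace ℝ V] [NormedSpace ℂ V]
  [NormedAddCommGroup W] [NormedSpace ℝ W] [NormedSpace ℂ W]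

/-- The form `∂u` of type `(1, 0)`. -/
def del (u : V → ℝ) (p v : V) : ℂ :=
  (1 / 2 : ℂ) * ((fderiv ℝ u p v : ℝ) - I * (fderiv ℝ u p (I • v) : ℝ))

lemma del_congr {u u' : V → ℝ} {p : V} (h : u =ᶠ[𝓝 p] u') (v : V) : del u p v = del u' p v := by
  unfold del
  rw [h.fderiv_eq]

lemma del_add {u u' : V → ℝ} {p : V} (hu : DifferentiableAt ℝ u p) (hu' : DifferentiableAt ℝ u' p)
    (v : V) : del (fun q => u q + u' q) p v = del u p v + del u' p v := by
  unfold del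
  rw [fderiv_fun_add hu hu']
  simp only [add_apply]
  push_cast
  ring

variable [IsScalarTower ℝ ℂ V] [IsScalarTower ℝ ℂ W]

lemma del_smul (u : V → ℝ) (p v : V) (c : ℂ) : del u p (c • v) = c * del u p v := by
  have h1 : ∀ w : V, fderiv ℝ u p (I • I • w) = -fderiv ℝ u p w := fun w => by
    rw [smul_smul, I_mul_I, neg_one_smul, map_neg]
  unfold del
  rw [complex_smul_eq c v, smul_add, smul_comm I c.re v, smul_comm I c.im (I • v)]
  simp only [map_add, map_smul, h1, smul_eq_mul]
  conv_rhs => rw [← re_add_im c]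
  push_cast
  ring_nf
  simp only [I_sq]
  ring

lemma del_comp {u : W → ℝ} {τ : V → W} {p : V} (hu : DifferentiableAt ℝ u (τ p))
    (hτ : DifferentiableAt ℂ τ p) (v : V) :
    del (fun q => u (τ q)) p v = del u (τ p) (fderiv ℂ τ p v) := by
  have h := (hu.hasFDerivAt.comp p (hτ.hasFDerivAt.restrictScalars ℝ)).fderiv
  have h' : fderiv ℝ (fun q => u (τ q)) p
      = (fderiv ℝ u (τ p)).comp ((fderiv ℂ τ p).restrictScalars ℝ) := h
  unfold del
  rw [h']
  simp

end Del

lemma del_log_norm_sq {V : Type*} [NormedAddCommGroup V] [NormedSpace ℝ V] [NormedSpace ℂ V]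
    [IsScalarTower ℝ ℂ V] (l : V →L[ℂ] ℂ) {p : V} (hp : l p ≠ 0) (v : V) :
    del (fun q => Real.log (‖l q‖ ^ 2)) p v = l v / l p := by
  have h1 : del (fun y : ℂ => Real.log (‖y‖ ^ 2)) (l p) (l v) = l v / l p := by
    have h2 : HasFDerivAt (fun y : ℂ => Real.log (‖y‖ ^ 2))
        ((‖l p‖ ^ 2)⁻¹ • ((2 : ℕ) • innerSL ℝ (l p))) (l p) :=
      ((hasStrictFDerivAt_norm_sq (l p)).hasFDerivAt).log (by simpa using hp)
    have h3 : conj (l p) ≠ 0 := by simpa using hp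
    unfold del
    rw [h2.fderiv]
    simp only [smul_apply, innerSL_apply_apply, smul_eq_mul, nsmul_eq_mul, Complex.inner]
    have h4 : (((‖l p‖ ^ 2)⁻¹ : ℝ) : ℂ) = (l p * conj (l p))⁻¹ := by
      rw [Complex.mul_conj, Complex.normSq_eq_norm_sq, ofReal_inv]
    push_cast [h4]
    have h5 : ∀ y : ℂ, ((y.re : ℝ) : ℂ) = (y + conj y) / 2 := fun y => by
      rw [Complex.add_conj]; push_cast; ring
    rw [h5, h5]
    simp only [map_mul, conj_I, conj_conj]
    field_simp
    ring_nf
    simp only [I_sq]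
    ring
  rw [← h1]
  have h6 : DifferentiableAt ℝ (fun y : ℂ => Real.log (‖y‖ ^ 2)) (l p) :=
    (((contDiff_norm_sq ℝ (E := ℂ) (n := 1)).contDiffAt).log (by simpa using hp)).differentiableAt
      (by simp)
  have := del_comp (τ := l) h6 l.differentiableAt v
  rwa [l.fderiv] at this

lemma norm_del_sq (w : ℂ → ℝ) (z : ℂ) : 4 * ‖del w z 1‖ ^ 2 = gradSq w z := by
  unfold del gradSq
  rw [norm_mul, mul_pow, ← Complex.normSq_eq_norm_sq (_ - _), Complex.normSq_apply]
  simp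
  ring

end

/-! ### The logarithmic derivative of a disc -/

section

variable {d : ℕ} {X : Type*} [TopologicalSpace X] [ChartedSpace (Fin d → ℂ) X] {ι : Type*}
  {D : ι → Set X}

lemma LogChart.analyticAt_chart (φ : LogChart d D) {f : ℂ → X} (hf : IsHolomorphicDisc d f) {z : ℂ}
    (hz : z ∈ ball (0 : ℂ) 1) (hφ : f z ∈ φ.chart.source) :
    AnalyticAt ℂ (fun w => φ.chart (f w)) z := by
  have hfc : ContinuousOn f (ball 0 1) := hf.continuousOn
  have ho : IsOpen (ball (0 : ℂ) 1 ∩ f ⁻¹' φ.chart.source) :=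
    hfc.isOpen_inter_preimage isOpen_ball φ.chart.open_source
  have hc : MDifferentiableOn 𝓘(ℂ, Fin d → ℂ) 𝓘(ℂ, Fin d → ℂ) φ.chart φ.chart.source :=
    (contMDiffOn_of_mem_maximalAtlas φ.mem_atlas).mdifferentiableOn (by simp)
  have hd : DifferentiableOn ℂ (fun w => φ.chart (f w)) (ball (0 : ℂ) 1 ∩ f ⁻¹' φ.chart.source) := by
    rw [← mdifferentiableOn_iff_differentiableOn]
    exact hc.comp (hf.mono inter_subset_left) inter_subset_right
  exact hd.analyticAt (ho.mem_nhds ⟨hz, hφ⟩)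

lemma IsHolomorphicDisc.continuousAt {f : ℂ → X} (hf : IsHolomorphicDisc d f) {z : ℂ}
    (hz : z ∈ ball (0 : ℂ) 1) : ContinuousAt f z := by
  have hfc : ContinuousOn f (ball 0 1) := MDifferentiableOn.continuousOn hf
  exact hfc.continuousAt (isOpen_ball.mem_nhds hz)

lemma IsHolomorphicDisc.eventually_mem_source {f : ℂ → X} (hf : IsHolomorphicDisc d f) {z : ℂ}
    (hz : z ∈ ball (0 : ℂ) 1) {φ : LogChart d D} (hφ : f z ∈ φ.chart.source) :
    ∀ᶠ w in 𝓝 z, w ∈ ball (0 : ℂ) 1 ∧ f w ∈ φ.chart.source :=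
  (isOpen_ball.eventually_mem hz).and
    ((hf.continuousAt hz).eventually (φ.chart.open_source.eventually_mem hφ))

/-- The disc `f` is holomorphic and avoids `D`. -/
structure IsLogDisc (d : ℕ) {X : Type*} [TopologicalSpace X] [ChartedSpace (Fin d → ℂ) X]
    {ι : Type*} (D : ι → Set X) (f : ℂ → X) : Prop where
  hol : IsHolomorphicDisc d f
  avoids : ∀ z ∈ ball (0 : ℂ) 1, f z ∉ ⋃ i, D i

namespace IsLogDisc
variable {f : ℂ → X} {φ ψ : LogChart d D} {z : ℂ}

lemma analyticAt_lift_snd (hf : IsLogDisc d D f) (hz : z ∈ ball (0 : ℂ) 1) (hφ : f z ∈ φ.chart.source) :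
    AnalyticAt ℂ (fun w => (φ.lift f w).2) z := by
  have h1 := φ.analyticAt_chart hf.hol hz hφ
  rw [analyticAt_pi_iff]
  intro k
  refine AnalyticAt.div ?_ ?_ (φ.weight_ne_zero hφ (hf.avoids z hz) k)
  · exact ((ContinuousLinearMap.proj (R := ℂ) (φ := fun _ : Fin d => ℂ) k).analyticAt _).comp
      h1.deriv
  · exact (φ.contDiff_weight k).contDiffAt.analyticAt.comp h1

lemma analyticAt_lift (hf : IsLogDisc d D f) (hz : z ∈ ball (0 : ℂ) 1) (hφ : f z ∈ φ.chart.source) :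
    AnalyticAt ℂ (φ.lift f) z :=
  (φ.analyticAt_chart hf.hol hz hφ).prod (hf.analyticAt_lift_snd hz hφ)

lemma weight_mul_lift (hf : IsLogDisc d D f) (hz : z ∈ ball (0 : ℂ) 1) (hφ : f z ∈ φ.chart.source) :
    (fun k => φ.weight (φ.lift f z).1 k * (φ.lift f z).2 k) = deriv (fun w => φ.chart (f w)) z := by
  funext k
  exact mul_div_cancel₀ _ (φ.weight_ne_zero hφ (hf.avoids z hz) k)

lemma lift_snd_eq_zero_iff (hf : IsLogDisc d D f) (hz : z ∈ ball (0 : ℂ) 1) (hφ : f z ∈ φ.chart.source) :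
    (φ.lift f z).2 = 0 ↔ deriv (fun w => φ.chart (f w)) z = 0 := by
  constructor
  · intro h
    rw [← hf.weight_mul_lift hz hφ, h]
    funext k
    simp
  · intro h
    funext k
    simp [LogChart.lift, h]

lemma symm_lift (hφ : f z ∈ φ.chart.source) : φ.chart.symm (φ.lift f z).1 = f z :=
  φ.chart.left_inv hφ

lemma deriv_change (hf : IsLogDisc d D f) (hz : z ∈ ball (0 : ℂ) 1) (hφ : f z ∈ φ.chart.source)
    (hψ : f z ∈ ψ.chart.source) :
    deriv (fun w => ψ.chart (f w)) z = fderiv ℂ (fun x => ψ.chart (φ.chart.symm x)) (φ.chart (f z))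
      (deriv (fun w => φ.chart (f w)) z) := by
  have h1 : HasFDerivAt (fun x => ψ.chart (φ.chart.symm x)) _ (φ.chart (f z)) :=
    ((φ.contDiffAt_change ψ (φ.chart.map_source hφ)
      (by rwa [φ.chart.left_inv hφ])).differentiableAt (by simp)).hasFDerivAt
  have h2 := h1.comp_hasDerivAt z (φ.analyticAt_chart hf.hol hz hφ).differentiableAt.hasDerivAt
  rw [← h2.deriv]
  refine EventuallyEq.deriv_eq ?_
  filter_upwards [hf.hol.eventually_mem_source hz hφ] with w hw
  simp only [Function.comp, φ.chart.left_inv hw.2]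

lemma transition_lift (hf : IsLogDisc d D f) (hz : z ∈ ball (0 : ℂ) 1) (hφ : f z ∈ φ.chart.source)
    (hψ : f z ∈ ψ.chart.source) : φ.transition ψ (φ.lift f z) = ψ.lift f z := by
  unfold LogChart.transition
  rw [hf.weight_mul_lift hz hφ, symm_lift hφ]
  refine Prod.ext rfl ?_
  funext k
  change (fderiv ℂ (fun x => ψ.chart (φ.chart.symm x)) (φ.chart (f z))
    (deriv (fun w => φ.chart (f w)) z)) k / _ = _
  rw [← hf.deriv_change hz hφ hψ]
  rfl

lemma lift_mem_dom (hφ : f z ∈ φ.chart.source) (h0 : (φ.lift f z).2 ≠ 0) : φ.lift f z ∈ φ.dom :=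
  ⟨φ.chart.map_source hφ, h0⟩

lemma lift_mem_overlap (hf : IsLogDisc d D f) (hz : z ∈ ball (0 : ℂ) 1) (hφ : f z ∈ φ.chart.source)
    (hψ : f z ∈ ψ.chart.source) (h0 : (φ.lift f z).2 ≠ 0) : φ.lift f z ∈ φ.overlap ψ :=
  ⟨lift_mem_dom hφ h0, by rwa [symm_lift hφ], by rw [symm_lift hφ]; exact hf.avoids z hz⟩

lemma lift_snd_ne_zero_of (hf : IsLogDisc d D f) (hz : z ∈ ball (0 : ℂ) 1) (hφ : f z ∈ φ.chart.source)
    (hψ : f z ∈ ψ.chart.source) (h0 : (φ.lift f z).2 ≠ 0) : (ψ.lift f z).2 ≠ 0 := by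
  rw [← hf.transition_lift hz hφ hψ]
  exact (φ.transition_mem_dom ψ (hf.lift_mem_overlap hz hφ hψ h0)).2

lemma deriv_lift_change (hf : IsLogDisc d D f) (hz : z ∈ ball (0 : ℂ) 1) (hφ : f z ∈ φ.chart.source)
    (hψ : f z ∈ ψ.chart.source) (h0 : (φ.lift f z).2 ≠ 0) :
    deriv (ψ.lift f) z = fderiv ℂ (φ.transition ψ) (φ.lift f z) (deriv (φ.lift f) z) := by
  have h1 := ((φ.contDiffAt_transition ψ (hf.lift_mem_overlap hz hφ hψ h0)).differentiableAt
    (by simp)).hasFDerivAt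
  have h2 := h1.comp_hasDerivAt z (hf.analyticAt_lift hz hφ).differentiableAt.hasDerivAt
  rw [← h2.deriv]
  refine EventuallyEq.deriv_eq ?_
  filter_upwards [hf.hol.eventually_mem_source hz hφ, hf.hol.eventually_mem_source hz hψ]
    with w hw hw'
  exact (hf.transition_lift hw.1 hw.2 hw'.2).symm

/-- The density of the pullback of a form may be computed in every logarithmic chart. -/
lemma pullbackDensity_eq (hf : IsLogDisc d D f) (h : logForms d D) (hz : z ∈ ball (0 : ℂ) 1) (hφ : f z ∈ φ.chart.source)
    (h0 : (φ.lift f z).2 ≠ 0) : pullbackDensity h f z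
      = 2 * h.1 φ (φ.lift f z) (deriv (φ.lift f) z) (deriv (φ.lift f) z) := by
  have hex : ∃ φ : LogChart d D, f z ∈ φ.chart.source := ⟨φ, hφ⟩
  unfold pullbackDensity
  rw [dif_pos hex, if_neg (hf.lift_snd_ne_zero_of hz hφ hex.choose_spec h0)]
  have h4 := h.2.2.2.2 φ hex.choose (φ.lift f z) (hf.lift_mem_overlap hz hφ hex.choose_spec h0)
    (deriv (φ.lift f) z) (deriv (φ.lift f) z)
  rw [hf.transition_lift hz hφ hex.choose_spec,
    ← hf.deriv_lift_change hz hφ hex.choose_spec h0] at h4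
  rw [h4]

lemma pullbackDensity_eq_zero (hf : IsLogDisc d D f) (h : logForms d D) (hz : z ∈ ball (0 : ℂ) 1)
    (hφ : f z ∈ φ.chart.source) (h0 : (φ.lift f z).2 = 0) : pullbackDensity h f z = 0 := by
  have hex : ∃ φ : LogChart d D, f z ∈ φ.chart.source := ⟨φ, hφ⟩
  unfold pullbackDensity
  rw [dif_pos hex, if_pos]
  by_contra h1
  exact hf.lift_snd_ne_zero_of hz hex.choose_spec hφ h1 h0

lemma norm_lift_eq (hf : IsLogDisc d D f) (ρ : LogMetric d D) (hz : z ∈ ball (0 : ℂ) 1) (hφ : f z ∈ φ.chart.source)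
    (hψ : f z ∈ ψ.chart.source) : ρ.norm ψ (ψ.lift f z) = ρ.norm φ (φ.lift f z) := by
  by_cases h0 : (φ.lift f z).2 = 0
  · have h1 : (ψ.lift f z).2 = 0 := by
      by_contra h1
      exact hf.lift_snd_ne_zero_of hz hψ hφ h1 h0
    have key : ∀ χ : LogChart d D, f z ∈ χ.chart.source → (χ.lift f z).2 = 0 →
        ρ.norm χ (χ.lift f z) = 0 := by
      intro χ hχ h
      have := ρ.norm_smul χ (χ.lift f z).1 (χ.chart.map_source hχ) 0 0
      rw [smul_zero, norm_zero, zero_mul, ← h] at this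
      exact this
    rw [key φ hφ h0, key ψ hψ h1]
  · rw [← hf.transition_lift hz hφ hψ]
    exact ρ.compat φ ψ _ (hf.lift_mem_overlap hz hφ hψ h0)

end IsLogDisc

end

/-! ### The density of the pullback of a form -/

section

lemma continuousOn_sesquilinear {V Y : Type*} [NormedAddCommGroup V] [NormedSpace ℂ V]
    [FiniteDimensional ℂ V] [TopologicalSpace Y] {A : Y → (V →ₗ[ℂ] V →ₗ⋆[ℂ] ℂ)} {s : Set Y}
    (hA : ∀ v w, ContinuousOn (fun p => A p v w) s) :
    ContinuousOn (fun q : Y × V × V => A q.1 q.2.1 q.2.2) (s ×ˢ univ) := by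
  let b := Module.finBasis ℂ V
  have hb : ∀ i, Continuous fun v : V => b.repr v i := fun i =>
    (LinearMap.continuous_of_finiteDimensional (b.coord i) :)
  have key : ∀ q : Y × V × V, A q.1 q.2.1 q.2.2
      = ∑ i, ∑ k, b.repr q.2.1 i * (conj (b.repr q.2.2 k) * A q.1 (b i) (b k)) := by
    intro q
    conv_lhs => rw [← b.sum_repr q.2.1, ← b.sum_repr q.2.2]
    simp only [map_sum, map_smul, LinearMap.map_smulₛₗ, LinearMap.sum_apply, LinearMap.smul_apply,
      smul_eq_mul, Finset.mul_sum]
    rw [Finset.sum_comm]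
    refine Finset.sum_congr rfl fun i _ => Finset.sum_congr rfl fun k _ => ?_
    ring
  simp only [key]
  refine continuousOn_finsetSum _ fun i _ => continuousOn_finsetSum _ fun k _ => ?_
  refine ContinuousOn.mul ((hb i).comp (by fun_prop)).continuousOn (ContinuousOn.mul ?_ ?_)
  · exact (Complex.continuous_conj.comp ((hb k).comp (by fun_prop))).continuousOn
  · exact (hA _ _).comp continuous_fst.continuousOn fun q hq => hq.1

variable {d : ℕ} {X : Type*} [TopologicalSpace X] [ChartedSpace (Fin d → ℂ) X] {ι : Type*}
  {D : ι → Set X}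

lemma continuousOn_logForm (h : logForms d D) (φ : LogChart d D) :
    ContinuousOn (fun q : Cpair d × Cpair d × Cpair d => h.1 φ q.1 q.2.1 q.2.2)
      (φ.dom ×ˢ univ) :=
  continuousOn_sesquilinear fun v w => (h.2.1 φ v w).continuousOn

lemma continuousAt_logForm (h : logForms d D) (φ : LogChart d D) {p v : ℂ → Cpair d} {z : ℂ}
    (hp : ContinuousAt p z) (hv : ContinuousAt v z) (hz : p z ∈ φ.dom) :
    ContinuousAt (fun z => h.1 φ (p z) (v z) (v z)) z := by
  have h1 := (continuousOn_logForm h φ).continuousAt (x := (p z, v z, v z))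
    ((φ.isOpen_dom.prod isOpen_univ).mem_nhds ⟨hz, mem_univ _⟩)
  exact ContinuousAt.comp (f := fun z => (p z, v z, v z)) h1 (hp.prodMk (hv.prodMk hv))

lemma logForm_add_euler (h : logForms d D) (φ : LogChart d D) {p : Cpair d} (hp : p ∈ φ.dom)
    (v : Cpair d) (c : ℂ) : h.1 φ p (v + (0, c • p.2)) (v + (0, c • p.2)) = h.1 φ p v v := by
  have h1 : ((0, c • p.2) : Cpair d) = c • (0, p.2) := by simp
  have h2 := fun w => h.2.2.1 φ p hp w
  rw [h1]
  simp only [map_add, LinearMap.add_apply, map_smul, LinearMap.map_smulₛₗ, LinearMap.smul_apply,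
    (h2 _).1, (h2 _).2, smul_zero, add_zero]

/-- At a zero of order `m` of the lift, the form can be evaluated on the lift divided by `z ^ m`. -/
lemma logForm_smul_curve (h : logForms d D) (φ : LogChart d D) {x a : ℂ → Fin d → ℂ} {c : ℂ → ℂ}
    {z : ℂ} (hx : DifferentiableAt ℂ x z) (ha : DifferentiableAt ℂ a z)
    (hc : DifferentiableAt ℂ c z) (hz : (x z, a z) ∈ φ.dom) (h0 : c z ≠ 0) :
    h.1 φ (x z, c z • a z) (deriv (fun w => (x w, c w • a w)) z)
        (deriv (fun w => (x w, c w • a w)) z)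
      = h.1 φ (x z, a z) (deriv (fun w => (x w, a w)) z) (deriv (fun w => (x w, a w)) z) := by
  have e1 : deriv (fun w => (x w, a w)) z = (deriv x z, deriv a z) :=
    (hx.hasDerivAt.prodMk ha.hasDerivAt).deriv
  have e2 : deriv (fun w => (x w, c w • a w)) z
      = (deriv x z, c z • (deriv a z + (deriv c z / c z) • a z)) := by
    rw [(hx.hasDerivAt.prodMk (hc.hasDerivAt.fun_smul ha.hasDerivAt)).deriv]
    congr 1
    rw [smul_add, smul_smul, mul_div_cancel₀ _ h0]
  rw [e1, e2, h.2.2.2.1 φ (x z, a z) hz (c z) h0 (deriv x z, deriv a z + (deriv c z / c z) • a z)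
    (deriv x z, deriv a z + (deriv c z / c z) • a z)]
  have := logForm_add_euler h φ hz (deriv x z, deriv a z) (deriv c z / c z)
  simpa using this

/-- The logarithmic derivative of a disc either vanishes near a point, or is there a power of the
coordinate times a nonvanishing lift. -/
lemma IsLogDisc.lift_dichotomy {f : ℂ → X} (hf : IsLogDisc d D f) {φ : LogChart d D} {z : ℂ}
    (hz : z ∈ ball (0 : ℂ) 1) (hφ : f z ∈ φ.chart.source) :
    (∀ᶠ w in 𝓝 z, (φ.lift f w).2 = 0) ∨ ∃ (m : ℕ) (a : ℂ → Fin d → ℂ), AnalyticAt ℂ a z ∧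
      a z ≠ 0 ∧ analyticOrderAt (fun w => (φ.lift f w).2) z = m ∧
      ∀ᶠ w in 𝓝 z, (φ.lift f w).2 = (w - z) ^ m • a w := by
  have h1 := hf.analyticAt_lift_snd hz hφ
  by_cases h : analyticOrderAt (fun w => (φ.lift f w).2) z = ⊤
  · exact Or.inl (analyticOrderAt_eq_top.1 h)
  · right
    obtain ⟨m, hm⟩ := ENat.ne_top_iff_exists.1 h
    obtain ⟨a, ha, ha0, hae⟩ := (h1.analyticOrderAt_eq_natCast).1 hm.symm
    exact ⟨m, a, ha, ha0, hm.symm, hae⟩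

lemma ae_ball_of_eventually_nhdsNE {p : ℂ → Prop} {ρ : ℝ}
    (h : ∀ z ∈ ball (0 : ℂ) ρ, ∀ᶠ w in 𝓝[≠] z, p w) : ∀ᵐ z, z ∈ ball (0 : ℂ) ρ → p z := by
  rw [← ae_restrict_iff' measurableSet_ball]
  refine ae_restrict_le_codiscreteWithin measurableSet_ball ?_
  rw [mem_codiscreteWithin]
  intro z hz
  rw [Filter.disjoint_principal_right]
  filter_upwards [h z hz] with w hw hw'
  exact hw'.2 hw

/-- The density of the pullback of a form extends continuously over the zeros of the logarithmic
derivative. -/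
lemma IsLogDisc.exists_continuous_density (hD : IsSNC d D) (h : logForms d D) {f : ℂ → X}
    (hf : IsLogDisc d D f) :
    ∃ g : ℂ → ℂ, ContinuousOn g (ball 0 1) ∧
      (∀ z ∈ ball (0 : ℂ) 1, ∀ᶠ w in 𝓝[≠] z, pullbackDensity h f w = g w) ∧
      ∀ z ∈ ball (0 : ℂ) 1, ∀ φ : LogChart d D, f z ∈ φ.chart.source → (φ.lift f z).2 ≠ 0 →
        g z = 2 * h.1 φ (φ.lift f z) (deriv (φ.lift f) z) (deriv (φ.lift f) z) := by
  obtain ⟨g, hg⟩ := exists_punctured_extension (pullbackDensity h f)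
  have hloc : ∀ z ∈ ball (0 : ℂ) 1, ∃ G : ℂ → ℂ, (∀ᶠ w in 𝓝 z, ContinuousAt G w) ∧
      ∀ᶠ w in 𝓝[≠] z, pullbackDensity h f w = G w := by
    intro z hz
    obtain ⟨φ, hφ⟩ := hD (f z)
    have hev := hf.hol.eventually_mem_source hz hφ
    rcases hf.lift_dichotomy hz hφ with h0 | ⟨m, a, ha, ha0, -, hae⟩
    · refine ⟨fun _ => 0, .of_forall fun w => continuousAt_const, ?_⟩
      filter_upwards [mem_nhdsWithin_of_mem_nhds h0, mem_nhdsWithin_of_mem_nhds hev] with w h1 h2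
      exact hf.pullbackDensity_eq_zero h h2.1 h2.2 h1
    · let p : ℂ → Cpair d := fun w => (φ.chart (f w), a w)
      have hx := φ.analyticAt_chart hf.hol hz hφ
      have hp : AnalyticAt ℂ p z := hx.prod ha
      have hne : ∀ᶠ w in 𝓝 z, a w ≠ 0 := ha.continuousAt.eventually_ne ha0
      refine ⟨fun w => 2 * h.1 φ (p w) (deriv p w) (deriv p w), ?_, ?_⟩
      · filter_upwards [hp.eventually_analyticAt, hev, hne] with w h1 h2 h3
        exact continuousAt_const.mul (continuousAt_logForm h φ h1.continuousAt
          h1.deriv.continuousAt ⟨φ.chart.map_source h2.2, h3⟩)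
      · filter_upwards [mem_nhdsWithin_of_mem_nhds (eventually_eventually_nhds.2 hae),
          mem_nhdsWithin_of_mem_nhds hev, mem_nhdsWithin_of_mem_nhds hne,
          mem_nhdsWithin_of_mem_nhds hx.eventually_analyticAt,
          mem_nhdsWithin_of_mem_nhds ha.eventually_analyticAt, self_mem_nhdsWithin]
          with w h1 h2 h3 h4 h5 h6
        have h6 : (w - z) ^ m ≠ 0 := pow_ne_zero m (sub_ne_zero.2 h6)
        have e : φ.lift f =ᶠ[𝓝 w] fun y => (φ.chart (f y), (y - z) ^ m • a y) := by
          filter_upwards [h1] with y hy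
          exact Prod.ext rfl hy
        rw [hf.pullbackDensity_eq h h2.1 h2.2 (by
          rw [h1.self_of_nhds]; exact smul_ne_zero h6 h3), e.deriv_eq, e.self_of_nhds]
        exact congrArg (2 * ·) (logForm_smul_curve h φ (c := fun y => (y - z) ^ m)
          h4.differentiableAt h5.differentiableAt (by fun_prop) ⟨φ.chart.map_source h2.2, h3⟩ h6)
  refine ⟨g, fun z hz => ?_, fun z hz => ?_, fun z hz φ hφ h0 => ?_⟩
  · obtain ⟨G, h1, h2⟩ := hloc z hz
    exact (h1.self_of_nhds.congr ((hg z G h1 h2).mono fun w hw => hw.symm)).continuousWithinAt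
  · obtain ⟨G, h1, h2⟩ := hloc z hz
    filter_upwards [h2, mem_nhdsWithin_of_mem_nhds (hg z G h1 h2)] with w h3 h4
    rw [h3, h4]
  · have hl := hf.analyticAt_lift hz hφ
    have hev : ∀ᶠ w in 𝓝 z, (φ.lift f w).2 ≠ 0 :=
      (hf.analyticAt_lift_snd hz hφ).continuousAt.eventually_ne h0
    refine (hg z (fun w => 2 * h.1 φ (φ.lift f w) (deriv (φ.lift f) w) (deriv (φ.lift f) w))
      ?_ ?_).self_of_nhds
    · filter_upwards [hl.eventually_analyticAt, hf.hol.eventually_mem_source hz hφ, hev]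
        with w h1 h2 h3
      exact continuousAt_const.mul (continuousAt_logForm h φ h1.continuousAt
          h1.deriv.continuousAt (lift_mem_dom h2.2 h3))
    · filter_upwards [mem_nhdsWithin_of_mem_nhds (hf.hol.eventually_mem_source hz hφ),
        mem_nhdsWithin_of_mem_nhds hev] with w h2 h3
      exact hf.pullbackDensity_eq h h2.1 h2.2 h3

lemma discCurrent_eq {h : logForms d D} {f : ℂ → X} {g : ℂ → ℝ} {r : ℝ} (h0 : 0 ≤ r)
    (hg : ∀ᵐ z, z ∈ ball (0 : ℂ) r → pullbackDensity h f z = g z) :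
    discCurrent f r h = (nev g r : ℂ) := by
  unfold discCurrent nev
  rw [← intervalIntegral.integral_ofReal]
  refine intervalIntegral.integral_congr fun t ht => ?_
  rw [uIcc_of_le h0] at ht
  have h1 : ∫ z in ball (0 : ℂ) t, pullbackDensity h f z = ∫ z in ball (0 : ℂ) t, (g z : ℂ) := by
    refine setIntegral_congr_ae measurableSet_ball ?_
    filter_upwards [hg] with z hz hzt
    exact hz (ball_subset_ball ht.2 hzt)
  have h2 : ∫ z in ball (0 : ℂ) t, (g z : ℂ) = ((∫ z in ball (0 : ℂ) t, g z : ℝ) : ℂ) :=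
    integral_ofReal
  simp only [h1, h2]
  push_cast
  rfl

/-- The density of the pullback of a positive form. -/
lemma IsLogDisc.exists_energy (hD : IsSNC d D) {η : logForms d D} (hη : IsPositiveForm η)
    {f : ℂ → X} (hf : IsLogDisc d D f) :
    ∃ e : ℂ → ℝ, ContinuousOn e (ball 0 1) ∧ (∀ z ∈ ball (0 : ℂ) 1, 0 ≤ e z) ∧
      (∀ r, 0 ≤ r → r < 1 → discCurrent f r η = (nev e r : ℂ)) ∧
      ∀ z ∈ ball (0 : ℂ) 1, ∀ φ : LogChart d D, f z ∈ φ.chart.source → (φ.lift f z).2 ≠ 0 →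
        e z = 2 * (η.1 φ (φ.lift f z) (deriv (φ.lift f) z) (deriv (φ.lift f) z)).re := by
  obtain ⟨g, hgc, hg1, hg2⟩ := hf.exists_continuous_density hD η
  have hpd : ∀ z ∈ ball (0 : ℂ) 1, 0 ≤ (pullbackDensity η f z).re ∧
      (pullbackDensity η f z).im = 0 := by
    intro z hz
    obtain ⟨φ, hφ⟩ := hD (f z)
    by_cases h0 : (φ.lift f z).2 = 0
    · rw [hf.pullbackDensity_eq_zero η hz hφ h0]
      simp
    · rw [hf.pullbackDensity_eq η hz hφ h0]
      have := hη φ _ (lift_mem_dom hφ h0) (deriv (φ.lift f) z)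
      simp only [mul_re, mul_im, re_ofNat, im_ofNat]
      constructor
      · linarith [this.1]
      · rw [this.2.1]; simp
  have hpos : ∀ z ∈ ball (0 : ℂ) 1, 0 ≤ (g z).re ∧ (g z).im = 0 := by
    intro z hz
    have hc : IsClosed {c : ℂ | 0 ≤ c.re ∧ c.im = 0} :=
      (isClosed_le continuous_const continuous_re).inter
        (isClosed_eq continuous_im continuous_const)
    have hg := (hgc.continuousAt (isOpen_ball.mem_nhds hz)).tendsto
    refine hc.mem_of_tendsto (hg.mono_left (nhdsWithin_le_nhds (s := {z}ᶜ))) ?_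
    filter_upwards [hg1 z hz, mem_nhdsWithin_of_mem_nhds (isOpen_ball.mem_nhds hz)] with w h1 h2
    have h3 := hpd w h2
    rwa [h1] at h3
  have hre : ∀ z ∈ ball (0 : ℂ) 1, g z = ((g z).re : ℂ) := fun z hz =>
    Complex.ext (by simp) (by simp [(hpos z hz).2])
  refine ⟨fun z => (g z).re, continuous_re.comp_continuousOn hgc, fun z hz => (hpos z hz).1,
    fun r h0 hr => discCurrent_eq h0 ?_, fun z hz φ hφ h0 => ?_⟩
  · filter_upwards [ae_ball_of_eventually_nhdsNE hg1] with z hz hzr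
    have hz1 := ball_subset_ball hr.le hzr
    rw [hz hz1, ← hre z hz1]
  · simp only [hg2 z hz φ hφ h0]
    simp

end

/-! ### Finite covers by logarithmic charts -/

section

variable {d : ℕ} {X : Type*} [TopologicalSpace X] [ChartedSpace (Fin d → ℂ) X] {ι : Type*}
  {D : ι → Set X}

/-- A finite cover of `X` by logarithmic charts, with smooth cutoff functions `χ b` supported in
compact subsets `K b` of the charts. -/
structure ChartCover (d : ℕ) {X : Type*} [TopologicalSpace X] [ChartedSpace (Fin d → ℂ) X]
    {ι : Type*} (D : ι → Set X) where
  β : Finset X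
  A : X → LogChart d D
  χ : X → X → ℝ
  K : X → Set X
  nonneg : ∀ b x, 0 ≤ χ b x
  le_one : ∀ b x, χ b x ≤ 1
  isCompact : ∀ b, IsCompact (K b)
  subset : ∀ b, K b ⊆ (A b).chart.source
  eq_zero : ∀ b, ∀ x ∉ K b, χ b x = 0
  smooth : ∀ b (φ : LogChart d D), ContDiffOn ℝ ∞ (fun y => χ b (φ.chart.symm y)) φ.chart.target
  cover : ∀ x, ∃ b ∈ β, χ b x = 1

lemma IsSNC.exists_cutoff [T2Space X] (hD : IsSNC d D) (x₀ : X) :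
    ∃ (φ : LogChart d D) (χ : X → ℝ) (K : Set X), (∀ x, 0 ≤ χ x) ∧ (∀ x, χ x ≤ 1) ∧ IsCompact K ∧
      K ⊆ φ.chart.source ∧ (∀ x ∉ K, χ x = 0) ∧
      (∀ ψ : LogChart d D, ContDiffOn ℝ ∞ (fun y => χ (ψ.chart.symm y)) ψ.chart.target) ∧
      ∀ᶠ x in 𝓝 x₀, χ x = 1 := by
  obtain ⟨φ, hφ⟩ := hD x₀
  obtain ⟨ε, hε, hεt⟩ := Metric.nhds_basis_closedBall.mem_iff.1
    (φ.chart.open_target.mem_nhds (φ.chart.map_source hφ))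
  let f : ContDiffBump (φ.chart x₀) := ⟨ε / 2, ε, by positivity, by linarith⟩
  classical
  let χ : X → ℝ := fun x => if x ∈ φ.chart.source then f (φ.chart x) else 0
  let K : Set X := φ.chart.symm '' closedBall (φ.chart x₀) ε
  have hK : IsCompact K := (isCompact_closedBall _ _).image_of_continuousOn
    (φ.chart.continuousOn_symm.mono hεt)
  have hKs : K ⊆ φ.chart.source := by
    rintro _ ⟨y, hy, rfl⟩
    exact φ.chart.map_target (hεt hy)
  have h0 : ∀ x ∉ K, χ x = 0 := by
    intro x hx
    by_cases hs : x ∈ φ.chart.source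
    · simp only [χ, if_pos hs]
      by_contra h
      have h1 : φ.chart x ∈ ball (φ.chart x₀) ε := by
        rw [← show Function.support f = ball (φ.chart x₀) ε from f.support_eq]
        exact h
      exact hx ⟨φ.chart x, ball_subset_closedBall h1, φ.chart.left_inv hs⟩
    · simp only [χ, if_neg hs]
  refine ⟨φ, χ, K, fun x => ?_, fun x => ?_, hK, hKs, h0, fun ψ y hy => ?_, ?_⟩
  · simp only [χ]
    split_ifs
    exacts [f.nonneg, le_rfl]
  · simp only [χ]
    split_ifs
    exacts [f.le_one, zero_le_one]
  · refine ContDiffAt.contDiffWithinAt ?_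
    have hc := ψ.chart.continuousAt_symm hy
    by_cases hs : ψ.chart.symm y ∈ φ.chart.source
    · have h1 : ContDiffAt ℝ ∞ (fun y => φ.chart (ψ.chart.symm y)) y :=
        ((ψ.contDiffAt_change φ hy hs).restrict_scalars ℝ).of_le (by simp)
      refine (f.contDiffAt.comp y h1).congr_of_eventuallyEq ?_
      filter_upwards [hc.eventually (φ.chart.open_source.eventually_mem hs)] with w hw
      simp only [χ, if_pos hw, Function.comp]
    · refine (contDiffAt_const (c := (0 : ℝ))).congr_of_eventuallyEq ?_
      filter_upwards [hc.eventually (hK.isClosed.isOpen_compl.eventually_mem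
        fun h => hs (hKs h))] with w hw
      exact h0 _ hw
  · have hc := φ.chart.continuousAt hφ
    filter_upwards [φ.chart.open_source.mem_nhds hφ,
      hc.eventually (closedBall_mem_nhds _ (half_pos hε))] with x hx hx2
    simp only [χ, if_pos hx]
    exact f.one_of_mem_closedBall hx2

lemma IsSNC.exists_chartCover [CompactSpace X] [T2Space X] (hD : IsSNC d D) :
    Nonempty (ChartCover d D) := by
  choose A χ K h1 h2 h3 h4 h5 h6 h7 using hD.exists_cutoff
  obtain ⟨β, -, hβ⟩ := isCompact_univ.elim_nhds_subcover (fun b => {x | χ b x = 1})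
    fun b _ => h7 b
  refine ⟨⟨β, A, χ, K, h1, h2, h3, h4, h5, h6, fun x => ?_⟩⟩
  obtain ⟨b, hb, hx⟩ := mem_iUnion₂.1 (hβ (mem_univ x))
  exact ⟨b, hb, hx⟩

namespace ChartCover
variable (𝒰 : ChartCover d D)

lemma cover_K (x : X) : ∃ b ∈ 𝒰.β, x ∈ 𝒰.K b := by
  obtain ⟨b, hb, hx⟩ := 𝒰.cover x
  refine ⟨b, hb, ?_⟩
  by_contra h
  rw [𝒰.eq_zero b x h] at hx
  exact zero_ne_one hx

/-- A function defined over one chart of the cover becomes globally smooth after multiplication with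
the cutoff function. -/
lemma contDiffAt_mul [T2Space X] {Y : Type*} [NormedAddCommGroup Y] [NormedSpace ℝ Y] (b : X)
    (φ : LogChart d D) {x : Y → Fin d → ℂ} {g : Y → ℝ} {y : Y} (hx : ContDiffAt ℝ ∞ x y)
    (hy : x y ∈ φ.chart.target)
    (hg : φ.chart.symm (x y) ∈ (𝒰.A b).chart.source → ContDiffAt ℝ ∞ g y) :
    ContDiffAt ℝ ∞ (fun y => 𝒰.χ b (φ.chart.symm (x y)) * g y) y := by
  by_cases hs : φ.chart.symm (x y) ∈ (𝒰.A b).chart.source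
  · have h1 : ContDiffAt ℝ ∞ (fun y => 𝒰.χ b (φ.chart.symm y)) (x y) :=
      (𝒰.smooth b φ).contDiffAt (φ.chart.open_target.mem_nhds hy)
    exact (h1.comp y hx).mul (hg hs)
  · refine (contDiffAt_const (c := (0 : ℝ))).congr_of_eventuallyEq ?_
    have hc : ContinuousAt (fun y => φ.chart.symm (x y)) y :=
      (φ.chart.continuousAt_symm hy).comp hx.continuousAt
    filter_upwards [hc.eventually ((𝒰.isCompact b).isClosed.isOpen_compl.eventually_mem
        fun h => hs (𝒰.subset b h))] with w hw
    rw [𝒰.eq_zero b _ hw, zero_mul]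

end ChartCover

/-- The divided difference of a function which vanishes on the hyperplane `x m = 0`: the quotient by
`x m`, extended by the partial derivative. -/
def divCoord (g : (Fin d → ℂ) → ℂ) (m : Fin d) (x : Fin d → ℂ) : ℂ :=
  if x m = 0 then fderiv ℂ g x (Pi.single m 1) else g x / x m

lemma mul_divCoord {g : (Fin d → ℂ) → ℂ} {m : Fin d} {x : Fin d → ℂ} (h : x m = 0 → g x = 0) :
    x m * divCoord g m x = g x := by
  unfold divCoord
  split_ifs with h0
  · rw [h0, zero_mul, h h0]
  · exact mul_div_cancel₀ _ h0

/-- Hadamard's lemma. -/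
lemma contDiffAt_divCoord {g : (Fin d → ℂ) → ℂ} {m : Fin d} {U : Set (Fin d → ℂ)} (hU : IsOpen U)
    (hg : ContDiffOn ℂ ω g U) (h0 : ∀ x ∈ U, x m = 0 → g x = 0) {x : Fin d → ℂ} (hx : x ∈ U) :
    ContDiffAt ℝ ∞ (divCoord g m) x := by
  by_cases hm : x m = 0
  swap
  · have h1 : ContDiffAt ℂ ω (fun y : Fin d → ℂ => g y / y m) x :=
      (hg.contDiffAt (hU.mem_nhds hx)).div (contDiff_apply ℂ ℂ m).contDiffAt hm
    refine ((h1.restrict_scalars ℝ).of_le (by simp)).congr_of_eventuallyEq ?_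
    filter_upwards [(continuous_apply m).continuousAt.eventually_ne hm] with y hy
    exact if_neg hy
  obtain ⟨ε, hε, hεU⟩ := Metric.isOpen_iff.1 hU x hx
  -- the segment from the hyperplane to `y`
  let S : ℝ → (Fin d → ℂ) → (Fin d → ℂ) := fun t y => fun k => if k = m then (t : ℂ) * y k else y k
  have hS : ContDiff ℝ ω fun q : (Fin d → ℂ) × ℝ => S q.2 q.1 := by
    rw [contDiff_pi]
    intro k
    have h1 : ContDiff ℝ ω fun q : (Fin d → ℂ) × ℝ => q.1 k :=
      (contDiff_apply ℝ ℂ k).comp contDiff_fst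
    simp only [S]
    split_ifs
    · exact (Complex.ofRealCLM.contDiff.comp contDiff_snd).mul h1
    · exact h1
  have hSU : ∀ y ∈ ball x (ε / 2), ∀ t : ℝ, |t| ≤ 2 → S t y ∈ U := by
    intro y hy t ht
    refine hεU ?_
    rw [mem_ball, dist_pi_lt_iff hε]
    intro k
    have h1 : dist (y k) (x k) < ε / 2 := (dist_le_pi_dist y x k).trans_lt hy
    simp only [S]
    split_ifs with hk
    · subst hk
      rw [hm, dist_zero_right] at h1 ⊢
      rw [norm_mul, norm_real, Real.norm_eq_abs]
      nlinarith [norm_nonneg (y k), abs_nonneg t]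
    · linarith
  let P : (Fin d → ℂ) → ℂ := fun y => fderiv ℂ g y (Pi.single m 1)
  have hP : ContDiffOn ℝ ∞ P U := by
    have h1 : ContDiffOn ℂ ω P U :=
      (hg.fderiv_of_isOpen hU (m := ω) (by simp)).clm_apply contDiffOn_const
    exact (h1.restrict_scalars ℝ).of_le (by simp)
  let χ : ContDiffBump (0 : ℝ) := ⟨1, 2, one_pos, one_lt_two⟩
  -- the integral of `P` over the segment is smooth in `y`, as a convolution with a parameter
  let G : (Fin d → ℂ) → ℝ → ℂ := fun y t => (χ t : ℂ) * P (S (-t) y)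
  have hG : ContDiffOn ℝ ∞ (Function.uncurry G) (ball x (ε / 2) ×ˢ univ) := by
    rintro ⟨y, t⟩ ⟨hy, -⟩
    refine ContDiffAt.contDiffWithinAt ?_
    have hχ : ContDiffAt ℝ ∞ (fun q : (Fin d → ℂ) × ℝ => (χ q.2 : ℂ)) (y, t) :=
      Complex.ofRealCLM.contDiff.contDiffAt.comp _ (χ.contDiffAt.comp _ contDiffAt_snd)
    rcases le_or_gt |t| 2 with ht | ht
    · refine hχ.mul ?_
      have h1 : ContDiffAt ℝ ∞ P (S (-t) y) :=
        hP.contDiffAt (hU.mem_nhds (hSU y hy (-t) (by rwa [abs_neg])))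
      have h2 : ContDiff ℝ ∞ fun q : (Fin d → ℂ) × ℝ => S (-q.2) q.1 :=
        (hS.of_le (by simp)).comp (contDiff_fst.prodMk contDiff_snd.neg)
      exact ContDiffAt.comp (f := fun q : (Fin d → ℂ) × ℝ => S (-q.2) q.1) (y, t) h1 h2.contDiffAt
    · refine (contDiffAt_const (c := (0 : ℂ))).congr_of_eventuallyEq ?_
      have h1 : ∀ᶠ q : (Fin d → ℂ) × ℝ in 𝓝 (y, t), 2 < |q.2| :=
        (continuous_snd.abs.tendsto (y, t)).eventually (lt_mem_nhds ht)
      filter_upwards [h1] with q hq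
      have h2 : χ q.2 = 0 := χ.zero_of_le_dist (by simpa using hq.le)
      simp [Function.uncurry, G, h2]
  have hconv := contDiffOn_convolution_right_with_param (𝕜 := ℝ) (n := ⊤)
    (ContinuousLinearMap.lsmul ℝ ℝ : ℝ →L[ℝ] ℂ →L[ℝ] ℂ) (μ := volume)
    (f := (Icc (0 : ℝ) 1).indicator fun _ => (1 : ℝ)) (s := ball x (ε / 2)) (k := Icc (-2) 2) (g := G)
    isOpen_ball isCompact_Icc (fun y t hy ht => by
      have h2 : χ t = 0 := χ.zero_of_le_dist (by
        have : ¬|t| ≤ 2 := fun h => ht (abs_le.1 h)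
        simpa using (not_le.1 this).le)
      simp [G, h2])
    ((locallyIntegrable_const (1 : ℝ)).indicator measurableSet_Icc) hG
  have h1 : ContDiffAt ℝ ∞ (fun y => MeasureTheory.convolution
      ((Icc (0 : ℝ) 1).indicator fun _ => (1 : ℝ)) (G y)
      (ContinuousLinearMap.lsmul ℝ ℝ : ℝ →L[ℝ] ℂ →L[ℝ] ℂ) volume 0) x := by
    have h2 := hconv.contDiffAt (x := (x, (0 : ℝ)))
      ((isOpen_ball.prod isOpen_univ).mem_nhds ⟨mem_ball_self (half_pos hε), mem_univ _⟩)
    exact ContDiffAt.comp (f := fun y : Fin d → ℂ => (y, (0 : ℝ))) x h2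
      (contDiffAt_id.prodMk contDiffAt_const)
  refine h1.congr_of_eventuallyEq ?_
  filter_upwards [ball_mem_nhds x (half_pos hε)] with y hy
  have h2 : MeasureTheory.convolution
      ((Icc (0 : ℝ) 1).indicator fun _ => (1 : ℝ)) (G y)
      (ContinuousLinearMap.lsmul ℝ ℝ : ℝ →L[ℝ] ℂ →L[ℝ] ℂ) volume 0 = ∫ t in (0 : ℝ)..1, P (S t y) := by
    unfold MeasureTheory.convolution
    rw [intervalIntegral.integral_of_le zero_le_one, ← integral_Icc_eq_integral_Ioc,
      ← integral_indicator measurableSet_Icc]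
    refine integral_congr_ae (.of_forall fun t => ?_)
    simp only [indicator]
    split_ifs with ht
    · have h3 : χ (0 - t) = 1 := χ.one_of_mem_closedBall (by
        simpa [abs_le] using ⟨by linarith [ht.1], ht.2⟩)
      simp [G] at h3 ⊢
      simp [h3]
    · simp
  rw [h2]
  -- the fundamental theorem of calculus along the segment
  have h3 : ∀ t ∈ uIcc (0 : ℝ) 1, HasDerivAt (fun t : ℝ => g (S t y)) (y m * P (S t y)) t := by
    intro t ht
    rw [uIcc_of_le zero_le_one] at ht
    have hU' : S t y ∈ U := hSU y hy t (by rw [abs_of_nonneg ht.1]; linarith [ht.2])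
    have h4 := ((hg.contDiffAt (hU.mem_nhds hU')).differentiableAt (by simp)).hasFDerivAt
    have h5 : HasDerivAt (fun t : ℝ => S t y) (y m • Pi.single m (1 : ℂ)) t := by
      rw [hasDerivAt_pi]
      intro k
      simp only [S]
      split_ifs with hk
      · subst hk
        simpa using (Complex.ofRealCLM.hasDerivAt (x := t)).mul_const (y k)
      · simpa [hk] using hasDerivAt_const t (y k)
    have h6 : HasDerivAt (fun t : ℝ => g (S t y)) (fderiv ℂ g (S t y) (y m • Pi.single m 1)) t :=
      HasFDerivAt.comp_hasDerivAt (l := g) (f := fun t : ℝ => S t y) t (h4.restrictScalars ℝ) h5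
    simpa [P] using h6
  have h7 : ContinuousOn (fun t : ℝ => P (S t y)) (uIcc 0 1) := by
    refine hP.continuousOn.comp ?_ fun t ht => ?_
    · exact (hS.continuous.comp (by fun_prop : Continuous fun t : ℝ => (y, t))).continuousOn
    · rw [uIcc_of_le zero_le_one] at ht
      exact hSU y hy t (by rw [abs_of_nonneg ht.1]; linarith [ht.2])
  have h8 := intervalIntegral.integral_eq_sub_of_hasDerivAt h3
    (continuousOn_const.mul h7).intervalIntegrable
  have e1 : S 1 y = y := by funext k; simp [S]
  have e0 : g (S 0 y) = 0 := h0 _ (hSU y hy 0 (by simp)) (by simp [S])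
  rw [intervalIntegral.integral_const_mul, e1, e0, sub_zero] at h8
  unfold divCoord
  split_ifs with hy0
  · have h9 : ∀ t : ℝ, S t y = y := fun t => by
      funext k
      simp only [S]
      split_ifs with hk
      · rw [hk, hy0, mul_zero]
      · rfl
    simp [h9, P]
  · rw [← h8, mul_div_cancel_left₀ _ hy0]

end

/-! ### Distance functions to the components of the divisor -/

section

variable {d : ℕ} {X : Type*} [TopologicalSpace X] [ChartedSpace (Fin d → ℂ) X] {ι : Type*}
  {D : ι → Set X}

namespace LogChart

open Classical in
/-- The equation of `D i` in a logarithmic chart. -/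
def eqn (φ : LogChart d D) (i : ι) (y : Fin d → ℂ) : ℂ :=
  if h : ∃ k, φ.label k = some i then y h.choose else 1

lemma eqn_of_label (φ : LogChart d D) {i : ι} {k : Fin d} (hk : φ.label k = some i)
    (y : Fin d → ℂ) : φ.eqn i y = y k := by
  have h : ∃ k, φ.label k = some i := ⟨k, hk⟩
  unfold eqn
  rw [dif_pos h, φ.label_inj _ _ _ h.choose_spec hk]

lemma eqn_of_forall_ne (φ : LogChart d D) {i : ι} (h : ¬∃ k, φ.label k = some i) (y : Fin d → ℂ) :
    φ.eqn i y = 1 := dif_neg h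

lemma eqn_eq_zero_iff (φ : LogChart d D) {x : X} (hx : x ∈ φ.chart.source) (i : ι) :
    φ.eqn i (φ.chart x) = 0 ↔ x ∈ D i := by
  rw [φ.mem_iff x hx i]
  constructor
  · intro h
    by_cases hk : ∃ k, φ.label k = some i
    · obtain ⟨k, hk⟩ := hk
      exact ⟨k, hk, by rwa [φ.eqn_of_label hk] at h⟩
    · rw [φ.eqn_of_forall_ne hk] at h
      exact absurd h one_ne_zero
  · rintro ⟨k, hk, h⟩
    rw [φ.eqn_of_label hk, h]

lemma contDiff_eqn (φ : LogChart d D) (i : ι) : ContDiff ℂ ω (φ.eqn i) := by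
  by_cases hk : ∃ k, φ.label k = some i
  · obtain ⟨k, hk⟩ := hk
    rw [show φ.eqn i = fun y => y k from funext fun y => φ.eqn_of_label hk y]
    exact contDiff_apply ℂ ℂ k
  · rw [show φ.eqn i = fun y => 1 from funext fun y => φ.eqn_of_forall_ne hk y]
    exact contDiff_const

/-- The part of the image of a chart which lies over the domain of another chart. -/
def meet (φ ψ : LogChart d D) : Set (Fin d → ℂ) :=
  {y | y ∈ φ.chart.target ∧ φ.chart.symm y ∈ ψ.chart.source}

lemma isOpen_meet (φ ψ : LogChart d D) : IsOpen (φ.meet ψ) :=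
  φ.chart.isOpen_inter_preimage_symm ψ.chart.open_source

lemma contDiffAt_eqn_change (φ ψ : LogChart d D) (i : ι) {y : Fin d → ℂ} (hy : y ∈ φ.meet ψ) :
    ContDiffAt ℂ ω (fun y => ψ.eqn i (ψ.chart (φ.chart.symm y))) y :=
  (ψ.contDiff_eqn i).contDiffAt.comp y (φ.contDiffAt_change ψ hy.1 hy.2)

open Classical in
/-- The quotient of the equations of `D i` in two charts, a nonvanishing function. -/
def unit (φ ψ : LogChart d D) (i : ι) (y : Fin d → ℂ) : ℂ :=
  if h : ∃ m, φ.label m = some i then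
    divCoord (fun y => ψ.eqn i (ψ.chart (φ.chart.symm y))) h.choose y
  else ψ.eqn i (ψ.chart (φ.chart.symm y))

lemma unit_of_label (φ ψ : LogChart d D) {i : ι} {m : Fin d} (hm : φ.label m = some i)
    (y : Fin d → ℂ) :
    φ.unit ψ i y = divCoord (fun y => ψ.eqn i (ψ.chart (φ.chart.symm y))) m y := by
  have h : ∃ k, φ.label k = some i := ⟨m, hm⟩
  unfold unit
  rw [dif_pos h, φ.label_inj _ _ _ h.choose_spec hm]

lemma eqn_change_eq_zero (φ ψ : LogChart d D) {i : ι} {m : Fin d} (hm : φ.label m = some i)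
    {y : Fin d → ℂ} (hy : y ∈ φ.meet ψ) (h0 : y m = 0) :
    ψ.eqn i (ψ.chart (φ.chart.symm y)) = 0 := by
  rw [ψ.eqn_eq_zero_iff hy.2, ← φ.eqn_eq_zero_iff (φ.chart.map_target hy.1), φ.eqn_of_label hm,
    φ.chart.right_inv hy.1, h0]

lemma eqn_mul_unit (φ ψ : LogChart d D) (i : ι) {y : Fin d → ℂ} (hy : y ∈ φ.meet ψ) :
    φ.eqn i y * φ.unit ψ i y = ψ.eqn i (ψ.chart (φ.chart.symm y)) := by
  by_cases hm : ∃ m, φ.label m = some i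
  · obtain ⟨m, hm⟩ := hm
    rw [φ.eqn_of_label hm, φ.unit_of_label ψ hm]
    exact mul_divCoord (φ.eqn_change_eq_zero ψ hm hy)
  · rw [φ.eqn_of_forall_ne hm, one_mul, unit, dif_neg hm]

lemma contDiffAt_unit (φ ψ : LogChart d D) (i : ι) {y : Fin d → ℂ} (hy : y ∈ φ.meet ψ) :
    ContDiffAt ℝ ∞ (φ.unit ψ i) y := by
  by_cases hm : ∃ m, φ.label m = some i
  · obtain ⟨m, hm⟩ := hm
    rw [show φ.unit ψ i = _ from funext fun y => φ.unit_of_label ψ hm y]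
    exact contDiffAt_divCoord (φ.isOpen_meet ψ)
      (fun y hy => (φ.contDiffAt_eqn_change ψ i hy).contDiffWithinAt)
      (fun y hy => φ.eqn_change_eq_zero ψ hm hy) hy
  · have : φ.unit ψ i = fun y => ψ.eqn i (ψ.chart (φ.chart.symm y)) :=
      funext fun y => by rw [unit, dif_neg hm]
    rw [this]
    exact ((φ.contDiffAt_eqn_change ψ i hy).restrict_scalars ℝ).of_le (by simp)

lemma fderiv_change_surjective (φ ψ : LogChart d D) {y : Fin d → ℂ} (hy : y ∈ φ.meet ψ)
    (v : Fin d → ℂ) : ∃ w, fderiv ℂ (fun x => ψ.chart (φ.chart.symm x)) y w = v := by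
  have h1 := (φ.contDiffAt_change ψ hy.1 hy.2).differentiableAt (by simp)
  have ht := ψ.chart.map_source hy.2
  have hs : φ.chart.symm y ∈ φ.chart.source := φ.chart.map_target hy.1
  have hy' : φ.chart (ψ.chart.symm (ψ.chart (φ.chart.symm y))) = y := by
    rw [ψ.chart.left_inv hy.2, φ.chart.right_inv hy.1]
  have h2 := (ψ.contDiffAt_change φ ht (by rwa [ψ.chart.left_inv hy.2])).differentiableAt (by simp)
  rw [← hy'] at h1
  have h3 := HasFDerivAt.comp (g := fun x => ψ.chart (φ.chart.symm x))
    (f := fun x => φ.chart (ψ.chart.symm x)) (ψ.chart (φ.chart.symm y)) h1.hasFDerivAt h2.hasFDerivAt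
  have h4 : ((fun x => ψ.chart (φ.chart.symm x)) ∘ fun x => φ.chart (ψ.chart.symm x))
      =ᶠ[𝓝 (ψ.chart (φ.chart.symm y))] id := by
    filter_upwards [(ψ.isOpen_meet φ).mem_nhds ⟨ht, by rwa [ψ.chart.left_inv hy.2]⟩] with x hx
    simp only [Function.comp, id]
    rw [φ.chart.left_inv hx.2, ψ.chart.right_inv hx.1]
  have h5 := h3.unique ((hasFDerivAt_id _).congr_of_eventuallyEq h4)
  rw [hy'] at h5
  exact ⟨_, DFunLike.congr_fun h5 v⟩

lemma unit_ne_zero (φ ψ : LogChart d D) (i : ι) {y : Fin d → ℂ} (hy : y ∈ φ.meet ψ) :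
    φ.unit ψ i y ≠ 0 := by
  intro h0
  have hψ : ψ.eqn i (ψ.chart (φ.chart.symm y)) = 0 := by
    rw [← φ.eqn_mul_unit ψ i hy, h0, mul_zero]
  have hφ : φ.eqn i y = 0 := by
    have := (φ.eqn_eq_zero_iff (φ.chart.map_target hy.1) i).2 ((ψ.eqn_eq_zero_iff hy.2 i).1 hψ)
    rwa [φ.chart.right_inv hy.1] at this
  have hm : ∃ m, φ.label m = some i := by
    by_contra hm
    rw [φ.eqn_of_forall_ne hm] at hφ
    exact one_ne_zero hφ
  have hk : ∃ k, ψ.label k = some i := by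
    by_contra hk
    rw [ψ.eqn_of_forall_ne hk] at hψ
    exact one_ne_zero hψ
  obtain ⟨m, hm⟩ := hm
  obtain ⟨k, hk⟩ := hk
  rw [φ.eqn_of_label hm] at hφ
  rw [φ.unit_of_label ψ hm, divCoord, if_pos hφ] at h0
  -- the differential of the equation vanishes, which contradicts the surjectivity of `dτ`
  set g : (Fin d → ℂ) → ℂ := fun y => ψ.eqn i (ψ.chart (φ.chart.symm y)) with hg
  have hgd := (φ.contDiffAt_eqn_change ψ i hy).differentiableAt (by simp)
  have hall : ∀ l, fderiv ℂ g y (Pi.single l 1) = 0 := by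
    intro l
    by_cases hl : l = m
    · rw [hl, h0]
    · have h1 : HasDerivAt (fun t : ℂ => y + t • (Pi.single l (1 : ℂ) : Fin d → ℂ))
          (Pi.single l 1) 0 := by
        simpa using ((hasDerivAt_id (0 : ℂ)).smul_const
          (Pi.single l (1 : ℂ) : Fin d → ℂ)).const_add y
      have h2 : HasFDerivAt g (fderiv ℂ g y)
          (y + (0 : ℂ) • (Pi.single l (1 : ℂ) : Fin d → ℂ)) := by
        simpa using hgd.hasFDerivAt
      have h3 : HasDerivAt (fun t : ℂ => g (y + t • (Pi.single l (1 : ℂ) : Fin d → ℂ)))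
          (fderiv ℂ g y (Pi.single l 1)) 0 :=
        HasFDerivAt.comp_hasDerivAt (l := g)
          (f := fun t : ℂ => y + t • (Pi.single l (1 : ℂ) : Fin d → ℂ)) 0 h2 h1
      refine h3.unique ((hasDerivAt_const (0 : ℂ) (0 : ℂ)).congr_of_eventuallyEq ?_)
      have h4 : Tendsto (fun t : ℂ => y + t • (Pi.single l (1 : ℂ) : Fin d → ℂ)) (𝓝 0) (𝓝 y) := by
        simpa using h1.continuousAt.tendsto
      filter_upwards [h4.eventually ((φ.isOpen_meet ψ).mem_nhds hy)] with t ht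
      refine φ.eqn_change_eq_zero ψ hm ht ?_
      simp [hφ, Ne.symm hl]
  have hz : fderiv ℂ g y = 0 := by
    refine ContinuousLinearMap.ext fun v => ?_
    rw [pi_eq_sum_univ' v, map_sum]
    simp [hall]
  obtain ⟨w, hw⟩ := φ.fderiv_change_surjective ψ hy (Pi.single k 1)
  have h5 : fderiv ℂ g y w = 1 := by
    have h6 : g = fun y => (ψ.chart (φ.chart.symm y)) k := funext fun y => ψ.eqn_of_label hk _
    have h7 := (φ.contDiffAt_change ψ hy.1 hy.2).differentiableAt (by simp)
    have h8 := (hasFDerivAt_pi'.1 h7.hasFDerivAt k).fderiv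
    rw [h6, h8, ContinuousLinearMap.comp_apply, hw]
    simp
  rw [hz] at h5
  simp at h5

end LogChart

namespace ChartCover
variable (𝒰 : ChartCover d D)

/-- A function on `X` comparable to the squared distance to `D i`. -/
def sigma (i : ι) (x : X) : ℝ :=
  ∑ b ∈ 𝒰.β, 𝒰.χ b x * ‖(𝒰.A b).eqn i ((𝒰.A b).chart x)‖ ^ 2

/-- In a chart, `sigma i` is `|equation of D i|²` times this function. -/
def density (φ : LogChart d D) (i : ι) (y : Fin d → ℂ) : ℝ :=
  ∑ b ∈ 𝒰.β, 𝒰.χ b (φ.chart.symm y) * ‖φ.unit (𝒰.A b) i y‖ ^ 2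

lemma sigma_symm (φ : LogChart d D) (i : ι) {y : Fin d → ℂ} (hy : y ∈ φ.chart.target) :
    𝒰.sigma i (φ.chart.symm y) = ‖φ.eqn i y‖ ^ 2 * 𝒰.density φ i y := by
  unfold sigma density
  rw [Finset.mul_sum]
  refine Finset.sum_congr rfl fun b _ => ?_
  by_cases hs : φ.chart.symm y ∈ (𝒰.A b).chart.source
  · rw [← φ.eqn_mul_unit (𝒰.A b) i ⟨hy, hs⟩, norm_mul]
    ring
  · rw [𝒰.eq_zero b _ fun h => hs (𝒰.subset b h)]
    ring

lemma contDiffOn_density [T2Space X] (φ : LogChart d D) (i : ι) :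
    ContDiffOn ℝ ∞ (𝒰.density φ i) φ.chart.target := by
  intro y hy
  refine ContDiffAt.contDiffWithinAt (ContDiffAt.sum fun b _ => ?_)
  exact 𝒰.contDiffAt_mul b φ contDiffAt_id hy fun hs =>
    (φ.contDiffAt_unit (𝒰.A b) i ⟨hy, hs⟩).norm_sq ℝ

lemma density_pos (φ : LogChart d D) (i : ι) {y : Fin d → ℂ} (hy : y ∈ φ.chart.target) :
    0 < 𝒰.density φ i y := by
  obtain ⟨b, hb, h1⟩ := 𝒰.cover (φ.chart.symm y)
  have hs : φ.chart.symm y ∈ (𝒰.A b).chart.source := by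
    refine 𝒰.subset b ?_
    by_contra h
    rw [𝒰.eq_zero b _ h] at h1
    exact zero_ne_one h1
  have h2 : 0 < ‖φ.unit (𝒰.A b) i y‖ := norm_pos_iff.2 (φ.unit_ne_zero (𝒰.A b) i ⟨hy, hs⟩)
  refine lt_of_lt_of_le ?_ (Finset.single_le_sum
    (f := fun b => 𝒰.χ b (φ.chart.symm y) * ‖φ.unit (𝒰.A b) i y‖ ^ 2)
    (fun b _ => mul_nonneg (𝒰.nonneg b _) (by positivity)) hb)
  simp only [h1, one_mul]
  positivity

lemma continuous_sigma [T2Space X] (hD : IsSNC d D) (i : ι) : Continuous (𝒰.sigma i) := by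
  rw [continuous_iff_continuousAt]
  intro x
  obtain ⟨φ, hφ⟩ := hD x
  have hφx := φ.chart.map_source hφ
  have h1 : ContinuousAt (fun y => ‖φ.eqn i y‖ ^ 2 * 𝒰.density φ i y) (φ.chart x) :=
    (((φ.contDiff_eqn i).continuous.continuousAt).norm.pow 2).mul
      ((𝒰.contDiffOn_density φ i).continuousOn.continuousAt (φ.chart.open_target.mem_nhds hφx))
  refine (ContinuousAt.comp h1 (φ.chart.continuousAt hφ)).congr ?_
  filter_upwards [φ.chart.open_source.mem_nhds hφ] with y hy
  simp only [Function.comp]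
  rw [← 𝒰.sigma_symm φ i (φ.chart.map_source hy), φ.chart.left_inv hy]

lemma sigma_pos (hD : IsSNC d D) (i : ι) {x : X} (hx : x ∉ D i) : 0 < 𝒰.sigma i x := by
  obtain ⟨φ, hφ⟩ := hD x
  have h := 𝒰.sigma_symm φ i (φ.chart.map_source hφ)
  rw [φ.chart.left_inv hφ] at h
  rw [h]
  have h1 : 0 < ‖φ.eqn i (φ.chart x)‖ := norm_pos_iff.2 fun h => hx ((φ.eqn_eq_zero_iff hφ i).1 h)
  have h2 := 𝒰.density_pos φ i (φ.chart.map_source hφ)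
  positivity

end ChartCover

end

/-! ### A smooth metric on the tautological bundle -/

section

lemma contDiffOn_del {V Y : Type*} [NormedAddCommGroup V] [NormedSpace ℝ V] [NormedSpace ℂ V]
    [NormedAddCommGroup Y] [NormedSpace ℝ Y] {u : V → ℝ} {x v : Y → V} {y : Y}
    (hu : ContDiffAt ℝ ∞ u (x y)) (hx : ContDiffAt ℝ ∞ x y) (hv : ContDiffAt ℝ ∞ v y) :
    ContDiffAt ℝ ∞ (fun y => del u (x y) (v y)) y := by
  have h1 : ContDiffAt ℝ ∞ (fun y => fderiv ℝ u (x y)) y :=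
    ContDiffAt.comp y (g := fderiv ℝ u) (hu.fderiv_right (m := ∞) (by simp)) hx
  have h2 : ContDiffAt ℝ ∞ (fun y => ((fderiv ℝ u (x y) (v y) : ℝ) : ℂ)) y :=
    Complex.ofRealCLM.contDiff.contDiffAt.comp y (h1.clm_apply hv)
  have h3 : ContDiffAt ℝ ∞ (fun y => ((fderiv ℝ u (x y) (I • v y) : ℝ) : ℂ)) y :=
    Complex.ofRealCLM.contDiff.contDiffAt.comp y (h1.clm_apply (contDiffAt_const.smul hv))
  exact contDiffAt_const.mul (h2.sub (contDiffAt_const.mul h3))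

variable {d : ℕ} {X : Type*} [TopologicalSpace X] [ChartedSpace (Fin d → ℂ) X] {ι : Type*}
  {D : ι → Set X}

namespace LogChart

/-- The tangent vector with coordinates `a` in the frame of `T_X(-log D)`. -/
def vec (φ : LogChart d D) (x a : Fin d → ℂ) : Fin d → ℂ := fun k => φ.weight x k * a k

lemma vec_smul (φ : LogChart d D) (x a : Fin d → ℂ) (c : ℂ) : φ.vec x (c • a) = c • φ.vec x a := by
  funext k
  simp only [vec, Pi.smul_apply, smul_eq_mul]
  ring

lemma contDiff_vec (φ : LogChart d D) : ContDiff ℝ ∞ fun p : Cpair d => φ.vec p.1 p.2 := by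
  rw [contDiff_pi]
  intro k
  have h1 : ContDiff ℝ ∞ fun x => φ.weight x k :=
    ((φ.contDiff_weight k).restrict_scalars ℝ).of_le (by simp)
  exact (h1.comp contDiff_fst).mul ((contDiff_apply ℝ ℂ k).comp contDiff_snd)

open Classical in
/-- The residue along `D i` of the pairing with `d log` of the equation of `D i`. -/
def res (φ : LogChart d D) (i : ι) (a : Fin d → ℂ) : ℂ :=
  if h : ∃ m, φ.label m = some i then a h.choose else 0

lemma res_of_label (φ : LogChart d D) {i : ι} {k : Fin d} (hk : φ.label k = some i)
    (a : Fin d → ℂ) : φ.res i a = a k := by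
  have h : ∃ k, φ.label k = some i := ⟨k, hk⟩
  unfold res
  rw [dif_pos h, φ.label_inj _ _ _ h.choose_spec hk]

lemma res_of_forall_ne (φ : LogChart d D) {i : ι} (h : ¬∃ k, φ.label k = some i) (a : Fin d → ℂ) :
    φ.res i a = 0 := dif_neg h

lemma res_smul (φ : LogChart d D) (i : ι) (c : ℂ) (a : Fin d → ℂ) :
    φ.res i (c • a) = c * φ.res i a := by
  unfold res
  split_ifs <;> simp

lemma contDiff_res (φ : LogChart d D) (i : ι) : ContDiff ℝ ∞ (φ.res i) := by
  unfold res
  split_ifs with h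
  · exact contDiff_apply ℝ ℂ _
  · exact contDiff_const

lemma fderiv_change_injective (φ ψ : LogChart d D) {y : Fin d → ℂ} (hy : y ∈ φ.meet ψ)
    {v : Fin d → ℂ} (hv : fderiv ℂ (fun x => ψ.chart (φ.chart.symm x)) y v = 0) : v = 0 := by
  have h1 : Function.Surjective
      (fderiv ℂ (fun x => ψ.chart (φ.chart.symm x)) y : (Fin d → ℂ) →ₗ[ℂ] (Fin d → ℂ)) :=
    φ.fderiv_change_surjective ψ hy
  exact (LinearMap.injective_iff_surjective.2 h1) (hv.trans (map_zero _).symm)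

end LogChart

namespace ChartCover
variable (𝒰 : ChartCover d D)

/-- The squared length of a tangent vector for a Hermitian metric on `X`. -/
def herm (φ : LogChart d D) (x v : Fin d → ℂ) : ℝ :=
  ∑ b ∈ 𝒰.β, 𝒰.χ b (φ.chart.symm x) *
    ∑ k, ‖fderiv ℂ (fun y => (𝒰.A b).chart (φ.chart.symm y)) x v k‖ ^ 2

/-- The pairing of a vector of `T_X(-log D)` with `∂ log (sigma i)`. -/
def conn (φ : LogChart d D) (i : ι) (x a : Fin d → ℂ) : ℂ :=
  φ.res i a + del (fun y => Real.log (𝒰.density φ i y)) x (φ.vec x a)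

lemma contDiffAt_log_density [T2Space X] (φ : LogChart d D) (i : ι) {y : Fin d → ℂ}
    (hy : y ∈ φ.chart.target) : ContDiffAt ℝ ∞ (fun y => Real.log (𝒰.density φ i y)) y :=
  ((𝒰.contDiffOn_density φ i).contDiffAt (φ.chart.open_target.mem_nhds hy)).log
    (𝒰.density_pos φ i hy).ne'

lemma log_sigma_symm (φ : LogChart d D) (i : ι) {y : Fin d → ℂ} (hy : y ∈ φ.chart.target)
    (h0 : φ.eqn i y ≠ 0) : Real.log (𝒰.sigma i (φ.chart.symm y))
      = Real.log (‖φ.eqn i y‖ ^ 2) + Real.log (𝒰.density φ i y) := by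
  rw [𝒰.sigma_symm φ i hy, Real.log_mul (by simpa using h0) (𝒰.density_pos φ i hy).ne']

lemma eqn_ne_zero (φ : LogChart d D) {i : ι} {y : Fin d → ℂ} (hy : y ∈ φ.chart.target)
    (h : φ.chart.symm y ∉ D i) : φ.eqn i y ≠ 0 := fun h0 => h <| by
  rw [← φ.eqn_eq_zero_iff (φ.chart.map_target hy), φ.chart.right_inv hy, h0]

lemma log_sigma_eventuallyEq (φ : LogChart d D) (i : ι) {y : Fin d → ℂ} (hy : y ∈ φ.chart.target)
    (h : φ.chart.symm y ∉ D i) :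
    (fun y => Real.log (𝒰.sigma i (φ.chart.symm y))) =ᶠ[𝓝 y]
      fun y => Real.log (‖φ.eqn i y‖ ^ 2) + Real.log (𝒰.density φ i y) := by
  filter_upwards [φ.chart.open_target.mem_nhds hy,
    (φ.contDiff_eqn i).continuous.continuousAt.eventually_ne (eqn_ne_zero φ hy h)] with x hx hx0
  exact 𝒰.log_sigma_symm φ i hx hx0

lemma contDiffAt_log_eqn (φ : LogChart d D) (i : ι) {y : Fin d → ℂ} (h0 : φ.eqn i y ≠ 0) :
    ContDiffAt ℝ ∞ (fun y => Real.log (‖φ.eqn i y‖ ^ 2)) y :=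
  ((((φ.contDiff_eqn i).contDiffAt.restrict_scalars ℝ).of_le (by simp)).norm_sq ℝ).log
    (by simpa using h0)

lemma contDiffAt_log_sigma [T2Space X] (φ : LogChart d D) (i : ι) {y : Fin d → ℂ}
    (hy : y ∈ φ.chart.target) (h : φ.chart.symm y ∉ D i) :
    ContDiffAt ℝ ∞ (fun y => Real.log (𝒰.sigma i (φ.chart.symm y))) y :=
  ((contDiffAt_log_eqn φ i (eqn_ne_zero φ hy h)).add
    (𝒰.contDiffAt_log_density φ i hy)).congr_of_eventuallyEq (𝒰.log_sigma_eventuallyEq φ i hy h)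

lemma conn_eq [T2Space X] (φ : LogChart d D) (i : ι) {x : Fin d → ℂ} (hx : x ∈ φ.chart.target)
    (h : φ.chart.symm x ∉ D i) (a : Fin d → ℂ) : 𝒰.conn φ i x a
      = del (fun y => Real.log (𝒰.sigma i (φ.chart.symm y))) x (φ.vec x a) := by
  have h0 := eqn_ne_zero φ hx h
  rw [del_congr (𝒰.log_sigma_eventuallyEq φ i hx h),
    del_add ((contDiffAt_log_eqn φ i h0).differentiableAt (by simp))
      ((𝒰.contDiffAt_log_density φ i hx).differentiableAt (by simp)), conn]
  congr 1
  by_cases hm : ∃ m, φ.label m = some i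
  · obtain ⟨m, hm⟩ := hm
    have hx0 : x m ≠ 0 := by rwa [φ.eqn_of_label hm] at h0
    have h1 := del_log_norm_sq (ContinuousLinearMap.proj (R := ℂ) (φ := fun _ : Fin d => ℂ) m)
      (p := x) hx0 (φ.vec x a)
    simp only [φ.eqn_of_label hm, φ.res_of_label hm]
    refine Eq.trans ?_ h1.symm
    simp [LogChart.vec, LogChart.weight, hm, hx0]
  · simp only [φ.eqn_of_forall_ne hm, φ.res_of_forall_ne hm]
    simp [del]

lemma herm_nonneg (φ : LogChart d D) (x v : Fin d → ℂ) : 0 ≤ 𝒰.herm φ x v :=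
  Finset.sum_nonneg fun b _ => mul_nonneg (𝒰.nonneg b _) (by positivity)

lemma herm_smul (φ : LogChart d D) (x v : Fin d → ℂ) (c : ℂ) :
    𝒰.herm φ x (c • v) = ‖c‖ ^ 2 * 𝒰.herm φ x v := by
  unfold herm
  simp only [map_smul, Pi.smul_apply, smul_eq_mul, norm_mul, mul_pow, Finset.mul_sum]
  refine Finset.sum_congr rfl fun b _ => Finset.sum_congr rfl fun k _ => ?_
  ring

lemma conn_smul (φ : LogChart d D) (i : ι) (x a : Fin d → ℂ) (c : ℂ) :
    𝒰.conn φ i x (c • a) = c * 𝒰.conn φ i x a := by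
  unfold conn
  rw [φ.res_smul, φ.vec_smul, del_smul]
  ring

lemma eq_zero_of_herm (φ : LogChart d D) {x v : Fin d → ℂ} (hx : x ∈ φ.chart.target)
    (h : 𝒰.herm φ x v = 0) : v = 0 := by
  obtain ⟨b, hb, h1⟩ := 𝒰.cover (φ.chart.symm x)
  have hs : φ.chart.symm x ∈ (𝒰.A b).chart.source := by
    refine 𝒰.subset b ?_
    by_contra h
    rw [𝒰.eq_zero b _ h] at h1
    exact zero_ne_one h1
  have h2 := (Finset.sum_eq_zero_iff_of_nonneg fun b _ =>
    mul_nonneg (𝒰.nonneg b _) (by positivity)).1 h b hb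
  rw [h1, one_mul] at h2
  refine φ.fderiv_change_injective (𝒰.A b) ⟨hx, hs⟩ (funext fun k => ?_)
  have h3 := (Finset.sum_eq_zero_iff_of_nonneg fun k _ => by positivity).1 h2 k (Finset.mem_univ k)
  simpa using h3

lemma contDiffAt_herm [T2Space X] (φ : LogChart d D) {p : Cpair d} (hp : p.1 ∈ φ.chart.target) :
    ContDiffAt ℝ ∞ (fun p : Cpair d => 𝒰.herm φ p.1 (φ.vec p.1 p.2)) p := by
  refine ContDiffAt.sum fun b _ => ?_
  refine 𝒰.contDiffAt_mul b φ contDiffAt_fst hp fun hs => ?_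
  refine ContDiffAt.sum fun k _ => ?_
  have h1 := φ.contDiffAt_change (𝒰.A b) hp hs
  have h2 : ContDiffAt ℂ ω (fun q : Cpair d =>
      fderiv ℂ (fun y => (𝒰.A b).chart (φ.chart.symm y)) q.1) p :=
    ContDiffAt.comp p (f := Prod.fst)
      (g := fderiv ℂ (fun y => (𝒰.A b).chart (φ.chart.symm y)))
      (h1.fderiv_right (m := ω) (by simp)) contDiffAt_fst
  have h3 : ContDiffAt ℂ ω (fun q : Cpair d => φ.vec q.1 q.2) p := by
    rw [contDiffAt_pi]
    intro j
    exact ((φ.contDiff_weight j).contDiffAt.comp p contDiffAt_fst).mul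
      ((contDiff_apply ℂ ℂ j).contDiffAt.comp p contDiffAt_snd)
  have h4 := contDiffAt_pi.1 (h2.clm_apply h3) k
  exact ((h4.restrict_scalars ℝ).of_le (by simp)).norm_sq ℝ

lemma contDiffAt_conn [T2Space X] (φ : LogChart d D) (i : ι) {p : Cpair d}
    (hp : p.1 ∈ φ.chart.target) : ContDiffAt ℝ ∞ (fun p : Cpair d => 𝒰.conn φ i p.1 p.2) p :=
  ((φ.contDiff_res i).contDiffAt.comp p contDiffAt_snd).add
    (contDiffOn_del (𝒰.contDiffAt_log_density φ i hp) contDiffAt_fst φ.contDiff_vec.contDiffAt)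

variable [Fintype ι]

/-- The squared length of a vector of `T_X(-log D)`. -/
def normSq (φ : LogChart d D) (x a : Fin d → ℂ) : ℝ :=
  𝒰.herm φ x (φ.vec x a) + ∑ i, ‖𝒰.conn φ i x a‖ ^ 2

/-- The squared length in terms of tangent vectors, at points over the complement of `D`. -/
def normSq' (φ : LogChart d D) (x v : Fin d → ℂ) : ℝ :=
  𝒰.herm φ x v + ∑ i, ‖del (fun y => Real.log (𝒰.sigma i (φ.chart.symm y))) x v‖ ^ 2

lemma normSq_eq [T2Space X] (φ : LogChart d D) {x : Fin d → ℂ} (hx : x ∈ φ.chart.target)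
    (h : φ.chart.symm x ∉ ⋃ i, D i) (a : Fin d → ℂ) :
    𝒰.normSq φ x a = 𝒰.normSq' φ x (φ.vec x a) := by
  unfold normSq normSq'
  congr 1
  exact Finset.sum_congr rfl fun i _ => by
    rw [𝒰.conn_eq φ i hx fun hi => h (mem_iUnion.2 ⟨i, hi⟩)]

lemma normSq_nonneg (φ : LogChart d D) (x a : Fin d → ℂ) : 0 ≤ 𝒰.normSq φ x a :=
  add_nonneg (𝒰.herm_nonneg φ _ _) (by positivity)

lemma normSq_pos (φ : LogChart d D) {x a : Fin d → ℂ} (hx : x ∈ φ.chart.target) (ha : a ≠ 0) :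
    0 < 𝒰.normSq φ x a := by
  refine lt_of_le_of_ne (𝒰.normSq_nonneg φ x a) fun h => ha ?_
  have hs : 0 ≤ ∑ i, ‖𝒰.conn φ i x a‖ ^ 2 := by positivity
  have h1 := 𝒰.herm_nonneg φ x (φ.vec x a)
  have h' : 𝒰.herm φ x (φ.vec x a) + ∑ i, ‖𝒰.conn φ i x a‖ ^ 2 = 0 := h.symm
  have hv : φ.vec x a = 0 := 𝒰.eq_zero_of_herm φ hx (by linarith)
  have h3 : ∑ i, ‖𝒰.conn φ i x a‖ ^ 2 = 0 := by linarith
  funext k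
  cases hk : φ.label k with
  | none =>
    have := congrFun hv k
    simpa [LogChart.vec, LogChart.weight, hk] using this
  | some i =>
    have h4 := (Finset.sum_eq_zero_iff_of_nonneg fun i _ => by positivity).1 h3 i
      (Finset.mem_univ i)
    have h5 : 𝒰.conn φ i x a = 0 := by simpa using h4
    rw [conn, hv, φ.res_of_label hk] at h5
    simpa [del] using h5

lemma normSq'_change [T2Space X] (φ ψ : LogChart d D) {y : Fin d → ℂ} (hy : y ∈ φ.meet ψ)
    (h : φ.chart.symm y ∉ ⋃ i, D i) (v : Fin d → ℂ) :
    𝒰.normSq' ψ (ψ.chart (φ.chart.symm y))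
      (fderiv ℂ (fun x => ψ.chart (φ.chart.symm x)) y v) = 𝒰.normSq' φ y v := by
  have ht := ψ.chart.map_source hy.2
  have hτ := (φ.contDiffAt_change ψ hy.1 hy.2).differentiableAt (by simp)
  have hinv : ∀ᶠ x in 𝓝 y, ψ.chart.symm (ψ.chart (φ.chart.symm x)) = φ.chart.symm x := by
    filter_upwards [(φ.isOpen_meet ψ).mem_nhds hy] with x hx using ψ.chart.left_inv hx.2
  unfold normSq' herm
  congr 1
  · refine Finset.sum_congr rfl fun b _ => ?_
    rw [hinv.self_of_nhds]
    by_cases hs : φ.chart.symm y ∈ (𝒰.A b).chart.source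
    · congr 1
      have h1 := (ψ.contDiffAt_change (𝒰.A b) ht
        (by rwa [hinv.self_of_nhds])).differentiableAt (by simp)
      have h2 := HasFDerivAt.comp (g := fun x => (𝒰.A b).chart (ψ.chart.symm x))
        (f := fun x => ψ.chart (φ.chart.symm x)) y h1.hasFDerivAt hτ.hasFDerivAt
      have h3 : fderiv ℂ (fun x => (𝒰.A b).chart (φ.chart.symm x)) y = _ :=
        (h2.congr_of_eventuallyEq (by
          filter_upwards [hinv] with x hx
          simp only [Function.comp, hx])).fderiv
      rw [h3]
      rfl
    · rw [𝒰.eq_zero b _ fun h => hs (𝒰.subset b h), zero_mul, zero_mul]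
  · refine Finset.sum_congr rfl fun i _ => ?_
    have hi : ψ.chart.symm (ψ.chart (φ.chart.symm y)) ∉ D i := by
      rw [hinv.self_of_nhds]
      exact fun hi => h (mem_iUnion.2 ⟨i, hi⟩)
    have h1 := del_comp (τ := fun x => ψ.chart (φ.chart.symm x))
      ((𝒰.contDiffAt_log_sigma ψ i ht hi).differentiableAt (by simp)) hτ v
    rw [← h1]
    congr 2
    refine del_congr ?_ v
    filter_upwards [hinv] with x hx
    rw [hx]

/-- The metric on `L` given by a Hermitian metric on `T_X(-log D)`. -/
def metric [T2Space X] : LogMetric d D where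
  norm φ p := Real.sqrt (𝒰.normSq φ p.1 p.2)
  pos φ p hp := Real.sqrt_pos.2 (𝒰.normSq_pos φ hp.1 hp.2)
  smooth φ p hp := by
    refine ContDiffAt.contDiffWithinAt (ContDiffAt.sqrt ?_ (𝒰.normSq_pos φ hp.1 hp.2).ne')
    exact (𝒰.contDiffAt_herm φ hp.1).add
      (ContDiffAt.sum fun i _ => (𝒰.contDiffAt_conn φ i hp.1).norm_sq ℝ)
  norm_smul φ x hx c a := by
    have : 𝒰.normSq φ x (c • a) = ‖c‖ ^ 2 * 𝒰.normSq φ x a := by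
      unfold normSq
      simp only [φ.vec_smul, 𝒰.herm_smul, 𝒰.conn_smul, norm_mul, mul_pow, mul_add, Finset.mul_sum]
    rw [this, Real.sqrt_mul (by positivity), Real.sqrt_sq (norm_nonneg c)]
  compat φ ψ p hp := by
    obtain ⟨hp, hs, hD⟩ := hp
    have hinv := ψ.chart.left_inv hs
    have h1 : ψ.vec (φ.transition ψ p).1 (φ.transition ψ p).2
        = fderiv ℂ (fun x => ψ.chart (φ.chart.symm x)) p.1 (φ.vec p.1 p.2) := by
      funext k
      exact mul_div_cancel₀ _ (ψ.weight_ne_zero hs hD k)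
    have h2 : (φ.transition ψ p).1 = ψ.chart (φ.chart.symm p.1) := rfl
    rw [𝒰.normSq_eq ψ (x := (φ.transition ψ p).1) (ψ.chart.map_source hs) (by rwa [h2, hinv]),
      h1, 𝒰.normSq_eq φ hp.1 hD]
    exact congrArg _ (𝒰.normSq'_change φ ψ ⟨hp.1, hs⟩ hD _)

end ChartCover

namespace IsLogDisc
variable {f : ℂ → X} {φ : LogChart d D} {z : ℂ}

lemma contDiffAt_log_sigma [T2Space X] (hf : IsLogDisc d D f) (𝒰 : ChartCover d D)
    (hD : IsSNC d D) (i : ι) (hz : z ∈ ball (0 : ℂ) 1) :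
    ContDiffAt ℝ 2 (fun w => Real.log (𝒰.sigma i (f w))) z := by
  obtain ⟨φ, hφ⟩ := hD (f z)
  have h1 := 𝒰.contDiffAt_log_sigma φ i (φ.chart.map_source hφ) (by
    rw [φ.chart.left_inv hφ]
    exact fun hi => hf.avoids z hz (mem_iUnion.2 ⟨i, hi⟩))
  have h2 : ContDiffAt ℝ 2 (fun w => φ.chart (f w)) z :=
    (φ.analyticAt_chart hf.hol hz hφ).contDiffAt.restrict_scalars ℝ
  refine (ContDiffAt.comp z (h1.of_le (WithTop.coe_le_coe.2 le_top)) h2).congr_of_eventuallyEq ?_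
  filter_upwards [hf.hol.eventually_mem_source hz hφ] with w hw
  simp only [Function.comp, φ.chart.left_inv hw.2]

/-- The length of the logarithmic derivative of a disc. -/
lemma metric_lift [T2Space X] [Fintype ι] (hf : IsLogDisc d D f) (𝒰 : ChartCover d D)
    (hz : z ∈ ball (0 : ℂ) 1) (hφ : f z ∈ φ.chart.source) :
    𝒰.metric.norm φ (φ.lift f z) ^ 2
      = ∑ b ∈ 𝒰.β, 𝒰.χ b (f z) * ∑ k, ‖deriv (fun w => (𝒰.A b).chart (f w)) z k‖ ^ 2
        + ∑ i, gradSq (fun w => Real.log (𝒰.sigma i (f w))) z / 4 := by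
  have hD : φ.chart.symm (φ.chart (f z)) ∉ ⋃ i, D i := by
    rw [φ.chart.left_inv hφ]
    exact hf.avoids z hz
  have h1 : 𝒰.metric.norm φ (φ.lift f z) ^ 2 = 𝒰.normSq φ (φ.lift f z).1 (φ.lift f z).2 :=
    Real.sq_sqrt (𝒰.normSq_nonneg φ _ _)
  have h2 : φ.vec (φ.lift f z).1 (φ.lift f z).2 = deriv (fun w => φ.chart (f w)) z :=
    hf.weight_mul_lift hz hφ
  have ht := φ.chart.map_source hφ
  rw [h1, 𝒰.normSq_eq φ (x := (φ.lift f z).1) ht hD, h2]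
  change 𝒰.normSq' φ (φ.chart (f z)) _ = _
  unfold ChartCover.normSq' ChartCover.herm
  rw [φ.chart.left_inv hφ]
  congr 1
  · refine Finset.sum_congr rfl fun b _ => ?_
    by_cases hs : f z ∈ (𝒰.A b).chart.source
    · rw [hf.deriv_change hz hφ hs]
    · rw [𝒰.eq_zero b _ fun h => hs (𝒰.subset b h), zero_mul, zero_mul]
  · refine Finset.sum_congr rfl fun i _ => ?_
    rw [← norm_del_sq]
    have h3 := del_comp (τ := fun w => φ.chart (f w)) (v := (1 : ℂ))
      ((𝒰.contDiffAt_log_sigma φ i ht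
        fun hi => hD (mem_iUnion.2 ⟨i, hi⟩)).differentiableAt (by simp))
      (φ.analyticAt_chart hf.hol hz hφ).differentiableAt
    have h4 : del (fun w => Real.log (𝒰.sigma i (f w))) z 1 = del (fun w =>
        Real.log (𝒰.sigma i (φ.chart.symm (φ.chart (f w))))) z 1 := by
      refine del_congr ?_ 1
      filter_upwards [hf.hol.eventually_mem_source hz hφ] with w hw
      rw [φ.chart.left_inv hw.2]
    rw [h4, h3]
    simp [fderiv_eq_smul_deriv]

end IsLogDisc

end

/-! ### Estimates along discs, uniform in the disc -/

section

variable {d : ℕ} {X : Type*} [TopologicalSpace X] [ChartedSpace (Fin d → ℂ) X] {ι : Type*}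
  {D : ι → Set X}

lemma norm_inv_norm_smul {V : Type*} [NormedAddCommGroup V] [NormedSpace ℂ V] {a : V} (ha : a ≠ 0) :
    ‖((‖a‖⁻¹ : ℝ) : ℂ) • a‖ = 1 := by
  rw [norm_smul, norm_real, norm_inv, norm_norm, inv_mul_cancel₀ (norm_ne_zero_iff.2 ha)]

/-- `e` is the continuous density of the pullback of the positive form `η` by the logarithmic
derivative of `f`. -/
structure IsEnergy (η : logForms d D) (f : ℂ → X) (e : ℂ → ℝ) : Prop where
  continuousOn : ContinuousOn e (ball 0 1)
  nonneg : ∀ z ∈ ball (0 : ℂ) 1, 0 ≤ e z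
  current : ∀ r, 0 ≤ r → r < 1 → discCurrent f r η = (nev e r : ℂ)
  eq : ∀ z ∈ ball (0 : ℂ) 1, ∀ φ : LogChart d D, f z ∈ φ.chart.source → (φ.lift f z).2 ≠ 0 →
    e z = 2 * (η.1 φ (φ.lift f z) (deriv (φ.lift f) z) (deriv (φ.lift f) z)).re

lemma IsLogDisc.exists_isEnergy (hD : IsSNC d D) {η : logForms d D} (hη : IsPositiveForm η)
    {f : ℂ → X} (hf : IsLogDisc d D f) : ∃ e, IsEnergy η f e := by
  obtain ⟨e, h1, h2, h3, h4⟩ := hf.exists_energy hD hη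
  exact ⟨e, h1, h2, h3, h4⟩

/-- A positive form bounds the horizontal part of tangent vectors of `P`. -/
lemma IsPositiveForm.exists_bound {η : logForms d D} (hη : IsPositiveForm η) (φ : LogChart d D)
    {L : Set (Fin d → ℂ)} (hL : IsCompact L) (hLt : L ⊆ φ.chart.target) :
    ∃ δ : ℝ, 0 < δ ∧ ∀ x ∈ L, ∀ a : Fin d → ℂ, a ≠ 0 → ∀ v : Cpair d,
      δ * ‖v.1‖ ^ 2 ≤ (η.1 φ (x, a) v v).re := by
  -- normalised vectors orthogonal to the Euler field
  let Q : Set (Cpair d × Cpair d) := {q | q.1.1 ∈ L ∧ ‖q.1.2‖ = 1 ∧ ‖q.2‖ = 1 ∧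
    ∑ k, conj (q.1.2 k) * q.2.2 k = 0}
  have hQ : IsCompact Q := by
    have h1 : IsCompact ((L ×ˢ sphere (0 : Fin d → ℂ) 1) ×ˢ sphere (0 : Cpair d) 1) :=
      (hL.prod (isCompact_sphere _ _)).prod (isCompact_sphere _ _)
    have h2 : IsClosed {q : Cpair d × Cpair d | ∑ k, conj (q.1.2 k) * q.2.2 k = 0} :=
      isClosed_eq (by fun_prop) continuous_const
    refine (h1.inter_right h2).of_isClosed_subset ?_ ?_
    · have : Q = ((L ×ˢ sphere (0 : Fin d → ℂ) 1) ×ˢ sphere (0 : Cpair d) 1) ∩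
          {q : Cpair d × Cpair d | ∑ k, conj (q.1.2 k) * q.2.2 k = 0} := by
        ext q
        simp [Q, and_assoc]
      rw [this]
      exact h1.isClosed.inter h2
    · rintro q ⟨h1, h2, h3, h4⟩
      exact ⟨⟨⟨h1, by simpa using h2⟩, by simpa using h3⟩, h4⟩
  have hne : ∀ a : Fin d → ℂ, ‖a‖ = 1 → a ≠ 0 := fun a ha h => by simp [h] at ha
  have hc : ContinuousOn (fun q : Cpair d × Cpair d => (η.1 φ q.1 q.2 q.2).re) Q := by
    refine continuous_re.comp_continuousOn ((continuousOn_logForm η φ).comp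
      (f := fun q : Cpair d × Cpair d => (q.1, q.2, q.2)) (by fun_prop) ?_)
    rintro q ⟨h1, h2, -, -⟩
    exact ⟨⟨hLt h1, hne _ h2⟩, mem_univ _⟩
  have hself : ∀ a : Fin d → ℂ, a ≠ 0 → ∑ k, conj (a k) * a k ≠ 0 := by
    intro a ha h0
    have h1 : ∑ k, ‖a k‖ ^ 2 = 0 := by
      have h2 : ∑ k, conj (a k) * a k = ((∑ k, ‖a k‖ ^ 2 : ℝ) : ℂ) := by
        push_cast
        exact Finset.sum_congr rfl fun k _ => Complex.conj_mul' (a k)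
      rw [h2] at h0
      exact_mod_cast h0
    refine ha (funext fun k => ?_)
    have := (Finset.sum_eq_zero_iff_of_nonneg fun k _ => by positivity).1 h1 k (Finset.mem_univ k)
    simpa using this
  obtain ⟨δ, hδ, hmin⟩ := hQ.exists_forall_le' hc (a := 0) (by
    rintro ⟨p, v⟩ ⟨h1, h2, h3, h4⟩
    have hp : p ∈ φ.dom := ⟨hLt h1, hne _ h2⟩
    obtain ⟨k1, k2, k3⟩ := hη φ p hp v
    refine lt_of_le_of_ne k1 fun h => ?_
    obtain ⟨c, hc⟩ := k3 (Complex.ext h.symm k2)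
    simp only [hc, Pi.smul_apply, smul_eq_mul] at h4
    have h5 : ∑ k, conj (p.2 k) * (c * p.2 k) = c * ∑ k, conj (p.2 k) * p.2 k := by
      rw [Finset.mul_sum]
      exact Finset.sum_congr rfl fun k _ => by ring
    rw [h5] at h4
    have hc0 := (mul_eq_zero.1 h4).resolve_right (hself _ hp.2)
    rw [hc, hc0] at h3
    simp at h3)
  have key : ∀ x ∈ L, ∀ a : Fin d → ℂ, ‖a‖ = 1 → ∀ v : Cpair d, ∑ k, conj (a k) * v.2 k = 0 →
      δ * ‖v‖ ^ 2 ≤ (η.1 φ (x, a) v v).re := by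
    intro x hx a ha v hv
    by_cases h0 : v = 0
    · simp [h0]
    have hn : 0 < ‖v‖ := norm_pos_iff.2 h0
    let t : ℂ := ((‖v‖⁻¹ : ℝ) : ℂ)
    have h1 := hmin ((x, a), t • v) ⟨hx, ha, by
      exact norm_inv_norm_smul h0, by
      have : ∑ k, conj (a k) * (t • v).2 k = t * ∑ k, conj (a k) * v.2 k := by
        rw [Finset.mul_sum]
        refine Finset.sum_congr rfl fun k _ => ?_
        simp only [Prod.smul_snd, Pi.smul_apply, smul_eq_mul]
        ring
      rw [this, hv, mul_zero]⟩
    simp only [map_smul, LinearMap.map_smulₛₗ, LinearMap.smul_apply, smul_eq_mul] at h1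
    have h2 : t * (conj t * η.1 φ (x, a) v v) = ((‖v‖⁻¹ ^ 2 : ℝ) : ℂ) * η.1 φ (x, a) v v := by
      simp only [t, conj_ofReal]
      push_cast
      ring
    have h3 : conj t * (t * η.1 φ (x, a) v v) = t * (conj t * η.1 φ (x, a) v v) := by ring
    rw [h3, h2, re_ofReal_mul] at h1
    have h4 := mul_le_mul_of_nonneg_right h1 (sq_nonneg ‖v‖)
    have h5 : ‖v‖⁻¹ ^ 2 * (η.1 φ (x, a) v v).re * ‖v‖ ^ 2 = (η.1 φ (x, a) v v).re := by
      field_simp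
    linarith
  refine ⟨δ, hδ, fun x hx a ha v => ?_⟩
  have hn : 0 < ‖a‖ := norm_pos_iff.2 ha
  let c : ℂ := ((‖a‖⁻¹ : ℝ) : ℂ)
  have hc0 : c ≠ 0 := by
    simp only [c, ne_eq, ofReal_eq_zero, inv_eq_zero]
    exact hn.ne'
  have hca : ‖c • a‖ = 1 := by
    exact norm_inv_norm_smul ha
  rw [← η.2.2.2.1 φ (x, a) ⟨hLt hx, ha⟩ c hc0 v v]
  -- normalise `a`, then project `v` along the Euler field, which the form annihilates
  let s : ℂ := -(∑ k, conj ((c • a) k) * (c • v.2) k) / ∑ k, conj ((c • a) k) * (c • a) k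
  rw [← logForm_add_euler η φ (p := (x, c • a)) ⟨hLt hx, hne _ hca⟩ (v.1, c • v.2) s]
  have h1 := key x hx (c • a) hca ((v.1, c • v.2) + (0, s • c • a)) (by
    have h2 := hself _ (hne _ hca)
    have h3 : ∑ k, conj ((c • a) k) * (((v.1, c • v.2) + (0, s • c • a) : Cpair d).2 k)
        = ∑ k, conj ((c • a) k) * (c • v.2) k + s * ∑ k, conj ((c • a) k) * (c • a) k := by
      rw [Finset.mul_sum, ← Finset.sum_add_distrib]
      refine Finset.sum_congr rfl fun k _ => ?_
      simp only [Prod.snd_add, Pi.add_apply, Pi.smul_apply, smul_eq_mul]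
      ring
    rw [h3, div_mul_cancel₀ _ h2, add_neg_cancel])
  refine le_trans ?_ h1
  have h2 : ‖v.1‖ ≤ ‖(v.1, c • v.2) + (0, s • c • a)‖ := by
    refine le_trans ?_ (norm_fst_le _)
    simp
  gcongr

/-- The energy density bounds the speed of a disc in a chart. -/
lemma IsPositiveForm.exists_speed_bound {η : logForms d D} (hη : IsPositiveForm η)
    (φ : LogChart d D) {K : Set X} (hK : IsCompact K) (hKs : K ⊆ φ.chart.source) :
    ∃ C : ℝ, 0 < C ∧ ∀ f e, IsLogDisc d D f → IsEnergy η f e → ∀ z ∈ ball (0 : ℂ) 1, f z ∈ K →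
      ‖deriv (fun w => φ.chart (f w)) z‖ ^ 2 ≤ C * e z := by
  have hL : IsCompact (φ.chart '' K) := hK.image_of_continuousOn (φ.chart.continuousOn.mono hKs)
  obtain ⟨δ, hδ, h⟩ := hη.exists_bound φ hL (by
    rintro _ ⟨x, hx, rfl⟩
    exact φ.chart.map_source (hKs hx))
  refine ⟨1 / (2 * δ), by positivity, fun f e hf he z hz hzK => ?_⟩
  have hφ := hKs hzK
  by_cases h0 : (φ.lift f z).2 = 0
  · rw [(hf.lift_snd_eq_zero_iff hz hφ).1 h0, norm_zero]
    have := he.nonneg z hz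
    rw [zero_pow two_ne_zero]
    positivity
  · have h1 := h (φ.chart (f z)) (mem_image_of_mem _ hzK) (φ.lift f z).2 h0 (deriv (φ.lift f) z)
    have h2 : (deriv (φ.lift f) z).1 = deriv (fun w => φ.chart (f w)) z := by
      have h3 := (φ.analyticAt_chart hf.hol hz hφ).differentiableAt.hasDerivAt.prodMk
        (hf.analyticAt_lift_snd hz hφ).differentiableAt.hasDerivAt
      have h4 : deriv (φ.lift f) z = _ := h3.deriv
      rw [h4]
    rw [h2] at h1
    have h5 : e z = 2 * (η.1 φ (φ.chart (f z), (φ.lift f z).2) (deriv (φ.lift f) z)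
      (deriv (φ.lift f) z)).re := he.eq z hz φ hφ h0
    rw [h5]
    rw [div_mul_eq_mul_div, one_mul, le_div_iff₀ (by positivity)]
    linarith

lemma levi_bound {u : (Fin d → ℂ) → ℝ} {U L : Set (Fin d → ℂ)} (hU : IsOpen U)
    (hu : ContDiffOn ℝ ∞ u U) (hL : IsCompact L) (hLU : L ⊆ U) :
    ∃ C : ℝ, 0 ≤ C ∧ ∀ x ∈ L, ∀ v, |(levi u x v v).re| ≤ C * ‖v‖ ^ 2 := by
  have h1 := continuousOn_sesquilinear (A := fun p => levi u p) (s := U)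
    fun v w => (levi_contDiffOn hU hu v w).continuousOn
  have hQ : IsCompact (L ×ˢ sphere (0 : Fin d → ℂ) 1) := hL.prod (isCompact_sphere _ _)
  have h2 : ContinuousOn (fun q : (Fin d → ℂ) × (Fin d → ℂ) => (levi u q.1 q.2 q.2).re)
      (L ×ˢ sphere (0 : Fin d → ℂ) 1) := by
    refine continuous_re.comp_continuousOn (h1.comp
      (f := fun q : (Fin d → ℂ) × (Fin d → ℂ) => (q.1, q.2, q.2)) (by fun_prop) ?_)
    rintro q ⟨h1, -⟩
    exact ⟨hLU h1, mem_univ _⟩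
  obtain ⟨C, hC⟩ := hQ.exists_bound_of_continuousOn h2
  refine ⟨max C 0, le_max_right _ _, fun x hx v => ?_⟩
  by_cases h0 : v = 0
  · simp [h0]
  have hn : 0 < ‖v‖ := norm_pos_iff.2 h0
  let t : ℂ := ((‖v‖⁻¹ : ℝ) : ℂ)
  have h3 := hC (x, t • v) ⟨hx, by
    rw [mem_sphere_zero_iff_norm]
    exact norm_inv_norm_smul h0⟩
  simp only [map_smul, LinearMap.map_smulₛₗ, LinearMap.smul_apply, smul_eq_mul] at h3
  have h4 : t * (conj t * levi u x v v) = ((‖v‖⁻¹ ^ 2 : ℝ) : ℂ) * levi u x v v := by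
    simp only [t, conj_ofReal]
    push_cast
    ring
  have h4' : conj t * (t * levi u x v v) = t * (conj t * levi u x v v) := by ring
  first
    | rw [h4, re_ofReal_mul] at h3
    | rw [h4', h4, re_ofReal_mul] at h3
  rw [Real.norm_eq_abs, abs_mul, abs_of_nonneg (by positivity)] at h3
  have h5 := mul_le_mul_of_nonneg_right (h3.trans (le_max_left C 0)) (sq_nonneg ‖v‖)
  have h6 : ‖v‖⁻¹ ^ 2 * |(levi u x v v).re| * ‖v‖ ^ 2 = |(levi u x v v).re| := by field_simp
  linarith

lemma ChartCover.exists_lap_bound [T2Space X] (𝒰 : ChartCover d D) {η : logForms d D}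
    (hη : IsPositiveForm η) (i : ι) :
    ∃ C : ℝ, 0 ≤ C ∧ ∀ f e, IsLogDisc d D f → IsEnergy η f e → ∀ z ∈ ball (0 : ℂ) 1,
      |lap (fun w => Real.log (𝒰.sigma i (f w))) z| ≤ C * e z := by
  have hloc : ∀ b, ∃ C : ℝ, 0 ≤ C ∧ ∀ f e, IsLogDisc d D f → IsEnergy η f e →
      ∀ z ∈ ball (0 : ℂ) 1, f z ∈ 𝒰.K b →
      |lap (fun w => Real.log (𝒰.sigma i (f w))) z| ≤ C * e z := by
    intro b
    set φ := 𝒰.A b with hφ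
    obtain ⟨C₁, hC₁, h1⟩ := hη.exists_speed_bound φ (𝒰.isCompact b) (𝒰.subset b)
    have hL : IsCompact (φ.chart '' 𝒰.K b) :=
      (𝒰.isCompact b).image_of_continuousOn (φ.chart.continuousOn.mono (𝒰.subset b))
    have hLt : φ.chart '' 𝒰.K b ⊆ φ.chart.target := by
      rintro _ ⟨x, hx, rfl⟩
      exact φ.chart.map_source (𝒰.subset b hx)
    obtain ⟨C₂, hC₂, h2⟩ := levi_bound φ.chart.open_target
      (u := fun y => Real.log (𝒰.density φ i y))
      (fun y hy => (𝒰.contDiffAt_log_density φ i hy).contDiffWithinAt) hL hLt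
    refine ⟨4 * (C₂ * C₁), by positivity, fun f e hf he z hz hzK => ?_⟩
    have hzs := 𝒰.subset b hzK
    have hx := φ.analyticAt_chart hf.hol hz hzs
    have ht := φ.chart.map_source hzs
    have hDi : φ.chart.symm (φ.chart (f z)) ∉ D i := by
      rw [φ.chart.left_inv hzs]
      exact fun hi => hf.avoids z hz (mem_iUnion.2 ⟨i, hi⟩)
    have he0 := ChartCover.eqn_ne_zero φ ht hDi
    have hxc : ContDiffAt ℝ 2 (fun w => φ.chart (f w)) z := hx.contDiffAt.restrict_scalars ℝ
    have hea : AnalyticAt ℂ (fun w => φ.eqn i (φ.chart (f w))) z :=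
      (φ.contDiff_eqn i).contDiffAt.analyticAt.comp hx
    have hs : (fun w => Real.log (𝒰.sigma i (f w))) =ᶠ[𝓝 z] fun w =>
        Real.log (‖φ.eqn i (φ.chart (f w))‖ ^ 2) + Real.log (𝒰.density φ i (φ.chart (f w))) := by
      filter_upwards [hf.hol.eventually_mem_source hz hzs,
        hx.continuousAt.eventually (𝒰.log_sigma_eventuallyEq φ i ht hDi)] with w hw hw2
      rw [φ.chart.left_inv hw.2] at hw2
      exact hw2
    have hd2 : ContDiffAt ℝ 2 (fun y => Real.log (𝒰.density φ i y)) (φ.chart (f z)) :=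
      (𝒰.contDiffAt_log_density φ i ht).of_le (WithTop.coe_le_coe.2 le_top)
    rw [lap_congr hs, lap_add (w' := fun w => Real.log (𝒰.density φ i (φ.chart (f w))))
      (contDiffAt_log_norm_sq hea he0)
      (ContDiffAt.comp z (g := fun y => Real.log (𝒰.density φ i y))
        (f := fun w => φ.chart (f w)) hd2 hxc),
      lap_log_norm_sq hea he0, zero_add,
      lap_comp (u := fun y => Real.log (𝒰.density φ i y)) hd2 hx, abs_mul]
    have h3 := h2 _ (mem_image_of_mem _ hzK) (deriv (fun w => φ.chart (f w)) z)
    have h4 := h1 f e hf he z hz hzK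
    have h5 := mul_le_mul_of_nonneg_left h4 hC₂
    rw [abs_of_pos (by norm_num : (0 : ℝ) < 4)]
    linarith
  choose C hC h using hloc
  refine ⟨∑ b ∈ 𝒰.β, C b, Finset.sum_nonneg fun b _ => hC b, fun f e hf he z hz => ?_⟩
  obtain ⟨b, hb, hz2⟩ := 𝒰.cover_K (f z)
  refine (h b f e hf he z hz hz2).trans ?_
  exact mul_le_mul_of_nonneg_right (Finset.single_le_sum (fun b _ => hC b) hb) (he.nonneg z hz)

/-- The length of the logarithmic derivative is bounded by the energy density and the gradients of the
logarithms of the distances to the components of `D`. -/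
lemma ChartCover.exists_metric_bound [T2Space X] [Fintype ι] (𝒰 : ChartCover d D)
    {η : logForms d D} (hη : IsPositiveForm η) :
    ∃ C : ℝ, 0 ≤ C ∧ ∀ f e, IsLogDisc d D f → IsEnergy η f e → ∀ z ∈ ball (0 : ℂ) 1,
      ∀ φ : LogChart d D, f z ∈ φ.chart.source → 𝒰.metric.norm φ (φ.lift f z) ^ 2
        ≤ C * e z + ∑ i, gradSq (fun w => Real.log (𝒰.sigma i (f w))) z := by
  choose C hC h using fun b => hη.exists_speed_bound (𝒰.A b) (𝒰.isCompact b) (𝒰.subset b)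
  refine ⟨∑ b ∈ 𝒰.β, d * C b, Finset.sum_nonneg fun b _ => by have := hC b; positivity,
    fun f e hf he z hz φ hφ => ?_⟩
  rw [hf.metric_lift 𝒰 hz hφ, Finset.sum_mul]
  refine add_le_add (Finset.sum_le_sum fun b _ => ?_) (Finset.sum_le_sum fun i _ => ?_)
  · have hez := he.nonneg z hz
    by_cases hzK : f z ∈ 𝒰.K b
    · have h1 := h b f e hf he z hz hzK
      have h2 : ∑ k, ‖deriv (fun w => (𝒰.A b).chart (f w)) z k‖ ^ 2 ≤ d * (C b * e z) := by
        calc _ ≤ ∑ _k : Fin d, C b * e z := Finset.sum_le_sum fun k _ => le_trans (by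
              gcongr
              exact norm_le_pi_norm _ k) h1
          _ = _ := by simp
      have h3 : 0 ≤ ∑ k, ‖deriv (fun w => (𝒰.A b).chart (f w)) z k‖ ^ 2 := by positivity
      nlinarith [𝒰.le_one b (f z), 𝒰.nonneg b (f z)]
    · rw [𝒰.eq_zero b _ hzK, zero_mul]
      have := hC b
      positivity
  · have := gradSq_nonneg (fun w => Real.log (𝒰.sigma i (f w))) z
    linarith

/-- Two smooth metrics on `L` are comparable. -/
lemma LogMetric.exists_le_mul (𝒰 : ChartCover d D) (ρ ρ' : LogMetric d D) :
    ∃ C : ℝ, 0 < C ∧ ∀ f, IsLogDisc d D f → ∀ z ∈ ball (0 : ℂ) 1, ∀ φ : LogChart d D,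
      f z ∈ φ.chart.source → ρ.norm φ (φ.lift f z) ≤ C * ρ'.norm φ (φ.lift f z) := by
  have hloc : ∀ b, ∃ C : ℝ, 0 < C ∧ ∀ x ∈ (𝒰.A b).chart '' 𝒰.K b, ∀ a : Fin d → ℂ,
      ρ.norm (𝒰.A b) (x, a) ≤ C * ρ'.norm (𝒰.A b) (x, a) := by
    intro b
    set φ := 𝒰.A b with hφ
    have hL : IsCompact (φ.chart '' 𝒰.K b) :=
      (𝒰.isCompact b).image_of_continuousOn (φ.chart.continuousOn.mono (𝒰.subset b))
    have hLt : φ.chart '' 𝒰.K b ⊆ φ.chart.target := by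
      rintro _ ⟨x, hx, rfl⟩
      exact φ.chart.map_source (𝒰.subset b hx)
    have hQ : IsCompact ((φ.chart '' 𝒰.K b) ×ˢ sphere (0 : Fin d → ℂ) 1) :=
      hL.prod (isCompact_sphere _ _)
    have hQd : (φ.chart '' 𝒰.K b) ×ˢ sphere (0 : Fin d → ℂ) 1 ⊆ φ.dom := by
      rintro ⟨x, a⟩ ⟨hx, ha⟩
      exact ⟨hLt hx, ne_zero_of_mem_unit_sphere (⟨a, ha⟩ : sphere (0 : Fin d → ℂ) 1)⟩
    obtain ⟨C, hC⟩ := hQ.exists_bound_of_continuousOn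
      (f := fun p => ρ.norm φ p / ρ'.norm φ p)
      (((ρ.smooth φ).continuousOn.mono hQd).div ((ρ'.smooth φ).continuousOn.mono hQd)
        fun p hp => (ρ'.pos φ p (hQd hp)).ne')
    refine ⟨max C 1, by positivity, fun x hx a => ?_⟩
    by_cases h0 : a = 0
    · have h1 := ρ.norm_smul φ x (hLt hx) 0 0
      have h2 := ρ'.norm_smul φ x (hLt hx) 0 0
      rw [smul_zero, norm_zero, zero_mul] at h1 h2
      rw [h0, h1, h2, mul_zero]
    · have hn : 0 < ‖a‖ := norm_pos_iff.2 h0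
      set a₁ : Fin d → ℂ := ((‖a‖⁻¹ : ℝ) : ℂ) • a with ha₁
      have ha : a = ((‖a‖ : ℝ) : ℂ) • a₁ := by
        rw [ha₁, smul_smul, ← ofReal_mul, mul_inv_cancel₀ hn.ne', ofReal_one, one_smul]
      have hQ1 : (x, a₁) ∈ (φ.chart '' 𝒰.K b) ×ˢ sphere (0 : Fin d → ℂ) 1 := by
        refine ⟨hx, ?_⟩
        rw [mem_sphere_zero_iff_norm]
        exact norm_inv_norm_smul h0
      have h1 := ((le_abs_self _).trans (hC _ hQ1)).trans (le_max_left C 1)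
      rw [div_le_iff₀ (ρ'.pos φ _ (hQd hQ1))] at h1
      rw [ha, ρ.norm_smul φ x (hLt hx), ρ'.norm_smul φ x (hLt hx)]
      have h2 := mul_le_mul_of_nonneg_left h1 (norm_nonneg ((‖a‖ : ℝ) : ℂ))
      linarith
  choose C hC h using hloc
  have hpos : ∀ (f : ℂ → X) (z : ℂ) (b : X), f z ∈ (𝒰.A b).chart.source →
      0 ≤ ρ'.norm (𝒰.A b) ((𝒰.A b).lift f z) := by
    intro f z b hs
    by_cases h0 : ((𝒰.A b).lift f z).2 = 0
    · have h2 := ρ'.norm_smul (𝒰.A b) ((𝒰.A b).lift f z).1 ((𝒰.A b).chart.map_source hs) 0 0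
      rw [smul_zero, norm_zero, zero_mul, ← h0] at h2
      exact h2.ge
    · exact (ρ'.pos _ _ ⟨(𝒰.A b).chart.map_source hs, h0⟩).le
  refine ⟨∑ b ∈ 𝒰.β, C b + 1,
    add_pos_of_nonneg_of_pos (Finset.sum_nonneg fun b _ => (hC b).le) one_pos,
    fun f hf z hz φ hφ => ?_⟩
  obtain ⟨b, hb, hz2⟩ := 𝒰.cover_K (f z)
  have hs := 𝒰.subset b hz2
  rw [hf.norm_lift_eq ρ hz hs hφ, hf.norm_lift_eq ρ' hz hs hφ]
  refine (h b _ (mem_image_of_mem _ hz2) _).trans ?_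
  refine mul_le_mul_of_nonneg_right ?_ (hpos f z b hs)
  have := Finset.single_le_sum (f := C) (fun b _ => (hC b).le) hb
  linarith

end

/-! ### The energy dominates the Fubini–Study form -/

section

open scoped Real

/-- Cauchy's estimate along complex lines. -/
lemma norm_fderiv_le_of_closedBall {V E : Type*} [NormedAddCommGroup V] [NormedSpace ℂ V]
    [NormedAddCommGroup E] [NormedSpace ℂ E] {Φ : V → E} {y : V} {ε M : ℝ} (hε : 0 < ε)
    (hd : ∀ x ∈ closedBall y ε, DifferentiableAt ℂ Φ x) (hM : ∀ x ∈ closedBall y ε, ‖Φ x‖ ≤ M)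
    (v : V) : ‖fderiv ℂ Φ y v‖ ≤ M / ε * ‖v‖ := by
  by_cases h0 : v = 0
  · simp [h0]
  have hn : 0 < ‖v‖ := norm_pos_iff.2 h0
  have hr : 0 < ε / ‖v‖ := div_pos hε hn
  have hmem : ∀ t ∈ closedBall (0 : ℂ) (ε / ‖v‖), y + t • v ∈ closedBall y ε := by
    intro t ht
    rw [mem_closedBall_zero_iff] at ht
    rw [mem_closedBall, dist_self_add_left, norm_smul]
    exact (le_div_iff₀ hn).1 ht
  have hline : ∀ t : ℂ, HasDerivAt (fun t : ℂ => y + t • v) v t := fun t => by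
    simpa using ((hasDerivAt_id t).smul_const v).const_add y
  have hg : ∀ t ∈ closedBall (0 : ℂ) (ε / ‖v‖),
      HasDerivAt (fun t : ℂ => Φ (y + t • v)) (fderiv ℂ Φ (y + t • v) v) t := fun t ht =>
    HasFDerivAt.comp_hasDerivAt (l := Φ) (f := fun t : ℂ => y + t • v) t
      (hd _ (hmem t ht)).hasFDerivAt (hline t)
  have h1 : DiffContOnCl ℂ (fun t : ℂ => Φ (y + t • v)) (ball 0 (ε / ‖v‖)) := by
    refine DifferentiableOn.diffContOnCl fun t ht => ?_
    rw [closure_ball _ hr.ne'] at ht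
    exact (hg t ht).differentiableAt.differentiableWithinAt
  have h2 := norm_deriv_le_of_forall_mem_sphere_norm_le hr h1
    (fun t ht => hM _ (hmem t (sphere_subset_closedBall ht)))
  rw [(hg 0 (mem_closedBall_self hr.le)).deriv, zero_smul, add_zero] at h2
  calc _ ≤ M / (ε / ‖v‖) := h2
    _ = M / ε * ‖v‖ := by field_simp

lemma sq_le_mul_norm {N : ℕ} (v : Fin (N + 1) → ℂ) : sq v ≤ (N + 1) * ‖v‖ ^ 2 := by
  unfold sq
  calc _ ≤ ∑ _a : Fin (N + 1), ‖v‖ ^ 2 := Finset.sum_le_sum fun a _ => by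
        gcongr
        exact norm_le_pi_norm v a
    _ = _ := by simp

/-- The Fubini–Study density does not depend on the homogeneous coordinates. -/
lemma lap_log_sq_congr {X : Type*} {N : ℕ} {j : X → Projectivization ℂ (Fin (N + 1) → ℂ)}
    {f : ℂ → X} {G H : ℂ → Fin (N + 1) → ℂ} {z : ℂ} (hG : AnalyticAt ℂ G z)
    (hH : AnalyticAt ℂ H z) (hGf : ∀ᶠ w in 𝓝 z, Lift j (f w) (G w))
    (hHf : ∀ᶠ w in 𝓝 z, Lift j (f w) (H w)) :
    lap (fun w => Real.log (sq (G w))) z = lap (fun w => Real.log (sq (H w))) z := by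
  obtain ⟨a, ha⟩ := Function.ne_iff.1 hHf.self_of_nhds.1
  have ha' : H z a ≠ 0 := ha
  have hπ : ∀ {K : ℂ → Fin (N + 1) → ℂ}, AnalyticAt ℂ K z → AnalyticAt ℂ (fun w => K w a) z :=
    fun {K} hK => ((ContinuousLinearMap.proj (R := ℂ) (φ := fun _ : Fin (N + 1) => ℂ)
      a).analyticAt _).comp hK
  let c : ℂ → ℂ := fun w => G w a / H w a
  have hc : AnalyticAt ℂ c z := (hπ hG).div (hπ hH) ha'
  have hev : ∀ᶠ w in 𝓝 z, c w ≠ 0 ∧ G w = c w • H w := by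
    filter_upwards [hGf, hHf, (hπ hH).continuousAt.eventually_ne ha'] with w h1 h2 h3
    obtain ⟨c', hc', h4⟩ := h2.exists_smul h1
    have h5 : c w = c' := by
      simp only [c, h4, Pi.smul_apply, smul_eq_mul]
      exact mul_div_cancel_right₀ _ h3
    rw [h5]
    exact ⟨hc', h4⟩
  have h1 : (fun w => Real.log (sq (G w))) =ᶠ[𝓝 z]
      fun w => Real.log (‖c w‖ ^ 2) + Real.log (sq (H w)) := by
    filter_upwards [hev, hHf] with w h1 h2
    rw [h1.2, sq_smul, Real.log_mul (by simpa using h1.1) (sq_pos h2.1).ne']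
  have h2 : ContDiffAt ℝ 2 (fun w => Real.log (sq (H w))) z :=
    (((contDiff_sq.of_le (WithTop.coe_le_coe.2 le_top)).contDiffAt).comp z
      (hH.contDiffAt.restrict_scalars ℝ)).log (sq_pos hHf.self_of_nhds.1).ne'
  rw [lap_congr h1, lap_add (contDiffAt_log_norm_sq hc hev.self_of_nhds.1) h2,
    lap_log_norm_sq hc hev.self_of_nhds.1, zero_add]

variable {d : ℕ} {X : Type*} [TopologicalSpace X] [ChartedSpace (Fin d → ℂ) X] {ι : Type*}
  {D : ι → Set X} {N : ℕ} {j : X → Projectivization ℂ (Fin (N + 1) → ℂ)}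

lemma IsEmbedded.exists_dominates [CompactSpace X] [T2Space X] (hj : IsEmbedded d j)
    (hD : IsSNC d D) {η : logForms d D} (hη : IsPositiveForm η) :
    ∃ C : ℝ, 0 ≤ C ∧ ∀ f e, IsLogDisc d D f → IsEnergy η f e → DominatesFubiniStudy j f e C := by
  have hloc : ∀ x : X, ∃ V ∈ 𝓝 x, ∃ C : ℝ, 0 ≤ C ∧ ∀ f e, IsLogDisc d D f → IsEnergy η f e →
      ∀ z ∈ ball (0 : ℂ) 1, f z ∈ V → ∀ G : ℂ → Fin (N + 1) → ℂ, AnalyticAt ℂ G z →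
      (∀ᶠ w in 𝓝 z, Lift j (f w) (G w)) → lap (fun w => Real.log (sq (G w))) z ≤ C * e z := by
    intro x
    obtain ⟨φ, hφ⟩ := hD x
    obtain ⟨U, F, hU, hxU, hF, hFl, -⟩ := hj.2 x
    set Φ : (Fin d → ℂ) → Fin (N + 1) → ℂ := fun y => F (φ.chart.symm y) with hΦ
    have ho : IsOpen (φ.chart.target ∩ φ.chart.symm ⁻¹' U) :=
      φ.chart.isOpen_inter_preimage_symm hU
    have hΦd : DifferentiableOn ℂ Φ (φ.chart.target ∩ φ.chart.symm ⁻¹' U) := by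
      have hc : MDifferentiableOn 𝓘(ℂ, Fin d → ℂ) 𝓘(ℂ, Fin d → ℂ) φ.chart.symm φ.chart.target :=
        (contMDiffOn_symm_of_mem_maximalAtlas φ.mem_atlas).mdifferentiableOn (by simp)
      rw [← mdifferentiableOn_iff_differentiableOn]
      exact hF.comp (hc.mono inter_subset_left) inter_subset_right
    obtain ⟨ε, hε, hεs⟩ := Metric.nhds_basis_closedBall.mem_iff.1 (ho.mem_nhds
      (⟨φ.chart.map_source hφ, by rwa [mem_preimage, φ.chart.left_inv hφ]⟩ :
        φ.chart x ∈ φ.chart.target ∩ φ.chart.symm ⁻¹' U))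
    have hK : IsCompact (closedBall (φ.chart x) ε) := isCompact_closedBall _ _
    have hΦc : ContinuousOn Φ (closedBall (φ.chart x) ε) := hΦd.continuousOn.mono hεs
    obtain ⟨M, hM⟩ := hK.exists_bound_of_continuousOn hΦc
    obtain ⟨m, hm, hmin⟩ := hK.exists_forall_le' (continuous_sq.comp_continuousOn hΦc) (a := 0)
      fun y hy => sq_pos (hFl _ (hεs hy).2).1
    have hM0 : 0 ≤ M := (norm_nonneg _).trans (hM _ (mem_closedBall_self hε.le))
    let K : Set X := φ.chart.symm '' closedBall (φ.chart x) ε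
    have hKs : K ⊆ φ.chart.source := by
      rintro _ ⟨y, hy, rfl⟩
      exact φ.chart.map_target (hεs hy).1
    have hKc : IsCompact K := hK.image_of_continuousOn
      (φ.chart.continuousOn_symm.mono fun y hy => (hεs hy).1)
    obtain ⟨C, hC, hsp⟩ := hη.exists_speed_bound φ hKc hKs
    refine ⟨φ.chart.source ∩ φ.chart ⁻¹' closedBall (φ.chart x) (ε / 2),
      inter_mem (φ.chart.open_source.mem_nhds hφ)
        ((φ.chart.continuousAt hφ) (closedBall_mem_nhds _ (half_pos hε))),
      4 * ((N + 1) * ((M / (ε / 2)) ^ 2 * C)) / m, by positivity,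
      fun f e hf he z hz hzV G hG hGf => ?_⟩
    obtain ⟨hzs, hzb⟩ := hzV
    have hsub : closedBall (φ.chart (f z)) (ε / 2) ⊆ closedBall (φ.chart x) ε := by
      refine closedBall_subset_closedBall' ?_
      have : dist (φ.chart (f z)) (φ.chart x) ≤ ε / 2 := hzb
      linarith
    have hmem := hsub (mem_closedBall_self (half_pos hε).le)
    have hx := φ.analyticAt_chart hf.hol hz hzs
    have hdiff : ∀ y ∈ closedBall (φ.chart x) ε, DifferentiableAt ℂ Φ y := fun y hy =>
      (hΦd y (hεs hy)).differentiableAt (ho.mem_nhds (hεs hy))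
    -- replace `G` by coordinates of the embedding in the chart, with derivative bounded by the speed
    set H : ℂ → Fin (N + 1) → ℂ := fun w => Φ (φ.chart (f w)) with hH
    have hHd : ∀ᶠ w in 𝓝 z, DifferentiableAt ℂ H w := by
      filter_upwards [hx.eventually_analyticAt,
        hx.continuousAt.eventually (ho.eventually_mem (hεs hmem))] with w h1 h2
      exact DifferentiableAt.comp (g := Φ) (f := fun w => φ.chart (f w)) w ((hΦd _ h2).differentiableAt (ho.mem_nhds h2))
        h1.differentiableAt
    have hHa : AnalyticAt ℂ H z := analyticAt_iff_eventually_differentiableAt.2 hHd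
    have hHf : ∀ᶠ w in 𝓝 z, Lift j (f w) (H w) := by
      filter_upwards [hf.hol.eventually_mem_source hz hzs,
        hx.continuousAt.eventually (ho.eventually_mem (hεs hmem))] with w h1 h2
      have h3 := h2.2
      rw [mem_preimage, φ.chart.left_inv h1.2] at h3
      simp only [hH, hΦ, φ.chart.left_inv h1.2]
      exact hFl _ h3
    rw [lap_log_sq_congr hG hHa hGf hHf]
    refine (lap_log_sq_le hHa hHf.self_of_nhds.1).trans ?_
    have h1 : deriv H z = fderiv ℂ Φ (φ.chart (f z)) (deriv (fun w => φ.chart (f w)) z) :=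
      (HasFDerivAt.comp_hasDerivAt (l := Φ) (f := fun w => φ.chart (f w)) z
        (hdiff _ hmem).hasFDerivAt hx.differentiableAt.hasDerivAt).deriv
    have h2 := norm_fderiv_le_of_closedBall (half_pos hε) (fun y hy => hdiff y (hsub hy))
      (fun y hy => hM y (hsub hy)) (deriv (fun w => φ.chart (f w)) z)
    have h3 := hsp f e hf he z hz ⟨φ.chart (f z), hmem, φ.chart.left_inv hzs⟩
    have hez := he.nonneg z hz
    have h4 : sq (deriv H z) ≤ (N + 1) * ((M / (ε / 2)) ^ 2 * C) * e z := by
      calc sq (deriv H z) ≤ (N + 1) * ‖deriv H z‖ ^ 2 := sq_le_mul_norm _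
        _ ≤ (N + 1) * (M / (ε / 2) * ‖deriv (fun w => φ.chart (f w)) z‖) ^ 2 := by
            rw [h1]; gcongr
        _ = (N + 1) * (M / (ε / 2)) ^ 2 * ‖deriv (fun w => φ.chart (f w)) z‖ ^ 2 := by ring
        _ ≤ (N + 1) * (M / (ε / 2)) ^ 2 * (C * e z) := by gcongr
        _ = _ := by ring
    have h5 : m ≤ sq (H z) := hmin _ hmem
    calc 4 * sq (deriv H z) / sq (H z)
        ≤ 4 * ((N + 1) * ((M / (ε / 2)) ^ 2 * C) * e z) / m := by
          gcongr
      _ = _ := by ring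
  choose V hV C hC h using hloc
  obtain ⟨β, -, hβ⟩ := isCompact_univ.elim_nhds_subcover V fun x _ => hV x
  refine ⟨∑ x ∈ β, C x, Finset.sum_nonneg fun x _ => hC x, fun f e hf he z hz G hG hGf => ?_⟩
  obtain ⟨x, hx, hfx⟩ := mem_iUnion₂.1 (hβ (mem_univ (f z)))
  refine (h x f e hf he z hz hfx G hG hGf).trans ?_
  exact mul_le_mul_of_nonneg_right (Finset.single_le_sum (fun x _ => hC x) hx) (he.nonneg z hz)

end

/-! ### Logarithmic estimates on circles -/

section

open scoped Real

lemma circInt_mono {g h : ℂ → ℝ} {ρ s : ℝ} (hs : 0 < s) (hsρ : s < ρ)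
    (hg : ContinuousOn g (ball 0 ρ)) (hh : ContinuousOn h (ball 0 ρ))
    (hle : ∀ z ∈ sphere (0 : ℂ) s, g z ≤ h z) : circInt g s ≤ circInt h s := by
  rw [circInt_eq, circInt_eq]
  refine mul_le_mul_of_nonneg_left ?_ (by positivity)
  exact Real.circleAverage_mono (circleIntegrable_of_continuousOn hg hs hsρ)
    (circleIntegrable_of_continuousOn hh hs hsρ) fun z hz => hle z (by rwa [abs_of_pos hs] at hz)

lemma circInt_const (c s : ℝ) : circInt (fun _ => c) s = 2 * π * c := by
  rw [circInt_eq, Real.circleAverage_const]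

lemma circInt_add {g h : ℂ → ℝ} {ρ s : ℝ} (hs : 0 < s) (hsρ : s < ρ)
    (hg : ContinuousOn g (ball 0 ρ)) (hh : ContinuousOn h (ball 0 ρ)) :
    circInt (fun z => g z + h z) s = circInt g s + circInt h s :=
  intervalIntegral.integral_add (circleIntegrable_of_continuousOn hg hs hsρ)
    (circleIntegrable_of_continuousOn hh hs hsρ)

lemma circInt_const_mul (c : ℝ) (g : ℂ → ℝ) (s : ℝ) :
    circInt (fun z => c * g z) s = c * circInt g s :=
  intervalIntegral.integral_const_mul c _

lemma circInt_sum {κ : Type*} (t : Finset κ) {g : κ → ℂ → ℝ} {ρ s : ℝ} (hs : 0 < s) (hsρ : s < ρ)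
    (hg : ∀ i, ContinuousOn (g i) (ball 0 ρ)) :
    circInt (fun z => ∑ i ∈ t, g i z) s = ∑ i ∈ t, circInt (g i) s :=
  intervalIntegral.integral_finsetSum fun i _ => circleIntegrable_of_continuousOn (hg i) hs hsρ

lemma nev_sum {κ : Type*} (t : Finset κ) {g : κ → ℂ → ℝ} {ρ r : ℝ} (h0 : 0 ≤ r) (hr : r < ρ)
    (hg : ∀ i, ContinuousOn (g i) (ball 0 ρ)) :
    nev (fun z => ∑ i ∈ t, g i z) r = ∑ i ∈ t, nev (g i) r := by
  classical
  induction t using Finset.induction_on with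
  | empty => simp [nev]
  | insert a t ha ih =>
    simp only [Finset.sum_insert ha]
    rw [nev_add (hg a) (continuousOn_finsetSum _ fun i _ => hg i) h0 hr, ih]

/-- Jensen's inequality for the logarithm. -/
lemma circInt_log_le {h : ℂ → ℝ} {ρ s m : ℝ} (hs : 0 < s) (hsρ : s < ρ)
    (hh : ContinuousOn h (ball 0 ρ)) (hpos : ∀ z ∈ ball (0 : ℂ) ρ, 0 < h z) (hm : 0 < m)
    (hle : circInt h s ≤ 2 * π * m) :
    circInt (fun z => Real.log (h z)) s ≤ 2 * π * Real.log m := by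
  -- the graph of `log` lies below its tangent at `m`
  have h1 : circInt (fun z => Real.log (h z)) s
      ≤ circInt (fun z => m⁻¹ * h z + (Real.log m - 1)) s := by
    refine circInt_mono hs hsρ (hh.log fun z hz => (hpos z hz).ne')
      ((continuousOn_const.mul hh).add continuousOn_const) fun z hz => ?_
    have hz := hpos z (closedBall_subset_ball hsρ (sphere_subset_closedBall hz))
    have h2 := Real.log_le_sub_one_of_pos (x := m⁻¹ * h z) (by positivity)
    rw [Real.log_mul (inv_ne_zero hm.ne') hz.ne', Real.log_inv] at h2
    linarith
  have hmh : ContinuousOn (fun z => m⁻¹ * h z) (ball 0 ρ) := continuousOn_const.mul hh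
  rw [circInt_add hs hsρ hmh continuousOn_const, circInt_const_mul,
    circInt_const] at h1
  have h3 : m⁻¹ * circInt h s ≤ 2 * π := by
    rw [inv_mul_le_iff₀ hm]
    linarith
  linarith

lemma lap_sub_const_neg {w : ℂ → ℝ} {z : ℂ} (hw : ContDiffAt ℝ 2 w z) (c : ℝ) :
    lap (fun y => c - w y) z = -lap w z := by
  have h1 : (fun y => c - w y) = fun y => c + (-1) * w y := by funext y; ring
  rw [h1, lap_add contDiffAt_const (contDiffAt_const.mul hw), lap_const, lap_const_mul _ hw]
  ring

lemma gradSq_sub_const_neg (w : ℂ → ℝ) (z : ℂ) (c : ℝ) :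
    gradSq (fun y => c - w y) z = gradSq w z := by
  unfold gradSq
  rw [fderiv_const_sub]
  simp

lemma continuousOn_gradSq {w : ℂ → ℝ} {U : Set ℂ} (hU : IsOpen U) (hw : ContDiffOn ℝ 2 w U) :
    ContinuousOn (gradSq w) U := by
  have h1 : ContinuousOn (fderiv ℝ w) U :=
    (hw.fderiv_of_isOpen hU (m := 1) (by norm_num)).continuousOn
  unfold gradSq
  exact ((h1.clm_apply continuousOn_const).pow 2).add ((h1.clm_apply continuousOn_const).pow 2)

section Growth
variable {l e : ℂ → ℝ} {C : ℝ}

/-- The circular means of a function grow at most like the energy which bounds its Laplacian. -/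
lemma circInt_le_of_lap_le (hl : ContDiffOn ℝ 2 l (ball 0 1)) (he : ContinuousOn e (ball 0 1))
    (hlap : ∀ z ∈ ball (0 : ℂ) 1, |lap l z| ≤ C * e z) {r : ℝ} (h0 : 0 < r) (h1 : r < 1) :
    circInt l r ≤ 2 * π * l 0 + C * nev e r := by
  have h2 := green hl h0 h1
  have h3 := nev_mono (g' := fun z => C * e z) (continuousOn_lap isOpen_ball hl)
    (continuousOn_const.mul he) (fun z hz => (le_abs_self _).trans (hlap z hz)) h0.le h1
  rw [nev_const_mul] at h3
  linarith

/-- The gradient of the logarithm of a function is controlled by the energy which bounds the Laplacian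
of the function. -/
lemma nev_gradSq_div_le (hl : ContDiffOn ℝ 2 l (ball 0 1)) (hl1 : ∀ z ∈ ball (0 : ℂ) 1, 1 ≤ l z)
    (he : ContinuousOn e (ball 0 1)) (hlap : ∀ z ∈ ball (0 : ℂ) 1, |lap l z| ≤ C * e z) {r : ℝ}
    (h0 : 0 < r) (h1 : r < 1) :
    nev (fun z => gradSq l z / l z ^ 2) r ≤ C * nev e r + 2 * π * Real.log (l 0) := by
  have hpos : ∀ z ∈ ball (0 : ℂ) 1, 0 < l z := fun z hz => one_pos.trans_le (hl1 z hz)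
  have hlog : ContDiffOn ℝ 2 (fun z => Real.log (l z)) (ball 0 1) :=
    hl.log fun z hz => (hpos z hz).ne'
  have hL := continuousOn_lap isOpen_ball hlog
  have h2 := nev_mono (g := fun z => gradSq l z / l z ^ 2)
    (g' := fun z => C * e z + (-1) * lap (fun y => Real.log (l y)) z)
    ((continuousOn_gradSq isOpen_ball hl).div (hl.continuousOn.pow 2)
      fun z hz => pow_ne_zero 2 (hpos z hz).ne')
    ((continuousOn_const.mul he).add (continuousOn_const.mul hL)) (fun z hz => by
      rw [lap_log (hl.contDiffAt (isOpen_ball.mem_nhds hz)) (hpos z hz)]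
      have h3 : lap l z / l z ≤ C * e z := by
        have h4 := hlap z hz
        rw [div_le_iff₀ (hpos z hz)]
        nlinarith [le_abs_self (lap l z), abs_nonneg (lap l z), hl1 z hz]
      linarith) h0.le h1
  have hCe : ContinuousOn (fun z => C * e z) (ball 0 1) := continuousOn_const.mul he
  have hL' : ContinuousOn (fun z => (-1) * lap (fun y => Real.log (l y)) z) (ball 0 1) :=
    continuousOn_const.mul hL
  rw [nev_add hCe hL' h0.le h1, nev_const_mul,
    nev_const_mul, green hlog h0 h1] at h2
  have h5 : 2 * π * 0 ≤ circInt (fun z => Real.log (l z)) r := by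
    rw [← circInt_const 0 r]
    exact circInt_mono h0 h1 continuousOn_const hlog.continuousOn fun z hz =>
      Real.log_nonneg (hl1 z (closedBall_subset_ball h1 (sphere_subset_closedBall hz)))
  linarith

end Growth

end

/-! ### The degree of the tautological bundle along a disc -/

section

open scoped Real

variable {d : ℕ} {X : Type*} [TopologicalSpace X] [ChartedSpace (Fin d → ℂ) X] {ι : Type*}
  {D : ι → Set X}

namespace IsLogDisc
variable {f : ℂ → X} {z : ℂ}

lemma lift_eventually_ne_zero (hf : IsLogDisc d D f) (hD : IsSNC d D)
    (h0 : ∀ φ : LogChart d D, f 0 ∈ φ.chart.source → (φ.lift f 0).2 ≠ 0) :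
    ∀ z ∈ ball (0 : ℂ) 1, ∀ᶠ w in 𝓝[≠] z, ∀ φ : LogChart d D, f w ∈ φ.chart.source →
      (φ.lift f w).2 ≠ 0 := by
  have h := eventually_nhdsNE_not_of_dichotomy
    (Z := fun w => ∃ φ : LogChart d D, f w ∈ φ.chart.source ∧ (φ.lift f w).2 = 0)
    (fun z hz => ?_) (fun ⟨φ, h1, h2⟩ => h0 φ h1 h2)
  · intro z hz
    filter_upwards [h z hz] with w h1 φ h2 h3 using h1 ⟨φ, h2, h3⟩
  · obtain ⟨φ, hφ⟩ := hD (f z)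
    have hev := hf.hol.eventually_mem_source hz hφ
    rcases (hf.analyticAt_lift_snd hz hφ).eventually_eq_zero_or_eventually_ne_zero with h | h
    · left
      filter_upwards [h, hev] with w h1 h2 using ⟨φ, h2.2, h1⟩
    · right
      filter_upwards [h, mem_nhdsWithin_of_mem_nhds hev] with w h1 h2 ⟨ψ, h3, h4⟩
      exact hf.lift_snd_ne_zero_of h2.1 h2.2 h3 h1 h4

/-- The density of the Chern form is the Laplacian of the logarithm of the length of the lift. -/
lemma pullbackDensity_chern (hf : IsLogDisc d D f) (ρ : LogMetric d D) {φ : LogChart d D}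
    (hz : z ∈ ball (0 : ℂ) 1) (hφ : f z ∈ φ.chart.source) (h0 : (φ.lift f z).2 ≠ 0) :
    pullbackDensity ρ.chern f z
      = ((lap (fun w => Real.log (ρ.norm φ (φ.lift f w) ^ 2)) z / (4 * π) : ℝ) : ℂ) := by
  have hd := ρ.contDiffAt_log φ (lift_mem_dom hφ h0)
  have h1 := lap_comp (u := fun q => Real.log (ρ.norm φ q ^ 2)) hd (hf.analyticAt_lift hz hφ)
  have h2 := levi_self_im hd (deriv (φ.lift f) z)
  have h3 : levi (fun q => Real.log (ρ.norm φ q ^ 2)) (φ.lift f z) (deriv (φ.lift f) z)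
      (deriv (φ.lift f) z) = (((levi (fun q => Real.log (ρ.norm φ q ^ 2)) (φ.lift f z)
        (deriv (φ.lift f) z) (deriv (φ.lift f) z)).re : ℝ) : ℂ) :=
    Complex.ext (by simp) (by simpa using h2)
  rw [hf.pullbackDensity_eq ρ.chern hz hφ h0, h1]
  change 2 * ((1 / (2 * π) : ℂ) • levi (fun q => Real.log (ρ.norm φ q ^ 2)) (φ.lift f z)
    (deriv (φ.lift f) z) (deriv (φ.lift f) z)) = _
  rw [h3, smul_eq_mul]
  have hπ : (π : ℂ) ≠ 0 := by exact_mod_cast Real.pi_ne_zero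
  push_cast
  field_simp
  norm_num

/-- The logarithm of the squared length of the logarithmic derivative, minus the logarithm of a
Blaschke product with the same zeros. -/
lemma exists_regularised_log_length (hf : IsLogDisc d D f) (hD : IsSNC d D) (ρ : LogMetric d D)
    (h0 : ∀ φ : LogChart d D, f 0 ∈ φ.chart.source → (φ.lift f 0).2 ≠ 0) {R : ℝ} (hR : 0 < R)
    (hR1 : R < 1) :
    ∃ (B : ℂ → ℂ) (w : ℂ → ℝ), AnalyticOnNhd ℂ B (closedBall 0 R) ∧ B 0 ≠ 0 ∧
      ContDiffOn ℝ 2 w (ball 0 R) ∧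
      (∀ z ∈ ball (0 : ℂ) R, B z ≠ 0 → ∀ φ : LogChart d D, f z ∈ φ.chart.source →
        (φ.lift f z).2 ≠ 0 ∧
        w z = Real.log (ρ.norm φ (φ.lift f z) ^ 2) - 2 * Real.log ‖B z‖) ∧
      ∀ z ∈ ball (0 : ℂ) R, ∀ᶠ y in 𝓝[≠] z,
        pullbackDensity ρ.chern f y = ((lap w y / (4 * π) : ℝ) : ℂ) := by
  have hne := hf.lift_eventually_ne_zero hD h0
  choose A hA using fun z => hD (f z)
  have hcl : closedBall (0 : ℂ) R ⊆ ball 0 1 := closedBall_subset_ball hR1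
  let k : ℂ → ℕ := fun z => analyticOrderNatAt (fun w => ((A z).lift f w).2) z
  have hk0 : ∀ z ∈ ball (0 : ℂ) 1, (∀ φ : LogChart d D, f z ∈ φ.chart.source →
      (φ.lift f z).2 ≠ 0) → k z = 0 := by
    intro z hz h
    simp only [k, analyticOrderNatAt]
    rw [((hf.analyticAt_lift_snd hz (hA z)).analyticOrderAt_eq_zero).2 (h _ (hA z))]
    rfl
  obtain ⟨B, hBa, hB1, hBs, hBk⟩ := exists_blaschke hR k fun z hz => by
    filter_upwards [hne z (hcl hz),
      mem_nhdsWithin_of_mem_nhds (isOpen_ball.mem_nhds (hcl hz))] with w h1 h2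
    exact hk0 w h2 h1
  let p : ℂ → ℝ := fun z => Real.log (ρ.norm (A z) ((A z).lift f z) ^ 2) - Real.log (‖B z‖ ^ 2)
  obtain ⟨w, hw⟩ := exists_punctured_extension p
  have hpφ : ∀ z ∈ ball (0 : ℂ) 1, ∀ φ : LogChart d D, f z ∈ φ.chart.source →
      p z = Real.log (ρ.norm φ (φ.lift f z) ^ 2) - Real.log (‖B z‖ ^ 2) := fun z hz φ hφ => by
    simp only [p, hf.norm_lift_eq ρ hz hφ (hA z)]
  -- near `z` the powers of the coordinate cancel, and `p` extends to the smooth function `G`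
  have hloc : ∀ z ∈ ball (0 : ℂ) R, ∃ G : ℂ → ℝ, ContDiffAt ℝ 2 G z ∧ (∀ᶠ y in 𝓝 z, w y = G y) ∧
      (∀ᶠ y in 𝓝[≠] z, p y = G y ∧ B y ≠ 0) ∧ (B z ≠ 0 → p z = G z ∧
        ∀ φ : LogChart d D, f z ∈ φ.chart.source → (φ.lift f z).2 ≠ 0) := by
    intro z hz
    have hz1 := hcl (ball_subset_closedBall hz)
    have hφ := hA z
    set φ := A z with hφdef
    have hev := hf.hol.eventually_mem_source hz1 hφ
    rcases hf.lift_dichotomy hz1 hφ with h | ⟨m, a, ha, ha0, hm, hae⟩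
    · exfalso
      obtain ⟨y, h1, h2, h3⟩ :=
        ((hne z hz1).and ((h.and hev).filter_mono nhdsWithin_le_nhds)).exists
      exact h1 φ h3.2 h2
    have hkm : k z = m := by
      simp only [k, analyticOrderNatAt]
      rw [← hφdef, hm]
      rfl
    obtain ⟨b, hb, hb0, hbe⟩ :=
      ((hBa z (ball_subset_closedBall hz)).analyticOrderAt_eq_natCast).1 (hBk z hz)
    rw [hkm] at hbe
    have hx := φ.analyticAt_chart hf.hol hz1 hφ
    let q : ℂ → Cpair d := fun y => (φ.chart (f y), a y)
    have hq : AnalyticAt ℂ q z := hx.prod ha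
    let G : ℂ → ℝ := fun y => Real.log (ρ.norm φ (q y) ^ 2) - Real.log (‖b y‖ ^ 2)
    have hG : ContDiffAt ℝ 2 G z := by
      refine ContDiffAt.sub ?_ (contDiffAt_log_norm_sq hb hb0)
      exact ContDiffAt.comp (g := fun p => Real.log (ρ.norm φ p ^ 2)) z
        (ρ.contDiffAt_log φ (p := q z) ⟨φ.chart.map_source hφ, ha0⟩)
        (hq.contDiffAt.restrict_scalars ℝ)
    have hB0 : ∀ y, B y = (y - z) ^ m • b y → B y ≠ 0 → (y - z) ^ m ≠ 0 := by
      intro y h1 h2 h3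
      rw [h1, h3, zero_smul] at h2
      exact h2 rfl
    have hpG : ∀ y, y ∈ ball (0 : ℂ) 1 → f y ∈ φ.chart.source →
        (φ.lift f y).2 = (y - z) ^ m • a y → a y ≠ 0 → B y = (y - z) ^ m • b y → b y ≠ 0 →
        (y - z) ^ m ≠ 0 → p y = G y := by
      intro y h1 h2 h3 h4 h5 h6 h7
      have e1 : φ.lift f y = ((q y).1, ((y - z) ^ m) • (q y).2) := Prod.ext rfl h3
      rw [hpφ y h1 φ h2, e1, ρ.log_smul φ (p := q y) ⟨φ.chart.map_source h2, h4⟩ h7, h5,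
        norm_smul, mul_pow, Real.log_mul (by simpa using h7) (by simpa using h6)]
      ring
    have hall : ∀ᶠ y in 𝓝 z, y ∈ ball (0 : ℂ) 1 ∧ f y ∈ φ.chart.source ∧
        (φ.lift f y).2 = (y - z) ^ m • a y ∧ a y ≠ 0 ∧ B y = (y - z) ^ m • b y ∧ b y ≠ 0 := by
      filter_upwards [hev, hae, ha.continuousAt.eventually_ne ha0, hbe,
        hb.continuousAt.eventually_ne hb0] with y h1 h2 h3 h4 h5
      exact ⟨h1.1, h1.2, h2, h3, h4, h5⟩
    have hpunct : ∀ᶠ y in 𝓝[≠] z, p y = G y ∧ B y ≠ 0 := by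
      filter_upwards [mem_nhdsWithin_of_mem_nhds hall, self_mem_nhdsWithin] with y h1 h2
      have h3 : (y - z) ^ m ≠ 0 := pow_ne_zero m (sub_ne_zero.2 h2)
      obtain ⟨h4, h5, h6, h7, h8, h9⟩ := h1
      refine ⟨hpG y h4 h5 h6 h7 h8 h9 h3, ?_⟩
      rw [h8]
      exact smul_ne_zero h3 h9
    refine ⟨G, hG, hw z G ?_ (hpunct.mono fun y hy => hy.1), hpunct, fun hBz => ?_⟩
    · exact (hG.eventually (by simp)).mono fun y hy => hy.continuousAt
    · obtain ⟨h4, h5, h6, h7, h8, h9⟩ := hall.self_of_nhds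
      have h3 := hB0 z h8 hBz
      refine ⟨hpG z h4 h5 h6 h7 h8 h9 h3, fun ψ hψ => hf.lift_snd_ne_zero_of hz1 hφ hψ ?_⟩
      rw [h6]
      exact smul_ne_zero h3 h7
  have h0R : (0 : ℂ) ∈ ball (0 : ℂ) R := mem_ball_self hR
  refine ⟨B, w, hBa, ?_, fun z hz => ?_, fun z hz hBz φ hφ => ?_, fun z hz => ?_⟩
  · have h1 := hBk 0 h0R
    rw [hk0 0 (by simp) h0, Nat.cast_zero] at h1
    exact ((hBa 0 (mem_closedBall_self hR.le)).analyticOrderAt_eq_zero).1 h1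
  · obtain ⟨G, hG, hwG, -, -⟩ := hloc z hz
    exact (hG.congr_of_eventuallyEq hwG).contDiffWithinAt
  · obtain ⟨G, hG, hwG, -, h2⟩ := hloc z hz
    refine ⟨(h2 hBz).2 φ hφ, ?_⟩
    rw [hwG.self_of_nhds, ← (h2 hBz).1, hpφ z (hcl (ball_subset_closedBall hz)) φ hφ,
      Real.log_pow ‖B z‖]
    norm_num
  · -- off the zeros, `w` differs from `log` of the squared length by a harmonic function
    have hev : ∀ᶠ y in 𝓝[≠] z, y ∈ ball (0 : ℂ) R ∧ B y ≠ 0 := by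
      obtain ⟨G, -, -, h2, -⟩ := hloc z hz
      filter_upwards [h2, mem_nhdsWithin_of_mem_nhds (isOpen_ball.mem_nhds hz)] with y h1 h3
      exact ⟨h3, h1.2⟩
    filter_upwards [hev] with y ⟨hy, hBy⟩
    have hy1 := hcl (ball_subset_closedBall hy)
    have hBya := hBa y (ball_subset_closedBall hy)
    have hφ := hA y
    have hl0 : ((A y).lift f y).2 ≠ 0 := by
      obtain ⟨G, -, -, -, h2⟩ := hloc y hy
      exact (h2 hBy).2 _ hφ
    rw [hf.pullbackDensity_chern ρ hy1 hφ hl0]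
    have h1 : w =ᶠ[𝓝 y] fun x => Real.log (ρ.norm (A y) ((A y).lift f x) ^ 2)
        + (-1) * Real.log (‖B x‖ ^ 2) := by
      filter_upwards [hf.hol.eventually_mem_source hy1 hφ, isOpen_ball.mem_nhds hy,
        hBya.continuousAt.eventually_ne hBy] with x h2 h3 h4
      obtain ⟨G, -, hwG, -, h5⟩ := hloc x h3
      rw [hwG.self_of_nhds, ← (h5 h4).1, hpφ x h2.1 _ h2.2]
      ring
    have h2 : ContDiffAt ℝ 2 (fun x => Real.log (ρ.norm (A y) ((A y).lift f x) ^ 2)) y :=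
      ContDiffAt.comp (g := fun p => Real.log (ρ.norm (A y) p ^ 2)) y
        (ρ.contDiffAt_log (A y) (lift_mem_dom hφ hl0))
        ((hf.analyticAt_lift hy1 hφ).contDiffAt.restrict_scalars ℝ)
    have h3 := contDiffAt_log_norm_sq hBya hBy
    rw [lap_congr h1, lap_add h2 (contDiffAt_const.mul h3), lap_const_mul _ h3,
      lap_log_norm_sq hBya hBy]
    simp

/-- The degree of `L` along a disc is at most the growth of the mean of the logarithm of the length of
the logarithmic derivative. -/
lemma exists_chern_le (hf : IsLogDisc d D f) (hD : IsSNC d D) (ρ : LogMetric d D)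
    (h0 : ∀ φ : LogChart d D, f 0 ∈ φ.chart.source → (φ.lift f 0).2 ≠ 0) {r : ℝ} (hr : 0 < r)
    (hr1 : r < 1) {W : ℂ → ℝ} (hW : ContinuousOn W (ball 0 1))
    (hle : ∀ z ∈ ball (0 : ℂ) 1, ∀ φ : LogChart d D, f z ∈ φ.chart.source → (φ.lift f z).2 ≠ 0 →
      Real.log (ρ.norm φ (φ.lift f z) ^ 2) ≤ W z) {c : ℝ}
    (hc : ∀ φ : LogChart d D, f 0 ∈ φ.chart.source →
      c ≤ Real.log (ρ.norm φ (φ.lift f 0) ^ 2)) :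
    ∃ x : ℝ, discCurrent f r ρ.chern = (x : ℂ) ∧ 4 * π * x ≤ circInt W r - 2 * π * c := by
  obtain ⟨R, hrR, hR1⟩ := exists_between hr1
  have hR := hr.trans hrR
  obtain ⟨B, w, hBa, hB0, hw, hwB, hpd⟩ := hf.exists_regularised_log_length hD ρ h0 hR hR1
  have hsub : ball (0 : ℂ) R ⊆ ball 0 1 := ball_subset_ball hR1.le
  refine ⟨nev (fun z => (4 * π)⁻¹ * lap w z) r, discCurrent_eq hr.le ?_, ?_⟩
  · filter_upwards [ae_ball_of_eventually_nhdsNE hpd] with z hz hzr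
    rw [hz (ball_subset_ball hrR.le hzr), div_eq_inv_mul]
  · rw [nev_const_mul, green hw hr hrR]
    have h1 := circInt_le_sub_log (c := 2) hr hrR zero_le_two hw.continuousOn (hW.mono hsub)
      (fun z hz => hBa z (closedBall_subset_closedBall hrR.le hz)) hB0 fun z hz hBz => by
        have hzR : z ∈ ball (0 : ℂ) R := closedBall_subset_ball hrR (sphere_subset_closedBall hz)
        obtain ⟨φ, hφ⟩ := hD (f z)
        obtain ⟨h2, h3⟩ := hwB z hzR hBz φ hφ
        rw [h3]
        exact sub_le_sub_right (hle z (hsub hzR) φ hφ h2) _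
    obtain ⟨φ, hφ⟩ := hD (f 0)
    have h2 := (hwB 0 (mem_ball_self hR) hB0 φ hφ).2
    have h3 : 4 * π * ((4 * π)⁻¹ * (circInt w r - 2 * π * w 0)) = circInt w r - 2 * π * w 0 := by
      have := Real.pi_pos
      field_simp
    rw [h3, h2]
    have h4 := mul_le_mul_of_nonneg_left (hc φ hφ) (by positivity : (0 : ℝ) ≤ 2 * π)
    linarith

end IsLogDisc

end

/-! ### The tautological inequality -/

section

open scoped Real

variable {d : ℕ} {X : Type*} [TopologicalSpace X] [ChartedSpace (Fin d → ℂ) X] {ι : Type*}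
  {D : ι → Set X}

lemma le_prod_of_one_le [Fintype ι] {g : ι → ℝ} (hg : ∀ i, 1 ≤ g i) (i : ι) : g i ≤ ∏ j, g j := by
  classical
  rw [← Finset.mul_prod_erase Finset.univ g (Finset.mem_univ i)]
  refine le_mul_of_one_le_right (zero_le_one.trans (hg i)) ?_
  exact Finset.prod_induction g (fun x => 1 ≤ x) (fun a b => one_le_mul_of_one_le_of_one_le) le_rfl
    fun j _ => hg j

/-- The functions `l i = const - log (sigma i ∘ f)`, and the auxiliary density
`θ = e + ∑ i, |∇ log (l i)|²`, bound the length of the logarithmic derivative, while their growth is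
bounded by the energy. -/
lemma ChartCover.exists_growth [CompactSpace X] [T2Space X] [Fintype ι] (𝒰 : ChartCover d D)
    (hD : IsSNC d D) {η : logForms d D} (hη : IsPositiveForm η) {U : Set X} (hU : IsOpen U)
    (hDU : ⋃ i, D i ⊆ U) :
    ∃ A : ℝ, 1 ≤ A ∧ ∀ f e, IsLogDisc d D f → IsEnergy η f e → f 0 ∉ U →
      ∃ (θ : ℂ → ℝ) (l : ι → ℂ → ℝ), ContinuousOn θ (ball 0 1) ∧
        (∀ z ∈ ball (0 : ℂ) 1, e z ≤ θ z) ∧ (∀ i, ContinuousOn (l i) (ball 0 1)) ∧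
        (∀ i, ∀ z ∈ ball (0 : ℂ) 1, 1 ≤ l i z) ∧
        (∀ r, 0 < r → r < 1 → nev θ r ≤ A * (1 + nev e r) ∧
          ∀ i, circInt (l i) r ≤ A * (1 + nev e r)) ∧
        ∀ z ∈ ball (0 : ℂ) 1, ∀ φ : LogChart d D, f z ∈ φ.chart.source → (φ.lift f z).2 ≠ 0 →
          Real.log (𝒰.metric.norm φ (φ.lift f z) ^ 2)
            ≤ Real.log A + Real.log (θ z + 1) + ∑ i, 2 * Real.log (l i z) := by
  choose C hC hlap using fun i => 𝒰.exists_lap_bound hη i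
  obtain ⟨Cm, hCm, hmet⟩ := 𝒰.exists_metric_bound hη
  -- bounds for `sigma i`, from above everywhere and from below off `U`
  have hup : ∀ i, ∃ M : ℝ, ∀ x, 𝒰.sigma i x ≤ M := fun i => by
    obtain ⟨M, hM⟩ := isCompact_univ.exists_bound_of_continuousOn
      (𝒰.continuous_sigma hD i).continuousOn
    exact ⟨M, fun x => (le_abs_self _).trans (hM x (mem_univ x))⟩
  choose M hM using hup
  have hlow : ∀ i, ∃ δ : ℝ, 0 < δ ∧ ∀ x ∉ U, δ ≤ 𝒰.sigma i x := fun i => by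
    obtain ⟨δ, hδ, h⟩ := (hU.isClosed_compl.isCompact).exists_forall_le'
      (𝒰.continuous_sigma hD i).continuousOn (a := 0)
      fun x hx => 𝒰.sigma_pos hD i fun hi => hx (hDU (mem_iUnion.2 ⟨i, hi⟩))
    exact ⟨δ, hδ, h⟩
  choose δ hδ hδU using hlow
  set Λ : ι → ℝ := fun i => 1 + Real.log (|M i| + 1) with hΛ
  set L : ℝ := 1 + ∑ i, |Λ i - Real.log (δ i)| with hL
  have hL1 : 1 ≤ L := le_add_of_nonneg_right (Finset.sum_nonneg fun i _ => abs_nonneg _)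
  have hCs : 0 ≤ ∑ i, C i := Finset.sum_nonneg fun i _ => hC i
  set A : ℝ := 1 + Cm + ∑ i, C i + (Fintype.card ι + 1) * (2 * π * L) with hA
  have hπL : 0 ≤ 2 * π * L := by positivity
  have hA1 : 1 + Cm ≤ A := by
    rw [hA]
    have : 0 ≤ (Fintype.card ι + 1 : ℝ) * (2 * π * L) := by positivity
    linarith
  refine ⟨A, by linarith, fun f e hf he hf0 => ?_⟩
  have h0 : (0 : ℂ) ∈ ball (0 : ℂ) 1 := by simp
  have hσpos : ∀ i, ∀ z ∈ ball (0 : ℂ) 1, 0 < 𝒰.sigma i (f z) := fun i z hz =>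
    𝒰.sigma_pos hD i fun hi => hf.avoids z hz (mem_iUnion.2 ⟨i, hi⟩)
  set l : ι → ℂ → ℝ := fun i z => Λ i - Real.log (𝒰.sigma i (f z)) with hl
  have hlσ : ∀ i, ∀ z ∈ ball (0 : ℂ) 1,
      ContDiffAt ℝ 2 (fun w => Real.log (𝒰.sigma i (f w))) z := fun i z hz =>
    hf.contDiffAt_log_sigma 𝒰 hD i hz
  have hlc : ∀ i, ContDiffOn ℝ 2 (l i) (ball 0 1) := fun i z hz =>
    (contDiffAt_const.sub (hlσ i z hz)).contDiffWithinAt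
  have hl1 : ∀ i, ∀ z ∈ ball (0 : ℂ) 1, 1 ≤ l i z := fun i z hz => by
    have h1 : Real.log (𝒰.sigma i (f z)) ≤ Real.log (|M i| + 1) :=
      Real.log_le_log (hσpos i z hz) (by linarith [hM i (f z), le_abs_self (M i)])
    simp only [hl, hΛ]
    linarith
  have hllap : ∀ i, ∀ z ∈ ball (0 : ℂ) 1, |lap (l i) z| ≤ C i * e z := fun i z hz => by
    rw [hl, lap_sub_const_neg (hlσ i z hz), abs_neg]
    exact hlap i f e hf he z hz
  have hlg : ∀ i z, gradSq (l i) z = gradSq (fun w => Real.log (𝒰.sigma i (f w))) z :=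
    fun i z => gradSq_sub_const_neg _ _ _
  have hl0 : ∀ i, l i 0 ≤ L := fun i => by
    have h1 : Real.log (δ i) ≤ Real.log (𝒰.sigma i (f 0)) :=
      Real.log_le_log (hδ i) (hδU i _ hf0)
    have h2 := Finset.single_le_sum (f := fun i => |Λ i - Real.log (δ i)|)
      (fun i _ => abs_nonneg _) (Finset.mem_univ i)
    have h3 := le_abs_self (Λ i - Real.log (δ i))
    simp only [hl, hL]
    linarith
  have hgc : ∀ i, ContinuousOn (fun z => gradSq (l i) z / l i z ^ 2) (ball 0 1) := fun i =>
    (continuousOn_gradSq isOpen_ball (hlc i)).div ((hlc i).continuousOn.pow 2)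
      fun z hz => pow_ne_zero 2 (one_pos.trans_le (hl1 i z hz)).ne'
  have hg0 : ∀ i z, 0 ≤ gradSq (l i) z / l i z ^ 2 := fun i z =>
    div_nonneg (gradSq_nonneg _ _) (sq_nonneg _)
  refine ⟨fun z => e z + ∑ i, gradSq (l i) z / l i z ^ 2, l,
    he.continuousOn.add (continuousOn_finsetSum _ fun i _ => hgc i),
    fun z _ => le_add_of_nonneg_right (Finset.sum_nonneg fun i _ => hg0 i z),
    fun i => (hlc i).continuousOn, hl1, fun r hr hr1 => ?_, fun z hz φ hφ hne => ?_⟩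
  · have hS : 0 ≤ nev e r := nev_nonneg he.nonneg hr.le hr1
    have hCi : ∀ i, C i ≤ ∑ i, C i := fun i =>
      Finset.single_le_sum (fun i _ => hC i) (Finset.mem_univ i)
    constructor
    · rw [nev_add he.continuousOn (continuousOn_finsetSum _ fun i _ => hgc i) hr.le hr1,
        nev_sum _ hr.le hr1 hgc]
      have h1 : ∑ i, nev (fun z => gradSq (l i) z / l i z ^ 2) r
          ≤ ∑ i, (C i * nev e r + 2 * π * L) := by
        refine Finset.sum_le_sum fun i _ => ?_
        have h2 := nev_gradSq_div_le (hlc i) (hl1 i) he.continuousOn (hllap i) hr hr1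
        have h3 : Real.log (l i 0) ≤ L := by
          have := Real.log_le_sub_one_of_pos (one_pos.trans_le (hl1 i 0 h0))
          linarith [hl0 i]
        have h4 := mul_le_mul_of_nonneg_left h3 (by positivity : (0 : ℝ) ≤ 2 * π)
        linarith
      rw [Finset.sum_add_distrib, ← Finset.sum_mul, Finset.sum_const, nsmul_eq_mul,
        Finset.card_univ] at h1
      have h5 : A * (1 + nev e r) = nev e r + ((∑ i, C i) * nev e r
          + Fintype.card ι * (2 * π * L)) + (1 + Cm * (1 + nev e r) + ∑ i, C i + 2 * π * L
          + (Fintype.card ι + 1) * (2 * π * L) * nev e r) := by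
        rw [hA]; ring
      have h6 : 0 ≤ 1 + Cm * (1 + nev e r) + ∑ i, C i + 2 * π * L
          + (Fintype.card ι + 1) * (2 * π * L) * nev e r := by positivity
      linarith
    · intro i
      have h1 := circInt_le_of_lap_le (hlc i) he.continuousOn (hllap i) hr hr1
      have h2 := mul_le_mul_of_nonneg_left (hl0 i) (by positivity : (0 : ℝ) ≤ 2 * π)
      have h3 := mul_le_mul_of_nonneg_right (hCi i) hS
      have h5 : A * (1 + nev e r) = 2 * π * L + (∑ i, C i) * nev e r
          + ((1 + Cm) * (1 + nev e r) + ∑ i, C i + Fintype.card ι * (2 * π * L)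
            + (Fintype.card ι + 1) * (2 * π * L) * nev e r) := by
        rw [hA]; ring
      have h6 : 0 ≤ (1 + Cm) * (1 + nev e r) + ∑ i, C i + Fintype.card ι * (2 * π * L)
          + (Fintype.card ι + 1) * (2 * π * L) * nev e r := by positivity
      linarith
  · have hez := he.nonneg z hz
    set P : ℝ := ∏ i, l i z ^ 2 with hP
    have hl2 : ∀ i, 1 ≤ l i z ^ 2 := fun i => one_le_pow₀ (hl1 i z hz)
    have hlP : ∀ i, l i z ^ 2 ≤ P := fun i => le_prod_of_one_le hl2 i
    have hP1 : 1 ≤ P := Finset.prod_induction (fun i => l i z ^ 2) (fun x => 1 ≤ x)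
      (fun a b => one_le_mul_of_one_le_of_one_le) le_rfl fun j _ => hl2 j
    set θ : ℝ := e z + ∑ i, gradSq (l i) z / l i z ^ 2 with hθ
    have hs0 : 0 ≤ ∑ i, gradSq (l i) z / l i z ^ 2 := Finset.sum_nonneg fun i _ => hg0 i z
    have h1 : ∑ i, gradSq (fun w => Real.log (𝒰.sigma i (f w))) z
        ≤ (∑ i, gradSq (l i) z / l i z ^ 2) * P := by
      rw [Finset.sum_mul]
      refine Finset.sum_le_sum fun i _ => ?_
      rw [← hlg i z]
      calc gradSq (l i) z = gradSq (l i) z / l i z ^ 2 * l i z ^ 2 :=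
            (div_mul_cancel₀ _ (zero_lt_one.trans_le (hl2 i)).ne').symm
        _ ≤ _ := mul_le_mul_of_nonneg_left (hlP i) (hg0 i z)
    have h2 : 𝒰.metric.norm φ (φ.lift f z) ^ 2 ≤ A * (θ + 1) * P := by
      refine (hmet f e hf he z hz φ hφ).trans ?_
      calc Cm * e z + ∑ i, gradSq (fun w => Real.log (𝒰.sigma i (f w))) z
          ≤ Cm * e z * P + (∑ i, gradSq (l i) z / l i z ^ 2) * P := by
            refine add_le_add (le_mul_of_one_le_right (by positivity) hP1) h1
        _ ≤ A * (θ + 1) * P := by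
            rw [← add_mul]
            refine mul_le_mul_of_nonneg_right ?_ (zero_le_one.trans hP1)
            rw [hθ]
            nlinarith
    have hpos : 0 < 𝒰.metric.norm φ (φ.lift f z) ^ 2 :=
      pow_pos (𝒰.metric.pos φ _ (IsLogDisc.lift_mem_dom hφ hne)) 2
    have hθ0 : 0 < θ + 1 := by rw [hθ]; linarith
    have hA0 : 0 < A := by linarith
    have h3 := Real.log_le_log hpos h2
    rw [Real.log_mul (by positivity) (by positivity), Real.log_mul hA0.ne' hθ0.ne', hP,
      Real.log_prod (fun i _ => (zero_lt_one.trans_le (hl2 i)).ne')] at h3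
    simpa [Real.log_pow] using h3

end

section

open scoped Real

variable {d : ℕ} {X : Type*} [TopologicalSpace X] [ChartedSpace (Fin d → ℂ) X] {ι : Type*}
  {D : ι → Set X}

lemma LogMetric.lift_snd_ne_zero (ρ : LogMetric d D) {φ : LogChart d D} {f : ℂ → X} {z : ℂ}
    (hφ : f z ∈ φ.chart.source) (h : 0 < ρ.norm φ (φ.lift f z)) : (φ.lift f z).2 ≠ 0 := by
  intro h0
  have h1 := ρ.norm_smul φ (φ.chart (f z)) (φ.chart.map_source hφ) 0 0
  rw [smul_zero, norm_zero, zero_mul] at h1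
  have h2 : φ.lift f z = (φ.chart (f z), 0) := Prod.ext rfl h0
  rw [h2, h1] at h
  exact h.false

lemma log_le_two_mul_sqrt {T : ℝ} (hT : 0 < T) : Real.log T ≤ 2 * √T := by
  have h1 := Real.log_le_sub_one_of_pos (Real.sqrt_pos.2 hT)
  rw [Real.log_sqrt hT.le] at h1
  linarith

/-- The mean value over a circle allowed by the inequality of `borel` is polynomial in any bound `T`
for the growth. -/
lemma le_of_borel {c N T r : ℝ} (hr : 0 < r) (hr1 : r < 1) (hN : 0 ≤ N) (hNT : N ≤ T) (hT : 1 ≤ T)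
    (h : c * (r * (1 - r ^ 2)) ≤ (N ^ 2 / (1 - r ^ 2) + N) ^ 2) :
    c ≤ 4 / (r * (1 - r ^ 2) ^ 3) * T ^ 4 := by
  have hq : 0 < 1 - r ^ 2 := by nlinarith
  have hq1 : 1 - r ^ 2 ≤ 1 := by nlinarith
  set q := 1 - r ^ 2
  have h1 : N ^ 2 / q + N ≤ 2 * T ^ 2 / q := by
    rw [div_add' _ _ _ hq.ne']
    refine div_le_div_of_nonneg_right ?_ hq.le
    have h2 : N * q ≤ N := mul_le_of_le_one_right hN hq1
    nlinarith
  have h3 : (N ^ 2 / q + N) ^ 2 ≤ (2 * T ^ 2 / q) ^ 2 :=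
    pow_le_pow_left₀ (by positivity) h1 2
  have h4 : c ≤ (2 * T ^ 2 / q) ^ 2 / (r * q) := (le_div_iff₀ (by positivity)).2 (h.trans h3)
  calc c ≤ _ := h4
    _ = _ := by field_simp; ring

/-- The tautological inequality for a single disc: at a radius `r` at which the growth inequality of
`borel` holds for an auxiliary density `Θ f e`, the degree of `L` is at most of the order of the
square root of the degree of `η`. -/
lemma ChartCover.exists_chern_le_sqrt [CompactSpace X] [T2Space X] [Fintype ι] (𝒰 : ChartCover d D)
    (hD : IsSNC d D) {η : logForms d D} (hη : IsPositiveForm η) {U : Set X} (hU : IsOpen U)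
    (hDU : ⋃ i, D i ⊆ U) :
    ∃ Θ : (ℂ → X) → (ℂ → ℝ) → ℂ → ℝ,
      (∀ f e, IsLogDisc d D f → IsEnergy η f e → f 0 ∉ U →
        ContinuousOn (Θ f e) (ball 0 1) ∧ ∀ z ∈ ball (0 : ℂ) 1, e z ≤ Θ f e z) ∧
      ∀ (ρ : LogMetric d D) (c r : ℝ), 0 < c → 0 < r → r < 1 → ∃ C : ℝ, ∀ f e,
        IsLogDisc d D f → IsEnergy η f e → f 0 ∉ U →
        (∀ φ : LogChart d D, f 0 ∈ φ.chart.source → c ≤ ρ.norm φ (φ.lift f 0)) →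
        circInt (Θ f e) r * (r * (1 - r ^ 2))
          ≤ (nev (Θ f e) r ^ 2 / (1 - r ^ 2) + nev (Θ f e) r) ^ 2 →
        1 ≤ nev e r → ∃ x : ℝ, discCurrent f r ρ.chern = x ∧ x ≤ C * √(nev e r) := by
  obtain ⟨A, hA1, hA⟩ := 𝒰.exists_growth hD hη hU hDU
  choose! Θ l hΘ heΘ hl hl1 hgrow hlog using hA
  refine ⟨Θ, fun f e hf he h0 => ⟨hΘ f e hf he h0, heΘ f e hf he h0⟩,
    fun ρ c r hc hr hr1 => ?_⟩
  obtain ⟨Cρ, hCρ, hρ⟩ := ρ.exists_le_mul 𝒰 𝒰.metric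
  have hA0 : 0 < A := one_pos.trans_le hA1
  have hq : 0 < 1 - r ^ 2 := by nlinarith
  set b : ℝ := 4 / (r * (1 - r ^ 2) ^ 3) + 1 with hb
  have hb0 : 0 < b := by positivity
  set a : ℝ := Real.log (Cρ ^ 2) + Real.log A with ha
  set n : ℝ := (Fintype.card ι : ℝ) with hn
  refine ⟨|a + Real.log b - Real.log (c ^ 2)| + (4 + 2 * n) * (2 * √(2 * A)),
    fun f e hf he hf0 hc0 hborel hS => ?_⟩
  specialize hΘ f e hf he hf0
  specialize heΘ f e hf he hf0
  specialize hl f e hf he hf0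
  specialize hl1 f e hf he hf0
  specialize hgrow f e hf he hf0 r hr hr1
  specialize hlog f e hf he hf0
  set θ := Θ f e
  set S := nev e r with hSdef
  set T : ℝ := A * (1 + S) with hT
  have hT1 : 1 ≤ T := by rw [hT]; nlinarith
  have hT0 : 0 < T := one_pos.trans_le hT1
  have hθ0 : ∀ z ∈ ball (0 : ℂ) 1, 0 ≤ θ z := fun z hz => (he.nonneg z hz).trans (heΘ z hz)
  have hN0 : 0 ≤ nev θ r := nev_nonneg hθ0 hr.le hr1
  have hθc : circInt θ r ≤ 4 / (r * (1 - r ^ 2) ^ 3) * T ^ 4 :=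
    le_of_borel hr hr1 hN0 hgrow.1 hT1 hborel
  have hθ1 : ContinuousOn (fun z => θ z + 1) (ball 0 1) := hΘ.add continuousOn_const
  have hlogθ : ContinuousOn (fun z => Real.log (θ z + 1)) (ball 0 1) :=
    hθ1.log fun z hz => by linarith [hθ0 z hz]
  have hlogl : ∀ i, ContinuousOn (fun z => 2 * Real.log (l f e i z)) (ball 0 1) := fun i =>
    continuousOn_const.mul ((hl i).log fun z hz => by linarith [hl1 i z hz])
  -- by concavity of the logarithm, its mean is at most the logarithm of the mean
  have hI1 : circInt (fun z => Real.log (θ z + 1)) r ≤ 2 * π * (Real.log b + 4 * Real.log T) := by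
    have h1 : circInt (fun z => θ z + 1) r ≤ 2 * π * (b * T ^ 4) := by
      rw [circInt_add hr hr1 hΘ continuousOn_const, circInt_const]
      have hT4 : 1 ≤ T ^ 4 := one_le_pow₀ hT1
      have h2 : 0 ≤ 4 / (r * (1 - r ^ 2) ^ 3) * T ^ 4 := by positivity
      have h3 : 4 / (r * (1 - r ^ 2) ^ 3) * T ^ 4 ≤ 2 * π * (4 / (r * (1 - r ^ 2) ^ 3) * T ^ 4) :=
        le_mul_of_one_le_left h2 (by linarith [Real.pi_gt_three])
      have h4 : 2 * π * 1 ≤ 2 * π * T ^ 4 :=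
        mul_le_mul_of_nonneg_left hT4 (by positivity)
      have h5 : 2 * π * (b * T ^ 4)
          = 2 * π * (4 / (r * (1 - r ^ 2) ^ 3) * T ^ 4) + 2 * π * T ^ 4 := by rw [hb]; ring
      linarith
    have h6 := circInt_log_le hr hr1 hθ1 (fun z hz => by linarith [hθ0 z hz])
      (by positivity : 0 < b * T ^ 4) h1
    rwa [Real.log_mul hb0.ne' (by positivity), Real.log_pow] at h6
  have hI2 : ∀ i, circInt (fun z => 2 * Real.log (l f e i z)) r ≤ 2 * (2 * π * Real.log T) := by
    intro i
    rw [circInt_const_mul]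
    refine mul_le_mul_of_nonneg_left ?_ zero_le_two
    refine circInt_log_le hr hr1 (hl i) (fun z hz => by linarith [hl1 i z hz]) hT0 ?_
    exact (hgrow.2 i).trans (le_mul_of_one_le_left hT0.le (by linarith [Real.pi_gt_three]))
  have hsumc : ContinuousOn (fun z => ∑ i, 2 * Real.log (l f e i z)) (ball 0 1) :=
    continuousOn_finsetSum _ fun i _ => hlogl i
  have hac : ContinuousOn (fun z => a + Real.log (θ z + 1)) (ball 0 1) :=
    continuousOn_const.add hlogθ
  obtain ⟨x, hx, hxle⟩ := hf.exists_chern_le hD ρ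
    (fun φ hφ => ρ.lift_snd_ne_zero hφ (hc.trans_le (hc0 φ hφ))) hr hr1
    (W := fun z => a + Real.log (θ z + 1) + ∑ i, 2 * Real.log (l f e i z)) (hac.add hsumc)
    (fun z hz φ hφ hne => by
      have h1 := hρ f hf z hz φ hφ
      have hm := IsLogDisc.lift_mem_dom hφ hne
      have hp1 := ρ.pos φ _ hm
      have hp2 := 𝒰.metric.pos φ _ hm
      have h2 := Real.log_le_log (by positivity) (pow_le_pow_left₀ hp1.le h1 2)
      rw [mul_pow, Real.log_mul (by positivity) (by positivity)] at h2
      linarith [hlog z hz φ hφ hne])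
    (c := Real.log (c ^ 2))
    (fun φ hφ => Real.log_le_log (by positivity) (pow_le_pow_left₀ hc.le (hc0 φ hφ) 2))
  refine ⟨x, hx, ?_⟩
  rw [circInt_add hr hr1 hac hsumc, circInt_add hr hr1 continuousOn_const hlogθ, circInt_const,
    circInt_sum _ hr hr1 hlogl] at hxle
  have hsum := Finset.sum_le_sum fun i (_ : i ∈ Finset.univ) => hI2 i
  rw [Finset.sum_const, nsmul_eq_mul, Finset.card_univ, ← hn] at hsum
  have hx2 : 2 * π * (2 * x) ≤ 2 * π *
      (a + Real.log b - Real.log (c ^ 2) + (4 + 2 * n) * Real.log T) := by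
    linarith
  have hx3 := le_of_mul_le_mul_left hx2 (by positivity)
  have hlogT0 : 0 ≤ Real.log T := Real.log_nonneg hT1
  have hn0 : 0 ≤ n := Nat.cast_nonneg _
  have hsqrtT : √T ≤ √(2 * A) * √S := by
    rw [← Real.sqrt_mul (by positivity)]
    refine Real.sqrt_le_sqrt ?_
    rw [hT]; nlinarith
  have hlogT : Real.log T ≤ 2 * √(2 * A) * √S := by
    linarith [log_le_two_mul_sqrt hT0]
  have h7 := mul_le_mul_of_nonneg_left hlogT (by positivity : 0 ≤ 4 + 2 * n)
  have h8 : |a + Real.log b - Real.log (c ^ 2)| * 1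
      ≤ |a + Real.log b - Real.log (c ^ 2)| * √S :=
    mul_le_mul_of_nonneg_left (Real.one_le_sqrt.2 hS) (abs_nonneg _)
  have h9 := le_abs_self (a + Real.log b - Real.log (c ^ 2))
  have h10 : 0 ≤ |a + Real.log b - Real.log (c ^ 2)| * √S
      + (4 + 2 * n) * (2 * √(2 * A) * √S) := by positivity
  have h11 : (|a + Real.log b - Real.log (c ^ 2)| + (4 + 2 * n) * (2 * √(2 * A))) * √S
      = |a + Real.log b - Real.log (c ^ 2)| * √S + (4 + 2 * n) * (2 * √(2 * A) * √S) := by ring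
  linarith

end

section

variable {d : ℕ} {X : Type*} [TopologicalSpace X] [ChartedSpace (Fin d → ℂ) X] {ι : Type*}
  {D : ι → Set X}

lemma exists_subsequence_pow_le {S : ℕ → ℝ} (hS : ∀ n, 0 ≤ S n) (h : ¬ ∃ M, ∀ n, S n ≤ M) :
    ∃ s : ℕ → ℕ, StrictMono s ∧ ∀ k, 2 ^ k ≤ S (s k) := by
  refine extraction_forall_of_frequently (P := fun k n => 2 ^ k ≤ S n) fun k => ?_
  by_contra hk
  obtain ⟨N, hN⟩ := eventually_atTop.1 (not_frequently.1 hk)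
  refine h ⟨2 ^ k + ∑ i ∈ Finset.range N, S i, fun n => ?_⟩
  rcases lt_or_ge n N with hn | hn
  · have h1 := Finset.single_le_sum (f := S) (fun i _ => hS i) (Finset.mem_range.2 hn)
    have : (0 : ℝ) ≤ 2 ^ k := by positivity
    linarith
  · have h1 := hN n hn
    have h2 : 0 ≤ ∑ i ∈ Finset.range N, S i := Finset.sum_nonneg fun i _ => hS i
    linarith

lemma finiteHyperbolicMeasure_union {R : ℝ} (hR : R ∈ Ioo (0 : ℝ) 1) {E : ℕ → Set ℝ}
    (hsub : ∀ k, E k ⊆ Ioo R 1) (hmeas : ∀ k, MeasurableSet (E k))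
    (hint : ∀ k, ∫⁻ r in E k, ENNReal.ofReal (1 / (1 - r ^ 2)) ≤ ENNReal.ofReal (2 / 2 ^ k)) :
    FiniteHyperbolicMeasure (Ioc 0 R ∪ ⋃ k, E k) := by
  refine ⟨measurableSet_Ioc.union (MeasurableSet.iUnion hmeas), ?_, ?_⟩
  · rintro r (hr | hr)
    · exact ⟨hr.1, hr.2.trans_lt hR.2⟩
    · obtain ⟨k, hk⟩ := mem_iUnion.1 hr
      exact ⟨hR.1.trans (hsub k hk).1, (hsub k hk).2⟩
  · refine (lintegral_union_le _ _ _).trans_lt (ENNReal.add_lt_top.2 ⟨?_, ?_⟩)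
    · calc ∫⁻ r in Ioc 0 R, ENNReal.ofReal (1 / (1 - r ^ 2))
          ≤ ∫⁻ _ in Ioc 0 R, ENNReal.ofReal (1 / (1 - R ^ 2)) := by
            refine setLIntegral_mono' measurableSet_Ioc fun r hr => ENNReal.ofReal_le_ofReal ?_
            have h1 : 0 < 1 - R ^ 2 := by nlinarith [hR.1, hR.2]
            have h2 : r ^ 2 ≤ R ^ 2 := pow_le_pow_left₀ hr.1.le hr.2 2
            exact one_div_le_one_div_of_le h1 (by linarith)
        _ < ⊤ := by
            rw [setLIntegral_const]
            exact ENNReal.mul_lt_top ENNReal.ofReal_lt_top measure_Ioc_lt_top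
    · refine (lintegral_iUnion_le _ _).trans_lt ((ENNReal.tsum_le_tsum hint).trans_lt ?_)
      have h1 : Summable fun k : ℕ => (2 : ℝ) / 2 ^ k := by
        have := summable_geometric_two.mul_left (2 : ℝ)
        refine this.congr fun k => ?_
        rw [one_div, inv_pow]; rfl
      exact h1.tsum_ofReal_ne_top.lt_top

/-- If discs with nondegenerate logarithmic derivatives at the origin have no convergent
subsequence, their degrees are unbounded; then `exists_chern_le_sqrt` applies along a subsequence
with degrees at least `2 ^ k`, the exceptional radii having total hyperbolic measure `∑ 2 / 2 ^ k`
beyond a fixed radius. -/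
theorem tautologicalInequality_of_nondegenerateAtOrigin [T2Space X] [CompactSpace X]
    [IsManifold 𝓘(ℂ, Fin d → ℂ) ω X] [Finite ι] (hX : IsProjective d X) (hD : IsSNC d D)
    {η : logForms d D} (hη : IsPositiveForm η) {f : ℕ → ℂ → X} (hf : ∀ n, IsLogDisc d D (f n))
    (h0 : AwayFrom D fun n => f n 0) (hconv : NoConvergentSubsequence d f)
    (hnd : NondegenerateAtOrigin d D f) : TautologicalInequality η f := by
  have := Fintype.ofFinite ι
  obtain ⟨N, j, hj⟩ := hX
  have hj : IsEmbedded d j := hj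
  obtain ⟨𝒰⟩ := hD.exists_chartCover
  obtain ⟨U, hU, hDU, hU0⟩ := h0
  obtain ⟨ρ₀, c₀, hc₀, hnd⟩ := hnd
  choose e he using fun n => IsLogDisc.exists_isEnergy hD hη (hf n)
  obtain ⟨C, hC, hdom⟩ := hj.exists_dominates hD hη
  have hSnn : ∀ n, ∀ r, 0 < r → r < 1 → 0 ≤ nev (e n) r := fun n r hr hr1 =>
    nev_nonneg (he n).nonneg hr.le hr1
  -- without convergent subsequences the degrees are unbounded at some radius
  obtain ⟨R, hR, hunb⟩ : ∃ R ∈ Ioo (0 : ℝ) 1, ¬ ∃ M, ∀ n, nev (e n) R ≤ M := by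
    by_contra! hb
    obtain ⟨s, B, hs, hB⟩ := hj.exists_convergesTo_of_bounded (fun n => (hf n).hol) hC
      (fun n => (he n).continuousOn) (fun n => (he n).nonneg)
      (fun n => hdom _ _ (hf n) (he n)) hb
    exact hconv s hs B hB
  obtain ⟨s, hs, hpow⟩ := exists_subsequence_pow_le (fun n => hSnn n R hR.1 hR.2) hunb
  obtain ⟨Θ, hΘ, hmain⟩ := 𝒰.exists_chern_le_sqrt hD hη hU hDU
  have hborel : ∀ k, ∃ E ⊆ Ioo R 1, MeasurableSet E ∧
      ∫⁻ r in E, ENNReal.ofReal (1 / (1 - r ^ 2)) ≤ ENNReal.ofReal (2 / 2 ^ k) ∧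
      ∀ r ∈ Ioo R 1 \ E, circInt (Θ (f (s k)) (e (s k))) r * (r * (1 - r ^ 2))
        ≤ (nev (Θ (f (s k)) (e (s k))) r ^ 2 / (1 - r ^ 2)
          + nev (Θ (f (s k)) (e (s k))) r) ^ 2 := fun k => by
    obtain ⟨h1, h2⟩ := hΘ _ _ (hf (s k)) (he (s k)) (hU0 (s k))
    exact LogDisc.borel h1 (fun z hz => ((he (s k)).nonneg z hz).trans (h2 z hz)) hR
      (by positivity) ((hpow k).trans (nev_mono (he (s k)).continuousOn h1 h2 hR.1.le hR.2))
  choose E hEsub hEmeas hEint hE using hborel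
  refine ⟨s, hs, _, finiteHyperbolicMeasure_union hR hEsub hEmeas hEint,
    fun r hr s' hs' T hT ρ => ?_⟩
  have hr0 : 0 < r := hr.1.1
  have hr1 : r < 1 := hr.1.2
  have hRr : R < r := lt_of_not_ge fun h => hr.2 (Or.inl ⟨hr0, h⟩)
  have hrE : ∀ k, r ∉ E k := fun k hk => hr.2 (Or.inr (mem_iUnion.2 ⟨k, hk⟩))
  obtain ⟨C₁, hC₁, hρ⟩ := ρ₀.exists_le_mul 𝒰 ρ
  obtain ⟨C₂, hC₂⟩ := hmain ρ (c₀ / C₁) r (by positivity) hr0 hr1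
  have hSpow : ∀ k, (2 : ℝ) ^ k ≤ nev (e (s k)) r := fun k =>
    (hpow k).trans (nev_le_nev (he (s k)).nonneg (he (s k)).continuousOn hR.1.le hRr.le hr1)
  choose x hx hxle using fun k => hC₂ _ _ (hf (s k)) (he (s k)) (hU0 (s k))
    (fun φ hφ => by
      rw [div_le_iff₀' hC₁]
      exact (hnd (s k) φ hφ).trans (hρ _ (hf (s k)) 0 (by simp) φ hφ))
    (hE k r ⟨⟨hRr, hr1⟩, hrE k⟩) ((one_le_pow₀ one_le_two).trans (hSpow k))
  have hlim := hT ρ.chern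
  have hq : ∀ k, discCurrent (f (s (s' k))) r ρ.chern / discCurrent (f (s (s' k))) r η
      = ((x (s' k) / nev (e (s (s' k))) r : ℝ) : ℂ) := fun k => by
    rw [hx, (he _).current r hr0.le hr1, ofReal_div]
  simp only [hq] at hlim
  have hStop : Tendsto (fun k => nev (e (s (s' k))) r) atTop atTop :=
    tendsto_atTop_mono (fun k => hSpow (s' k))
      ((tendsto_pow_atTop_atTop_of_one_lt one_lt_two).comp hs'.tendsto_atTop)
  constructor
  · refine tendsto_nhds_unique ((continuous_im.tendsto _).comp hlim) ?_
    simp only [Function.comp_def, ofReal_im]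
    exact tendsto_const_nhds
  · have h1 := (continuous_re.tendsto _).comp hlim
    simp only [Function.comp_def, ofReal_re] at h1
    have h2 : Tendsto (fun k => C₂ / √(nev (e (s (s' k))) r)) atTop (𝓝 0) :=
      (Real.tendsto_sqrt_atTop.comp hStop).const_div_atTop C₂
    refine le_of_tendsto_of_tendsto' h1 h2 fun k => ?_
    have hS : 0 < nev (e (s (s' k))) r := (by positivity : (0 : ℝ) < 2 ^ s' k).trans_le (hSpow _)
    rw [div_le_div_iff₀ hS (Real.sqrt_pos.2 hS)]
    calc x (s' k) * √(nev (e (s (s' k))) r)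
        ≤ C₂ * √(nev (e (s (s' k))) r) * √(nev (e (s (s' k))) r) :=
          mul_le_mul_of_nonneg_right (hxle _) (Real.sqrt_nonneg _)
      _ = C₂ * nev (e (s (s' k))) r := by rw [mul_assoc, Real.mul_self_sqrt hS.le]

end

/-! ### Change of origin in the disc -/

section

lemma discAut_zero (a : ℂ) : discAut a 0 = a := by simp [discAut]

lemma one_add_conj_mul_ne_zero {a z : ℂ} (ha : ‖a‖ < 1) (hz : ‖z‖ < 1) : 1 + conj a * z ≠ 0 := by
  intro h
  have h1 : ‖conj a * z‖ = 1 := by rw [eq_neg_of_add_eq_zero_right h, norm_neg, norm_one]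
  rw [norm_mul, RCLike.norm_conj] at h1
  nlinarith [norm_nonneg a, norm_nonneg z]

lemma norm_discAut_lt {a z : ℂ} (ha : ‖a‖ < 1) (hz : ‖z‖ < 1) : ‖discAut a z‖ < 1 := by
  have h0 := one_add_conj_mul_ne_zero ha hz
  rw [discAut, norm_div, div_lt_one (norm_pos_iff.2 h0)]
  refine lt_of_pow_lt_pow_left₀ 2 (norm_nonneg _) ?_
  have h1 : 0 < (1 - ‖a‖ ^ 2) * (1 - ‖z‖ ^ 2) := by
    have := norm_nonneg a
    have := norm_nonneg z
    apply mul_pos <;> nlinarith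
  simp only [Complex.sq_norm, normSq_apply, add_re, add_im, mul_re, mul_im, conj_re, conj_im, one_re,
    one_im] at h1 ⊢
  nlinarith

lemma discAut_neg_discAut {a z : ℂ} (ha : ‖a‖ < 1) (hz : ‖z‖ < 1) :
    discAut (-a) (discAut a z) = z := by
  have h0 := one_add_conj_mul_ne_zero ha hz
  have h1 := one_add_conj_mul_ne_zero (a := -a) (by rwa [norm_neg]) (norm_discAut_lt ha hz)
  rw [discAut, div_eq_iff h1]
  have h2 : discAut a z * (1 + conj a * z) = z + a := div_mul_cancel₀ _ h0
  rw [map_neg]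
  linear_combination h2

lemma discAut_discAut_neg {a z : ℂ} (ha : ‖a‖ < 1) (hz : ‖z‖ < 1) :
    discAut a (discAut (-a) z) = z := by
  have := discAut_neg_discAut (a := -a) (by rwa [norm_neg]) hz
  rwa [neg_neg] at this

lemma continuousAt_discAut {a z : ℂ} (ha : ‖a‖ < 1) (hz : ‖z‖ < 1) :
    ContinuousAt (fun p : ℂ × ℂ => discAut p.1 p.2) (a, z) := by
  unfold discAut
  refine ContinuousAt.div (by fun_prop) ?_ (one_add_conj_mul_ne_zero ha hz)
  exact Continuous.continuousAt
    (continuous_const.add ((continuous_conj.comp continuous_fst).mul continuous_snd))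

lemma hasDerivAt_discAut {a z : ℂ} (ha : ‖a‖ < 1) (hz : ‖z‖ < 1) :
    HasDerivAt (discAut a) ((1 - conj a * a) / (1 + conj a * z) ^ 2) z := by
  have h0 := one_add_conj_mul_ne_zero ha hz
  have h1 := ((hasDerivAt_id z).add_const a).div
    (((hasDerivAt_id z).const_mul (conj a)).const_add 1) h0
  refine h1.congr_deriv ?_
  simp only [id]
  congr 1
  ring

lemma mapsTo_discAut {a : ℂ} (ha : ‖a‖ < 1) : MapsTo (discAut a) (ball 0 1) (ball 0 1) :=
  fun _ hz => mem_ball_zero_iff.2 (norm_discAut_lt ha (mem_ball_zero_iff.1 hz))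

variable {d : ℕ} {X : Type*} [TopologicalSpace X] [ChartedSpace (Fin d → ℂ) X] {ι : Type*}
  {D : ι → Set X}

lemma IsHolomorphicDisc.comp_discAut {f : ℂ → X} (hf : IsHolomorphicDisc d f) {a : ℂ}
    (ha : ‖a‖ < 1) : IsHolomorphicDisc d fun z => f (discAut a z) := by
  have h1 : DifferentiableOn ℂ (discAut a) (ball 0 1) := fun _ hz =>
    (hasDerivAt_discAut ha (mem_ball_zero_iff.1 hz)).differentiableAt.differentiableWithinAt
  exact MDifferentiableOn.comp (g := f) (f := discAut a) (I' := 𝓘(ℂ)) (u := ball 0 1) hf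
    h1.mdifferentiableOn (mapsTo_discAut ha)

lemma IsLogDisc.comp_discAut {f : ℂ → X} (hf : IsLogDisc d D f) {a : ℂ} (ha : ‖a‖ < 1) :
    IsLogDisc d D fun z => f (discAut a z) :=
  ⟨hf.hol.comp_discAut ha, fun _ hz => hf.avoids _ (mapsTo_discAut ha hz)⟩

lemma IsHolomorphicSphere.isCompact_range {g : OnePoint ℂ → X} (hg : IsHolomorphicSphere d g) :
    IsCompact (range g) := by
  obtain ⟨h1, h2⟩ := hg
  have h3 : range g = (fun w : ℂ => g (w : OnePoint ℂ)) '' closedBall 0 1 ∪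
      (fun w : ℂ => g (if w = 0 then OnePoint.infty else ((w⁻¹ : ℂ) : OnePoint ℂ))) ''
        closedBall 0 1 := by
    apply Subset.antisymm
    · rintro _ ⟨p, rfl⟩
      induction p using OnePoint.rec with
      | infty => exact Or.inr ⟨0, by simp⟩
      | coe w =>
        rcases le_total ‖w‖ 1 with h | h
        · exact Or.inl ⟨w, mem_closedBall_zero_iff.2 h, rfl⟩
        · have hw : w ≠ 0 := norm_pos_iff.1 (one_pos.trans_le h)
          refine Or.inr ⟨w⁻¹, ?_, ?_⟩
          · rw [mem_closedBall_zero_iff, norm_inv]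
            exact inv_le_one_of_one_le₀ h
          · simp [hw]
    · rintro _ (⟨w, -, rfl⟩ | ⟨w, -, rfl⟩) <;> exact mem_range_self _
  rw [h3]
  exact ((isCompact_closedBall 0 1).image h1.continuous).union
    ((isCompact_closedBall 0 1).image h2.continuous)

namespace BubbleDisc

/-- The graph of a disc with bubbles is closed in (unit disc) `× X`. -/
lemma compl_graph_mem_nhds [T2Space X] (F : BubbleDisc d X) {w : ℂ} {x : X}
    (hw : w ∈ ball (0 : ℂ) 1) (hx : (w, x) ∉ F.graph) : F.graphᶜ ∈ 𝓝 (w, x) := by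
  obtain ⟨U, hU, hfin⟩ := F.locally_finite w hw
  have hcont : ContinuousAt F.disc w :=
    F.holomorphic.continuousOn.continuousAt (isOpen_ball.mem_nhds hw)
  have hne : x ≠ F.disc w := fun h => hx ⟨hw, Or.inl h⟩
  have h1 : ∀ᶠ p : ℂ × X in 𝓝 (w, x), p.2 ≠ F.disc p.1 :=
    ((continuous_snd.tendsto (w, x)).prodMk_nhds
      (hcont.tendsto.comp (continuous_fst.tendsto (w, x)))).eventually
      (isClosed_diagonal.isOpen_compl.mem_nhds hne)
  have h2 : ∀ᶠ p : ℂ × X in 𝓝 (w, x), ∀ v ∈ U ∩ F.nodes, p.1 = v →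
      ∀ i, p.2 ∉ range ((F.tree v).map i) := by
    rw [Filter.eventually_all_finite hfin]
    intro v hv
    by_cases hvw : v = w
    · subst hvw
      have h3 : ∀ i, ∀ᶠ p : ℂ × X in 𝓝 (v, x), p.2 ∉ range ((F.tree v).map i) := fun i => by
        have h4 := ((F.tree v).holomorphic i).isCompact_range.isClosed.isOpen_compl
        refine (continuous_snd.tendsto (v, x)).eventually (h4.mem_nhds ?_)
        rintro ⟨q, hq⟩
        exact hx ⟨hw, Or.inr ⟨hv.2, i, q, hq.symm⟩⟩
      exact (eventually_all.2 h3).mono fun p hp _ => hp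
    · have h3 : ∀ᶠ p : ℂ × X in 𝓝 (w, x), p.1 ≠ v :=
        (continuous_fst.tendsto (w, x)).eventually_ne (Ne.symm hvw)
      exact h3.mono fun p hp h => absurd h hp
  filter_upwards [h1, h2, (continuous_fst.tendsto (w, x)).eventually hU] with p hp1 hp2 hpU
  rintro ⟨-, h | ⟨hn, i, q, hq⟩⟩
  · exact hp1 h
  · exact hp2 p.1 ⟨hpU, hn⟩ rfl i ⟨q, hq.symm⟩

/-- The disc with bubbles obtained by precomposition with an automorphism of the disc. -/
def compAut (F : BubbleDisc d X) (a : ℂ) (ha : ‖a‖ < 1) : BubbleDisc d X where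
  disc z := F.disc (discAut a z)
  holomorphic := F.holomorphic.comp_discAut ha
  nodes := ball 0 1 ∩ discAut a ⁻¹' F.nodes
  nodes_subset := inter_subset_left
  locally_finite z hz := by
    obtain ⟨U, hU, hfin⟩ := F.locally_finite _ (mapsTo_discAut ha hz)
    refine ⟨discAut a ⁻¹' U,
      (hasDerivAt_discAut ha (mem_ball_zero_iff.1 hz)).continuousAt hU,
      (hfin.image (discAut (-a))).subset ?_⟩
    rintro w ⟨hw, hw1, hw2⟩
    exact ⟨discAut a w, ⟨hw, hw2⟩, discAut_neg_discAut ha (mem_ball_zero_iff.1 hw1)⟩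
  tree z := F.tree (discAut a z)
  attach z hz := F.attach _ hz.2

lemma mem_graph_compAut (F : BubbleDisc d X) {a : ℂ} (ha : ‖a‖ < 1) {p : ℂ × X}
    (hp : p.1 ∈ ball (0 : ℂ) 1) :
    p ∈ (F.compAut a ha).graph ↔ (discAut a p.1, p.2) ∈ F.graph := by
  simp only [graph, compAut, mem_ofPred_eq, mem_inter_iff, mem_preimage, hp, mapsTo_discAut ha hp,
    true_and]

end BubbleDisc

/-- If `g n ∘ discAut (a n)` converges and `a n` tends to a point `b` of the disc, then `g n`
converges. -/
lemma ConvergesTo.of_comp_discAut [T2Space X] [CompactSpace X] {g : ℕ → ℂ → X} {a : ℕ → ℂ} {b : ℂ}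
    (ha : ∀ n, ‖a n‖ < 1) (hb : ‖b‖ < 1) (hab : Tendsto a atTop (𝓝 b)) {F : BubbleDisc d X}
    (hF : ConvergesTo (fun n z => g n (discAut (a n) z)) F) :
    ConvergesTo g (F.compAut (-b) (by rwa [norm_neg])) := by
  have hb' : ‖-b‖ < 1 := by rwa [norm_neg]
  have ha' : ∀ n, ‖-a n‖ < 1 := fun n => by rw [norm_neg]; exact ha n
  constructor
  · rintro W hW ⟨⟨z, x⟩, hzW, hz⟩
    have hz1 : z ∈ ball (0 : ℂ) 1 := hz.1
    rw [F.mem_graph_compAut hb' hz1] at hz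
    set w := discAut (-b) z with hw
    have hw1 : w ∈ ball (0 : ℂ) 1 := mapsTo_discAut hb' hz1
    have hbw : discAut b w = z := discAut_discAut_neg hb (mem_ball_zero_iff.1 hz1)
    have hc : ContinuousAt (fun p : ℂ × ℂ × X => (discAut p.1 p.2.1, p.2.2)) (b, w, x) := by
      refine ContinuousAt.prodMk ?_ (by fun_prop)
      exact ContinuousAt.comp (g := fun p : ℂ × ℂ => discAut p.1 p.2)
        (f := fun p : ℂ × ℂ × X => (p.1, p.2.1))
        (continuousAt_discAut hb (mem_ball_zero_iff.1 hw1)) (by fun_prop)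
    have hW1 : W ∈ 𝓝 (discAut b w, x) := by rw [hbw]; exact hW.mem_nhds hzW
    have h2 := hc.preimage_mem_nhds hW1
    rw [nhds_prod_eq, Filter.mem_prod_iff] at h2
    obtain ⟨A, hA, V, hV, hAV⟩ := h2
    have h3 := hF.1 (interior V) isOpen_interior ⟨(w, x), mem_interior_iff_mem_nhds.2 hV, hz⟩
    filter_upwards [h3, hab.eventually hA] with n hn hnA
    obtain ⟨⟨w', x'⟩, hwV, hw'1, hw'2⟩ := hn
    exact ⟨(discAut (a n) w', x'), hAV (mk_mem_prod hnA (interior_subset hwV)),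
      mapsTo_discAut (ha n) hw'1, hw'2⟩
  · intro K hK hKb hKF
    refine hK.induction_on (p := fun S => ∀ᶠ n in atTop, S ∩ discGraph (g n) = ∅) (by simp)
      (fun S S' hSS' h => h.mono fun n hn => ?_) (fun S S' h h' => ?_) fun p hp => ?_
    · exact subset_eq_empty (inter_subset_inter_left _ hSS') hn
    · filter_upwards [h, h'] with n h1 h2
      rw [union_inter_distrib_right, h1, h2, union_empty]
    · obtain ⟨z, x⟩ := p
      have hz1 : z ∈ ball (0 : ℂ) 1 := (hKb hp).1
      have hnot : (discAut (-b) z, x) ∉ F.graph := fun h =>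
        (eq_empty_iff_forall_notMem.1 hKF) (z, x) ⟨hp, (F.mem_graph_compAut hb' hz1).2 h⟩
      have hw1 := mapsTo_discAut hb' hz1
      obtain ⟨Q, hQ, hQs, hQc⟩ := local_compact_nhds (inter_mem (F.compl_graph_mem_nhds hw1 hnot)
        ((isOpen_ball.prod isOpen_univ).mem_nhds (mk_mem_prod hw1 (mem_univ x))))
      have h1 := hF.2 Q hQc (fun q hq => (hQs hq).2)
        (eq_empty_iff_forall_notMem.2 fun q hq => (hQs hq.1).1 hq.2)
      have hc : ContinuousAt (fun p : ℂ × ℂ × X => (discAut (-p.1) p.2.1, p.2.2)) (b, z, x) := by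
        refine ContinuousAt.prodMk ?_ (by fun_prop)
        exact ContinuousAt.comp (g := fun p : ℂ × ℂ => discAut p.1 p.2)
          (f := fun p : ℂ × ℂ × X => (-p.1, p.2.1))
          (continuousAt_discAut hb' (mem_ball_zero_iff.1 hz1)) (by fun_prop)
      have h2 := hc.preimage_mem_nhds hQ
      rw [nhds_prod_eq, Filter.mem_prod_iff] at h2
      obtain ⟨A, hA, V, hV, hAV⟩ := h2
      refine ⟨V, mem_nhdsWithin_of_mem_nhds hV, ?_⟩
      filter_upwards [h1, hab.eventually hA] with n hn hnA
      refine eq_empty_iff_forall_notMem.2 ?_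
      rintro ⟨z', x'⟩ ⟨hzV, hz'1, hz'2⟩
      refine eq_empty_iff_forall_notMem.1 hn (discAut (-a n) z', x')
        ⟨hAV (mk_mem_prod hnA hzV), mapsTo_discAut (ha' n) hz'1, ?_⟩
      change x' = g n (discAut (a n) (discAut (-a n) z'))
      rw [discAut_discAut_neg (ha n) (mem_ball_zero_iff.1 hz'1)]
      exact hz'2

end

/-! ### Points of nondegeneracy -/

section

variable {d : ℕ} {X : Type*} [TopologicalSpace X] [ChartedSpace (Fin d → ℂ) X] {ι : Type*}
  {D : ι → Set X}

/-- The constant disc, without bubbles. -/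
def BubbleDisc.const (d : ℕ) [ChartedSpace (Fin d → ℂ) X] (x₀ : X) : BubbleDisc d X where
  disc _ := x₀
  holomorphic := mdifferentiableOn_const
  nodes := ∅
  nodes_subset := empty_subset _
  locally_finite _ _ := ⟨univ, univ_mem, by simp⟩
  tree _ := RationalTree.single (fun _ => x₀) ⟨mdifferentiable_const, mdifferentiable_const⟩
    OnePoint.infty
  attach _ h := h.elim

lemma convergesTo_const [T2Space X] {g : ℕ → ℂ → X} {x₀ : X}
    (h : ∀ R ∈ Ioo (0 : ℝ) 1, ∀ V ∈ 𝓝 x₀, ∀ᶠ n in atTop, ∀ z ∈ closedBall (0 : ℂ) R, g n z ∈ V) :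
    ConvergesTo g (BubbleDisc.const d x₀) := by
  have hgr : ∀ p : ℂ × X, p ∈ (BubbleDisc.const d x₀).graph ↔
      p.1 ∈ ball (0 : ℂ) 1 ∧ p.2 = x₀ := fun p => by
    simp [BubbleDisc.graph, BubbleDisc.const]
  constructor
  · rintro W hW ⟨⟨z, x⟩, hzW, hz⟩
    obtain ⟨hz1, hx⟩ := (hgr _).1 hz
    change x = x₀ at hx
    subst hx
    obtain ⟨R, hR, hR1⟩ := exists_between (mem_ball_zero_iff.1 hz1)
    have h1 : (fun y => (z, y)) ⁻¹' W ∈ 𝓝 x :=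
      (Continuous.prodMk_right z).continuousAt.preimage_mem_nhds (hW.mem_nhds hzW)
    filter_upwards [h R ⟨(norm_nonneg z).trans_lt hR, hR1⟩ _ h1] with n hn
    exact ⟨(z, g n z), hn z (mem_closedBall_zero_iff.2 hR.le), hz1, rfl⟩
  · intro K hK hKb hKF
    have h1 : IsCompact (Prod.fst '' K) := hK.image continuous_fst
    have h2 : IsCompact (Prod.snd '' K) := hK.image continuous_snd
    have h3 : x₀ ∉ Prod.snd '' K := by
      rintro ⟨p, hp, hpx⟩
      exact eq_empty_iff_forall_notMem.1 hKF p ⟨hp, (hgr p).2 ⟨(hKb hp).1, hpx⟩⟩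
    obtain ⟨R, hR, hKR⟩ := exists_lt_subset_ball (r := 1) (x := (0 : ℂ)) h1.isClosed (by
      rintro _ ⟨p, hp, rfl⟩
      exact (hKb hp).1)
    have hR2 : max R (1 / 2) ∈ Ioo (0 : ℝ) 1 := ⟨by positivity, max_lt hR (by norm_num)⟩
    filter_upwards [h _ hR2 _ (h2.isClosed.isOpen_compl.mem_nhds h3)] with n hn
    refine eq_empty_iff_forall_notMem.2 ?_
    rintro ⟨z, x⟩ ⟨hp, -, hx⟩
    have hzR : z ∈ closedBall (0 : ℂ) (max R (1 / 2)) :=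
      closedBall_subset_closedBall (le_max_left _ _)
        (ball_subset_closedBall (hKR (mem_image_of_mem Prod.fst hp)))
    refine hn z hzR ⟨(z, x), hp, hx⟩

/-- A disc which starts near the centre of a chart and has small speed while it stays in the chart
does not leave the chart. -/
lemma IsHolomorphicDisc.norm_chart_sub_le [T2Space X] {f : ℂ → X} (hf : IsHolomorphicDisc d f)
    (φ : LogChart d D) {y₀ : Fin d → ℂ} {ε δ c R : ℝ} (hε : closedBall y₀ ε ⊆ φ.chart.target)
    (hR1 : R < 1) (hc : 0 < c) (h0 : f 0 ∈ φ.chart.source)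
    (h0δ : ‖φ.chart (f 0) - y₀‖ ≤ δ) (hδc : δ + c < ε)
    (hslow : ∀ z ∈ closedBall (0 : ℂ) R, f z ∈ φ.chart.source → ‖φ.chart (f z) - y₀‖ ≤ ε →
      ‖deriv (fun w => φ.chart (f w)) z‖ < c) {z : ℂ} (hz : z ∈ closedBall (0 : ℂ) R) :
    f z ∈ φ.chart.source ∧ ‖φ.chart (f z) - y₀‖ ≤ δ + c := by
  have hzR := mem_closedBall_zero_iff.1 hz
  have htz : ∀ t ∈ Icc (0 : ℝ) 1, (t : ℂ) * z ∈ closedBall (0 : ℂ) R := fun t ht => by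
    rw [mem_closedBall_zero_iff, norm_mul, norm_real, Real.norm_of_nonneg ht.1]
    nlinarith [norm_nonneg z, ht.2]
  have hsub : closedBall (0 : ℂ) R ⊆ ball 0 1 := closedBall_subset_ball hR1
  set G : ℝ → X := fun t => f (t * z) with hG
  have hGc : ContinuousOn G (Icc 0 1) := fun t ht =>
    (ContinuousAt.comp (g := f) (f := fun t : ℝ => (t : ℂ) * z) (hf.continuousAt (hsub (htz t ht)))
      (by fun_prop)).continuousWithinAt
  -- continuity method along the radius through `z`
  set s : Set ℝ := {t | G t ∈ φ.chart.source ∧ ‖φ.chart (G t) - y₀‖ ≤ δ + c * t} with hs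
  have hK : IsCompact (φ.chart.symm '' closedBall y₀ ε) :=
    (isCompact_closedBall y₀ ε).image_of_continuousOn (φ.chart.symm.continuousOn.mono hε)
  have hmem : ∀ x, x ∈ φ.chart.symm '' closedBall y₀ ε ↔
      x ∈ φ.chart.source ∧ ‖φ.chart x - y₀‖ ≤ ε := fun x => by
    constructor
    · rintro ⟨y, hy, rfl⟩
      rw [φ.chart.right_inv (hε hy)]
      exact ⟨φ.chart.map_target (hε hy), mem_closedBall_iff_norm.1 hy⟩
    · rintro ⟨h1, h2⟩
      exact ⟨φ.chart x, mem_closedBall_iff_norm.2 h2, φ.chart.left_inv h1⟩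
  have hlt : ∀ t ∈ Icc (0 : ℝ) 1, δ + c * t < ε := fun t ht => by nlinarith [ht.2]
  have hclosed : IsClosed (s ∩ Icc 0 1) := by
    have hA := hGc.preimage_isClosed_of_isClosed isClosed_Icc hK.isClosed
    have hAs : ∀ t ∈ Icc (0 : ℝ) 1 ∩ G ⁻¹' (φ.chart.symm '' closedBall y₀ ε),
        G t ∈ φ.chart.source := fun t ht => ((hmem _).1 ht.2).1
    have hF : ContinuousOn (fun t => ‖φ.chart (G t) - y₀‖ - (δ + c * t))
        (Icc (0 : ℝ) 1 ∩ G ⁻¹' (φ.chart.symm '' closedBall y₀ ε)) := by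
      have h1 : ContinuousOn (fun t => φ.chart (G t))
          (Icc (0 : ℝ) 1 ∩ G ⁻¹' (φ.chart.symm '' closedBall y₀ ε)) :=
        φ.chart.continuousOn.comp (hGc.mono inter_subset_left) hAs
      exact (h1.sub continuousOn_const).norm.sub (by fun_prop)
    have hB := hF.preimage_isClosed_of_isClosed hA (isClosed_Iic (a := 0))
    convert hB using 1
    ext t
    simp only [hs, mem_inter_iff, mem_ofPred_eq, mem_preimage, hmem, mem_Iic, sub_nonpos]
    constructor
    · rintro ⟨⟨h1, h2⟩, h3⟩
      exact ⟨⟨h3, h1, h2.trans (hlt t h3).le⟩, h2⟩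
    · rintro ⟨⟨h3, h1, -⟩, h2⟩
      exact ⟨⟨h1, h2⟩, h3⟩
  have hstart : (0 : ℝ) ∈ s := by
    simp only [hs, hG, mem_ofPred_eq, ofReal_zero, zero_mul, mul_zero, add_zero]
    exact ⟨h0, h0δ⟩
  have hstep : ∀ t ∈ s ∩ Ico 0 1, s ∈ 𝓝[>] t := by
    rintro t ⟨⟨ht1, ht2⟩, ht⟩
    have htI : t ∈ Icc (0 : ℝ) 1 := ⟨ht.1, ht.2.le⟩
    have htb := htz t htI
    have hsp := hslow _ htb ht1 (ht2.trans (hlt t htI).le)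
    have hd : HasDerivAt (fun w => φ.chart (f w)) (deriv (fun w => φ.chart (f w)) (t * z)) (t * z) :=
      (φ.analyticAt_chart hf (hsub htb) ht1).differentiableAt.hasDerivAt
    have hm : HasDerivAt (fun t : ℝ => (t : ℂ) * z) z t := by
      simpa using (hasDerivAt_id t).ofReal_comp.mul_const z
    have hH : HasDerivAt (fun t : ℝ => φ.chart (G t) - y₀)
        (z • deriv (fun w => φ.chart (f w)) (t * z)) t :=
      (HasDerivAt.scomp (g₁ := fun w => φ.chart (f w)) (h := fun t : ℝ => (t : ℂ) * z) t hd
        hm).sub_const y₀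
    have hn : ‖z • deriv (fun w => φ.chart (f w)) (t * z)‖ < c := by
      rw [norm_smul]
      exact (mul_le_of_le_one_left (norm_nonneg _) (hzR.trans hR1.le)).trans_lt hsp
    have hev : ∀ᶠ t' in 𝓝 t, G t' ∈ φ.chart.source :=
      ((ContinuousAt.comp (g := f) (f := fun t : ℝ => (t : ℂ) * z) (hf.continuousAt (hsub htb))
        (by fun_prop)) : ContinuousAt G t).eventually (φ.chart.open_source.mem_nhds ht1)
    filter_upwards [(hH.hasDerivWithinAt (s := Ioi t)).limsup_slope_norm_le hn,
      nhdsWithin_le_nhds hev, self_mem_nhdsWithin] with t' h1 h2 h3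
    have h4 : 0 < t' - t := sub_pos.2 h3
    rw [Real.norm_of_nonneg h4.le, inv_mul_lt_iff₀ h4] at h1
    refine ⟨h2, ?_⟩
    linarith
  have h1 := hclosed.Icc_subset_of_forall_mem_nhdsWithin hstart hstep (right_mem_Icc.2 zero_le_one)
  simpa [hs, hG] using h1

/-- On compact subsets of a chart the length of the logarithmic derivative is bounded below by the
speed in the chart. -/
lemma LogMetric.exists_mul_le_norm_lift (ρ : LogMetric d D) (φ : LogChart d D) {K : Set X}
    (hK : IsCompact K) (hKs : K ⊆ φ.chart.source) :
    ∃ m : ℝ, 0 < m ∧ ∀ f, IsLogDisc d D f → ∀ z ∈ ball (0 : ℂ) 1, f z ∈ K →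
      m * ‖deriv (fun w => φ.chart (f w)) z‖ ≤ ρ.norm φ (φ.lift f z) := by
  have hL : IsCompact (φ.chart '' K) := hK.image_of_continuousOn (φ.chart.continuousOn.mono hKs)
  have hQd : (φ.chart '' K) ×ˢ sphere (0 : Fin d → ℂ) 1 ⊆ φ.dom := by
    rintro ⟨_, a⟩ ⟨⟨x, hx, rfl⟩, ha⟩
    exact ⟨φ.chart.map_source (hKs hx),
      ne_zero_of_mem_unit_sphere (⟨a, ha⟩ : sphere (0 : Fin d → ℂ) 1)⟩
  obtain ⟨m, hm, hmle⟩ := (hL.prod (isCompact_sphere (0 : Fin d → ℂ) 1)).exists_forall_le'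
    ((ρ.smooth φ).continuousOn.mono hQd) (a := 0) fun p hp => ρ.pos φ p (hQd hp)
  have hw : Continuous φ.weight := continuous_pi fun k => (φ.contDiff_weight k).continuous
  obtain ⟨M, hM⟩ := hL.exists_bound_of_continuousOn hw.continuousOn
  refine ⟨m / max M 1, by positivity, fun f hf z hz hzK => ?_⟩
  have hzs := hKs hzK
  by_cases h0 : (φ.lift f z).2 = 0
  · rw [(hf.lift_snd_eq_zero_iff hz hzs).1 h0, norm_zero, mul_zero]
    have h1 := ρ.norm_smul φ (φ.lift f z).1 (φ.chart.map_source hzs) 0 0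
    rw [smul_zero, norm_zero, zero_mul, ← h0] at h1
    exact h1.ge
  · set a := (φ.lift f z).2 with ha
    have hn : 0 < ‖a‖ := norm_pos_iff.2 h0
    have h1 : ‖deriv (fun w => φ.chart (f w)) z‖ ≤ max M 1 * ‖a‖ := by
      rw [← hf.weight_mul_lift hz hzs, pi_norm_le_iff_of_nonneg (by positivity)]
      intro k
      rw [norm_mul]
      exact mul_le_mul (((norm_le_pi_norm _ k).trans (hM _ (mem_image_of_mem _ hzK))).trans
        (le_max_left _ _)) (norm_le_pi_norm a k) (norm_nonneg _) (by positivity)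
    have h2 := ρ.norm_smul φ (φ.chart (f z)) (φ.chart.map_source hzs) ((‖a‖ : ℝ) : ℂ)
      (((‖a‖⁻¹ : ℝ) : ℂ) • a)
    rw [smul_smul, ← ofReal_mul, mul_inv_cancel₀ hn.ne', ofReal_one, one_smul, norm_real,
      norm_norm] at h2
    have h3 : m ≤ ρ.norm φ (φ.chart (f z), ((‖a‖⁻¹ : ℝ) : ℂ) • a) :=
      hmle _ ⟨mem_image_of_mem _ hzK, mem_sphere_zero_iff_norm.2 (norm_inv_norm_smul h0)⟩
    calc m / max M 1 * ‖deriv (fun w => φ.chart (f w)) z‖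
        ≤ m / max M 1 * (max M 1 * ‖a‖) := mul_le_mul_of_nonneg_left h1 (by positivity)
      _ = ‖a‖ * m := by field_simp
      _ ≤ _ := (mul_le_mul_of_nonneg_left h3 hn.le).trans h2.ge

lemma LogChart.eventually_notMem (φ : LogChart d D) {x : X} (hx : x ∈ φ.chart.source)
    (hxD : x ∉ ⋃ i, D i) :
    ∀ᶠ y in 𝓝 (φ.chart x), y ∈ φ.chart.target ∧ φ.chart.symm y ∉ ⋃ i, D i := by
  have h1 : ∀ k, ∀ᶠ y in 𝓝 (φ.chart x), φ.weight y k ≠ 0 := fun k =>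
    (φ.contDiff_weight k).continuous.continuousAt.eventually_ne (φ.weight_ne_zero hx hxD k)
  filter_upwards [eventually_all.2 h1,
    φ.chart.open_target.mem_nhds (φ.chart.map_source hx)] with y hy hyt
  refine ⟨hyt, fun hyD => ?_⟩
  obtain ⟨i, hi⟩ := mem_iUnion.1 hyD
  obtain ⟨k, hk, h0⟩ := (φ.mem_iff _ (φ.chart.map_target hyt) i).1 hi
  rw [φ.chart.right_inv hyt] at h0
  exact hy k (by simp [weight, hk, h0])

/-- Discs without convergent subsequences have, along a subsequence, points in a fixed smaller disc
which are mapped to a fixed compact subset of `X \ D` with speed bounded below: otherwise a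
subsequence would converge to a constant. -/
lemma exists_points_of_noConvergentSubsequence [T2Space X] [CompactSpace X] (hD : IsSNC d D)
    {f : ℕ → ℂ → X} (hf : ∀ n, IsHolomorphicDisc d (f n)) (h0 : AwayFrom D fun n => f n 0)
    (hconv : NoConvergentSubsequence d f) :
    ∃ (φ : LogChart d D) (K : Set X) (R c : ℝ) (s : ℕ → ℕ) (a : ℕ → ℂ), IsCompact K ∧
      K ⊆ φ.chart.source ∧ (∀ x ∈ K, x ∉ ⋃ i, D i) ∧ R < 1 ∧ 0 < c ∧ StrictMono s ∧
      ∀ n, a n ∈ closedBall (0 : ℂ) R ∧ f (s n) (a n) ∈ K ∧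
        c ≤ ‖deriv (fun w => φ.chart (f (s n) w)) (a n)‖ := by
  have : SecondCountableTopology X := ChartedSpace.secondCountable_of_sigmaCompact (Fin d → ℂ) X
  obtain ⟨U, hU, hDU, hfU⟩ := h0
  obtain ⟨x₀, hx₀U, t, ht, hx⟩ := hU.isClosed_compl.isCompact.isSeqCompact
    (x := fun n => f n 0) hfU
  obtain ⟨φ, hφ⟩ := hD x₀
  obtain ⟨ε, hε, hεs⟩ := Metric.nhds_basis_closedBall.mem_iff.1
    (φ.eventually_notMem hφ fun h => hx₀U (hDU h))
  set y₀ := φ.chart x₀ with hy₀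
  have hεt : closedBall y₀ ε ⊆ φ.chart.target := fun y hy => (hεs hy).1
  have hmem : ∀ x, x ∈ φ.chart.source → ‖φ.chart x - y₀‖ ≤ ε →
      x ∈ φ.chart.symm '' closedBall y₀ ε := fun x h1 h2 =>
    ⟨φ.chart x, mem_closedBall_iff_norm.2 h2, φ.chart.left_inv h1⟩
  suffices h : ∃ R ∈ Ioo (0 : ℝ) 1, ∃ c > 0, ∃ᶠ n in atTop, ∃ z ∈ closedBall (0 : ℂ) R,
      f (t n) z ∈ φ.chart.symm '' closedBall y₀ ε ∧
        c ≤ ‖deriv (fun w => φ.chart (f (t n) w)) z‖ by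
    obtain ⟨R, hR, c, hc, h⟩ := h
    obtain ⟨u, hu, h⟩ := extraction_of_frequently_atTop h
    choose a ha1 ha2 ha3 using h
    refine ⟨φ, _, R, c, fun n => t (u n), a,
      (isCompact_closedBall y₀ ε).image_of_continuousOn (φ.chart.symm.continuousOn.mono hεt),
      ?_, ?_, hR.2, hc, ht.comp hu, fun n => ⟨ha1 n, ha2 n, ha3 n⟩⟩
    · rintro _ ⟨y, hy, rfl⟩
      exact φ.chart.map_target (hεt hy)
    · rintro _ ⟨y, hy, rfl⟩
      exact (hεs hy).2
  -- otherwise the maps are slow in the chart, so they stay near `x₀` on every smaller disc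
  by_contra! hslow
  refine hconv t ht (BubbleDisc.const d x₀) (convergesTo_const fun R hR V hV => ?_)
  have hV' : φ.chart.symm ⁻¹' V ∈ 𝓝 y₀ :=
    (φ.chart.continuousAt_symm (φ.chart.map_source hφ)).preimage_mem_nhds
      (by rwa [φ.chart.left_inv hφ])
  obtain ⟨δ, hδ, hδV⟩ := Metric.nhds_basis_closedBall.mem_iff.1 hV'
  set κ := min δ ε / 4 with hκ
  have hκ0 : 0 < κ := by positivity
  have hκδ : κ + κ ≤ δ := by linarith [min_le_left δ ε]
  have hκε : κ + κ < ε := by linarith [min_le_right δ ε]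
  have hstart : ∀ᶠ n in atTop, f (t n) 0 ∈ φ.chart.source ∧ ‖φ.chart (f (t n) 0) - y₀‖ ≤ κ := by
    refine hx.eventually (p := fun x => x ∈ φ.chart.source ∧ ‖φ.chart x - y₀‖ ≤ κ) ?_
    filter_upwards [φ.chart.open_source.mem_nhds hφ,
      (φ.chart.continuousAt hφ).preimage_mem_nhds (closedBall_mem_nhds y₀ hκ0)] with x h1 h2
    exact ⟨h1, mem_closedBall_iff_norm.1 h2⟩
  filter_upwards [hslow R hR κ hκ0, hstart] with n hn hn0 z hz
  obtain ⟨h1, h2⟩ := (hf (t n)).norm_chart_sub_le φ hεt hR.2 hκ0 hn0.1 hn0.2 hκε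
    (fun z hz h1 h2 => hn z hz (hmem _ h1 h2)) hz
  have h3 := hδV (mem_closedBall_iff_norm.2 (h2.trans hκδ))
  rwa [mem_preimage, φ.chart.left_inv h1] at h3

/-- Moving the origin to suitable points makes the logarithmic derivatives nondegenerate. -/
theorem exists_nondegenerateAtOrigin [T2Space X] [CompactSpace X] [Finite ι] (hD : IsSNC d D)
    {f : ℕ → ℂ → X} (hf : ∀ n, IsLogDisc d D (f n)) (h0 : AwayFrom D fun n => f n 0)
    (hconv : NoConvergentSubsequence d f) :
    ∃ (s : ℕ → ℕ) (a : ℕ → ℂ) (b : ℂ), StrictMono s ∧ (∀ n, ‖a n‖ < 1) ∧ ‖b‖ < 1 ∧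
      Tendsto a atTop (𝓝 b) ∧ AwayFrom D (fun n => f (s n) (discAut (a n) 0)) ∧
      NondegenerateAtOrigin d D fun n z => f (s n) (discAut (a n) z) := by
  have := Fintype.ofFinite ι
  obtain ⟨𝒰⟩ := hD.exists_chartCover
  obtain ⟨φ, K, R, c, s, a, hK, hKs, hKD, hR, hc, hs, ha⟩ :=
    exists_points_of_noConvergentSubsequence hD (fun n => (hf n).hol) h0 hconv
  obtain ⟨b, hb, u, hu, hub⟩ := (isCompact_closedBall (0 : ℂ) R).isSeqCompact fun n => (ha n).1
  obtain ⟨m, hm, hmle⟩ := 𝒰.metric.exists_mul_le_norm_lift φ hK hKs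
  have haR : ∀ n, ‖a n‖ ≤ R := fun n => mem_closedBall_zero_iff.1 (ha n).1
  have ha1 : ∀ n, ‖a n‖ < 1 := fun n => (haR n).trans_lt hR
  have hR0 : 0 ≤ R := (norm_nonneg _).trans (haR 0)
  have hR2 : 0 < 1 - R ^ 2 := by nlinarith
  refine ⟨fun n => s (u n), fun n => a (u n), b, hs.comp hu, fun n => ha1 _,
    (mem_closedBall_zero_iff.1 hb).trans_lt hR, hub, ?_, 𝒰.metric, m * ((1 - R ^ 2) * c),
    by positivity, fun n ψ hψ => ?_⟩
  · refine ⟨Kᶜ, ?_, fun x hx hxK => hKD x hxK hx, fun n => ?_⟩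
    · exact hK.isClosed.isOpen_compl
    · change f (s (u n)) (discAut (a (u n)) 0) ∉ Kᶜ
      rw [discAut_zero]
      exact fun h => h (ha _).2.1
  · set k := u n with hk
    have hfk := (hf (s k)).comp_discAut (ha1 k)
    have h00 : (0 : ℂ) ∈ ball (0 : ℂ) 1 := by simp
    have hKk : f (s k) (discAut (a k) 0) ∈ K := by rw [discAut_zero]; exact (ha k).2.1
    have h1 := hmle _ hfk 0 h00 hKk
    rw [hfk.norm_lift_eq 𝒰.metric h00 (hKs hKk) hψ]
    refine (mul_le_mul_of_nonneg_left ?_ hm.le).trans h1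
    have hd : HasDerivAt (fun w => φ.chart (f (s k) w))
        (deriv (fun w => φ.chart (f (s k) w)) (a k)) (discAut (a k) 0) := by
      rw [discAut_zero]
      exact (φ.analyticAt_chart (hf (s k)).hol (mem_ball_zero_iff.2 (ha1 k))
        (hKs (ha k).2.1)).differentiableAt.hasDerivAt
    have h2 := hd.scomp 0 (hasDerivAt_discAut (ha1 k) (z := 0) (by simp))
    have h3 : deriv (fun w => φ.chart (f (s k) (discAut (a k) w))) 0 = _ := h2.deriv
    have h4 : (1 - conj (a k) * a k) / (1 + conj (a k) * 0) ^ 2 = ((1 - ‖a k‖ ^ 2 : ℝ) : ℂ) := by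
      rw [mul_zero, add_zero, one_pow, div_one, conj_mul']
      push_cast
      rfl
    have h5 : ‖a k‖ ^ 2 ≤ R ^ 2 := pow_le_pow_left₀ (norm_nonneg _) (haR k) 2
    rw [h3, h4, norm_smul, norm_real, Real.norm_of_nonneg (by linarith)]
    exact mul_le_mul (by linarith) (ha k).2.2 hc.le (by linarith)

lemma NoConvergentSubsequence.comp_discAut [T2Space X] [CompactSpace X] {f : ℕ → ℂ → X}
    (hconv : NoConvergentSubsequence d f) {s : ℕ → ℕ} (hs : StrictMono s) {a : ℕ → ℂ} {b : ℂ}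
    (ha : ∀ n, ‖a n‖ < 1) (hb : ‖b‖ < 1) (hab : Tendsto a atTop (𝓝 b)) :
    NoConvergentSubsequence d fun n z => f (s n) (discAut (a n) z) := fun t ht _ hF =>
  hconv (fun n => s (t n)) (hs.comp ht) _
    (ConvergesTo.of_comp_discAut (g := fun n => f (s (t n))) (a := fun n => a (t n))
      (fun n => ha (t n)) hb (hab.comp ht.tendsto_atTop) hF)

end

end

end LogDisc

theorem fact4p3 {d : ℕ} {X : Type*} [TopologicalSpace X] [T2Space X] [CompactSpace X]
    [ChartedSpace (Fin d → ℂ) X] [IsManifold 𝓘(ℂ, Fin d → ℂ) ω X] (hX : IsProjective d X)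
    {ι : Type*} [Finite ι] (D : ι → Set X) (hD : IsSNC d D)
    (η : logForms d D) (hη : IsPositiveForm η)
    (f : ℕ → ℂ → X) (hf : ∀ n, IsHolomorphicDisc d (f n))
    (hfD : ∀ n, ∀ z ∈ Metric.ball (0 : ℂ) 1, f n z ∉ ⋃ i, D i)
    (h0 : AwayFrom D (fun n => f n 0)) (hconv : NoConvergentSubsequence d f) :
    (NondegenerateAtOrigin d D f → TautologicalInequality η f) ∧
    ∃ (s : ℕ → ℕ) (a : ℕ → ℂ) (b : ℂ), StrictMono s ∧ (∀ n, ‖a n‖ < 1) ∧ ‖b‖ < 1 ∧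
      Filter.Tendsto a Filter.atTop (𝓝 b) ∧
      AwayFrom D (fun n => f (s n) (discAut (a n) 0)) ∧
      NondegenerateAtOrigin d D (fun n z => f (s n) (discAut (a n) z)) ∧
      TautologicalInequality η (fun n z => f (s n) (discAut (a n) z)) := by
  have hlog : ∀ n, IsLogDisc d D (f n) := fun n => ⟨hf n, hfD n⟩
  refine ⟨tautologicalInequality_of_nondegenerateAtOrigin hX hD hη hlog h0 hconv, ?_⟩
  obtain ⟨s, a, b, hs, ha, hb, hab, haway, hnd⟩ := exists_nondegenerateAtOrigin hD hlog h0 hconv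
  exact ⟨s, a, b, hs, ha, hb, hab, haway, hnd,
    tautologicalInequality_of_nondegenerateAtOrigin hX hD hη
      (fun n => (hlog (s n)).comp_discAut (ha n)) haway (hconv.comp_discAut hs ha hb hab) hnd⟩
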